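/- Let $n\ge 2$ and let $\Omega\subset\mathbf R^n$ be a bounded domain with smooth boundary. A $C^2$ Riemannian metric $g$ on $\bar\Omega$ is called simple if $\partial\Omega$ is strictly convex with respect to $g$ (its second fundamental form is positive definite) and $\exp_x:\exp_x^{-1}(\bar\Omega)\to\bar\Omega$ is a diffeomorphism for every $x\in\bar\Omega$. Let $\rho_g(x,y)$ denote the infimum of the $g$-lengths of the $C^1$ curves in $\bar\Omega$ from $x$ to $y$. Let $\varphi:U\to\partial\Omega$, $U\subset\mathbf R^{n-1}$ open, be a smooth local parametrization of $\partial\Omega$, and let $K\subset U$ be compact. Let $k,m\ge 0$ be integers, and let $A\ge 0$ and $c>0$. Then there is a constant $C$, depending only on these data, with the following property. Let $g_0,g_1$ be simple metrics on $\bar\Omega$ such that $\|g_j\|_{C^{m+2k+5}(\bar\Omega)}\le A$ and such that, on $\partial\Omega$, both $g_j$ and the second fundamental form of $\partial\Omega$ with respect to $g_j$ are bounded below by $c$ times the Euclidean metric, $j=0,1$. Let $\Gamma,\Gamma'$ be relatively open subsets of $\partial\Omega$ with $\bar\Gamma\subset\Gamma'\subset\varphi(K)$. Let $\psi$ be a diffeomorphism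 between relatively open neighbourhoods of $\partial\Omega$ in $\bar\Omega$ that fixes $\partial\Omega$ pointwise and maps the $g_0$-geodesics starting on $\partial\Omega$ normally to it into the $g_1$-geodesics starting on $\partial\Omega$ normally to it, preserving arc length. Write $\psi_*g_1$ for the transported metric $(v,w)\mapsto g_1(d\psi\,v,d\psi\,w)$, and let $(x',x^n)$ be the boundary normal coordinates of $g_0$ that belong to $\varphi$: the point with coordinates $(x',x^n)$ is $\gamma(x^n)$, where $\gamma$ is the inward unit speed $g_0$-geodesic starting at $\varphi(x')$ normally to $\partial\Omega$. Then $$\left\|\partial_{x^n}^k(\psi_*g_1-g_0)\big|_{x^n=0}\right\|_{C^m(\bar\Gamma)}\le C\left\|\rho_{g_1}^2-\rho_{g_0}^2\right\|_{C^{m+2k+2}(\overline{\Gamma'\times\Gamma'})},$$ where the tensor on the left is written in the coordinates $(x',x^n)$ and both norms are taken in the local coordinates of $\partial\Omega$ given by $\varphi$ (a $C^N$ norm is $+\infty$ for a function that is not $C^N$). -/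

import Mathlib

open Set Topology
open scoped ENNReal NNReal ContDiff

noncomputable section

namespace BoundaryStability

/-- Euclidean space `ℝⁿ`. -/
abbrev Eu (n : ℕ) : Type := EuclideanSpace ℝ (Fin n)

/-- The space `ℝⁿ⁻¹ × ℝ` of the coordinates `(x', xⁿ)`. -/
abbrev Co (n : ℕ) : Type := Eu (n - 1) × ℝ

/-- A field of bilinear forms (covariant 2-tensor field) on `ℝⁿ`, `g x v w = g_{ij}(x) vⁱ wʲ`. -/
abbrev TensorField (n : ℕ) : Type := Eu n → Eu n →L[ℝ] Eu n →L[ℝ] ℝ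

/-! ### Norms of spaces of `N` times continuously differentiable functions -/

section Norms

variable {X Y : Type*} [NormedAddCommGroup X] [NormedSpace ℝ X]
  [NormedAddCommGroup Y] [NormedSpace ℝ Y]

open Classical in
/-- The `C^N(S)` norm of a function given on a set `S` with unique derivatives (such as the closure
of a smooth domain); it is `∞` if the function is not in `C^N(S)`. -/
def cNormOn (N : ℕ) (f : X → Y) (S : Set X) : ℝ≥0∞ :=
  if ContDiffOn ℝ N f S then
    ⨆ (i : ℕ) (_ : i ≤ N) (x ∈ S), ‖iteratedFDerivWithin ℝ i f S x‖ₑ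
  else ∞

open Classical in
/-- The `C^N(S)` norm of a function that is defined in a neighbourhood of `S`; it is `∞` if the
function is not `N` times continuously differentiable near each point of `S`. -/
def cNormNear (N : ℕ) (f : X → Y) (S : Set X) : ℝ≥0∞ :=
  if ∀ x ∈ S, ContDiffAt ℝ N f x then
    ⨆ (i : ℕ) (_ : i ≤ N) (x ∈ S), ‖iteratedFDeriv ℝ i f x‖ₑ
  else ∞

/-- The pull-back `(f^*h)_x(a, b) = h_{f(x)}(df_x a, df_x b)` of a field `h` of bilinear forms under
a map `f` given on the set `S`. -/
def pullbackOn (S : Set X) (f : X → Y) (h : Y → Y →L[ℝ] Y →L[ℝ] ℝ) (x : X) : X →L[ℝ] X →L[ℝ] ℝ :=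
  (h (f x)).bilinearComp (fderivWithin ℝ f S x) (fderivWithin ℝ f S x)

end Norms

variable {n : ℕ}

/-! ### Smooth domains -/

/-- `r` is a smooth function near `p` with `dr(p) ≠ 0` and `Ω = {r < 0}` near `p`. -/
def IsLocalDefiningFunction (Ω : Set (Eu n)) (p : Eu n) (r : Eu n → ℝ) : Prop :=
  ∃ O : Set (Eu n), IsOpen O ∧ p ∈ O ∧ ContDiffOn ℝ ∞ r O ∧ fderiv ℝ r p ≠ 0 ∧
    ∀ x ∈ O, (x ∈ Ω ↔ r x < 0)

/-- `Ω` is a bounded domain with smooth boundary. -/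
structure IsSmoothDomain (Ω : Set (Eu n)) : Prop where
  isOpen : IsOpen Ω
  isConnected : IsConnected Ω
  isBounded : Bornology.IsBounded Ω
  smooth_boundary : ∀ p ∈ frontier Ω, ∃ r, IsLocalDefiningFunction Ω p r

/-- `φ : U → ∂Ω`, with `U ⊆ ℝⁿ⁻¹` open, is a smooth local parametrization of the boundary. -/
structure IsBoundaryChart (Ω : Set (Eu n)) (U : Set (Eu (n - 1))) (φ : Eu (n - 1) → Eu n) :
    Prop where
  isOpen : IsOpen U
  smooth : ContDiffOn ℝ ∞ φ U
  mapsTo : MapsTo φ U (frontier Ω)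
  injOn : InjOn φ U
  immersion : ∀ x ∈ U, Function.Injective (fderiv ℝ φ x)

/-! ### Riemannian metrics on the closure of `Ω`: geodesics, distance, simplicity -/

/-- The derivative of the metric on `closure Ω` (one-sided at the boundary):
`dMetric Ω g x u v w = ∂_k g_{ij}(x) uᵏ vⁱ wʲ`. -/
def dMetric (Ω : Set (Eu n)) (g : TensorField n) (x : Eu n) :
    Eu n →L[ℝ] Eu n →L[ℝ] Eu n →L[ℝ] ℝ :=
  fderivWithin ℝ g (closure Ω) x

/-- `γ` is a geodesic of `g` on the interval `I`, running in `closure Ω`. The equation is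
`γ''ᵏ + Γᵏ_{ij} γ'ⁱ γ'ʲ = 0` with the upper index lowered by `g`. -/
structure IsGeodesicOn (Ω : Set (Eu n)) (g : TensorField n) (γ : ℝ → Eu n) (I : Set ℝ) :
    Prop where
  contDiffOn : ContDiffOn ℝ 2 γ I
  mapsTo : MapsTo γ I (closure Ω)
  equation : ∀ t ∈ I, ∀ w : Eu n,
    g (γ t) (iteratedDerivWithin 2 γ I t) w
      + dMetric Ω g (γ t) (derivWithin γ I t) (derivWithin γ I t) w
      - (1 / 2) * dMetric Ω g (γ t) w (derivWithin γ I t) (derivWithin γ I t) = 0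

/-- There is a geodesic `γ : [0, 1] → closure Ω` with `γ(0) = x`, `γ'(0) = v`, `γ(1) = y`. -/
def ExpRel (Ω : Set (Eu n)) (g : TensorField n) (x v y : Eu n) : Prop :=
  ∃ γ : ℝ → Eu n, IsGeodesicOn Ω g γ (Icc 0 1) ∧ γ 0 = x ∧
    derivWithin γ (Icc 0 1) 0 = v ∧ γ 1 = y

/-- The domain `exp_x⁻¹(closure Ω)` of the exponential map. -/
def expDomain (Ω : Set (Eu n)) (g : TensorField n) (x : Eu n) : Set (Eu n) :=
  {v | ∃ y, ExpRel Ω g x v y}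

open Classical in
/-- The exponential map `exp_x` on `expDomain Ω g x` (extended by `0`). -/
def expMap (Ω : Set (Eu n)) (g : TensorField n) (x v : Eu n) : Eu n :=
  if h : ∃ y, ExpRel Ω g x v y then h.choose else 0

/-- `ν` is the inward unit normal (with respect to `g`) to `∂Ω` at the boundary point `p`. -/
def IsInwardUnitNormal (Ω : Set (Eu n)) (g : TensorField n) (p ν : Eu n) : Prop :=
  p ∈ frontier Ω ∧ ∃ r, IsLocalDefiningFunction Ω p r ∧ g p ν ν = 1 ∧
    (∀ w, fderiv ℝ r p w = 0 → g p ν w = 0) ∧ fderiv ℝ r p ν < 0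

/-- The second fundamental form `II(v, v)` of `∂Ω` at `p`, for a vector `v` tangent to `∂Ω`, the
inward unit normal `ν` and a local defining function `r`. It equals `g(c'' + Γ(c', c'), ν)` for any
curve `c` in `∂Ω` with `c(0) = p`, `c'(0) = v`, since `g(·, ν) = dr(·) / dr(ν)` and
`dr(c'') = -D²r(v, v)`. -/
def secondFundamentalForm (Ω : Set (Eu n)) (g : TensorField n) (r : Eu n → ℝ) (p ν v : Eu n) : ℝ :=
  fderiv ℝ (fderiv ℝ r) p v v / (-(fderiv ℝ r p ν))
    + dMetric Ω g p v v ν - (1 / 2) * dMetric Ω g p ν v v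

/-- A simple `C²` Riemannian metric on `closure Ω`: the boundary is strictly convex, and
`exp_x : exp_x⁻¹(closure Ω) → closure Ω` is a diffeomorphism for every `x` in `closure Ω`. -/
structure IsSimpleMetric (Ω : Set (Eu n)) (g : TensorField n) : Prop where
  contDiffOn : ContDiffOn ℝ 2 g (closure Ω)
  symm : ∀ x ∈ closure Ω, ∀ v w, g x v w = g x w v
  pos : ∀ x ∈ closure Ω, ∀ v, v ≠ 0 → 0 < g x v v
  strictly_convex : ∀ p ∈ frontier Ω, ∀ r ν v, IsLocalDefiningFunction Ω p r →
    IsInwardUnitNormal Ω g p ν → fderiv ℝ r p v = 0 → v ≠ 0 →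
    0 < secondFundamentalForm Ω g r p ν v
  exp_diffeo : ∀ x ∈ closure Ω, ∃ L : Eu n → Eu n,
    ContDiffOn ℝ 1 (expMap Ω g x) (expDomain Ω g x) ∧ ContDiffOn ℝ 1 L (closure Ω) ∧
    MapsTo (expMap Ω g x) (expDomain Ω g x) (closure Ω) ∧
    MapsTo L (closure Ω) (expDomain Ω g x) ∧
    InvOn L (expMap Ω g x) (expDomain Ω g x) (closure Ω)

/-- On the boundary, the metric and the second fundamental form are bounded below by `c`, as
quadratic forms, relative to the Euclidean metric. -/
structure HasBoundaryLowerBound (Ω : Set (Eu n)) (g : TensorField n) (c : ℝ) : Prop where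
  metric_le : ∀ p ∈ frontier Ω, ∀ v, c * ‖v‖ ^ 2 ≤ g p v v
  secondFundamentalForm_le : ∀ p ∈ frontier Ω, ∀ r ν v, IsLocalDefiningFunction Ω p r →
    IsInwardUnitNormal Ω g p ν → fderiv ℝ r p v = 0 →
    c * ‖v‖ ^ 2 ≤ secondFundamentalForm Ω g r p ν v

/-- The length of a curve `γ : [0, 1] → closure Ω`. -/
def curveLength (g : TensorField n) (γ : ℝ → Eu n) : ℝ :=
  ∫ t in (0 : ℝ)..1,
    Real.sqrt (g (γ t) (derivWithin γ (Icc 0 1) t) (derivWithin γ (Icc 0 1) t))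

/-- The distance function `ρ_g` on `closure Ω`: the infimum of the lengths of the continuously
differentiable curves in `closure Ω` that join `x` to `y`. -/
def riemDist (Ω : Set (Eu n)) (g : TensorField n) (x y : Eu n) : ℝ :=
  sInf {l | ∃ γ : ℝ → Eu n, ContDiffOn ℝ 1 γ (Icc 0 1) ∧ MapsTo γ (Icc 0 1) (closure Ω) ∧
    γ 0 = x ∧ γ 1 = y ∧ l = curveLength g γ}

/-! ### Boundary normal coordinates -/

/-- `γ : [0, s) → closure Ω` is the unit speed geodesic that starts at the boundary point `p`
normally to `∂Ω`. -/
structure IsNormalGeodesic (Ω : Set (Eu n)) (g : TensorField n) (p : Eu n) (s : ℝ)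
    (γ : ℝ → Eu n) : Prop where
  geodesic : IsGeodesicOn Ω g γ (Ico 0 s)
  start : γ 0 = p
  normal : IsInwardUnitNormal Ω g p (derivWithin γ (Ico 0 s) 0)

/-- `(x', xⁿ) ↦ F(x', xⁿ)`, `x' ∈ U`, `0 ≤ xⁿ < ε`, is the inverse of the boundary normal
coordinates of `g` that belong to the local parametrization `φ : U → ∂Ω`: the curve `F(x', ·)` is
the unit speed geodesic that starts at `φ(x')` normally to `∂Ω`. -/
structure IsBoundaryNormalCoordinates (Ω : Set (Eu n)) (g : TensorField n)
    (U : Set (Eu (n - 1))) (φ : Eu (n - 1) → Eu n) (ε : ℝ) (F : Co n → Eu n) : Prop where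
  pos : 0 < ε
  normalGeodesic : ∀ x ∈ U, IsNormalGeodesic Ω g (φ x) ε (fun t => F (x, t))

/-- `ψ` is a diffeomorphism near `∂Ω` (between relatively open neighbourhoods of `∂Ω` in
`closure Ω`) that fixes `∂Ω` and maps the geodesics of `g₀` normal to `∂Ω` into the geodesics of
`g₁` normal to `∂Ω`, preserving the arc length. -/
structure IsBoundaryNormalMatching (Ω : Set (Eu n)) (g₀ g₁ : TensorField n) (ψ : Eu n → Eu n) :
    Prop where
  diffeo : ∃ (N N' : Set (Eu n)) (χ : Eu n → Eu n), IsOpen N ∧ IsOpen N' ∧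
    frontier Ω ⊆ N ∧ frontier Ω ⊆ N' ∧
    ContDiffOn ℝ 1 ψ (N ∩ closure Ω) ∧ ContDiffOn ℝ 1 χ (N' ∩ closure Ω) ∧
    MapsTo ψ (N ∩ closure Ω) (N' ∩ closure Ω) ∧ MapsTo χ (N' ∩ closure Ω) (N ∩ closure Ω) ∧
    InvOn χ ψ (N ∩ closure Ω) (N' ∩ closure Ω)
  fixes : ∀ p ∈ frontier Ω, ψ p = p
  geodesics : ∃ δ : ℝ, 0 < δ ∧ ∀ p ∈ frontier Ω, ∀ s : ℝ, 0 < s → s ≤ δ → ∀ γ₀ γ₁ : ℝ → Eu n,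
    IsNormalGeodesic Ω g₀ p s γ₀ → IsNormalGeodesic Ω g₁ p s γ₁ →
    ∀ t ∈ Ico 0 s, ψ (γ₀ t) = γ₁ t

/-- The metric `g₁` transported by `ψ` to the side of `g₀`, minus `g₀`. Since `ψ` maps the normal
geodesics of `g₀` to those of `g₁`, the transported metric, which has the same normal geodesics as
`g₀`, is `(v, w) ↦ g₁(dψ v, dψ w)`. -/
def metricDifference (Ω : Set (Eu n)) (g₀ g₁ : TensorField n) (ψ : Eu n → Eu n) : TensorField n :=
  fun x => pullbackOn (closure Ω) ψ g₁ x - g₀ x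

/-- The `k`-th derivative with respect to `xⁿ`, at `xⁿ = 0`, of (the matrix of) the tensor field `h`
in the coordinates `(x', xⁿ)` given by `F`, as a function of `x'`. -/
def normalDeriv (U : Set (Eu (n - 1))) (ε : ℝ) (F : Co n → Eu n) (k : ℕ) (h : TensorField n) :
    Eu (n - 1) → (Co n →L[ℝ] Co n →L[ℝ] ℝ) :=
  fun x => iteratedDerivWithin k (fun t : ℝ => pullbackOn (U ×ˢ Ico 0 ε) F h (x, t)) (Ico 0 ε) 0

/-- The function `ρ²_{g₁} - ρ²_{g₀}` on `∂Ω × ∂Ω` in the local coordinates given by `φ`. -/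
def distSqDifference (Ω : Set (Eu n)) (g₀ g₁ : TensorField n) (φ : Eu (n - 1) → Eu n) :
    Eu (n - 1) × Eu (n - 1) → ℝ :=
  fun z => riemDist Ω g₁ (φ z.1) (φ z.2) ^ 2 - riemDist Ω g₀ (φ z.1) (φ z.2) ^ 2

end BoundaryStability

end

noncomputable section

open Set Topology Filter MeasureTheory
open scoped ENNReal NNReal ContDiff

set_option linter.unusedSectionVars false
set_option maxSynthPendingDepth 3

namespace BoundaryStability

/-! ### Families of functions with uniformly bounded jets at given points -/

section JetBound

variable {ι κ : Type*}
variable {X Y Z W : Type} [NormedAddCommGroup X] [NormedSpace ℝ X]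
  [NormedAddCommGroup Y] [NormedSpace ℝ Y] [NormedAddCommGroup Z] [NormedSpace ℝ Z]
  [NormedAddCommGroup W] [NormedSpace ℝ W]

/-! In boundary normal coordinates both metrics have the form `h_j + (dxⁿ)²` by the Gauss lemma, and
`ψ` becomes the identity. So the tensor to be estimated is the `k`-th normal derivative of `h₁ - h₀`
at `xⁿ = 0`. It is read off from the Taylor expansion in `ε` of the difference of the squared
distances between the boundary points `x` and `x + εξ`.

Because of strict convexity the geodesic between these points enters the domain to a depth of order
`ε²`. After the scaling `x' = x + ε z'`, `xⁿ = ε² zⁿ` the geodesic equation is regular down to `ε =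
0`. In the limit the tangential part is a straight segment and the normal part is the parabola `zⁿ =
β (t² - t) / 2`, where `β = ½ ∂ₙh(ξ, ξ)` is minus the second fundamental form
(`IsNormalFlow.fderiv_tangentialMetric`), hence negative.

Join the metrics by the segment `h_s = (1 - s) h₀ + s h₁`. Along the geodesics of `h_s` the first
variation vanishes, so the energy changes at the rate `∫ (h₁ - h₀)(γ', γ')`, and the difference of
the squared distances is `ε²` times the integral over `s` and `t` of `h₁ - h₀` on the scaled
velocities. Expanding in `xⁿ = ε² zⁿ` shows that the coefficient of `ε^(2k+2)` is a weight times
`∂ₙᵏ(h₁ - h₀)(ξ, ξ) / k!`, plus terms with the normal derivatives of order `i < k`, differentiated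
`2k - 2i` times in `ε` (`weight_mul_normalJet`). The weight is the mean of `(zⁿ)ᵏ`, bounded below by
convexity (`exists_weight_lower_bound`). Strong induction on `k` and polarization finish the
recursion (`jetBound_normalJet_of_distSq`).

Exact geodesics of the two-point problem are not constructed. They are replaced by the Picard
iterates `pic`, whose residual is `O(ε^(M+1))` after `2M + 1` iterations. Convexity of the energy on
short curves shows that they are almost minimal (`energy_ge_of_approx_geodesic`), and the variation
along the segment of metrics is computed up to the same error (`energy_sub_energy_of_family`). The
constants in these remainders need no uniformity, since they serve only to establish an exact
identity between Taylor coefficients, valid at all base points near `x`.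

Uniformity is carried by `JetBound`: it bounds the jets of a whole family of functions at single
points. At `ε = 0` and `t = 0` all constructions depend only on the jets of the metrics at the
boundary, so no estimate on a neighbourhood is ever required. The scale `R` in `JetBound` is the
norm of the distance difference, and it enters linearly throughout.

The remaining work is geometric. Metrics are extended across the boundary by reflection. The flow of
normal geodesics is smooth by the implicit function theorem on a space of paths. The squared
distance is locally an infimum of energies (`IsNormalFlow.isLocalDistSq`). The tensor in the
statement agrees with the normal jet of `h₁ - h₀` (`normalDeriv_eventuallyEq`). -/

/-- The functions `u i` are of class `C^l` at the points `p i`, with derivatives up to the order `l`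
bounded there by a constant times `R i`. -/
def JetBound (l : ℕ) (u : ι → X → Y) (p : ι → X) (R : ι → ℝ) : Prop :=
  ∃ C, 0 ≤ C ∧ ∀ i, ContDiffAt ℝ l (u i) (p i) ∧
    ∀ j ≤ l, ‖iteratedFDeriv ℝ j (u i) (p i)‖ ≤ C * R i

theorem JetBound.contDiffAt {l : ℕ} {u : ι → X → Y} {p : ι → X} {R : ι → ℝ}
    (h : JetBound l u p R) (i : ι) : ContDiffAt ℝ l (u i) (p i) := by
  obtain ⟨C, _, h⟩ := h
  exact (h i).1

theorem JetBound.mono {l l' : ℕ} {u : ι → X → Y} {p : ι → X} {R : ι → ℝ}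
    (h : JetBound l u p R) (hl : l' ≤ l) : JetBound l' u p R := by
  obtain ⟨C, hC, h⟩ := h
  exact ⟨C, hC, fun i => ⟨(h i).1.of_le (by exact_mod_cast hl), fun j hj => (h i).2 j (hj.trans hl)⟩⟩

theorem JetBound.congr {l : ℕ} {u v : ι → X → Y} {p : ι → X} {R : ι → ℝ}
    (h : JetBound l u p R) (huv : ∀ i, v i =ᶠ[𝓝 (p i)] u i) : JetBound l v p R := by
  obtain ⟨C, hC, h⟩ := h
  refine ⟨C, hC, fun i => ⟨(h i).1.congr_of_eventuallyEq (huv i), fun j hj => ?_⟩⟩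
  rw [((huv i).iteratedFDeriv ℝ j).eq_of_nhds]
  exact (h i).2 j hj

theorem JetBound.reindex {l : ℕ} {u : ι → X → Y} {p : ι → X} {R : ι → ℝ}
    (h : JetBound l u p R) (σ : κ → ι) :
    JetBound l (fun k => u (σ k)) (fun k => p (σ k)) (fun k => R (σ k)) := by
  obtain ⟨C, hC, h⟩ := h
  exact ⟨C, hC, fun i => h (σ i)⟩

theorem jetBound_zero_iff {u : ι → X → Y} {p : ι → X} {R : ι → ℝ} :
    JetBound 0 u p R ↔ (∀ i, ContDiffAt ℝ 0 (u i) (p i)) ∧ ∃ C, 0 ≤ C ∧ ∀ i, ‖u i (p i)‖ ≤ C * R i := by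
  constructor
  · rintro ⟨C, hC, h⟩
    refine ⟨fun i => by simpa using (h i).1, C, hC, fun i => ?_⟩
    simpa using (h i).2 0 le_rfl
  · rintro ⟨h1, C, hC, h⟩
    refine ⟨C, hC, fun i => ⟨by simpa using h1 i, fun j hj => ?_⟩⟩
    obtain rfl : j = 0 := by omega
    simpa using h i

theorem JetBound.bound {l : ℕ} {u : ι → X → Y} {p : ι → X} {R : ι → ℝ}
    (h : JetBound l u p R) : ∃ C, 0 ≤ C ∧ ∀ i, ‖u i (p i)‖ ≤ C * R i :=
  (jetBound_zero_iff.1 (h.mono (Nat.zero_le l))).2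

theorem eventually_differentiableAt {l : ℕ} {f : X → Y} {x : X} (h : ContDiffAt ℝ l f x)
    (hl : l ≠ 0) : ∀ᶠ y in 𝓝 x, DifferentiableAt ℝ f y :=
  (h.eventually (by simp)).mono fun _ hy => hy.differentiableAt (by exact_mod_cast hl)

theorem contDiffAt_succ_iff_fderiv' {l : ℕ} {f : X → Y} {x : X} :
    ContDiffAt ℝ (l + 1 : ℕ) f x ↔
      (∀ᶠ y in 𝓝 x, DifferentiableAt ℝ f y) ∧ ContDiffAt ℝ l (fderiv ℝ f) x := by
  constructor
  · intro h
    exact ⟨eventually_differentiableAt h (by omega), h.fderiv_right (by push_cast; exact le_rfl)⟩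
  · rintro ⟨h1, h2⟩
    push_cast
    rw [contDiffAt_succ_iff_hasFDerivAt]
    exact ⟨fderiv ℝ f, ⟨_, h1, fun y hy => hy.hasFDerivAt⟩, h2⟩

/-- The closure properties of `JetBound` are proved by induction on `l` through this splitting. The
target space has to be generalized there, since the derivative takes values in a space of linear
maps. -/
theorem jetBound_succ_iff {l : ℕ} {u : ι → X → Y} {p : ι → X} {R : ι → ℝ} (hR : ∀ i, 0 ≤ R i) :
    JetBound (l + 1) u p R ↔ (∃ C, 0 ≤ C ∧ ∀ i, ‖u i (p i)‖ ≤ C * R i) ∧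
      (∀ i, ∀ᶠ x in 𝓝 (p i), DifferentiableAt ℝ (u i) x) ∧
      JetBound l (fun i => fderiv ℝ (u i)) p R := by
  constructor
  · intro h
    refine ⟨h.bound, fun i => (contDiffAt_succ_iff_fderiv'.1 (h.contDiffAt i)).1, ?_⟩
    obtain ⟨C, hC, h⟩ := h
    refine ⟨C, hC, fun i => ⟨(contDiffAt_succ_iff_fderiv'.1 (h i).1).2, fun j hj => ?_⟩⟩
    rw [norm_iteratedFDeriv_fderiv]
    exact (h i).2 _ (by omega)
  · rintro ⟨⟨C, hC, h1⟩, h2, C', hC', h3⟩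
    refine ⟨max C C', le_max_of_le_left hC, fun i =>
      ⟨contDiffAt_succ_iff_fderiv'.2 ⟨h2 i, (h3 i).1⟩, fun j hj => ?_⟩⟩
    rcases j with _ | j
    · simpa using (h1 i).trans (mul_le_mul_of_nonneg_right (le_max_left C C') (hR i))
    · rw [← norm_iteratedFDeriv_fderiv]
      exact ((h3 i).2 j (by omega)).trans (mul_le_mul_of_nonneg_right (le_max_right C C') (hR i))

theorem JetBound.fderiv {l : ℕ} {u : ι → X → Y} {p : ι → X} {R : ι → ℝ}
    (h : JetBound (l + 1) u p R) : JetBound l (fun i => fderiv ℝ (u i)) p R := by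
  obtain ⟨C, hC, h⟩ := h
  refine ⟨C, hC, fun i => ⟨(contDiffAt_succ_iff_fderiv'.1 (h i).1).2, fun j hj => ?_⟩⟩
  rw [norm_iteratedFDeriv_fderiv]
  exact (h i).2 _ (by omega)

theorem JetBound.add {l : ℕ} {u v : ι → X → Y} {p : ι → X} {R : ι → ℝ}
    (hu : JetBound l u p R) (hv : JetBound l v p R) :
    JetBound l (fun i x => u i x + v i x) p R := by
  obtain ⟨C, hC, hu⟩ := hu
  obtain ⟨C', hC', hv⟩ := hv
  refine ⟨C + C', by positivity, fun i => ⟨(hu i).1.add (hv i).1, fun j hj => ?_⟩⟩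
  have hj' : (j : WithTop ℕ∞) ≤ l := by exact_mod_cast hj
  rw [fun_iteratedFDeriv_add_apply ((hu i).1.of_le hj') ((hv i).1.of_le hj'), add_mul]
  exact (norm_add_le _ _).trans (add_le_add ((hu i).2 j hj) ((hv i).2 j hj))

theorem JetBound.clm_apply {l : ℕ} {u : ι → X → Y} {p : ι → X} {R : ι → ℝ}
    (hu : JetBound l u p R) (L : Y →L[ℝ] Z) : JetBound l (fun i x => L (u i x)) p R := by
  obtain ⟨C, hC, hu⟩ := hu
  refine ⟨‖L‖ * C, by positivity, fun i => ⟨L.contDiff.contDiffAt.comp _ (hu i).1, fun j hj => ?_⟩⟩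
  have hj' : (j : WithTop ℕ∞) ≤ l := by exact_mod_cast hj
  refine (L.norm_iteratedFDeriv_comp_left (hu i).1 hj').trans ?_
  rw [mul_assoc]
  exact mul_le_mul_of_nonneg_left ((hu i).2 j hj) (norm_nonneg L)

theorem JetBound.neg {l : ℕ} {u : ι → X → Y} {p : ι → X} {R : ι → ℝ}
    (hu : JetBound l u p R) : JetBound l (fun i x => -u i x) p R := by
  simpa using hu.clm_apply (-ContinuousLinearMap.id ℝ Y)

theorem JetBound.sub {l : ℕ} {u v : ι → X → Y} {p : ι → X} {R : ι → ℝ}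
    (hu : JetBound l u p R) (hv : JetBound l v p R) :
    JetBound l (fun i x => u i x - v i x) p R := by
  simpa [sub_eq_add_neg] using hu.add hv.neg

theorem JetBound.const_smul {l : ℕ} {u : ι → X → Y} {p : ι → X} {R : ι → ℝ}
    (hu : JetBound l u p R) (a : ℝ) : JetBound l (fun i x => a • u i x) p R := by
  simpa using hu.clm_apply (a • ContinuousLinearMap.id ℝ Y)

theorem jetBound_const_family {l : ℕ} {p : ι → X} (y : ι → Y) {R : ι → ℝ} (hR : ∀ i, 0 ≤ R i)
    (hy : ∃ C, 0 ≤ C ∧ ∀ i, ‖y i‖ ≤ C * R i) : JetBound l (fun i _ => y i) p R := by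
  obtain ⟨C, hC, hy⟩ := hy
  refine ⟨C, hC, fun i => ⟨contDiffAt_const, fun j hj => ?_⟩⟩
  rcases j with _ | j
  · simpa using hy i
  · rw [iteratedFDeriv_const_of_ne (by omega)]
    simpa using mul_nonneg hC (hR i)

theorem jetBound_const {l : ℕ} {p : ι → X} (y : Y) :
    JetBound l (fun _ _ => y) p (fun _ => 1) :=
  jetBound_const_family _ (fun _ => zero_le_one) ⟨‖y‖, norm_nonneg y, fun i => by simp⟩

theorem JetBound.sum {l : ℕ} {α : Type*} (s : Finset α) {u : α → ι → X → Y} {p : ι → X}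
    {R : ι → ℝ} (hR : ∀ i, 0 ≤ R i)
    (hu : ∀ a ∈ s, JetBound l (u a) p R) :
    JetBound l (fun i x => ∑ a ∈ s, u a i x) p R := by
  classical
  induction s using Finset.induction_on with
  | empty => simpa using jetBound_const_family (fun _ => (0 : Y)) hR ⟨0, le_rfl, by simp⟩
  | insert a s ha ih =>
    simp only [Finset.sum_insert ha]
    exact (hu a (by simp)).add (ih fun b hb => hu b (by simp [hb]))

theorem bilin_bound {u : ι → X → Y} {v : ι → X → Z} {p : ι → X} {R : ι → ℝ}
    (hR : ∀ i, 0 ≤ R i) (B : Y →L[ℝ] Z →L[ℝ] W) (hu : ∃ C, 0 ≤ C ∧ ∀ i, ‖u i (p i)‖ ≤ C * R i)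
    (hv : ∃ C, 0 ≤ C ∧ ∀ i, ‖v i (p i)‖ ≤ C * 1) :
    ∃ C, 0 ≤ C ∧ ∀ i, ‖B (u i (p i)) (v i (p i))‖ ≤ C * R i := by
  obtain ⟨C, hC, h1⟩ := hu
  obtain ⟨C', hC', h2⟩ := hv
  refine ⟨‖B‖ * C * C', by positivity, fun i => ?_⟩
  calc _ ≤ ‖B‖ * ‖u i (p i)‖ * ‖v i (p i)‖ := B.le_opNorm₂ _ _
    _ ≤ ‖B‖ * (C * R i) * (C' * 1) := by
      have := h1 i; have := h2 i; have := hR i; gcongr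
    _ = _ := by ring

/-- Leibniz rule. The scale `R` sits on one factor and the other is merely bounded, so products stay
linear in `R`. The derivative consists of two terms built with `precompR` and `precompL`, which are
bilinear again, and this closes the induction. -/
theorem JetBound.bilin {l : ℕ} {u : ι → X → Y} {v : ι → X → Z} {p : ι → X} {R : ι → ℝ}
    (hR : ∀ i, 0 ≤ R i) (B : Y →L[ℝ] Z →L[ℝ] W)
    (hu : JetBound l u p R) (hv : JetBound l v p (fun _ => 1)) :
    JetBound l (fun i x => B (u i x) (v i x)) p R := by
  induction l generalizing Y Z W with
  | zero =>
    refine jetBound_zero_iff.2 ⟨fun i => ?_, bilin_bound hR B hu.bound hv.bound⟩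
    exact B.isBoundedBilinearMap.contDiff.contDiffAt.comp (p i)
      ((jetBound_zero_iff.1 hu).1 i |>.prodMk ((jetBound_zero_iff.1 hv).1 i))
  | succ l ih =>
    have hu' := (jetBound_succ_iff hR).1 hu
    have hv' := (jetBound_succ_iff (fun _ => zero_le_one)).1 hv
    refine (jetBound_succ_iff hR).2 ⟨bilin_bound hR B hu.bound hv.bound, fun i => ?_, ?_⟩
    · filter_upwards [hu'.2.1 i, hv'.2.1 i] with x h1 h2
      exact B.isBoundedBilinearMap.differentiableAt _ |>.comp x (h1.prodMk h2)
    · have e1 : JetBound l (fun i x => B.precompR X (u i x) (_root_.fderiv ℝ (v i) x)) p R := by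
        exact ih (B.precompR X) (hu.mono (Nat.le_succ l)) hv.fderiv
      have e2 : JetBound l (fun i x => B.precompL X (_root_.fderiv ℝ (u i) x) (v i x)) p R := by
        exact ih (B.precompL X) hu.fderiv (hv.mono (Nat.le_succ l))
      refine (e1.add e2).congr fun i => ?_
      filter_upwards [hu'.2.1 i, hv'.2.1 i] with x h1 h2
      exact B.fderiv_of_bilinear h1 h2

/-- This replaces the Faà di Bruno formula: by the chain rule the derivative is bilinear in `Du ∘ v`
and `Dv`, and the induction takes care of `Du ∘ v`. The jets of the outer functions matter only at
the points `v i (p i)`. -/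
theorem JetBound.comp {l : ℕ} {u : ι → Y → Z} {v : ι → X → Y} {p : ι → X} {R : ι → ℝ}
    (hR : ∀ i, 0 ≤ R i) (hu : JetBound l u (fun i => v i (p i)) R)
    (hv : JetBound l v p (fun _ => 1)) :
    JetBound l (fun i x => u i (v i x)) p R := by
  induction l generalizing Z with
  | zero =>
    exact jetBound_zero_iff.2 ⟨fun i => ContDiffAt.comp (p i) ((jetBound_zero_iff.1 hu).1 i)
      ((jetBound_zero_iff.1 hv).1 i), hu.bound⟩
  | succ l ih =>
    have hu' := (jetBound_succ_iff hR).1 hu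
    have hv' := (jetBound_succ_iff (fun _ => zero_le_one)).1 hv
    have ev : ∀ i, ∀ᶠ x in 𝓝 (p i), DifferentiableAt ℝ (u i) (v i x) := fun i =>
      (hv'.2.1 i).self_of_nhds.continuousAt.eventually (hu'.2.1 i)
    refine (jetBound_succ_iff hR).2 ⟨hu.bound, fun i => ?_, ?_⟩
    · filter_upwards [ev i, hv'.2.1 i] with x h1 h2 using h1.comp x h2
    · refine JetBound.congr (JetBound.bilin hR (ContinuousLinearMap.compL ℝ X Y Z)
        (ih hu.fderiv (hv.mono (Nat.le_succ l))) hv.fderiv) fun i => ?_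
      filter_upwards [ev i, hv'.2.1 i] with x h1 h2
      exact fderiv_comp x h1 h2

theorem JetBound.prodMk {l : ℕ} {u : ι → X → Y} {v : ι → X → Z} {p : ι → X} {R : ι → ℝ}
    (hu : JetBound l u p R) (hv : JetBound l v p R) :
    JetBound l (fun i x => (u i x, v i x)) p R := by
  simpa using (hu.clm_apply (ContinuousLinearMap.inl ℝ Y Z)).add
    (hv.clm_apply (ContinuousLinearMap.inr ℝ Y Z))

/-- The source of uniform constants: a single function, with base points confined to a compact set.
Inversion of forms, square roots and reciprocals enter the estimates in this way. -/
theorem jetBound_of_compact {l : ℕ} {G : Y → Z} {K : Set Y} (hK : IsCompact K)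
    (hG : ∀ y ∈ K, ContDiffAt ℝ l G y) {q : ι → Y} (hq : ∀ i, q i ∈ K) :
    JetBound l (fun _ => G) q (fun _ => 1) := by
  have : ∀ j ∈ Finset.range (l + 1), ∃ C, ∀ y ∈ K, ‖iteratedFDeriv ℝ j G y‖ ≤ C := by
    intro j hj
    refine hK.exists_bound_of_continuousOn fun y hy => ?_
    exact ((hG y hy).continuousAt_iteratedFDeriv
      (by exact_mod_cast Nat.lt_succ_iff.1 (Finset.mem_range.1 hj))).continuousWithinAt
  choose! C hC using this
  refine ⟨∑ j ∈ Finset.range (l + 1), |C j|, Finset.sum_nonneg fun _ _ => abs_nonneg _,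
    fun i => ⟨hG _ (hq i), fun j hj => ?_⟩⟩
  have hj' : j ∈ Finset.range (l + 1) := by simpa [Nat.lt_succ_iff] using hj
  rw [mul_one]
  exact ((hC j hj' _ (hq i)).trans (le_abs_self _)).trans
    (Finset.single_le_sum (f := fun j => |C j|) (fun _ _ => abs_nonneg _) hj')

/-- Composition with a fixed function that is smooth on a compact set. -/
theorem JetBound.comp_of_compact {l : ℕ} {G : Y → Z} {K : Set Y} (hK : IsCompact K)
    (hG : ∀ y ∈ K, ContDiffAt ℝ l G y) {v : ι → X → Y} {p : ι → X}
    (hv : JetBound l v p (fun _ => 1)) (hvK : ∀ i, v i (p i) ∈ K) :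
    JetBound l (fun i x => G (v i x)) p (fun _ => 1) :=
  JetBound.comp (fun _ => zero_le_one) (jetBound_of_compact hK hG hvK) hv

/-- Composition with a fixed smooth function, in the case of a finite dimensional space. -/
theorem JetBound.comp_contDiff [ProperSpace Y] {l : ℕ} {G : Y → Z} (hG : ContDiff ℝ l G)
    {v : ι → X → Y} {p : ι → X} (hv : JetBound l v p (fun _ => 1)) :
    JetBound l (fun i x => G (v i x)) p (fun _ => 1) := by
  obtain ⟨C, hC, h⟩ := hv.bound
  refine hv.comp_of_compact (isCompact_closedBall (0 : Y) C) (fun y _ => hG.contDiffAt) fun i => ?_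
  simpa using h i

theorem jetBound_id {l : ℕ} {p : ι → X} (hp : ∃ C, 0 ≤ C ∧ ∀ i, ‖p i‖ ≤ C) :
    JetBound l (fun _ x => x) p (fun _ => 1) := by
  cases l with
  | zero => exact jetBound_zero_iff.2 ⟨fun i => contDiffAt_id, by simpa using hp⟩
  | succ l =>
    refine (jetBound_succ_iff fun _ => zero_le_one).2 ⟨by simpa using hp,
      fun i => Eventually.of_forall fun x => differentiableAt_id, ?_⟩
    exact (jetBound_const (ContinuousLinearMap.id ℝ X)).congr fun i =>
      Eventually.of_forall fun x => fderiv_id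

theorem JetBound.smul {l : ℕ} {u : ι → X → ℝ} {v : ι → X → Y} {p : ι → X} {R : ι → ℝ}
    (hR : ∀ i, 0 ≤ R i) (hu : JetBound l u p (fun _ => 1)) (hv : JetBound l v p R) :
    JetBound l (fun i x => u i x • v i x) p R := by
  simpa using JetBound.bilin hR (ContinuousLinearMap.lsmul ℝ ℝ (E := Y)).flip hv hu

theorem JetBound.mul {l : ℕ} {u v : ι → X → ℝ} {p : ι → X} {R : ι → ℝ}
    (hR : ∀ i, 0 ≤ R i) (hu : JetBound l u p (fun _ => 1)) (hv : JetBound l v p R) :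
    JetBound l (fun i x => u i x * v i x) p R := by
  simpa using JetBound.smul hR hu hv

theorem JetBound.pow {l : ℕ} {u : ι → X → ℝ} {p : ι → X}
    (hu : JetBound l u p (fun _ => 1)) (k : ℕ) :
    JetBound l (fun i x => u i x ^ k) p (fun _ => 1) :=
  hu.comp_contDiff (G := fun y : ℝ => y ^ k) (contDiff_id.pow k)

theorem JetBound.clm_bilin {l : ℕ} {u : ι → X → Y →L[ℝ] Z} {v : ι → X → Y} {p : ι → X} {R : ι → ℝ}
    (hR : ∀ i, 0 ≤ R i) (hu : JetBound l u p R) (hv : JetBound l v p (fun _ => 1)) :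
    JetBound l (fun i x => u i x (v i x)) p R :=
  JetBound.bilin hR (ContinuousLinearMap.id ℝ (Y →L[ℝ] Z)) hu hv

end JetBound

section JetCalculus

variable {ι κ : Type*}
variable {X Y Z W : Type} [NormedAddCommGroup X] [NormedSpace ℝ X]
  [NormedAddCommGroup Y] [NormedSpace ℝ Y] [NormedAddCommGroup Z] [NormedSpace ℝ Z]
  [NormedAddCommGroup W] [NormedSpace ℝ W]

/-! ### Partial derivatives with respect to a real variable -/

theorem deriv_slice_eventuallyEq {u : X × ℝ → Y} {x : X} {t : ℝ}
    (h : ∀ᶠ q in 𝓝 (x, t), DifferentiableAt ℝ u q) :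
    ∀ᶠ y in 𝓝 x, (fun s => deriv (fun s => u (y, s)) s) =ᶠ[𝓝 t] fun s => fderiv ℝ u (y, s) (0, 1) := by
  rw [nhds_prod_eq] at h
  filter_upwards [h.curry] with y hy
  filter_upwards [hy] with s hs
  have h1 : HasDerivAt (fun s : ℝ => (y, s)) ((0 : X), (1 : ℝ)) s :=
    (hasDerivAt_const s y).prodMk (hasDerivAt_id s)
  exact (hs.hasFDerivAt.comp_hasDerivAt s h1).deriv

/-- Each derivative in the real variable spends one order of the joint jet; `l` orders remain for
the parameter. -/
theorem JetBound.iteratedDeriv_slice {l j : ℕ} {u : ι → X × ℝ → Y} {p : ι → X} {R : ι → ℝ}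
    (hR : ∀ i, 0 ≤ R i) (hp : ∃ C, 0 ≤ C ∧ ∀ i, ‖p i‖ ≤ C) {t : ℝ}
    (h : JetBound (l + j) u (fun i => (p i, t)) R) :
    JetBound l (fun i x => iteratedDeriv j (fun s => u i (x, s)) t) p R := by
  induction j generalizing u with
  | zero =>
    simp only [iteratedDeriv_zero]
    refine JetBound.comp (v := fun _ x => (x, t)) hR h ?_
    exact (jetBound_id hp).prodMk (jetBound_const t)
  | succ j ih =>
    have h' : JetBound (l + j) (fun i q => _root_.fderiv ℝ (u i) q (0, 1)) (fun i => (p i, t)) R :=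
      JetBound.clm_apply (JetBound.fderiv (l := l + j) h) (ContinuousLinearMap.apply ℝ Y ((0 : X), (1 : ℝ)))
    refine (ih h').congr fun i => ?_
    have h2 := deriv_slice_eventuallyEq (eventually_differentiableAt (h.contDiffAt i) (by omega))
    filter_upwards [h2] with x hx
    rw [iteratedDeriv_succ', hx.iteratedDeriv_eq]

/-! ### Integrals depending on a parameter -/

theorem eventually_forall_Icc {P : X → ℝ → Prop} {x : X}
    (h : ∀ t ∈ Icc (0 : ℝ) 1, ∀ᶠ q : X × ℝ in 𝓝 (x, t), P q.1 q.2) :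
    ∀ᶠ y in 𝓝 x, ∀ t ∈ Icc (0 : ℝ) 1, P y t :=
  isCompact_Icc.eventually_forall_of_forall_eventually h

theorem continuousOn_slice {u : X × ℝ → Y} {x : X} {s : Set ℝ}
    (h : ∀ t ∈ s, ContinuousAt u (x, t)) : ContinuousOn (fun t => u (x, t)) s := fun t ht =>
  ((h t ht).comp (f := fun t : ℝ => (x, t)) (by fun_prop)).continuousWithinAt

theorem intervalIntegrable_slice {u : X × ℝ → Y} {x : X}
    (h : ∀ t ∈ Icc (0 : ℝ) 1, ContinuousAt u (x, t)) :
    IntervalIntegrable (fun t => u (x, t)) volume 0 1 :=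
  (by simpa using continuousOn_slice h :
    ContinuousOn (fun t => u (x, t)) (uIcc 0 1)).intervalIntegrable

theorem eventually_norm_sub_le {u : X × ℝ → Y} {x : X}
    (h : ∀ t ∈ Icc (0 : ℝ) 1, ContinuousAt u (x, t)) {δ : ℝ} (hδ : 0 < δ) :
    ∀ᶠ y in 𝓝 x, ∀ t ∈ Icc (0 : ℝ) 1, ‖u (y, t) - u (x, t)‖ ≤ δ := by
  refine eventually_forall_Icc fun t ht => ?_
  have h1 : ContinuousAt (fun q : X × ℝ => u q - u (x, q.2)) (x, t) :=
    (h t ht).sub ((show ContinuousAt u (x, (x, t).2) from h t ht).comp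
      (f := fun q : X × ℝ => (x, q.2)) (by fun_prop))
  have h2 : Tendsto (fun q : X × ℝ => ‖u q - u (x, q.2)‖) (𝓝 (x, t)) (𝓝 0) := by
    simpa [ContinuousAt] using h1.norm
  filter_upwards [h2.eventually_lt_const hδ] with q hq using hq.le

theorem continuousAt_integral {u : X × ℝ → Y} {x : X}
    (h : ∀ᶠ y in 𝓝 x, ∀ t ∈ Icc (0 : ℝ) 1, ContinuousAt u (y, t)) :
    ContinuousAt (fun y => ∫ t in (0 : ℝ)..1, u (y, t)) x := by
  rw [Metric.continuousAt_iff']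
  intro δ hδ
  filter_upwards [h, eventually_norm_sub_le h.self_of_nhds (half_pos hδ)] with y hy hy'
  rw [dist_eq_norm, ← intervalIntegral.integral_sub (intervalIntegrable_slice hy)
    (intervalIntegrable_slice h.self_of_nhds)]
  refine (intervalIntegral.norm_integral_le_of_norm_le_const (C := δ / 2) fun t ht => ?_).trans_lt ?_
  · exact hy' t (by rw [uIoc_of_le zero_le_one] at ht; exact Ioc_subset_Icc_self ht)
  · norm_num; linarith

theorem hasFDerivAt_integral {u : X × ℝ → Y} {x : X}
    (h : ∀ t ∈ Icc (0 : ℝ) 1, ContDiffAt ℝ 1 u (x, t)) :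
    HasFDerivAt (fun y => ∫ t in (0 : ℝ)..1, u (y, t))
      (∫ t in (0 : ℝ)..1, (fderiv ℝ u (x, t)).comp (ContinuousLinearMap.inl ℝ X ℝ)) x := by
  have hsub : uIoc (0 : ℝ) 1 ⊆ Icc 0 1 := by
    rw [uIoc_of_le zero_le_one]; exact Ioc_subset_Icc_self
  have h1 : ∀ᶠ y in 𝓝 x, ∀ t ∈ Icc (0 : ℝ) 1, ContDiffAt ℝ 1 u (y, t) :=
    eventually_forall_Icc (P := fun y t => ContDiffAt ℝ 1 u (y, t))
      fun t ht => (h t ht).eventually (by simp)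
  let u' : X × ℝ → X →L[ℝ] Y := fun q => (fderiv ℝ u q).comp (ContinuousLinearMap.inl ℝ X ℝ)
  have hu' : ∀ t ∈ Icc (0 : ℝ) 1, ContinuousAt u' (x, t) := fun t ht =>
    ((((ContinuousLinearMap.compL ℝ X (X × ℝ) Y).flip (ContinuousLinearMap.inl ℝ X ℝ)).continuous
      ).continuousAt).comp ((h t ht).continuousAt_fderiv (by simp))
  -- Compactness of `[0, 1]` gives `‖u' (y, t)‖ ≤ ‖u' (x, t)‖ + 1` for `y` near `x`, which is the
  -- dominating function.
  have h2 := eventually_norm_sub_le hu' one_pos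
  have hs := h1.and h2
  have hc : ContinuousOn (fun t => u' (x, t)) (Icc 0 1) := continuousOn_slice hu'
  refine intervalIntegral.hasFDerivAt_integral_of_dominated_of_fderiv_le
    (F := fun y t => u (y, t)) (F' := fun y t => u' (y, t)) (bound := fun t => ‖u' (x, t)‖ + 1)
    (μ := volume) hs ?_ ?_ ?_ ?_ ?_ ?_
  · filter_upwards [h1] with y hy
    exact ((continuousOn_slice fun t ht => (hy t ht).continuousAt).mono hsub).aestronglyMeasurable
      measurableSet_uIoc
  · exact intervalIntegrable_slice fun t ht => (h t ht).continuousAt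
  · exact (hc.mono hsub).aestronglyMeasurable measurableSet_uIoc
  · refine Eventually.of_forall fun t ht y hy => ?_
    have := hy.2 t (hsub ht)
    calc ‖u' (y, t)‖ = ‖u' (x, t) + (u' (y, t) - u' (x, t))‖ := by congr 1; abel
      _ ≤ _ := (norm_add_le _ _).trans (by gcongr)
  · exact ((by simpa using hc : ContinuousOn (fun t => u' (x, t)) (uIcc 0 1)).norm.add
      continuousOn_const).intervalIntegrable
  · refine Eventually.of_forall fun t ht y hy => ?_
    have h3 : HasFDerivAt (fun y : X => (y, t)) (ContinuousLinearMap.inl ℝ X ℝ) y :=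
      hasFDerivAt_prodMk_left y t
    exact ((hy.1 t (hsub ht)).differentiableAt (by simp)).hasFDerivAt.comp y h3

/-- Differentiation under the integral sign, order by order. The integration variable is part of the
index `ι × [0, 1]`, so the hypothesis already contains the uniformity in `t`. -/
theorem JetBound.integral {l : ℕ} {u : ι → X × ℝ → Y} {p : ι → X} {R : ι → ℝ} (hR : ∀ i, 0 ≤ R i)
    (h : JetBound l (fun k : ι × Icc (0 : ℝ) 1 => u k.1) (fun k => (p k.1, (k.2 : ℝ)))
      (fun k => R k.1)) :
    JetBound l (fun i x => ∫ t in (0 : ℝ)..1, u i (x, t)) p R := by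
  have hsub : uIoc (0 : ℝ) 1 ⊆ Icc 0 1 := by
    rw [uIoc_of_le zero_le_one]; exact Ioc_subset_Icc_self
  induction l generalizing Y with
  | zero =>
    have hc : ∀ i, ∀ᶠ y in 𝓝 (p i), ∀ t ∈ Icc (0 : ℝ) 1, ContinuousAt (u i) (y, t) := fun i =>
      eventually_forall_Icc (P := fun y t => ContinuousAt (u i) (y, t)) fun t ht =>
        ((h.contDiffAt (i, ⟨t, ht⟩)).eventually (by simp)).mono fun q hq => hq.continuousAt
    refine jetBound_zero_iff.2 ⟨fun i => ?_, ?_⟩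
    · refine contDiffAt_zero.2 ⟨_, eventually_eventually_nhds.2 (hc i), fun y hy => ?_⟩
      exact (continuousAt_integral hy).continuousWithinAt
    · obtain ⟨C, hC, hb⟩ := h.bound
      refine ⟨C, hC, fun i => ?_⟩
      refine (intervalIntegral.norm_integral_le_of_norm_le_const (C := C * R i)
        fun t ht => ?_).trans (by norm_num)
      exact hb (i, ⟨t, hsub ht⟩)
  | succ l ih =>
    have hd : ∀ i, ∀ᶠ y in 𝓝 (p i), ∀ t ∈ Icc (0 : ℝ) 1, ContDiffAt ℝ 1 (u i) (y, t) := fun i =>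
      eventually_forall_Icc (P := fun y t => ContDiffAt ℝ 1 (u i) (y, t)) fun t ht =>
        ((h.contDiffAt (i, ⟨t, ht⟩)).eventually (by simp)).mono fun q hq =>
          hq.of_le (by exact_mod_cast Nat.succ_le_succ (Nat.zero_le l))
    refine (jetBound_succ_iff hR).2 ⟨?_, fun i => ?_, ?_⟩
    · obtain ⟨C, hC, hb⟩ := h.bound
      refine ⟨C, hC, fun i => ?_⟩
      refine (intervalIntegral.norm_integral_le_of_norm_le_const (C := C * R i)
        fun t ht => ?_).trans (by norm_num)
      exact hb (i, ⟨t, hsub ht⟩)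
    · filter_upwards [hd i] with y hy using (hasFDerivAt_integral hy).differentiableAt
    · have := ih (u := fun i q => (_root_.fderiv ℝ (u i) q).comp (ContinuousLinearMap.inl ℝ X ℝ))
        (JetBound.clm_apply h.fderiv
          ((ContinuousLinearMap.compL ℝ X (X × ℝ) Y).flip (ContinuousLinearMap.inl ℝ X ℝ)))
      refine this.congr fun i => ?_
      filter_upwards [hd i] with y hy using (hasFDerivAt_integral hy).fderiv

theorem bounded_prodMk {p : ι → X} {q : ι → Y} (hp : ∃ C, 0 ≤ C ∧ ∀ i, ‖p i‖ ≤ C)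
    (hq : ∃ C, 0 ≤ C ∧ ∀ i, ‖q i‖ ≤ C) : ∃ C, 0 ≤ C ∧ ∀ i, ‖(p i, q i)‖ ≤ C := by
  obtain ⟨C, hC, h⟩ := hp
  obtain ⟨C', _, h'⟩ := hq
  exact ⟨max C C', le_max_of_le_left hC, fun i => max_le_max (h i) (h' i)⟩

theorem bounded_Icc (f : ι → Icc (0 : ℝ) 1) : ∃ C, 0 ≤ C ∧ ∀ i, ‖(f i : ℝ)‖ ≤ C :=
  ⟨1, zero_le_one, fun i => by
    rw [Real.norm_eq_abs, abs_of_nonneg (f i).2.1]; exact (f i).2.2⟩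

theorem bounded_reindex {p : ι → X} (hp : ∃ C, 0 ≤ C ∧ ∀ i, ‖p i‖ ≤ C) (σ : κ → ι) :
    ∃ C, 0 ≤ C ∧ ∀ k, ‖p (σ k)‖ ≤ C := by
  obtain ⟨C, hC, h⟩ := hp
  exact ⟨C, hC, fun k => h _⟩

/-- The primitive `∫₀ᵗ u(x, τ) dτ`, at the points of `[0, 1]`. -/
theorem JetBound.primitive {l : ℕ} {u : ι → X × ℝ → Y} {p : ι → X} {R : ι → ℝ}
    (hR : ∀ i, 0 ≤ R i) (hp : ∃ C, 0 ≤ C ∧ ∀ i, ‖p i‖ ≤ C)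
    (h : JetBound l (fun k : ι × Icc (0 : ℝ) 1 => u k.1) (fun k => (p k.1, (k.2 : ℝ)))
      (fun k => R k.1)) :
    JetBound l (fun (k : ι × Icc (0 : ℝ) 1) (q : X × ℝ) => ∫ τ in (0 : ℝ)..q.2, u k.1 (q.1, τ))
      (fun k => (p k.1, (k.2 : ℝ))) (fun k => R k.1) := by
  have hp' : ∃ C, 0 ≤ C ∧ ∀ k : ι × Icc (0 : ℝ) 1, ‖(p k.1, (k.2 : ℝ))‖ ≤ C :=
    bounded_prodMk (bounded_reindex hp _) (bounded_Icc _)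
  have hid : JetBound (ι := (ι × Icc (0 : ℝ) 1) × Icc (0 : ℝ) 1) l (fun _ (x : (X × ℝ) × ℝ) => x)
      (fun k => ((p k.1.1, (k.1.2 : ℝ)), (k.2 : ℝ))) (fun _ => 1) :=
    jetBound_id (bounded_prodMk (bounded_reindex hp' _) (bounded_Icc _))
  -- Rescaling the variable writes the primitive as `t ∫₀¹ u(x, t τ) dτ`, with a fixed interval of
  -- integration; products of points of `[0, 1]` stay in `[0, 1]`.
  have h1 : JetBound l (fun (k : ι × Icc (0 : ℝ) 1) (q : X × ℝ) =>
      ∫ τ in (0 : ℝ)..1, u k.1 (q.1, q.2 * τ)) (fun k => (p k.1, (k.2 : ℝ))) (fun k => R k.1) := by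
    refine JetBound.integral (u := fun (k : ι × Icc (0 : ℝ) 1) (q : (X × ℝ) × ℝ) => u k.1 (q.1.1, q.1.2 * q.2))
      (fun k => hR _) ?_
    refine JetBound.comp (v := fun _ (q : (X × ℝ) × ℝ) => (q.1.1, q.1.2 * q.2)) (fun k => hR _) ?_ ?_
    · exact h.reindex fun k : (ι × Icc (0 : ℝ) 1) × Icc (0 : ℝ) 1 => (k.1.1, ⟨(k.1.2 : ℝ) * k.2,
        mul_nonneg k.1.2.2.1 k.2.2.1, mul_le_one₀ k.1.2.2.2 k.2.2.1 k.2.2.2⟩)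
    · refine JetBound.prodMk ?_ (JetBound.mul (fun _ => zero_le_one) ?_ ?_)
      · exact hid.clm_apply ((ContinuousLinearMap.fst ℝ X ℝ).comp (ContinuousLinearMap.fst ℝ _ ℝ))
      · exact hid.clm_apply ((ContinuousLinearMap.snd ℝ X ℝ).comp (ContinuousLinearMap.fst ℝ _ ℝ))
      · exact hid.clm_apply (ContinuousLinearMap.snd ℝ _ ℝ)
  have h2 := JetBound.smul (fun k => hR _)
    ((jetBound_id (l := l) hp').clm_apply (ContinuousLinearMap.snd ℝ X ℝ)) h1
  refine h2.congr fun k => Eventually.of_forall fun q => ?_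
  simp [intervalIntegral.smul_integral_comp_mul_left (fun τ => u k.1 (q.1, τ))]

/-! ### Solutions of ordinary differential equations -/

/-- The jets at `t = 0` of a flow are controlled by the jets of the initial values and of the
vector field. -/
theorem JetBound.of_ode {l : ℕ} {V : ι → Y → Y} {y : ι → X × ℝ → Y} {p : ι → X}
    (hy : ∀ i, ContDiffAt ℝ l (y i) (p i, 0))
    (hode : ∀ i, ∀ᶠ q : X × ℝ in 𝓝 (p i, 0),
      HasDerivAt (fun t => y i (q.1, t)) (V i (y i q)) q.2)
    (h0 : JetBound l (fun i x => y i (x, 0)) p (fun _ => 1))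
    (hV : JetBound l V (fun i => y i (p i, 0)) (fun _ => 1)) :
    JetBound l y (fun i => (p i, 0)) (fun _ => 1) := by
  induction l generalizing Y with
  | zero => exact jetBound_zero_iff.2 ⟨hy, h0.bound⟩
  | succ l ih =>
    have h1 : JetBound l y (fun i => (p i, 0)) (fun _ => 1) :=
      ih (fun i => (hy i).of_le (by exact_mod_cast Nat.le_succ l)) hode (h0.mono (Nat.le_succ l))
        (hV.mono (Nat.le_succ l))
    have hyd : ∀ i, ∀ᶠ q in 𝓝 (p i, (0 : ℝ)), DifferentiableAt ℝ (y i) q := fun i =>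
      eventually_differentiableAt (hy i) (by omega)
    have hVy : JetBound l (fun i q => V i (y i q)) (fun i => (p i, (0 : ℝ))) (fun _ => 1) :=
      JetBound.comp (fun _ => zero_le_one) (hV.mono (Nat.le_succ l)) h1
    -- To gain one order: the `t`-derivative of `y` is `V(y)` and already controlled, so only the
    -- `x`-derivative `Dx` is left. It comes from the linearized equation.
    let Lx : ((X × ℝ) →L[ℝ] Y) →L[ℝ] (X →L[ℝ] Y) :=
      (ContinuousLinearMap.compL ℝ X (X × ℝ) Y).flip (ContinuousLinearMap.inl ℝ X ℝ)
    let Dx : ι → X × ℝ → X →L[ℝ] Y := fun i q => Lx (_root_.fderiv ℝ (y i) q)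
    have hDt : ∀ i, ∀ᶠ q in 𝓝 (p i, (0 : ℝ)), _root_.fderiv ℝ (y i) q (0, 1) = V i (y i q) := by
      intro i
      filter_upwards [hyd i, hode i] with q h2 h3
      have h4 : HasDerivAt (fun t : ℝ => (q.1, t)) ((0 : X), (1 : ℝ)) q.2 :=
        (hasDerivAt_const q.2 q.1).prodMk (hasDerivAt_id q.2)
      exact (h2.hasFDerivAt.comp_hasDerivAt q.2 h4).unique h3
    have hDx0 : JetBound l (fun i x => Dx i (x, 0)) p (fun _ => 1) := by
      refine h0.fderiv.congr fun i => ?_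
      have : Tendsto (fun x : X => (x, (0 : ℝ))) (𝓝 (p i)) (𝓝 (p i, 0)) := by
        exact Continuous.tendsto (by fun_prop) _
      filter_upwards [this.eventually (hyd i)] with x hx
      have h3 : HasFDerivAt (fun y : X => (y, (0 : ℝ))) (ContinuousLinearMap.inl ℝ X ℝ) x :=
        hasFDerivAt_prodMk_left x 0
      exact (hx.hasFDerivAt.comp x h3).fderiv.symm
    have hDx : JetBound l Dx (fun i => (p i, 0)) (fun _ => 1) := by
      rcases l with _ | l
      · exact jetBound_zero_iff.2 ⟨fun i => Lx.contDiff.contDiffAt.comp _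
          ((hy i).fderiv_right (by simp)), hDx0.bound⟩
      · have hDxs : ∀ i, ContDiffAt ℝ (l + 1 : ℕ) (Dx i) (p i, 0) := fun i =>
          Lx.contDiff.contDiffAt.comp _ ((hy i).fderiv_right (by push_cast; exact le_rfl))
        -- The pair `(y, Dx)` solves the equation of the field `V'`, which contains `DV` and so has
        -- one order less than `V`. The induction hypothesis applies to it on the larger space.
        let V' : ι → Y × (X →L[ℝ] Y) → Y × (X →L[ℝ] Y) := fun i q =>
          (V i q.1, (_root_.fderiv ℝ (V i) q.1).comp q.2)
        have hbd : ∃ C, 0 ≤ C ∧ ∀ i, ‖(y i (p i, 0), Dx i (p i, 0))‖ ≤ C :=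
          bounded_prodMk (by simpa using h1.bound) (by simpa using hDx0.bound)
        have hV' : JetBound (l + 1) V' (fun i => (y i (p i, 0), Dx i (p i, 0))) (fun _ => 1) := by
          have hid := jetBound_id (l := l + 1) hbd
          have hf := hid.clm_apply (ContinuousLinearMap.fst ℝ Y (X →L[ℝ] Y))
          have hs := hid.clm_apply (ContinuousLinearMap.snd ℝ Y (X →L[ℝ] Y))
          refine JetBound.prodMk (JetBound.comp (fun _ => zero_le_one)
            (hV.mono (Nat.le_succ _)) hf) ?_
          exact JetBound.bilin (fun _ => zero_le_one) (ContinuousLinearMap.compL ℝ X Y Y)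
            (JetBound.comp (u := fun i => _root_.fderiv ℝ (V i)) (fun _ => zero_le_one) hV.fderiv hf)
            hs
        have := ih (V := V') (y := fun i q => (y i q, Dx i q))
          (fun i => ((hy i).of_le (by exact_mod_cast Nat.le_succ _)).prodMk (hDxs i)) (fun i => ?_)
          (JetBound.prodMk (h0.mono (Nat.le_succ _)) hDx0) hV'
        · exact this.clm_apply (ContinuousLinearMap.snd ℝ Y (X →L[ℝ] Y))
        have hVd : ∀ᶠ q in 𝓝 (p i, (0 : ℝ)), DifferentiableAt ℝ (V i) (y i q) :=
          (hy i).continuousAt.eventually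
            (eventually_differentiableAt (hV.contDiffAt i) (by omega))
        filter_upwards [hode i, hyd i, (hDt i).eventually_nhds, hVd,
          (hy i).eventually (by simp)] with q a1 a2 a3 a4 a5
        refine a1.prodMk ?_
        have h4 : HasDerivAt (fun t : ℝ => (q.1, t)) ((0 : X), (1 : ℝ)) q.2 :=
          (hasDerivAt_const q.2 q.1).prodMk (hasDerivAt_id q.2)
        have a6 : ContDiffAt ℝ 1 (_root_.fderiv ℝ (y i)) q := a5.fderiv_right (by
          push_cast; gcongr; exact le_add_self)
        have a7 := (a6.differentiableAt (by simp)).hasFDerivAt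
        have h5 := Lx.hasFDerivAt.comp_hasDerivAt q.2 (a7.comp_hasDerivAt q.2 h4)
        refine h5.congr_deriv (ContinuousLinearMap.ext fun a => ?_)
        -- Symmetry of the second derivative turns `∂ₜ Dₓ y` into `Dₓ ∂ₜ y = Dₓ (V(y))`.
        have hsymm : IsSymmSndFDerivAt ℝ (y i) q := a5.isSymmSndFDerivAt (by
          simp only [minSmoothness_of_isRCLikeNormedField]
          exact_mod_cast Nat.succ_le_succ (Nat.succ_le_succ (Nat.zero_le l)))
        have h6 : HasFDerivAt (fun q => _root_.fderiv ℝ (y i) q (0, 1))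
            ((ContinuousLinearMap.apply ℝ Y ((0 : X), (1 : ℝ))).comp
              (_root_.fderiv ℝ (_root_.fderiv ℝ (y i)) q)) q :=
          (ContinuousLinearMap.apply ℝ Y ((0 : X), (1 : ℝ))).hasFDerivAt.comp q a7
        have h7 := (h6.congr_of_eventuallyEq (a3.mono fun _ h => h.symm)).unique
          (a4.hasFDerivAt.comp q a2.hasFDerivAt)
        have h8 := congrArg (fun L => L (a, (0 : ℝ))) h7
        simp only [ContinuousLinearMap.comp_apply, ContinuousLinearMap.apply_apply] at h8
        have h9 := hsymm (a, (0 : ℝ)) ((0 : X), (1 : ℝ))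
        simp only [Lx, Dx, ContinuousLinearMap.flip_apply, ContinuousLinearMap.compL_apply,
          ContinuousLinearMap.comp_apply, ContinuousLinearMap.inl_apply]
        rw [← h9, h8]
    refine (jetBound_succ_iff fun _ => zero_le_one).2 ⟨h1.bound, hyd, ?_⟩
    have e1 := hDx.clm_apply ((ContinuousLinearMap.compL ℝ (X × ℝ) X Y).flip
      (ContinuousLinearMap.fst ℝ X ℝ))
    have e2 := hVy.clm_apply ((ContinuousLinearMap.smulRightL ℝ (X × ℝ) Y)
      (ContinuousLinearMap.snd ℝ X ℝ))
    refine (e1.add e2).congr fun i => ?_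
    filter_upwards [hDt i] with q hq
    refine ContinuousLinearMap.ext fun ⟨a, b⟩ => ?_
    have : ((a, b) : X × ℝ) = (a, 0) + b • (0, 1) := by simp
    simp only [Lx, Dx, ContinuousLinearMap.flip_apply, ContinuousLinearMap.compL_apply,
      add_apply, ContinuousLinearMap.comp_apply,
      ContinuousLinearMap.smulRightL_apply_apply, ContinuousLinearMap.coe_fst',
      ContinuousLinearMap.coe_snd', ContinuousLinearMap.inl_apply,
      ContinuousLinearMap.smulRight_apply]
    conv_lhs => rw [this, map_add, map_smul, hq]

end JetCalculus

/-! ### The energy of curves -/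

section Energy

variable {E : Type} [NormedAddCommGroup E] [NormedSpace ℝ E]

/-- The energy of a curve `c : [0, 1] → E` with respect to the field `G` of bilinear forms. -/
noncomputable def energy (G : E → E →L[ℝ] E →L[ℝ] ℝ) (c : ℝ → E) : ℝ :=
  ∫ t in (0 : ℝ)..1, G (c t) (derivWithin c (Icc 0 1) t) (derivWithin c (Icc 0 1) t)

/-- The left hand side of the geodesic equation, paired with a vector `w`. -/
noncomputable def geodesicResidual (G : E → E →L[ℝ] E →L[ℝ] ℝ) (x v a w : E) : ℝ :=
  G x a w + fderiv ℝ G x v v w - (1 / 2) * fderiv ℝ G x w v v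

theorem intervalIntegrable_of_continuousOn {F : Type} [NormedAddCommGroup F] [NormedSpace ℝ F]
    {f : ℝ → F} (h : ContinuousOn f (Icc 0 1)) :
    IntervalIntegrable f volume 0 1 :=
  (by simpa using h : ContinuousOn f (uIcc 0 1)).intervalIntegrable

theorem integral_deriv_eq_sub {F : Type} [NormedAddCommGroup F] [NormedSpace ℝ F] [CompleteSpace F]
    {f f' : ℝ → F} {b : ℝ} (hb0 : 0 ≤ b) (hb : b ≤ 1)
    (h : ∀ t ∈ Icc (0 : ℝ) 1, HasDerivWithinAt f (f' t) (Icc 0 1) t)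
    (h' : ContinuousOn f' (Icc 0 1)) : ∫ t in (0 : ℝ)..b, f' t = f b - f 0 := by
  have hsub : Icc 0 b ⊆ Icc (0 : ℝ) 1 := Icc_subset_Icc le_rfl hb
  refine intervalIntegral.integral_eq_sub_of_hasDerivAt_of_le hb0
    (fun t ht => ((h t (hsub ht)).continuousWithinAt.mono hsub)) (fun t ht => ?_) ?_
  · exact (h t (hsub (Ioo_subset_Icc_self ht))).hasDerivAt (Icc_mem_nhds ht.1 (ht.2.trans_le hb))
  · exact (by simpa [hb0] using h'.mono hsub : ContinuousOn f' (uIcc 0 b)).intervalIntegrable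

/-- Expand `∫ (f - ∫ f)² ≥ 0`. It bounds the square of a displacement by the energy of a variation,
and the square of a length by the energy. -/
theorem sq_integral_le {f : ℝ → ℝ} (h : ContinuousOn f (Icc 0 1)) :
    (∫ t in (0 : ℝ)..1, f t) ^ 2 ≤ ∫ t in (0 : ℝ)..1, f t ^ 2 := by
  set S := ∫ t in (0 : ℝ)..1, f t with hS
  have h1 : 0 ≤ ∫ t in (0 : ℝ)..1, (f t - S) ^ 2 :=
    intervalIntegral.integral_nonneg zero_le_one fun t _ => sq_nonneg _
  have h2 : ∫ t in (0 : ℝ)..1, (f t - S) ^ 2 = (∫ t in (0 : ℝ)..1, f t ^ 2) - S ^ 2 := by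
    have e : (fun t => (f t - S) ^ 2) = fun t => (f t ^ 2 - (2 * S) * f t) + S ^ 2 := by
      ext t; ring
    rw [e, intervalIntegral.integral_add (f := fun t => f t ^ 2 - (2 * S) * f t)
        (((intervalIntegrable_of_continuousOn (h.pow 2)).sub
          ((intervalIntegrable_of_continuousOn h).const_mul _)))
        (intervalIntegrable_of_continuousOn continuousOn_const),
      intervalIntegral.integral_sub (f := fun t => f t ^ 2) (g := fun t => 2 * S * f t)
        (intervalIntegrable_of_continuousOn (h.pow 2))
        ((intervalIntegrable_of_continuousOn h).const_mul _), intervalIntegral.integral_const_mul,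
      ← hS]
    simp
    ring
  linarith

/-- Integration by parts: the derivative of `t ↦ G(γ)(γ', η)` has integral zero because `η` vanishes
at both ends. What is left of the variation of the energy is the geodesic equation paired with `η`.
-/
theorem first_variation {G : E → E →L[ℝ] E →L[ℝ] ℝ} {γ γ' γ'' η η' : ℝ → E}
    (hγ : ∀ t ∈ Icc (0 : ℝ) 1, HasDerivAt γ (γ' t) t)
    (hγ' : ∀ t ∈ Icc (0 : ℝ) 1, HasDerivAt γ' (γ'' t) t) (hγ'' : ContinuousOn γ'' (Icc 0 1))
    (hG : ∀ t ∈ Icc (0 : ℝ) 1, ContDiffAt ℝ 1 G (γ t))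
    (hη : ∀ t ∈ Icc (0 : ℝ) 1, HasDerivWithinAt η (η' t) (Icc 0 1) t)
    (hη' : ContinuousOn η' (Icc 0 1)) (h0 : η 0 = 0) (h1 : η 1 = 0) :
    ∫ t in (0 : ℝ)..1, (fderiv ℝ G (γ t) (η t) (γ' t) (γ' t) + 2 * G (γ t) (γ' t) (η' t)) =
      -2 * ∫ t in (0 : ℝ)..1, geodesicResidual G (γ t) (γ' t) (γ'' t) (η t) := by
  have cγ : ContinuousOn γ (Icc 0 1) := fun t ht => (hγ t ht).continuousAt.continuousWithinAt
  have cγ' : ContinuousOn γ' (Icc 0 1) := fun t ht => (hγ' t ht).continuousAt.continuousWithinAt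
  have cη : ContinuousOn η (Icc 0 1) := fun t ht => (hη t ht).continuousWithinAt
  have cG : ContinuousOn (fun t => G (γ t)) (Icc 0 1) := fun t ht =>
    (ContinuousAt.comp (f := γ) (hG t ht).continuousAt (hγ t ht).continuousAt).continuousWithinAt
  have cdG : ContinuousOn (fun t => fderiv ℝ G (γ t)) (Icc 0 1) := fun t ht =>
    (ContinuousAt.comp (f := γ) ((hG t ht).continuousAt_fderiv (by simp))
      (hγ t ht).continuousAt).continuousWithinAt
  have hd : ∀ t ∈ Icc (0 : ℝ) 1, HasDerivWithinAt (fun t => G (γ t) (γ' t) (η t))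
      (fderiv ℝ G (γ t) (γ' t) (γ' t) (η t) + G (γ t) (γ'' t) (η t) + G (γ t) (γ' t) (η' t))
      (Icc 0 1) t := by
    intro t ht
    have a1 := (((hG t ht).differentiableAt (by simp)).hasFDerivAt.comp_hasDerivAt t
      (hγ t ht)).hasDerivWithinAt (s := Icc 0 1)
    exact (a1.clm_apply (hγ' t ht).hasDerivWithinAt).clm_apply (hη t ht)
  have c1 : ContinuousOn (fun t => fderiv ℝ G (γ t) (γ' t) (γ' t) (η t) + G (γ t) (γ'' t) (η t)
      + G (γ t) (γ' t) (η' t)) (Icc 0 1) :=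
    ((((cdG.clm_apply cγ').clm_apply cγ').clm_apply cη).add ((cG.clm_apply hγ'').clm_apply cη)).add
      ((cG.clm_apply cγ').clm_apply hη')
  have hint := integral_deriv_eq_sub zero_le_one le_rfl hd c1
  rw [h0, h1] at hint
  simp only [map_zero, sub_zero] at hint
  have c2 : ContinuousOn (fun t => geodesicResidual G (γ t) (γ' t) (γ'' t) (η t)) (Icc 0 1) :=
    (((cG.clm_apply hγ'').clm_apply cη).add (((cdG.clm_apply cγ').clm_apply cγ').clm_apply cη)).sub
      (continuousOn_const.mul (((cdG.clm_apply cη).clm_apply cγ').clm_apply cγ'))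
  have e : ∀ t, fderiv ℝ G (γ t) (η t) (γ' t) (γ' t) + 2 * G (γ t) (γ' t) (η' t) =
      2 * (fderiv ℝ G (γ t) (γ' t) (γ' t) (η t) + G (γ t) (γ'' t) (η t) + G (γ t) (γ' t) (η' t)) -
      2 * geodesicResidual G (γ t) (γ' t) (γ'' t) (η t) := by
    intro t; simp only [geodesicResidual]; ring
  simp only [e]
  rw [intervalIntegral.integral_sub ((intervalIntegrable_of_continuousOn c1).const_mul _)
    ((intervalIntegrable_of_continuousOn c2).const_mul _), intervalIntegral.integral_const_mul,
    intervalIntegral.integral_const_mul, hint]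
  ring

theorem derivWithin_Icc_of_hasDerivAt {c : ℝ → E} {c' : E} {t : ℝ} (ht : t ∈ Icc (0 : ℝ) 1)
    (h : HasDerivAt c c' t) : derivWithin c (Icc 0 1) t = c' :=
  h.hasDerivWithinAt.derivWithin (uniqueDiffOn_Icc zero_lt_one t ht)

theorem energy_eq_integral {G : E → E →L[ℝ] E →L[ℝ] ℝ} {γ γ' : ℝ → E}
    (hγ : ∀ t ∈ Icc (0 : ℝ) 1, HasDerivAt γ (γ' t) t) :
    energy G γ = ∫ t in (0 : ℝ)..1, G (γ t) (γ' t) (γ' t) := by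
  refine intervalIntegral.integral_congr fun t ht => ?_
  rw [uIcc_of_le zero_le_one] at ht
  simp only [derivWithin_Icc_of_hasDerivAt ht (hγ t ht)]

/-- Convexity of the energy on short curves: an approximate geodesic almost minimizes it. -/
theorem energy_ge_of_approx_geodesic [CompleteSpace E] {G : E → E →L[ℝ] E →L[ℝ] ℝ}
    {γ γ' γ'' c : ℝ → E} {B : Set E} {K a r e d : ℝ} (hK : 0 ≤ K) (hr : 0 ≤ r) (he : 0 ≤ e)
    (hGC : ∀ x ∈ B, ContDiffAt ℝ 1 G x) (hsymm : ∀ x ∈ B, ∀ v w, G x v w = G x w v)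
    (hell : ∀ x ∈ B, ∀ v, a * ‖v‖ ^ 2 ≤ G x v v)
    (hLip : ∀ x ∈ B, ∀ y ∈ B, ‖G y - G x‖ ≤ K * ‖y - x‖)
    (hTay : ∀ x ∈ B, ∀ y ∈ B, ‖G y - G x - fderiv ℝ G x (y - x)‖ ≤ K * ‖y - x‖ ^ 2)
    (hγ : ∀ t ∈ Icc (0 : ℝ) 1, HasDerivAt γ (γ' t) t)
    (hγ' : ∀ t ∈ Icc (0 : ℝ) 1, HasDerivAt γ' (γ'' t) t) (hγ'' : ContinuousOn γ'' (Icc 0 1))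
    (hγB : ∀ t ∈ Icc (0 : ℝ) 1, γ t ∈ B) (hγr : ∀ t ∈ Icc (0 : ℝ) 1, ‖γ' t‖ ≤ r)
    (hsmall : 2 * K * r + K * r ^ 2 ≤ a)
    (hres : ∀ t ∈ Icc (0 : ℝ) 1, ∀ w, |geodesicResidual G (γ t) (γ' t) (γ'' t) w| ≤ e * ‖w‖)
    (hc : ContDiffOn ℝ 1 c (Icc 0 1)) (hcB : ∀ t ∈ Icc (0 : ℝ) 1, c t ∈ B)
    (hd : ∀ t ∈ Icc (0 : ℝ) 1, ‖c t - γ t‖ ≤ d) (h0 : c 0 = γ 0) (h1 : c 1 = γ 1) :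
    energy G γ - 2 * (e * d) ≤ energy G c := by
  set c' : ℝ → E := derivWithin c (Icc 0 1) with hc'
  have hcd : ∀ t ∈ Icc (0 : ℝ) 1, HasDerivWithinAt c (c' t) (Icc 0 1) t := fun t ht =>
    (hc.differentiableOn (by simp) t ht).hasDerivWithinAt
  have cc' : ContinuousOn c' (Icc 0 1) :=
    hc.continuousOn_derivWithin (uniqueDiffOn_Icc zero_lt_one) (by simp)
  have cc : ContinuousOn c (Icc 0 1) := hc.continuousOn
  have cγ : ContinuousOn γ (Icc 0 1) := fun t ht => (hγ t ht).continuousAt.continuousWithinAt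
  have cγ' : ContinuousOn γ' (Icc 0 1) := fun t ht => (hγ' t ht).continuousAt.continuousWithinAt
  set η : ℝ → E := fun t => c t - γ t with hη
  set η' : ℝ → E := fun t => c' t - γ' t with hη'
  have hηd : ∀ t ∈ Icc (0 : ℝ) 1, HasDerivWithinAt η (η' t) (Icc 0 1) t := fun t ht =>
    (hcd t ht).sub (hγ t ht).hasDerivWithinAt
  have cη' : ContinuousOn η' (Icc 0 1) := cc'.sub cγ'
  have cη : ContinuousOn η (Icc 0 1) := cc.sub cγ
  have hη0 : η 0 = 0 := by simp [hη, h0]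
  have hη1 : η 1 = 0 := by simp [hη, h1]
  have cGγ : ContinuousOn (fun t => G (γ t)) (Icc 0 1) := fun t ht =>
    (hGC _ (hγB t ht)).continuousAt.comp_continuousWithinAt (cγ t ht)
  have cGc : ContinuousOn (fun t => G (c t)) (Icc 0 1) := fun t ht =>
    (hGC _ (hcB t ht)).continuousAt.comp_continuousWithinAt (cc t ht)
  have cdG : ContinuousOn (fun t => fderiv ℝ G (γ t)) (Icc 0 1) := fun t ht =>
    ((hGC _ (hγB t ht)).continuousAt_fderiv (by simp)).comp_continuousWithinAt (cγ t ht)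
  have hfv := first_variation hγ hγ' hγ'' (fun t ht => hGC _ (hγB t ht)) hηd cη' hη0 hη1
  -- the remainder
  set S := ∫ t in (0 : ℝ)..1, ‖η' t‖ with hS
  have iη' : IntervalIntegrable (fun t => ‖η' t‖) volume 0 1 :=
    intervalIntegrable_of_continuousOn cη'.norm
  have hS0 : 0 ≤ S := intervalIntegral.integral_nonneg zero_le_one fun t _ => norm_nonneg _
  have hηS : ∀ t ∈ Icc (0 : ℝ) 1, ‖η t‖ ≤ S := by
    intro t ht
    have := integral_deriv_eq_sub ht.1 ht.2 hηd cη'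
    rw [hη0, sub_zero] at this
    rw [← this]
    refine (intervalIntegral.norm_integral_le_integral_norm ht.1).trans ?_
    exact intervalIntegral.integral_mono_interval le_rfl ht.1 ht.2
      (Eventually.of_forall fun _ => norm_nonneg _) iη'
  have hSb : S ^ 2 ≤ ∫ t in (0 : ℝ)..1, ‖η' t‖ ^ 2 := sq_integral_le cη'.norm
  -- Expansion of the integrand at `γ` to second order. As `η` starts at 0, the displacement is at
  -- most `S`; the terms without a sign are therefore bounded by expressions that carry the small
  -- speed bound `r`.
  have hpt : ∀ t ∈ Icc (0 : ℝ) 1, G (γ t) (γ' t) (γ' t) +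
      (fderiv ℝ G (γ t) (η t) (γ' t) (γ' t) + 2 * G (γ t) (γ' t) (η' t)) +
      (a * ‖η' t‖ ^ 2 - 2 * K * r * S * ‖η' t‖ - K * r ^ 2 * S ^ 2) ≤ G (c t) (c' t) (c' t) := by
    intro t ht
    have e1 : c' t = γ' t + η' t := by simp [hη']
    have e2 : G (c t) (c' t) (c' t) = G (γ t) (γ' t) (γ' t) +
        (fderiv ℝ G (γ t) (η t) (γ' t) (γ' t) + 2 * G (γ t) (γ' t) (η' t)) +
        ((G (c t) - G (γ t) - fderiv ℝ G (γ t) (c t - γ t)) (γ' t) (γ' t) +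
          2 * (G (c t) - G (γ t)) (γ' t) (η' t) + G (c t) (η' t) (η' t)) := by
      rw [e1]
      simp only [map_add, add_apply, sub_apply]
      rw [hsymm _ (hcB t ht) (η' t) (γ' t)]
      simp only [hη]
      ring
    have b1 : |(G (c t) - G (γ t) - fderiv ℝ G (γ t) (c t - γ t)) (γ' t) (γ' t)| ≤
        K * r ^ 2 * S ^ 2 := by
      rw [← Real.norm_eq_abs]
      refine (ContinuousLinearMap.le_opNorm₂ _ _ _).trans ?_
      have := hTay _ (hγB t ht) _ (hcB t ht)
      have h2 := hηS t ht
      have h3 := hγr t ht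
      calc _ ≤ (K * S ^ 2) * r * r := by
            gcongr
            exact this.trans (by gcongr)
        _ = _ := by ring
    have b2 : |(G (c t) - G (γ t)) (γ' t) (η' t)| ≤ K * r * S * ‖η' t‖ := by
      rw [← Real.norm_eq_abs]
      refine (ContinuousLinearMap.le_opNorm₂ _ _ _).trans ?_
      have := hLip _ (hγB t ht) _ (hcB t ht)
      have h2 := hηS t ht
      have h3 := hγr t ht
      calc _ ≤ (K * S) * r * ‖η' t‖ := by
            gcongr
            exact this.trans (by gcongr)
        _ = _ := by ring
    have b3 := hell _ (hcB t ht) (η' t)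
    rw [e2]
    have := abs_le.1 b1
    have := abs_le.1 b2
    linarith [this.1]
  have cint1 : ContinuousOn (fun t => G (γ t) (γ' t) (γ' t)) (Icc 0 1) :=
    (cGγ.clm_apply cγ').clm_apply cγ'
  have cint2 : ContinuousOn (fun t => fderiv ℝ G (γ t) (η t) (γ' t) (γ' t) +
      2 * G (γ t) (γ' t) (η' t)) (Icc 0 1) :=
    (((cdG.clm_apply cη).clm_apply cγ').clm_apply cγ').add
      (continuousOn_const.mul ((cGγ.clm_apply cγ').clm_apply cη'))
  have cint3 : ContinuousOn (fun t => a * ‖η' t‖ ^ 2 - 2 * K * r * S * ‖η' t‖ - K * r ^ 2 * S ^ 2)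
      (Icc 0 1) :=
    ((continuousOn_const.mul (cη'.norm.pow 2)).sub (continuousOn_const.mul cη'.norm)).sub
      continuousOn_const
  have hmono := intervalIntegral.integral_mono_on (μ := volume) zero_le_one
    (intervalIntegrable_of_continuousOn ((cint1.add cint2).add cint3))
    (intervalIntegrable_of_continuousOn ((cGc.clm_apply cc').clm_apply cc')) hpt
  have i3 : ∫ t in (0 : ℝ)..1, (a * ‖η' t‖ ^ 2 - 2 * K * r * S * ‖η' t‖ - K * r ^ 2 * S ^ 2) =
      a * (∫ t in (0 : ℝ)..1, ‖η' t‖ ^ 2) - 2 * K * r * S * S - K * r ^ 2 * S ^ 2 := by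
    rw [intervalIntegral.integral_sub (f := fun t => a * ‖η' t‖ ^ 2 - 2 * K * r * S * ‖η' t‖)
        (intervalIntegrable_of_continuousOn
          ((continuousOn_const.mul (cη'.norm.pow 2)).sub (continuousOn_const.mul cη'.norm)))
        (intervalIntegrable_of_continuousOn continuousOn_const),
      intervalIntegral.integral_sub (f := fun t => a * ‖η' t‖ ^ 2)
        (g := fun t => 2 * K * r * S * ‖η' t‖) (intervalIntegrable_of_continuousOn
        (continuousOn_const.mul (cη'.norm.pow 2))) (intervalIntegrable_of_continuousOn
        (continuousOn_const.mul cη'.norm)), intervalIntegral.integral_const_mul,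
      intervalIntegral.integral_const_mul, ← hS]
    simp
  have hsum := intervalIntegral.integral_add (intervalIntegrable_of_continuousOn (cint1.add cint2))
    (intervalIntegrable_of_continuousOn cint3)
  have hsum' := intervalIntegral.integral_add
    (intervalIntegrable_of_continuousOn cint1) (intervalIntegrable_of_continuousOn cint2)
  simp only [Pi.add_apply] at hsum hsum' hmono
  rw [hsum, hsum', hfv, i3] at hmono
  -- With `S² ≤ ∫ ‖η'‖²` the ellipticity absorbs both error terms precisely under `hsmall`. This is
  -- the convexity of the energy along slow curves.
  have hpos : 0 ≤ a * (∫ t in (0 : ℝ)..1, ‖η' t‖ ^ 2) - 2 * K * r * S * S - K * r ^ 2 * S ^ 2 := by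
    have ha : 0 ≤ a := le_trans (by positivity) hsmall
    nlinarith [mul_le_mul_of_nonneg_left hSb ha, mul_le_mul_of_nonneg_right hsmall (sq_nonneg S)]
  have hρ : |∫ t in (0 : ℝ)..1, geodesicResidual G (γ t) (γ' t) (γ'' t) (η t)| ≤ e * d := by
    have := intervalIntegral.norm_integral_le_of_norm_le_const (a := (0 : ℝ)) (b := 1)
      (C := e * d) (f := fun t => geodesicResidual G (γ t) (γ' t) (γ'' t) (η t)) fun t ht => ?_
    · simpa using this
    · rw [uIoc_of_le zero_le_one] at ht
      have ht' := Ioc_subset_Icc_self ht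
      exact (hres t ht' _).trans (by have := hd t ht'; gcongr)
  rw [energy_eq_integral hγ]
  have := (abs_le.1 hρ).2
  have e3 : energy G c = ∫ t in (0 : ℝ)..1, G (c t) (c' t) (c' t) := rfl
  rw [e3]
  linarith

set_option maxHeartbeats 1000000 in
/-- The energies of a one-parameter family of approximate geodesics, for a segment of metrics. -/
theorem energy_sub_energy_of_family [CompleteSpace E] {G₀ G₁ : E → E →L[ℝ] E →L[ℝ] ℝ}
    {Γ Γ' Γ'' : ℝ × ℝ → E} {a b : E} {e d : ℝ} (he : 0 ≤ e)
    (hΓ : ∀ s ∈ Icc (0 : ℝ) 1, ∀ t ∈ Icc (0 : ℝ) 1, ContDiffAt ℝ 2 Γ (s, t))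
    (hΓ' : ∀ s ∈ Icc (0 : ℝ) 1, ∀ t ∈ Icc (0 : ℝ) 1, ContDiffAt ℝ 1 Γ' (s, t))
    (hΓ'' : ∀ s ∈ Icc (0 : ℝ) 1, ContinuousOn (fun t => Γ'' (s, t)) (Icc 0 1))
    (hd1 : ∀ s ∈ Icc (0 : ℝ) 1, ∀ t ∈ Icc (0 : ℝ) 1,
      ∀ᶠ q in 𝓝 (s, t), HasDerivAt (fun τ => Γ (q.1, τ)) (Γ' q) q.2)
    (hd2 : ∀ s ∈ Icc (0 : ℝ) 1, ∀ t ∈ Icc (0 : ℝ) 1,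
      HasDerivAt (fun τ => Γ' (s, τ)) (Γ'' (s, t)) t)
    (h0 : ∀ s, Γ (s, 0) = a) (h1 : ∀ s, Γ (s, 1) = b)
    (hG₀ : ∀ s ∈ Icc (0 : ℝ) 1, ∀ t ∈ Icc (0 : ℝ) 1, ContDiffAt ℝ 1 G₀ (Γ (s, t)))
    (hG₁ : ∀ s ∈ Icc (0 : ℝ) 1, ∀ t ∈ Icc (0 : ℝ) 1, ContDiffAt ℝ 1 G₁ (Γ (s, t)))
    (hsymm : ∀ s ∈ Icc (0 : ℝ) 1, ∀ t ∈ Icc (0 : ℝ) 1, ∀ v w,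
      G₀ (Γ (s, t)) v w = G₀ (Γ (s, t)) w v ∧ G₁ (Γ (s, t)) v w = G₁ (Γ (s, t)) w v)
    (hres : ∀ s ∈ Icc (0 : ℝ) 1, ∀ t ∈ Icc (0 : ℝ) 1, ∀ w,
      |geodesicResidual (fun x => (1 - s) • G₀ x + s • G₁ x) (Γ (s, t)) (Γ' (s, t)) (Γ'' (s, t)) w|
        ≤ e * ‖w‖)
    (hd : ∀ s ∈ Icc (0 : ℝ) 1, ∀ t ∈ Icc (0 : ℝ) 1, ‖fderiv ℝ Γ (s, t) (1, 0)‖ ≤ d) :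
    |energy G₁ (fun t => Γ (1, t)) - energy G₀ (fun t => Γ (0, t)) -
      ∫ s in (0 : ℝ)..1, ∫ t in (0 : ℝ)..1,
        (G₁ (Γ (s, t)) - G₀ (Γ (s, t))) (Γ' (s, t)) (Γ' (s, t))| ≤ 2 * (e * d) := by
  have hmk : ∀ s t : ℝ, HasDerivAt (fun σ : ℝ => (σ, t)) ((1 : ℝ), (0 : ℝ)) s := fun s t =>
    (hasDerivAt_id s).prodMk (hasDerivAt_const s t)
  have hmk' : ∀ s t : ℝ, HasDerivAt (fun τ : ℝ => (s, τ)) ((0 : ℝ), (1 : ℝ)) t := fun s t =>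
    (hasDerivAt_const t s).prodMk (hasDerivAt_id t)
  -- the Lagrangian and its derivative
  let L : ℝ × ℝ → ℝ := fun q => ((1 - q.1) • G₀ (Γ q) + q.1 • G₁ (Γ q)) (Γ' q) (Γ' q)
  have hLC : ∀ s ∈ Icc (0 : ℝ) 1, ∀ t ∈ Icc (0 : ℝ) 1, ContDiffAt ℝ 1 L (s, t) := by
    intro s hs t ht
    have a1 : ContDiffAt ℝ 1 (fun q => G₀ (Γ q)) (s, t) :=
      (hG₀ s hs t ht).comp (s, t) ((hΓ s hs t ht).of_le (by norm_num))
    have a2 : ContDiffAt ℝ 1 (fun q => G₁ (Γ q)) (s, t) :=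
      (hG₁ s hs t ht).comp (s, t) ((hΓ s hs t ht).of_le (by norm_num))
    have a3 : ContDiffAt ℝ 1 (fun q : ℝ × ℝ => (1 - q.1) • G₀ (Γ q) + q.1 • G₁ (Γ q)) (s, t) :=
      ((contDiffAt_const.sub contDiffAt_fst).smul a1).add (contDiffAt_fst.smul a2)
    exact (a3.clm_apply (hΓ' s hs t ht)).clm_apply (hΓ' s hs t ht)
  let e' : ℝ → ℝ := fun s => ∫ t in (0 : ℝ)..1, fderiv ℝ L (s, t) (1, 0)
  have hderiv : ∀ s ∈ Icc (0 : ℝ) 1, HasDerivAt (fun s => ∫ t in (0 : ℝ)..1, L (s, t)) (e' s) s := by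
    intro s hs
    have b1 := (hasFDerivAt_integral (fun t ht => hLC s hs t ht)).hasDerivAt
    have b2 : ContinuousOn (fun t => (fderiv ℝ L (s, t)).comp (ContinuousLinearMap.inl ℝ ℝ ℝ))
        (Icc 0 1) := by
      refine continuousOn_slice (u := fun q => (fderiv ℝ L q).comp (ContinuousLinearMap.inl ℝ ℝ ℝ))
        fun t ht => ?_
      exact (((ContinuousLinearMap.compL ℝ ℝ (ℝ × ℝ) ℝ).flip
        (ContinuousLinearMap.inl ℝ ℝ ℝ)).continuous.continuousAt).comp
        ((hLC s hs t ht).continuousAt_fderiv (by simp))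
    refine b1.congr_deriv ?_
    rw [ContinuousLinearMap.intervalIntegral_apply (intervalIntegrable_of_continuousOn b2)]
    simp [e']
  have hcont : ContinuousOn e' (Icc 0 1) := by
    intro s hs
    refine (continuousAt_integral (u := fun q => fderiv ℝ L q (1, 0)) ?_).continuousWithinAt
    refine eventually_forall_Icc (P := fun s t => ContinuousAt (fun q => fderiv ℝ L q (1, 0)) (s, t))
      fun t ht => ?_
    filter_upwards [(hLC s hs t ht).eventually (by simp)] with q hq
    exact (hq.continuousAt_fderiv (by simp)).clm_apply continuousAt_const
  have hFTC := integral_deriv_eq_sub zero_le_one le_rfl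
    (fun s hs => (hderiv s hs).hasDerivWithinAt) hcont
  -- identification of the derivative
  have he' : ∀ s ∈ Icc (0 : ℝ) 1, |e' s - ∫ t in (0 : ℝ)..1,
      (G₁ (Γ (s, t)) - G₀ (Γ (s, t))) (Γ' (s, t)) (Γ' (s, t))| ≤ 2 * (e * d) := by
    intro s hs
    let Gs : E → E →L[ℝ] E →L[ℝ] ℝ := fun x => (1 - s) • G₀ x + s • G₁ x
    let η : ℝ → E := fun t => fderiv ℝ Γ (s, t) (1, 0)
    let η' : ℝ → E := fun t => fderiv ℝ Γ' (s, t) (1, 0)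
    have hγ : ∀ t ∈ Icc (0 : ℝ) 1, HasDerivAt (fun t => Γ (s, t)) (Γ' (s, t)) t := fun t ht =>
      (hd1 s hs t ht).self_of_nhds
    have hΓt : ∀ t ∈ Icc (0 : ℝ) 1, (fun q => fderiv ℝ Γ q (0, 1)) =ᶠ[𝓝 (s, t)] Γ' := by
      intro t ht
      filter_upwards [hd1 s hs t ht, (hΓ s hs t ht).eventually (by simp)] with q h2 h3
      exact ((h3.differentiableAt (by simp)).hasFDerivAt.comp_hasDerivAt q.2
        (hmk' q.1 q.2)).unique h2
    -- Mixed derivatives commute: the time derivative of the variation field is the variation of the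
    -- velocity.
    have hηd : ∀ t ∈ Icc (0 : ℝ) 1, HasDerivAt η (η' t) t := by
      intro t ht
      have c1 : ContDiffAt ℝ 1 (fderiv ℝ Γ) (s, t) := (hΓ s hs t ht).fderiv_right (by norm_num)
      have c2 := (c1.differentiableAt (by simp)).hasFDerivAt
      have c3 := c2.comp_hasDerivAt t (hmk' s t)
      have c4 : HasDerivAt η (fderiv ℝ (fderiv ℝ Γ) (s, t) (0, 1) (1, 0)) t :=
        (ContinuousLinearMap.apply ℝ E ((1 : ℝ), (0 : ℝ))).hasFDerivAt.comp_hasDerivAt t c3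
      convert c4 using 1
      have hsy : IsSymmSndFDerivAt ℝ Γ (s, t) := (hΓ s hs t ht).isSymmSndFDerivAt (by simp)
      rw [hsy]
      have c5 : HasFDerivAt (fun q => fderiv ℝ Γ q (0, 1))
          ((ContinuousLinearMap.apply ℝ E ((0 : ℝ), (1 : ℝ))).comp (fderiv ℝ (fderiv ℝ Γ) (s, t)))
          (s, t) := (ContinuousLinearMap.apply ℝ E ((0 : ℝ), (1 : ℝ))).hasFDerivAt.comp (s, t) c2
      have c6 := (c5.congr_of_eventuallyEq (hΓt t ht).symm).fderiv
      simp only [η', c6]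
      rfl
    have hη'c : ContinuousOn η' (Icc 0 1) :=
      continuousOn_slice (u := fun q => fderiv ℝ Γ' q (1, 0)) fun t ht =>
        ((hΓ' s hs t ht).continuousAt_fderiv (by simp)).clm_apply continuousAt_const
    have hηc : ContinuousOn η (Icc 0 1) := fun t ht =>
      (hηd t ht).continuousAt.continuousWithinAt
    have hη0 : η 0 = 0 := by
      have c1 := ((hΓ s hs 0 (by simp)).differentiableAt (by simp)).hasFDerivAt.comp_hasDerivAt s
        (hmk s 0)
      have c2 : HasDerivAt (Γ ∘ fun σ => (σ, (0 : ℝ))) 0 s := by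
        rw [show (Γ ∘ fun σ => (σ, (0 : ℝ))) = fun _ => a from funext h0]
        exact hasDerivAt_const s a
      exact c1.unique c2
    have hη1 : η 1 = 0 := by
      have c1 := ((hΓ s hs 1 (by simp)).differentiableAt (by simp)).hasFDerivAt.comp_hasDerivAt s
        (hmk s 1)
      have c2 : HasDerivAt (Γ ∘ fun σ => (σ, (1 : ℝ))) 0 s := by
        rw [show (Γ ∘ fun σ => (σ, (1 : ℝ))) = fun _ => b from funext h1]
        exact hasDerivAt_const s b
      exact c1.unique c2
    have hGs : ∀ t ∈ Icc (0 : ℝ) 1, ContDiffAt ℝ 1 Gs (Γ (s, t)) := fun t ht =>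
      ((hG₀ s hs t ht).const_smul (1 - s)).add ((hG₁ s hs t ht).const_smul s)
    have hfv := first_variation hγ (hd2 s hs) (hΓ'' s hs) hGs
      (fun t ht => (hηd t ht).hasDerivWithinAt) hη'c hη0 hη1
    -- The Lagrangian depends on `s` explicitly, which produces `G₁ - G₀`, and through the curve,
    -- which produces a first variation. By `first_variation` the latter is an integral of the small
    -- residual.
    have hLd : ∀ t ∈ Icc (0 : ℝ) 1, fderiv ℝ L (s, t) (1, 0) =
        (G₁ (Γ (s, t)) - G₀ (Γ (s, t))) (Γ' (s, t)) (Γ' (s, t)) +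
        (fderiv ℝ Gs (Γ (s, t)) (η t) (Γ' (s, t)) (Γ' (s, t)) +
          2 * Gs (Γ (s, t)) (Γ' (s, t)) (η' t)) := by
      intro t ht
      have c1 : HasDerivAt (fun σ => L (σ, t)) (fderiv ℝ L (s, t) (1, 0)) s :=
        HasFDerivAt.comp_hasDerivAt (l := L) (f := fun σ : ℝ => (σ, t)) s
          ((hLC s hs t ht).differentiableAt (by simp)).hasFDerivAt (hmk s t)
      have g : HasDerivAt (fun σ => Γ (σ, t)) (η t) s :=
        HasFDerivAt.comp_hasDerivAt (l := Γ) (f := fun σ : ℝ => (σ, t)) s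
          ((hΓ s hs t ht).differentiableAt (by simp)).hasFDerivAt (hmk s t)
      have g' : HasDerivAt (fun σ => Γ' (σ, t)) (η' t) s :=
        HasFDerivAt.comp_hasDerivAt (l := Γ') (f := fun σ : ℝ => (σ, t)) s
          ((hΓ' s hs t ht).differentiableAt (by simp)).hasFDerivAt (hmk s t)
      have d0 := ((hG₀ s hs t ht).differentiableAt (by simp)).hasFDerivAt
      have d1 := ((hG₁ s hs t ht).differentiableAt (by simp)).hasFDerivAt
      have c2 : HasDerivAt (fun σ => (1 - σ) • G₀ (Γ (σ, t)) + σ • G₁ (Γ (σ, t))) _ s :=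
        (((hasDerivAt_id s).const_sub 1).smul (d0.comp_hasDerivAt s g)).add
          ((hasDerivAt_id s).smul (d1.comp_hasDerivAt s g))
      have c3 := (c2.clm_apply g').clm_apply g'
      have hGsd : fderiv ℝ Gs (Γ (s, t)) = (1 - s) • fderiv ℝ G₀ (Γ (s, t)) +
          s • fderiv ℝ G₁ (Γ (s, t)) := ((d0.const_smul (1 - s)).add (d1.const_smul s)).fderiv
      rw [c1.unique c3, hGsd]
      have s0 := (hsymm s hs t ht (η' t) (Γ' (s, t))).1
      have s1 := (hsymm s hs t ht (η' t) (Γ' (s, t))).2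
      simp only [Gs, id, add_apply, sub_apply,
        smul_apply, smul_eq_mul, s0, s1, Function.comp, neg_smul, one_smul,
        neg_apply]
      ring
    have cΓ' : ContinuousOn (fun t => Γ' (s, t)) (Icc 0 1) :=
      continuousOn_slice fun t ht => (hΓ' s hs t ht).continuousAt
    have cΓ : ContinuousOn (fun t => Γ (s, t)) (Icc 0 1) :=
      continuousOn_slice fun t ht => (hΓ s hs t ht).continuousAt
    have cG0 : ContinuousOn (fun t => G₀ (Γ (s, t))) (Icc 0 1) := fun t ht =>
      ContinuousAt.comp_continuousWithinAt (g := G₀) (f := fun t => Γ (s, t))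
        (hG₀ s hs t ht).continuousAt (cΓ t ht)
    have cG1 : ContinuousOn (fun t => G₁ (Γ (s, t))) (Icc 0 1) := fun t ht =>
      ContinuousAt.comp_continuousWithinAt (g := G₁) (f := fun t => Γ (s, t))
        (hG₁ s hs t ht).continuousAt (cΓ t ht)
    have cGs : ContinuousOn (fun t => Gs (Γ (s, t))) (Icc 0 1) := fun t ht =>
      ContinuousAt.comp_continuousWithinAt (g := Gs) (hGs t ht).continuousAt (cΓ t ht)
    have cdGs : ContinuousOn (fun t => fderiv ℝ Gs (Γ (s, t))) (Icc 0 1) := fun t ht =>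
      ContinuousAt.comp_continuousWithinAt (g := fderiv ℝ Gs)
        ((hGs t ht).continuousAt_fderiv (by simp)) (cΓ t ht)
    have : e' s = (∫ t in (0 : ℝ)..1, (G₁ (Γ (s, t)) - G₀ (Γ (s, t))) (Γ' (s, t)) (Γ' (s, t))) +
        ∫ t in (0 : ℝ)..1, (fderiv ℝ Gs (Γ (s, t)) (η t) (Γ' (s, t)) (Γ' (s, t)) +
          2 * Gs (Γ (s, t)) (Γ' (s, t)) (η' t)) := by
      rw [← intervalIntegral.integral_add]
      · refine intervalIntegral.integral_congr fun t ht => ?_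
        rw [uIcc_of_le zero_le_one] at ht
        exact hLd t ht
      · exact intervalIntegrable_of_continuousOn
          (((cG1.sub cG0).clm_apply cΓ').clm_apply cΓ')
      · exact intervalIntegrable_of_continuousOn
          ((((cdGs.clm_apply hηc).clm_apply cΓ').clm_apply cΓ').add
            (continuousOn_const.mul ((cGs.clm_apply cΓ').clm_apply hη'c)))
    rw [this, hfv, add_sub_cancel_left, abs_mul]
    have hρ : |∫ t in (0 : ℝ)..1, geodesicResidual Gs (Γ (s, t)) (Γ' (s, t)) (Γ'' (s, t)) (η t)|
        ≤ e * d := by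
      have := intervalIntegral.norm_integral_le_of_norm_le_const (a := (0 : ℝ)) (b := 1)
        (C := e * d) (f := fun t => geodesicResidual Gs (Γ (s, t)) (Γ' (s, t)) (Γ'' (s, t)) (η t))
        fun t ht => ?_
      · simpa using this
      · rw [uIoc_of_le zero_le_one] at ht
        have ht' := Ioc_subset_Icc_self ht
        exact (hres s hs t ht' _).trans (by have := hd s hs t ht'; gcongr)
    norm_num
    exact hρ
  have hE : ∀ s ∈ Icc (0 : ℝ) 1, ∫ t in (0 : ℝ)..1, L (s, t) =
      energy (fun x => (1 - s) • G₀ x + s • G₁ x) (fun t => Γ (s, t)) := fun s hs =>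
    (energy_eq_integral (G := fun x => (1 - s) • G₀ x + s • G₁ x) (γ := fun t => Γ (s, t))
      (γ' := fun t => Γ' (s, t)) fun t ht => (hd1 s hs t ht).self_of_nhds).symm
  have hE1 := hE 1 (by simp)
  have hE0 := hE 0 (by simp)
  simp only [sub_self, zero_smul, one_smul, zero_add, sub_zero, add_zero] at hE1 hE0
  have cint : ContinuousOn (fun s => ∫ t in (0 : ℝ)..1,
      (G₁ (Γ (s, t)) - G₀ (Γ (s, t))) (Γ' (s, t)) (Γ' (s, t))) (Icc 0 1) := by
    intro s hs
    refine (continuousAt_integral (u := fun q => (G₁ (Γ q) - G₀ (Γ q)) (Γ' q) (Γ' q))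
      ?_).continuousWithinAt
    refine eventually_forall_Icc
      (P := fun s t => ContinuousAt (fun q => (G₁ (Γ q) - G₀ (Γ q)) (Γ' q) (Γ' q)) (s, t))
      fun t ht => ?_
    have a0 : ContDiffAt ℝ 1 (fun q => G₀ (Γ q)) (s, t) :=
      (hG₀ s hs t ht).comp (s, t) ((hΓ s hs t ht).of_le (by norm_num))
    have a1 : ContDiffAt ℝ 1 (fun q => G₁ (Γ q)) (s, t) :=
      (hG₁ s hs t ht).comp (s, t) ((hΓ s hs t ht).of_le (by norm_num))
    have a2 := ((a1.sub a0).clm_apply (hΓ' s hs t ht)).clm_apply (hΓ' s hs t ht)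
    filter_upwards [a2.eventually (by simp)] with q hq using hq.continuousAt
  rw [← hE1, ← hE0, ← hFTC, ← intervalIntegral.integral_sub
    (intervalIntegrable_of_continuousOn hcont) (intervalIntegrable_of_continuousOn cint)]
  have := intervalIntegral.norm_integral_le_of_norm_le_const (a := (0 : ℝ)) (b := 1)
    (C := 2 * (e * d)) (f := fun s => e' s - ∫ t in (0 : ℝ)..1,
      (G₁ (Γ (s, t)) - G₀ (Γ (s, t))) (Γ' (s, t)) (Γ' (s, t))) fun s hs => ?_
  · simpa using this
  · rw [uIoc_of_le zero_le_one] at hs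
    exact he' s (Ioc_subset_Icc_self hs)

end Energy

/-! ### Positive definite bilinear forms -/

section Bilinear

variable {X : Type} [NormedAddCommGroup X] [NormedSpace ℝ X] [FiniteDimensional ℝ X]

/-- Ellipticity excludes a kernel, and `X` and its dual have the same finite dimension. -/
theorem isInvertible_of_elliptic {B : X →L[ℝ] X →L[ℝ] ℝ} {a : ℝ} (ha : 0 < a)
    (h : ∀ v, a * ‖v‖ ^ 2 ≤ B v v) : B.IsInvertible := by
  have hinj : Function.Injective (B : X →ₗ[ℝ] X →L[ℝ] ℝ) := by
    rw [← LinearMap.ker_eq_bot, LinearMap.ker_eq_bot']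
    intro v hv
    have h1 := h v
    have h2 : B v = 0 := hv
    rw [h2] at h1
    have h3 : ‖v‖ ^ 2 ≤ 0 := by
      by_contra hc
      push Not at hc
      have := mul_pos ha hc
      simp at h1
      linarith
    exact norm_eq_zero.1 (pow_eq_zero_iff (two_ne_zero) |>.1 (le_antisymm h3 (sq_nonneg _)))
  have hdim : Module.finrank ℝ X = Module.finrank ℝ (X →L[ℝ] ℝ) := by
    rw [← (LinearMap.toContinuousLinearMap (𝕜 := ℝ) (E := X) (F' := ℝ)).finrank_eq]
    exact (Subspace.dual_finrank_eq (K := ℝ) (V := X)).symm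
  let e := (LinearMap.linearEquivOfInjective (B : X →ₗ[ℝ] X →L[ℝ] ℝ) hinj hdim).toContinuousLinearEquiv
  exact ⟨e, by ext v w; rfl⟩

theorem contDiffAt_inverse_of_isInvertible {B : X →L[ℝ] X →L[ℝ] ℝ} (h : B.IsInvertible)
    {l : WithTop ℕ∞} :
    ContDiffAt ℝ l (ContinuousLinearMap.inverse :
      (X →L[ℝ] X →L[ℝ] ℝ) → ((X →L[ℝ] ℝ) →L[ℝ] X)) B := by
  obtain ⟨e, rfl⟩ := h
  exact contDiffAt_map_inverse e

/-- For `a > 0`, inversion is smooth on this compact set, so its derivatives there are bounded in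
terms of `C` and `a` alone; `JetBound.inverse` rests on this. -/
theorem isCompact_elliptic (C a : ℝ) :
    IsCompact {B : X →L[ℝ] X →L[ℝ] ℝ | ‖B‖ ≤ C ∧ ∀ v, a * ‖v‖ ^ 2 ≤ B v v} := by
  have : ProperSpace (X →L[ℝ] X →L[ℝ] ℝ) := FiniteDimensional.proper ℝ _
  have h1 : IsClosed {B : X →L[ℝ] X →L[ℝ] ℝ | ∀ v, a * ‖v‖ ^ 2 ≤ B v v} := by
    simp only [ofPred_forall]
    exact isClosed_iInter fun v => isClosed_le continuous_const
      ((ContinuousLinearMap.apply ℝ ℝ v).continuous.comp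
        (ContinuousLinearMap.apply ℝ (X →L[ℝ] ℝ) v).continuous)
  refine ((isCompact_closedBall (0 : X →L[ℝ] X →L[ℝ] ℝ) C).inter_right h1).of_isClosed_subset ?_ ?_
  · exact (isClosed_le continuous_norm continuous_const).inter h1
  · intro B hB
    exact ⟨by simpa using hB.1, hB.2⟩

variable {ι : Type*} {Y : Type} [NormedAddCommGroup Y] [NormedSpace ℝ Y]

theorem JetBound.inverse {l : ℕ} {u : ι → Y → X →L[ℝ] X →L[ℝ] ℝ} {p : ι → Y} {a : ℝ} (ha : 0 < a)
    (hu : JetBound l u p (fun _ => 1)) (hell : ∀ i v, a * ‖v‖ ^ 2 ≤ u i (p i) v v) :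
    JetBound l (fun i y => (u i y).inverse) p (fun _ => 1) := by
  obtain ⟨C, hC, h⟩ := hu.bound
  exact hu.comp_of_compact (isCompact_elliptic C a)
    (fun B hB => contDiffAt_inverse_of_isInvertible (isInvertible_of_elliptic ha hB.2))
    fun i => ⟨by simpa using h i, hell i⟩

end Bilinear

/-! ### The scaled geodesic equation and its approximate solutions -/

section Picard

variable {X : Type} [NormedAddCommGroup X] [NormedSpace ℝ X]

/-- The segment between two metrics. -/
noncomputable def segMetric (h₀ h₁ : X × ℝ → X →L[ℝ] X →L[ℝ] ℝ) (s : ℝ) (p : X × ℝ) :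
    X →L[ℝ] X →L[ℝ] ℝ := (1 - s) • h₀ p + s • h₁ p

/-- The derivative of `segMetric h₀ h₁ s`. -/
noncomputable def segDeriv (h₀ h₁ : X × ℝ → X →L[ℝ] X →L[ℝ] ℝ) (s : ℝ) (p : X × ℝ) :
    (X × ℝ) →L[ℝ] X →L[ℝ] X →L[ℝ] ℝ := (1 - s) • fderiv ℝ h₀ p + s • fderiv ℝ h₁ p

/-- The right hand side of the geodesic equation of the metric `h_s + (dxⁿ)²` after the anisotropic
scaling `(x', xⁿ) = (x + ε z', ε² zⁿ)`; the first component still has to be multiplied by `ε`. -/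
noncomputable def accel (h₀ h₁ : X × ℝ → X →L[ℝ] X →L[ℝ] ℝ)
    (a : (X × ℝ) × ℝ × ℝ × (X × ℝ)) : X × ℝ :=
  ((segMetric h₀ h₁ a.2.2.1 a.1).inverse
      ((1 / 2 : ℝ) • (((segDeriv h₀ h₁ a.2.2.1 a.1).comp (ContinuousLinearMap.inl ℝ X ℝ)).flip
          a.2.2.2.1).flip a.2.2.2.1
        - segDeriv h₀ h₁ a.2.2.1 a.1 (a.2.2.2.1, a.2.1 * a.2.2.2.2) a.2.2.2.1),
    (1 / 2) * segDeriv h₀ h₁ a.2.2.1 a.1 (0, 1) a.2.2.2.1 a.2.2.2.1)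

/-- The space of the parameters `((x, ε), s)`. -/
abbrev Par (X : Type) : Type := (X × ℝ) × ℝ

/-- The point `(x + ε z', ε² zⁿ)`. -/
noncomputable def picPos (S : Par X × ℝ → (X × ℝ) × (X × ℝ)) (r : Par X × ℝ) : X × ℝ :=
  (r.1.1.1 + r.1.1.2 • (S r).1.1, r.1.1.2 ^ 2 * (S r).1.2)

/-- The scaled acceleration prescribed by the state `S` (position and velocity). -/
noncomputable def picAcc (h₀ h₁ : X × ℝ → X →L[ℝ] X →L[ℝ] ℝ)
    (S : Par X × ℝ → (X × ℝ) × (X × ℝ)) (r : Par X × ℝ) : X × ℝ :=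
  (r.1.1.2 • (accel h₀ h₁ (picPos S r, r.1.1.2, r.1.2, (S r).2)).1,
    (accel h₀ h₁ (picPos S r, r.1.1.2, r.1.2, (S r).2)).2)

/-- The curve from `0` to `(ξ, 0)` with the acceleration `A`, and its velocity. -/
noncomputable def curveOfAcc (ξ : X) (A : Par X × ℝ → X × ℝ) (r : Par X × ℝ) :
    (X × ℝ) × (X × ℝ) :=
  (r.2 • ((ξ, 0) - ∫ τ in (0 : ℝ)..1, ∫ σ in (0 : ℝ)..τ, A (r.1, σ)) +
      ∫ τ in (0 : ℝ)..r.2, ∫ σ in (0 : ℝ)..τ, A (r.1, σ),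
    ((ξ, 0) - ∫ τ in (0 : ℝ)..1, ∫ σ in (0 : ℝ)..τ, A (r.1, σ)) + ∫ σ in (0 : ℝ)..r.2, A (r.1, σ))

/-- The Picard iterates of the scaled geodesic equation. -/
noncomputable def pic (h₀ h₁ : X × ℝ → X →L[ℝ] X →L[ℝ] ℝ) (ξ : X) :
    ℕ → Par X × ℝ → (X × ℝ) × (X × ℝ)
  | 0 => fun r => ((r.2 • ξ, 0), (ξ, 0))
  | J + 1 => curveOfAcc ξ (picAcc h₀ h₁ (pic h₀ h₁ ξ J))

/-- At `ε = 0` the whole curve collapses to the base point, whatever `S` is. Hence the jets at `ε =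
0` of everything built from the iterates involve only the jets of the metrics at `(x, 0)`. -/
theorem picPos_zero (S : Par X × ℝ → (X × ℝ) × (X × ℝ)) (x : X) (s t : ℝ) :
    picPos S (((x, 0), s), t) = (x, 0) := by simp [picPos]

variable {ι κ : Type*} [FiniteDimensional ℝ X]

theorem jetBound_segMetric {l : ℕ} {h₀ h₁ : ι → X × ℝ → X →L[ℝ] X →L[ℝ] ℝ}
    {a : ι → (X × ℝ) × ℝ × ℝ × (X × ℝ)} (ha : ∃ C, 0 ≤ C ∧ ∀ i, ‖a i‖ ≤ C)
    (H₀ : JetBound l h₀ (fun i => (a i).1) (fun _ => 1))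
    (H₁ : JetBound l h₁ (fun i => (a i).1) (fun _ => 1)) :
    JetBound l (fun i a => segMetric (h₀ i) (h₁ i) a.2.2.1 a.1) a (fun _ => 1) := by
  have hid := jetBound_id (l := l) ha
  have hp := hid.clm_apply (ContinuousLinearMap.fst ℝ (X × ℝ) (ℝ × ℝ × (X × ℝ)))
  have hs := hid.clm_apply (((ContinuousLinearMap.fst ℝ ℝ (X × ℝ)).comp
    (ContinuousLinearMap.snd ℝ ℝ (ℝ × (X × ℝ)))).comp
    (ContinuousLinearMap.snd ℝ (X × ℝ) (ℝ × ℝ × (X × ℝ))))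
  have one : ∀ i : ι, (0 : ℝ) ≤ 1 := fun _ => zero_le_one
  exact (JetBound.smul one ((jetBound_const (1 : ℝ)).sub hs) (JetBound.comp one H₀ hp)).add
    (JetBound.smul one hs (JetBound.comp one H₁ hp))

theorem jetBound_segDeriv {l : ℕ} {h₀ h₁ : ι → X × ℝ → X →L[ℝ] X →L[ℝ] ℝ}
    {a : ι → (X × ℝ) × ℝ × ℝ × (X × ℝ)} (ha : ∃ C, 0 ≤ C ∧ ∀ i, ‖a i‖ ≤ C)
    (H₀ : JetBound (l + 1) h₀ (fun i => (a i).1) (fun _ => 1))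
    (H₁ : JetBound (l + 1) h₁ (fun i => (a i).1) (fun _ => 1)) :
    JetBound l (fun i a => segDeriv (h₀ i) (h₁ i) a.2.2.1 a.1) a (fun _ => 1) := by
  have hid := jetBound_id (l := l) ha
  have hp := hid.clm_apply (ContinuousLinearMap.fst ℝ (X × ℝ) (ℝ × ℝ × (X × ℝ)))
  have hs := hid.clm_apply (((ContinuousLinearMap.fst ℝ ℝ (X × ℝ)).comp
    (ContinuousLinearMap.snd ℝ ℝ (ℝ × (X × ℝ)))).comp
    (ContinuousLinearMap.snd ℝ (X × ℝ) (ℝ × ℝ × (X × ℝ))))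
  have one : ∀ i : ι, (0 : ℝ) ≤ 1 := fun _ => zero_le_one
  exact (JetBound.smul one ((jetBound_const (1 : ℝ)).sub hs)
      (JetBound.comp (u := fun i => fderiv ℝ (h₀ i)) one H₀.fderiv hp)).add
    (JetBound.smul one hs (JetBound.comp (u := fun i => fderiv ℝ (h₁ i)) one H₁.fderiv hp))

theorem segMetric_elliptic {h₀ h₁ : X × ℝ → X →L[ℝ] X →L[ℝ] ℝ} {p : X × ℝ} {c s : ℝ}
    (h0 : ∀ v, c * ‖v‖ ^ 2 ≤ h₀ p v v) (h1 : ∀ v, c * ‖v‖ ^ 2 ≤ h₁ p v v) (hs : s ∈ Icc (0 : ℝ) 1)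
    (v : X) : c * ‖v‖ ^ 2 ≤ segMetric h₀ h₁ s p v v := by
  have e : segMetric h₀ h₁ s p v v = (1 - s) * h₀ p v v + s * h₁ p v v := by simp [segMetric]
  rw [e]
  nlinarith [mul_le_mul_of_nonneg_left (h0 v) (sub_nonneg.2 hs.2),
    mul_le_mul_of_nonneg_left (h1 v) hs.1]

theorem jetBound_accel {l : ℕ} {h₀ h₁ : ι → X × ℝ → X →L[ℝ] X →L[ℝ] ℝ}
    {a : ι → (X × ℝ) × ℝ × ℝ × (X × ℝ)} (ha : ∃ C, 0 ≤ C ∧ ∀ i, ‖a i‖ ≤ C)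
    (H₀ : JetBound (l + 1) h₀ (fun i => (a i).1) (fun _ => 1))
    (H₁ : JetBound (l + 1) h₁ (fun i => (a i).1) (fun _ => 1))
    (hs : ∀ i, (a i).2.2.1 ∈ Icc (0 : ℝ) 1) {c : ℝ} (hc : 0 < c)
    (hell₀ : ∀ i v, c * ‖v‖ ^ 2 ≤ h₀ i (a i).1 v v) (hell₁ : ∀ i v, c * ‖v‖ ^ 2 ≤ h₁ i (a i).1 v v) :
    JetBound l (fun i => accel (h₀ i) (h₁ i)) a (fun _ => 1) := by
  have one : ∀ i : ι, (0 : ℝ) ≤ 1 := fun _ => zero_le_one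
  have hid := jetBound_id (l := l) ha
  have hM := (jetBound_segMetric ha (H₀.mono (Nat.le_succ l)) (H₁.mono (Nat.le_succ l))).inverse hc
    fun i v => segMetric_elliptic (hell₀ i) (hell₁ i) (hs i) v
  have hD := jetBound_segDeriv ha H₀ H₁
  have hε := hid.clm_apply ((ContinuousLinearMap.fst ℝ ℝ (ℝ × (X × ℝ))).comp
    (ContinuousLinearMap.snd ℝ (X × ℝ) (ℝ × ℝ × (X × ℝ))))
  have hy := hid.clm_apply (((ContinuousLinearMap.snd ℝ ℝ (X × ℝ)).comp
    (ContinuousLinearMap.snd ℝ ℝ (ℝ × (X × ℝ)))).comp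
    (ContinuousLinearMap.snd ℝ (X × ℝ) (ℝ × ℝ × (X × ℝ))))
  have hy1 := hy.clm_apply (ContinuousLinearMap.fst ℝ X ℝ)
  have hy2 := hy.clm_apply (ContinuousLinearMap.snd ℝ X ℝ)
  have hD1 := hD.clm_apply ((ContinuousLinearMap.compL ℝ X (X × ℝ) (X →L[ℝ] X →L[ℝ] ℝ)).flip
    (ContinuousLinearMap.inl ℝ X ℝ))
  have hD2 := JetBound.clm_bilin one (hD1.clm_apply (ContinuousLinearMap.flipₗᵢ ℝ X X
    (X →L[ℝ] ℝ)).toContinuousLinearEquiv.toContinuousLinearMap) hy1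
  have hD3 := JetBound.clm_bilin one (hD2.clm_apply (ContinuousLinearMap.flipₗᵢ ℝ X X
    ℝ).toContinuousLinearEquiv.toContinuousLinearMap) hy1
  have hD4 := JetBound.clm_bilin one (JetBound.clm_bilin one hD
    (hy1.prodMk (JetBound.mul one hε hy2))) hy1
  have hD5 := JetBound.clm_bilin one (JetBound.clm_bilin one
    (hD.clm_apply (ContinuousLinearMap.apply ℝ (X →L[ℝ] X →L[ℝ] ℝ) ((0 : X), (1 : ℝ)))) hy1) hy1
  exact (JetBound.clm_bilin one hM ((hD3.const_smul (1 / 2)).sub hD4)).prodMk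
    (hD5.const_smul (1 / 2))

/-- Integration costs no derivative, and the affine correction of the end point is an integral as
well. -/
theorem jetBound_curveOfAcc {l : ℕ} {ξ : X} {A : ι → Par X × ℝ → X × ℝ} {p : ι → Par X}
    (hp : ∃ C, 0 ≤ C ∧ ∀ i, ‖p i‖ ≤ C)
    (hA : JetBound l (fun k : ι × Icc (0 : ℝ) 1 => A k.1) (fun k => (p k.1, (k.2 : ℝ)))
      (fun _ => 1)) :
    JetBound l (fun k : ι × Icc (0 : ℝ) 1 => curveOfAcc ξ (A k.1)) (fun k => (p k.1, (k.2 : ℝ)))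
      (fun _ => 1) := by
  have one : ∀ i : ι, (0 : ℝ) ≤ 1 := fun _ => zero_le_one
  have one' : ∀ i : ι × Icc (0 : ℝ) 1, (0 : ℝ) ≤ 1 := fun _ => zero_le_one
  have h1 := JetBound.primitive one hp hA
  have h2 := JetBound.primitive (u := fun i q => ∫ σ in (0 : ℝ)..q.2, A i (q.1, σ)) one hp h1
  have h3 := JetBound.integral (u := fun i q => ∫ σ in (0 : ℝ)..q.2, A i (q.1, σ)) one h1
  have hid := jetBound_id (l := l) (p := fun k : ι × Icc (0 : ℝ) 1 => (p k.1, (k.2 : ℝ)))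
    (bounded_prodMk (bounded_reindex hp _) (bounded_Icc _))
  have h4 := JetBound.comp (u := fun (k : ι × Icc (0 : ℝ) 1) q =>
      ∫ τ in (0 : ℝ)..1, ∫ σ in (0 : ℝ)..τ, A k.1 (q, σ)) one'
    (h3.reindex Prod.fst) (hid.clm_apply (ContinuousLinearMap.fst ℝ (Par X) ℝ))
  have h5 := (jetBound_const (l := l) (p := fun k : ι × Icc (0 : ℝ) 1 => (p k.1, (k.2 : ℝ)))
    ((ξ, 0) : X × ℝ)).sub h4
  exact ((JetBound.smul one' (hid.clm_apply (ContinuousLinearMap.snd ℝ (Par X) ℝ)) h5).add h2).prodMk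
    (h5.add h1)

theorem jetBound_picPos {l : ℕ} {S : ι → Par X × ℝ → (X × ℝ) × (X × ℝ)} {r : ι → Par X × ℝ}
    (hr : ∃ C, 0 ≤ C ∧ ∀ i, ‖r i‖ ≤ C) (hS : JetBound l S r (fun _ => 1)) :
    JetBound l (fun i => picPos (S i)) r (fun _ => 1) := by
  have one : ∀ i : ι, (0 : ℝ) ≤ 1 := fun _ => zero_le_one
  have hid := (jetBound_id (l := l) hr).clm_apply
    ((ContinuousLinearMap.fst ℝ (X × ℝ) ℝ).comp (ContinuousLinearMap.fst ℝ (Par X) ℝ))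
  have hx := hid.clm_apply (ContinuousLinearMap.fst ℝ X ℝ)
  have hε := hid.clm_apply (ContinuousLinearMap.snd ℝ X ℝ)
  have hz := hS.clm_apply (ContinuousLinearMap.fst ℝ (X × ℝ) (X × ℝ))
  exact (hx.add (JetBound.smul one hε (hz.clm_apply (ContinuousLinearMap.fst ℝ X ℝ)))).prodMk
    (JetBound.mul one (hε.pow 2) (hz.clm_apply (ContinuousLinearMap.snd ℝ X ℝ)))

theorem jetBound_picAcc {l : ℕ} {h₀ h₁ : ι → X × ℝ → X →L[ℝ] X →L[ℝ] ℝ} {x : ι → X}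
    (hx : ∃ C, 0 ≤ C ∧ ∀ i, ‖x i‖ ≤ C)
    (H₀ : JetBound (l + 1) h₀ (fun i => (x i, 0)) (fun _ => 1))
    (H₁ : JetBound (l + 1) h₁ (fun i => (x i, 0)) (fun _ => 1)) {c : ℝ} (hc : 0 < c)
    (hell₀ : ∀ i v, c * ‖v‖ ^ 2 ≤ h₀ i (x i, 0) v v) (hell₁ : ∀ i v, c * ‖v‖ ^ 2 ≤ h₁ i (x i, 0) v v)
    {S : ι → Par X × ℝ → (X × ℝ) × (X × ℝ)} {s t : ι → ℝ} (hs : ∀ i, s i ∈ Icc (0 : ℝ) 1)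
    (ht : ∀ i, t i ∈ Icc (0 : ℝ) 1)
    (hS : JetBound l S (fun i => (((x i, 0), s i), t i)) (fun _ => 1)) :
    JetBound l (fun i => picAcc (h₀ i) (h₁ i) (S i)) (fun i => (((x i, 0), s i), t i))
      (fun _ => 1) := by
  have one : ∀ i : ι, (0 : ℝ) ≤ 1 := fun _ => zero_le_one
  have hr : ∃ C, 0 ≤ C ∧ ∀ i, ‖(((x i, (0 : ℝ)), s i), t i)‖ ≤ C :=
    bounded_prodMk (bounded_prodMk (bounded_prodMk hx ⟨0, le_rfl, by simp⟩)
      (bounded_Icc fun i => ⟨s i, hs i⟩)) (bounded_Icc fun i => ⟨t i, ht i⟩)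
  have hid := jetBound_id (l := l) hr
  have hε := hid.clm_apply ((ContinuousLinearMap.snd ℝ X ℝ).comp
    ((ContinuousLinearMap.fst ℝ (X × ℝ) ℝ).comp (ContinuousLinearMap.fst ℝ (Par X) ℝ)))
  have hsv := hid.clm_apply ((ContinuousLinearMap.snd ℝ (X × ℝ) ℝ).comp
    (ContinuousLinearMap.fst ℝ (Par X) ℝ))
  have hy := hS.clm_apply (ContinuousLinearMap.snd ℝ (X × ℝ) (X × ℝ))
  have hv := (jetBound_picPos hr hS).prodMk (hε.prodMk (hsv.prodMk hy))
  have hb : ∃ C, 0 ≤ C ∧ ∀ i, ‖(picPos (S i) (((x i, 0), s i), t i), (0 : ℝ), s i,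
      (S i (((x i, 0), s i), t i)).2)‖ ≤ C := by simpa using hv.bound
  have hacc := jetBound_accel (l := l) (h₀ := h₀) (h₁ := h₁) hb (by simpa [picPos_zero] using H₀)
    (by simpa [picPos_zero] using H₁) hs hc (by simpa [picPos_zero] using hell₀)
    (by simpa [picPos_zero] using hell₁)
  have h1 := JetBound.comp (p := fun i => (((x i, (0 : ℝ)), s i), t i))
    (v := fun i r => (picPos (S i) r, r.1.1.2, r.1.2, (S i r).2)) one hacc hv
  exact (JetBound.smul one hε (h1.clm_apply (ContinuousLinearMap.fst ℝ X ℝ))).prodMk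
    (h1.clm_apply (ContinuousLinearMap.snd ℝ X ℝ))

/-- The acceleration differentiates the metrics once and the previous iterate never. So a single
order is lost in total, for every `J`. -/
theorem jetBound_pic {l : ℕ} {h₀ h₁ : ι → X × ℝ → X →L[ℝ] X →L[ℝ] ℝ} {x : ι → X}
    (hx : ∃ C, 0 ≤ C ∧ ∀ i, ‖x i‖ ≤ C)
    (H₀ : JetBound (l + 1) h₀ (fun i => (x i, 0)) (fun _ => 1))
    (H₁ : JetBound (l + 1) h₁ (fun i => (x i, 0)) (fun _ => 1)) {c : ℝ} (hc : 0 < c)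
    (hell₀ : ∀ i v, c * ‖v‖ ^ 2 ≤ h₀ i (x i, 0) v v) (hell₁ : ∀ i v, c * ‖v‖ ^ 2 ≤ h₁ i (x i, 0) v v)
    (ξ : X) (J : ℕ) :
    JetBound l (fun k : (ι × Icc (0 : ℝ) 1) × Icc (0 : ℝ) 1 => pic (h₀ k.1.1) (h₁ k.1.1) ξ J)
      (fun k => (((x k.1.1, 0), (k.1.2 : ℝ)), (k.2 : ℝ))) (fun _ => 1) := by
  have hp : ∃ C, 0 ≤ C ∧ ∀ k : ι × Icc (0 : ℝ) 1, ‖((x k.1, (0 : ℝ)), (k.2 : ℝ))‖ ≤ C :=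
    bounded_prodMk (bounded_prodMk (bounded_reindex hx Prod.fst) ⟨0, le_rfl, by simp⟩)
      (bounded_Icc _)
  induction J with
  | zero =>
    have hid := jetBound_id (l := l)
      (p := fun k : (ι × Icc (0 : ℝ) 1) × Icc (0 : ℝ) 1 =>
        (((x k.1.1, (0 : ℝ)), (k.1.2 : ℝ)), (k.2 : ℝ)))
      (bounded_prodMk (bounded_reindex hp _) (bounded_Icc _))
    have h1 := hid.clm_apply ((ContinuousLinearMap.toSpanSingleton ℝ ξ).comp
      (ContinuousLinearMap.snd ℝ (Par X) ℝ))
    exact ((h1.congr fun k => Eventually.of_forall fun r => by simp).prodMk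
      (jetBound_const (0 : ℝ))).prodMk (jetBound_const ((ξ, 0) : X × ℝ))
  | succ J ih =>
    have h1 := jetBound_picAcc (l := l) (ι := (ι × Icc (0 : ℝ) 1) × Icc (0 : ℝ) 1)
      (h₀ := fun k => h₀ k.1.1) (h₁ := fun k => h₁ k.1.1) (x := fun k => x k.1.1)
      (S := fun k => pic (h₀ k.1.1) (h₁ k.1.1) ξ J)
      (s := fun k => k.1.2) (t := fun k => k.2)
      (bounded_reindex hx fun k : (ι × Icc (0 : ℝ) 1) × Icc (0 : ℝ) 1 => k.1.1)
      (H₀.reindex fun k : (ι × Icc (0 : ℝ) 1) × Icc (0 : ℝ) 1 => k.1.1)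
      (H₁.reindex fun k : (ι × Icc (0 : ℝ) 1) × Icc (0 : ℝ) 1 => k.1.1) hc
      (fun k => hell₀ k.1.1) (fun k => hell₁ k.1.1) (fun k => k.1.2.2) (fun k => k.2.2) ih
    let A : ι × Icc (0 : ℝ) 1 → Par X × ℝ → X × ℝ :=
      fun k => picAcc (h₀ k.1) (h₁ k.1) (pic (h₀ k.1) (h₁ k.1) ξ J)
    let p : ι × Icc (0 : ℝ) 1 → Par X := fun k => ((x k.1, 0), (k.2 : ℝ))
    have h2 : JetBound l (fun k : (ι × Icc (0 : ℝ) 1) × Icc (0 : ℝ) 1 => curveOfAcc ξ (A k.1))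
        (fun k => (p k.1, (k.2 : ℝ))) (fun _ => 1) := jetBound_curveOfAcc (ξ := ξ) hp h1
    exact h2

end Picard

/-! ### The approximate geodesics: derivatives, end points, values at `ε = 0` -/

section Approximation

variable {X : Type} [NormedAddCommGroup X] [NormedSpace ℝ X]

theorem eventually_forall_Icc_Icc {P : Par X × ℝ → Prop} {x : X}
    (h : ∀ s ∈ Icc (0 : ℝ) 1, ∀ t ∈ Icc (0 : ℝ) 1, ∀ᶠ r in 𝓝 (((x, (0 : ℝ)), s), t), P r) :
    ∀ᶠ ε in 𝓝 (0 : ℝ), ∀ s ∈ Icc (0 : ℝ) 1, ∀ t ∈ Icc (0 : ℝ) 1, P (((x, ε), s), t) := by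
  have h1 := (isCompact_Icc (a := (0 : ℝ)) (b := 1)).prod (isCompact_Icc (a := (0 : ℝ)) (b := 1))
    |>.eventually_forall_of_forall_eventually (x₀ := (0 : ℝ))
      (P := fun (ε : ℝ) (q : ℝ × ℝ) => P (((x, ε), q.1), q.2)) (fun q hq => by
        have hc : ContinuousAt (fun z : ℝ × (ℝ × ℝ) => (((x, z.1), z.2.1), z.2.2)) (0, q) := by
          fun_prop
        exact hc.eventually (h q.1 hq.1 q.2 hq.2))
  filter_upwards [h1] with ε hε s hs t ht using hε (s, t) ⟨hs, ht⟩

/-- A primitive is differentiated at the end points 0 and 1 as well, which requires control on an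
open interval. Compactness provides a margin `δ` common to all parameters near `x`. -/
theorem exists_Ioo_of_eventually {P : X × ℝ → Prop} {x : X}
    (h : ∀ t ∈ Icc (0 : ℝ) 1, ∀ᶠ q in 𝓝 (x, t), P q) :
    ∃ δ > 0, ∀ᶠ y in 𝓝 x, ∀ t ∈ Ioo (-δ) (1 + δ), P (y, t) := by
  have h1 : ({x} : Set X) ×ˢ Icc (0 : ℝ) 1 ⊆ interior {q | P q} := by
    rintro ⟨y, t⟩ ⟨rfl, ht⟩
    exact mem_interior_iff_mem_nhds.2 (h t ht)
  obtain ⟨u, v, hu, hv, hxu, hIv, huv⟩ :=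
    generalized_tube_lemma isCompact_singleton isCompact_Icc isOpen_interior h1
  obtain ⟨δ, hδ, hv'⟩ := (isCompact_Icc (a := (0 : ℝ)) (b := 1)).exists_thickening_subset_open hv hIv
  refine ⟨δ, hδ, ?_⟩
  filter_upwards [hu.mem_nhds (hxu rfl)] with y hy t ht
  refine interior_subset (huv ⟨hy, hv' (Metric.mem_thickening_iff.2 ?_)⟩)
  rcases lt_or_ge t 0 with h0 | h0
  · exact ⟨0, by simp, by rw [Real.dist_eq, abs_lt]; constructor <;> linarith [ht.1]⟩
  rcases lt_or_ge 1 t with h1 | h1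
  · exact ⟨1, by simp, by rw [Real.dist_eq, abs_lt]; constructor <;> linarith [ht.2]⟩
  · exact ⟨t, ⟨h0, h1⟩, by simpa using hδ⟩

theorem hasDerivAt_primitive {F : Type} [NormedAddCommGroup F] [NormedSpace ℝ F] [CompleteSpace F]
    {f : ℝ → F} {a b t : ℝ} (hf : ContinuousOn f (Ioo a b)) (h0 : (0 : ℝ) ∈ Ioo a b)
    (ht : t ∈ Ioo a b) : HasDerivAt (fun τ => ∫ σ in (0 : ℝ)..τ, f σ) (f t) t := by
  have hsub : uIcc 0 t ⊆ Ioo a b := ordConnected_Ioo.uIcc_subset h0 ht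
  exact intervalIntegral.integral_hasDerivAt_right (hf.mono hsub).intervalIntegrable
    (hf.stronglyMeasurableAtFilter isOpen_Ioo t ht) (hf.continuousAt (isOpen_Ioo.mem_nhds ht))

theorem hasDerivAt_curveOfAcc [CompleteSpace X] {ξ : X} {A : Par X × ℝ → X × ℝ} {p : Par X}
    (hA : ∀ t ∈ Icc (0 : ℝ) 1, ∀ᶠ r in 𝓝 (p, t), ContinuousAt A r) :
    ∀ t ∈ Icc (0 : ℝ) 1, ∀ᶠ r in 𝓝 (p, t),
      HasDerivAt (fun τ => (curveOfAcc ξ A (r.1, τ)).1) (curveOfAcc ξ A r).2 r.2 ∧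
      HasDerivAt (fun τ => (curveOfAcc ξ A (r.1, τ)).2) (A r) r.2 := by
  obtain ⟨δ, hδ, h⟩ := exists_Ioo_of_eventually hA
  intro t ht
  have h2 : ∀ᶠ r : Par X × ℝ in 𝓝 (p, t), r.2 ∈ Ioo (-δ) (1 + δ) :=
    continuousAt_snd.eventually (isOpen_Ioo.mem_nhds ⟨by linarith [ht.1], by linarith [ht.2]⟩)
  filter_upwards [continuousAt_fst.eventually h, h2] with r hr hr2
  have h0 : (0 : ℝ) ∈ Ioo (-δ) (1 + δ) := ⟨by linarith, by linarith⟩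
  have c1 : ContinuousOn (fun σ => A (r.1, σ)) (Ioo (-δ) (1 + δ)) :=
    continuousOn_slice fun τ hτ => hr τ hτ
  have d1 : ∀ τ ∈ Ioo (-δ) (1 + δ), HasDerivAt (fun τ => ∫ σ in (0 : ℝ)..τ, A (r.1, σ))
    (A (r.1, τ)) τ := fun τ hτ => hasDerivAt_primitive c1 h0 hτ
  have d2 := hasDerivAt_primitive (fun τ hτ => (d1 τ hτ).continuousAt.continuousWithinAt) h0 hr2
  constructor
  · exact (((hasDerivAt_id r.2).smul_const
      ((ξ, (0 : ℝ)) - ∫ τ in (0 : ℝ)..1, ∫ σ in (0 : ℝ)..τ, A (r.1, σ))).add d2).congr_deriv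
        (by simp [curveOfAcc])
  · simpa [curveOfAcc] using (d1 r.2 hr2).const_add
      ((ξ, (0 : ℝ)) - ∫ τ in (0 : ℝ)..1, ∫ σ in (0 : ℝ)..τ, A (r.1, σ))

theorem curveOfAcc_zero (ξ : X) (A : Par X × ℝ → X × ℝ) (q : Par X) :
    (curveOfAcc ξ A (q, 0)).1 = 0 := by simp [curveOfAcc]

theorem curveOfAcc_one (ξ : X) (A : Par X × ℝ → X × ℝ) (q : Par X) :
    (curveOfAcc ξ A (q, 1)).1 = (ξ, 0) := by simp [curveOfAcc]

/-- The normal acceleration of the scaled geodesics at `ε = 0`. -/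
noncomputable def bend (h₀ h₁ : X × ℝ → X →L[ℝ] X →L[ℝ] ℝ) (ξ x : X) (s : ℝ) : ℝ :=
  (1 / 2) * segDeriv h₀ h₁ s (x, 0) (0, 1) ξ ξ

/-- The tangential acceleration carries a factor `ε`. In the normal one only the tangential velocity
survives, so the limit is constant in time. -/
theorem picAcc_at_zero [CompleteSpace X] (h₀ h₁ : X × ℝ → X →L[ℝ] X →L[ℝ] ℝ)
    {S : Par X × ℝ → (X × ℝ) × (X × ℝ)} {ξ x : X} {s t : ℝ}
    (hS : (S (((x, 0), s), t)).2.1 = ξ) :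
    picAcc h₀ h₁ S (((x, 0), s), t) = (0, bend h₀ h₁ ξ x s) := by
  have e := picPos_zero S x s t
  simp [picAcc, e, accel, bend, hS]

/-- From the first iteration on, the limit curve is the same: straight in the tangential directions
and, having constant normal acceleration and normal ends 0, a parabola in the normal one. -/
theorem pic_succ_at_zero [CompleteSpace X] (h₀ h₁ : X × ℝ → X →L[ℝ] X →L[ℝ] ℝ) (ξ x : X) (J : ℕ)
    (s t : ℝ) : pic h₀ h₁ ξ (J + 1) (((x, 0), s), t) =
      ((t • ξ, bend h₀ h₁ ξ x s * (t ^ 2 - t) / 2), (ξ, bend h₀ h₁ ξ x s * (t - 1 / 2))) := by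
  have key : ∀ S : Par X × ℝ → (X × ℝ) × (X × ℝ), (∀ t, (S (((x, 0), s), t)).2.1 = ξ) →
      ∀ t, curveOfAcc ξ (picAcc h₀ h₁ S) (((x, 0), s), t) =
      ((t • ξ, bend h₀ h₁ ξ x s * (t ^ 2 - t) / 2), (ξ, bend h₀ h₁ ξ x s * (t - 1 / 2))) := by
    intro S hS t
    have e : ∀ σ, picAcc h₀ h₁ S (((x, 0), s), σ) = (0, bend h₀ h₁ ξ x s) := fun σ =>
      picAcc_at_zero h₀ h₁ (hS σ)
    simp only [curveOfAcc, e, intervalIntegral.integral_const, sub_zero]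
    have e2 : ∀ b : ℝ, ∫ τ in (0 : ℝ)..b, τ • ((0 : X), bend h₀ h₁ ξ x s) =
        (b ^ 2 / 2) • ((0 : X), bend h₀ h₁ ξ x s) := by
      intro b
      rw [intervalIntegral.integral_smul_const, integral_id]
      simp
    rw [e2, e2]
    ext
    · simp
    · simp; ring
    · simp
    · simp; ring
  induction J generalizing t with
  | zero => exact key _ (fun t => rfl) t
  | succ J ih => exact key _ (fun t => by rw [ih]) t

theorem pic_snd_fst_at_zero [CompleteSpace X] (h₀ h₁ : X × ℝ → X →L[ℝ] X →L[ℝ] ℝ) (ξ x : X) (J : ℕ)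
    (s t : ℝ) : (pic h₀ h₁ ξ J (((x, 0), s), t)).2.1 = ξ := by
  cases J with
  | zero => rfl
  | succ J => rw [pic_succ_at_zero]

/-! ### The convergence of the Picard iteration -/

/-- `u = O(ε^M)` at the base point `x`, uniformly in the parameters `s, t ∈ [0, 1]`. -/
def UnifO {Y : Type} [NormedAddCommGroup Y] (M : ℕ) (x : X) (u : Par X × ℝ → Y) : Prop :=
  ∃ C, 0 ≤ C ∧ ∀ᶠ ε in 𝓝[>] (0 : ℝ), ∀ s ∈ Icc (0 : ℝ) 1, ∀ t ∈ Icc (0 : ℝ) 1,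
    ‖u (((x, ε), s), t)‖ ≤ C * ε ^ M

theorem unifO_zero_of_continuousAt {Y : Type} [NormedAddCommGroup Y] {x : X} {u : Par X × ℝ → Y}
    (h : ∀ s ∈ Icc (0 : ℝ) 1, ∀ t ∈ Icc (0 : ℝ) 1, ContinuousAt u (((x, 0), s), t)) :
    UnifO 0 x u := by
  have hc : ContinuousOn (fun q : ℝ × ℝ => u (((x, 0), q.1), q.2)) (Icc 0 1 ×ˢ Icc 0 1) :=
    fun q hq => (ContinuousAt.comp (f := fun q : ℝ × ℝ => (((x, (0 : ℝ)), q.1), q.2))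
      (h q.1 hq.1 q.2 hq.2) (by fun_prop)).continuousWithinAt
  obtain ⟨C, hC⟩ := (isCompact_Icc.prod isCompact_Icc).exists_bound_of_continuousOn hc
  have h0 := hC (0, 0) (by simp)
  refine ⟨C + 1, by linarith [norm_nonneg (u (((x, 0), (0 : ℝ)), (0 : ℝ)))], ?_⟩
  refine nhdsWithin_le_nhds (eventually_forall_Icc_Icc (P := fun r => ‖u r‖ ≤ _ * r.1.1.2 ^ 0)
    fun s hs t ht => ?_)
  filter_upwards [(h s hs t ht).norm.eventually_lt_const
    (lt_of_le_of_lt (hC (s, t) ⟨hs, ht⟩) (lt_add_one C))] with r hr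
  simpa using hr.le

theorem continuousOn_primitive_Icc {F : Type} [NormedAddCommGroup F] [NormedSpace ℝ F]
    {f : ℝ → F} (hf : ContinuousOn f (Icc 0 1)) :
    ContinuousOn (fun τ => ∫ σ in (0 : ℝ)..τ, f σ) (Icc 0 1) := by
  have := intervalIntegral.continuousOn_primitive_interval (a := (0 : ℝ)) (b := 1) (μ := volume)
    (f := f) (by rw [uIcc_of_le zero_le_one]; exact hf.integrableOn_Icc)
  rwa [uIcc_of_le zero_le_one] at this

theorem norm_clm_primitive_le {F Z : Type} [NormedAddCommGroup F] [NormedSpace ℝ F]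
    [NormedAddCommGroup Z] [NormedSpace ℝ Z] [CompleteSpace F] [CompleteSpace Z]
    {f : ℝ → F} {L : F →L[ℝ] Z} {δ : ℝ}
    (hf : ContinuousOn f (Icc 0 1)) (h : ∀ t ∈ Icc (0 : ℝ) 1, ‖L (f t)‖ ≤ δ) {τ : ℝ}
    (hτ : τ ∈ Icc (0 : ℝ) 1) : ‖L (∫ σ in (0 : ℝ)..τ, f σ)‖ ≤ δ := by
  have hδ : 0 ≤ δ := (norm_nonneg _).trans (h 0 (by simp))
  have hsub : uIcc 0 τ ⊆ Icc (0 : ℝ) 1 := by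
    rw [uIcc_of_le hτ.1]; exact Icc_subset_Icc le_rfl hτ.2
  rw [← L.intervalIntegral_comp_comm (hf.mono hsub).intervalIntegrable]
  refine (intervalIntegral.norm_integral_le_of_norm_le_const (C := δ) fun t ht =>
    h t (hsub (uIoc_subset_uIcc ht))).trans ?_
  rw [sub_zero, abs_of_nonneg hτ.1]
  nlinarith [hτ.2]

/-- `L` will be the projection to the tangential or to the normal part, which are tracked with
different powers of `ε`. One `δ` comes from the integral of the acceleration, the other from the
correction of the end point. -/
theorem norm_clm_curveOfAcc_sub_le {Z : Type} [NormedAddCommGroup Z] [NormedSpace ℝ Z]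
    [CompleteSpace X] [CompleteSpace Z] {ξ : X} {A B : Par X × ℝ → X × ℝ} {q : Par X} {t δ : ℝ}
    {L : X × ℝ →L[ℝ] Z} (hA : ContinuousOn (fun t => A (q, t)) (Icc 0 1))
    (hB : ContinuousOn (fun t => B (q, t)) (Icc 0 1)) (ht : t ∈ Icc (0 : ℝ) 1)
    (h : ∀ t ∈ Icc (0 : ℝ) 1, ‖L (A (q, t) - B (q, t))‖ ≤ δ) :
    ‖L ((curveOfAcc ξ A (q, t)).1 - (curveOfAcc ξ B (q, t)).1)‖ ≤ 2 * δ ∧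
    ‖L ((curveOfAcc ξ A (q, t)).2 - (curveOfAcc ξ B (q, t)).2)‖ ≤ 2 * δ := by
  have hδ : 0 ≤ δ := (norm_nonneg _).trans (h 0 (by simp))
  have hsub : ∀ {τ : ℝ}, τ ∈ Icc (0 : ℝ) 1 → uIcc 0 τ ⊆ Icc (0 : ℝ) 1 := fun {τ} hτ => by
    rw [uIcc_of_le hτ.1]; exact Icc_subset_Icc le_rfl hτ.2
  have pA := continuousOn_primitive_Icc hA
  have pB := continuousOn_primitive_Icc hB
  have hAB := hA.sub hB
  have e1 : ∀ τ ∈ Icc (0 : ℝ) 1, (∫ σ in (0 : ℝ)..τ, A (q, σ)) - (∫ σ in (0 : ℝ)..τ, B (q, σ)) =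
      ∫ σ in (0 : ℝ)..τ, (A (q, σ) - B (q, σ)) := fun τ hτ =>
    (intervalIntegral.integral_sub (hA.mono (hsub hτ)).intervalIntegrable
      (hB.mono (hsub hτ)).intervalIntegrable).symm
  have b1 : ∀ τ ∈ Icc (0 : ℝ) 1,
      ‖L ((∫ σ in (0 : ℝ)..τ, A (q, σ)) - (∫ σ in (0 : ℝ)..τ, B (q, σ)))‖ ≤ δ := fun τ hτ => by
    rw [e1 τ hτ]; exact norm_clm_primitive_le hAB h hτ
  have b2 : ∀ τ ∈ Icc (0 : ℝ) 1,
      ‖L ((∫ υ in (0 : ℝ)..τ, ∫ σ in (0 : ℝ)..υ, A (q, σ)) -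
        (∫ υ in (0 : ℝ)..τ, ∫ σ in (0 : ℝ)..υ, B (q, σ)))‖ ≤ δ := fun τ hτ => by
    rw [← intervalIntegral.integral_sub (pA.mono (hsub hτ)).intervalIntegrable
      (pB.mono (hsub hτ)).intervalIntegrable]
    exact norm_clm_primitive_le (pA.sub pB) b1 hτ
  have one : (1 : ℝ) ∈ Icc (0 : ℝ) 1 := by simp
  constructor
  · have e : (curveOfAcc ξ A (q, t)).1 - (curveOfAcc ξ B (q, t)).1 =
        ((∫ υ in (0 : ℝ)..t, ∫ σ in (0 : ℝ)..υ, A (q, σ)) -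
          (∫ υ in (0 : ℝ)..t, ∫ σ in (0 : ℝ)..υ, B (q, σ))) -
        t • ((∫ υ in (0 : ℝ)..1, ∫ σ in (0 : ℝ)..υ, A (q, σ)) -
          (∫ υ in (0 : ℝ)..1, ∫ σ in (0 : ℝ)..υ, B (q, σ))) := by
      simp only [curveOfAcc, smul_sub]; abel
    rw [e, map_sub, map_smul]
    refine (norm_sub_le _ _).trans ?_
    rw [norm_smul, Real.norm_eq_abs, abs_of_nonneg ht.1]
    nlinarith [b2 t ht, b2 1 one, ht.1, ht.2]
  · have e : (curveOfAcc ξ A (q, t)).2 - (curveOfAcc ξ B (q, t)).2 =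
        ((∫ σ in (0 : ℝ)..t, A (q, σ)) - (∫ σ in (0 : ℝ)..t, B (q, σ))) -
        ((∫ υ in (0 : ℝ)..1, ∫ σ in (0 : ℝ)..υ, A (q, σ)) -
          (∫ υ in (0 : ℝ)..1, ∫ σ in (0 : ℝ)..υ, B (q, σ))) := by
      simp only [curveOfAcc]; abel
    rw [e, map_sub]
    refine (norm_sub_le _ _).trans ?_
    linarith [b1 t ht, b2 1 one]

end Approximation

/-! ### Accuracy of the Picard iterates in powers of `ε` -/

section Convergence

variable {X : Type} [NormedAddCommGroup X] [NormedSpace ℝ X] [FiniteDimensional ℝ X]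

theorem jetBound_single {Y Z : Type} [NormedAddCommGroup Y] [NormedSpace ℝ Y]
    [NormedAddCommGroup Z] [NormedSpace ℝ Z] {l : ℕ} {f : Y → Z} {y : Y} (h : ContDiffAt ℝ l f y) :
    JetBound l (fun _ : Unit => f) (fun _ => y) (fun _ => 1) :=
  jetBound_of_compact (K := {y}) isCompact_singleton (by rintro _ rfl; exact h) (by simp)

/-- Two metrics near a boundary point, in boundary normal coordinates, such that `∂Ω` is strictly
convex in the direction of `ξ`. -/
structure NormalMetrics (h₀ h₁ : X × ℝ → X →L[ℝ] X →L[ℝ] ℝ) (x : X) (c : ℝ) : Prop where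
  pos : 0 < c
  smooth₀ : ContDiffAt ℝ 3 h₀ (x, 0)
  smooth₁ : ContDiffAt ℝ 3 h₁ (x, 0)
  symm₀ : ∀ᶠ p in 𝓝 (x, (0 : ℝ)), ∀ v w, h₀ p v w = h₀ p w v
  symm₁ : ∀ᶠ p in 𝓝 (x, (0 : ℝ)), ∀ v w, h₁ p v w = h₁ p w v
  elliptic₀ : ∀ v, c * ‖v‖ ^ 2 ≤ h₀ (x, 0) v v
  elliptic₁ : ∀ v, c * ‖v‖ ^ 2 ≤ h₁ (x, 0) v v

theorem eventually_elliptic {Y : Type} [TopologicalSpace Y] {h : Y → X →L[ℝ] X →L[ℝ] ℝ} {p : Y} {c : ℝ}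
    (hh : ContinuousAt h p) (hc : 0 < c) (hell : ∀ v, c * ‖v‖ ^ 2 ≤ h p v v) :
    ∀ᶠ q in 𝓝 p, ∀ v, c / 2 * ‖v‖ ^ 2 ≤ h q v v := by
  have h1 : ContinuousAt (fun q => ‖h q - h p‖) p := (hh.sub continuousAt_const).norm
  filter_upwards [h1.eventually_lt_const (show ‖h p - h p‖ < c / 2 by simpa using half_pos hc)]
    with q hq v
  have h2 : ‖(h q - h p) v v‖ ≤ ‖h q - h p‖ * ‖v‖ * ‖v‖ := (h q - h p).le_opNorm₂ v v
  have h3 : (h q - h p) v v = h q v v - h p v v := by simp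
  rw [h3, Real.norm_eq_abs] at h2
  have h4 := (abs_le.1 h2).1
  nlinarith [hell v, mul_le_mul_of_nonneg_right hq.le (sq_nonneg ‖v‖)]

variable {h₀ h₁ : X × ℝ → X →L[ℝ] X →L[ℝ] ℝ} {x : X} {c : ℝ}

theorem contDiffAt_accel (h0 : ContDiffAt ℝ 2 h₀ (x, 0)) (h1 : ContDiffAt ℝ 2 h₁ (x, 0))
    (hc : 0 < c) (e0 : ∀ v, c * ‖v‖ ^ 2 ≤ h₀ (x, 0) v v) (e1 : ∀ v, c * ‖v‖ ^ 2 ≤ h₁ (x, 0) v v) :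
    ∀ᶠ p in 𝓝 (x, (0 : ℝ)), ∀ ε, ∀ s ∈ Icc (0 : ℝ) 1, ∀ y,
      ContDiffAt ℝ 1 (accel h₀ h₁) (p, ε, s, y) := by
  filter_upwards [h0.eventually (by simp), h1.eventually (by simp),
    eventually_elliptic h0.continuousAt hc e0, eventually_elliptic h1.continuousAt hc e1]
    with p s0 s1 el0 el1 ε s hs y
  exact (jetBound_accel (l := 1) (ι := Unit) (a := fun _ => (p, ε, s, y)) ⟨‖(p, ε, s, y)‖,
    norm_nonneg _, fun _ => le_rfl⟩ (jetBound_single s0) (jetBound_single s1) (fun _ => hs)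
    (half_pos hc) (fun _ => el0) (fun _ => el1)).contDiffAt ()

/-- A `C¹` map is locally Lipschitz, hence Lipschitz on a compact set. The constant may depend on
the metrics: it enters remainders only. -/
theorem exists_lipschitz_accel (H : NormalMetrics h₀ h₁ x c) (R : ℝ) :
    ∃ r > 0, ∃ K ≥ 0, ∀ p ∈ Metric.closedBall (x, (0 : ℝ)) r, ∀ p' ∈ Metric.closedBall (x, (0 : ℝ)) r,
      ∀ ε ∈ Icc (0 : ℝ) 1, ∀ s ∈ Icc (0 : ℝ) 1, ∀ y y' : X × ℝ, ‖y‖ ≤ R → ‖y'‖ ≤ R →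
      ‖accel h₀ h₁ (p, ε, s, y) - accel h₀ h₁ (p', ε, s, y')‖ ≤ K * (‖p - p'‖ + ‖y - y'‖) := by
  have hP : ProperSpace X := FiniteDimensional.proper ℝ X
  obtain ⟨r, hr, hb⟩ := Metric.nhds_basis_closedBall.eventually_iff.1 (contDiffAt_accel
    (H.smooth₀.of_le (by norm_num)) (H.smooth₁.of_le (by norm_num)) H.pos H.elliptic₀ H.elliptic₁)
  let T : Set ((X × ℝ) × ℝ × ℝ × (X × ℝ)) := Metric.closedBall (x, (0 : ℝ)) r ×ˢ Icc (0 : ℝ) 1 ×ˢ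
    Icc (0 : ℝ) 1 ×ˢ Metric.closedBall (0 : X × ℝ) R
  have hT : IsCompact T := (isCompact_closedBall _ _).prod
    (isCompact_Icc.prod (isCompact_Icc.prod (isCompact_closedBall _ _)))
  have hL : LocallyLipschitzOn T (accel h₀ h₁) := by
    rintro ⟨p, ε, s, y⟩ ⟨hp, hε, hs, hy⟩
    obtain ⟨K, t, ht, hK⟩ := (hb hp ε s hs y).exists_lipschitzOnWith
    exact ⟨K, t, nhdsWithin_le_nhds ht, hK⟩
  obtain ⟨K, hK⟩ := hL.exists_lipschitzOnWith_of_compact hT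
  refine ⟨r, hr, K, K.2, fun p hp p' hp' ε hε s hs y y' hy hy' => ?_⟩
  have := hK.dist_le_mul (p, ε, s, y) ⟨hp, hε, hs, by simpa using hy⟩ (p', ε, s, y')
    ⟨hp', hε, hs, by simpa using hy'⟩
  rw [dist_eq_norm] at this
  refine this.trans (mul_le_mul_of_nonneg_left ?_ K.2)
  rw [dist_eq_norm]
  simp only [Prod.mk_sub_mk, sub_self]
  generalize p - p' = P
  generalize y - y' = Y
  rw [Prod.norm_mk P, Prod.norm_mk (0 : ℝ) ((0 : ℝ), Y), Prod.norm_mk (0 : ℝ) Y, norm_zero]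
  refine max_le (le_add_of_nonneg_right (norm_nonneg _)) (max_le (by positivity) (max_le
    (by positivity) (le_add_of_nonneg_left (norm_nonneg _))))

/-- The tangential components are `O(ε^a)`, the normal ones `O(ε^b)`. -/
def UnifO₂ (a b : ℕ) (x : X) (D : Par X × ℝ → (X × ℝ) × (X × ℝ)) : Prop :=
  ∃ C, 0 ≤ C ∧ ∀ᶠ ε in 𝓝[>] (0 : ℝ), ∀ s ∈ Icc (0 : ℝ) 1, ∀ t ∈ Icc (0 : ℝ) 1,
    ‖(D (((x, ε), s), t)).1.1‖ ≤ C * ε ^ a ∧ ‖(D (((x, ε), s), t)).2.1‖ ≤ C * ε ^ a ∧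
    ‖(D (((x, ε), s), t)).1.2‖ ≤ C * ε ^ b ∧ ‖(D (((x, ε), s), t)).2.2‖ ≤ C * ε ^ b

theorem eventually_small {r : ℝ} (hr : 0 < r) : ∀ᶠ ε in 𝓝[>] (0 : ℝ), 0 < ε ∧ ε ≤ r := by
  filter_upwards [Ioc_mem_nhdsGT hr] with ε hε using hε

theorem picPos_mem_closedBall {S : Par X × ℝ → (X × ℝ) × (X × ℝ)} (hS : UnifO 0 x S) {r : ℝ}
    (hr : 0 < r) : ∀ᶠ ε in 𝓝[>] (0 : ℝ), ∀ s ∈ Icc (0 : ℝ) 1, ∀ t ∈ Icc (0 : ℝ) 1,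
      picPos S (((x, ε), s), t) ∈ Metric.closedBall (x, (0 : ℝ)) r := by
  obtain ⟨C, hC, h⟩ := hS
  filter_upwards [h, eventually_small zero_lt_one, eventually_small (r := r / (C + 1)) (by positivity)]
    with ε hε h1 h2 s hs t ht
  have h3 := hε s hs t ht
  rw [pow_zero, mul_one] at h3
  have h4 : ε * (C + 1) ≤ r := (le_div_iff₀ (by positivity)).1 h2.2
  have h5 : ‖(S (((x, ε), s), t)).1.1‖ ≤ C := (norm_fst_le _).trans ((norm_fst_le _).trans h3)
  have h6 : ‖(S (((x, ε), s), t)).1.2‖ ≤ C := (norm_snd_le _).trans ((norm_fst_le _).trans h3)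
  rw [mem_closedBall_iff_norm]
  simp only [picPos, Prod.mk_sub_mk, add_sub_cancel_left, sub_zero, Prod.norm_def (_, _)]
  refine max_le ?_ ?_
  · rw [norm_smul, Real.norm_of_nonneg h1.1.le]; nlinarith
  · rw [norm_mul, norm_pow, Real.norm_of_nonneg h1.1.le]
    have : ε ^ 2 ≤ ε := by nlinarith
    nlinarith [norm_nonneg (S (((x, ε), s), t)).1.2]

/-- The count of exponents. The tangential acceleration carries a factor `ε` and sees all components
of the state. The normal one sees the tangential velocity, of order `a`, and the position, whose
difference is multiplied by `ε` or `ε²`. So the orders `(a, b)` become `(min a b + 1, min a (b +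
1))`. -/
theorem unifO_picAcc_sub (H : NormalMetrics h₀ h₁ x c) {S S' : Par X × ℝ → (X × ℝ) × (X × ℝ)}
    (hS : UnifO 0 x S) (hS' : UnifO 0 x S') {a b a' b' : ℕ}
    (hD : UnifO₂ a b x (fun r => S' r - S r)) (h1 : a' ≤ a + 1) (h2 : a' ≤ b + 1) (h3 : b' ≤ a)
    (h4 : b' ≤ b + 1) :
    ∃ C, 0 ≤ C ∧ ∀ᶠ ε in 𝓝[>] (0 : ℝ), ∀ s ∈ Icc (0 : ℝ) 1, ∀ t ∈ Icc (0 : ℝ) 1,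
    ‖(picAcc h₀ h₁ S' (((x, ε), s), t) - picAcc h₀ h₁ S (((x, ε), s), t)).1‖ ≤ C * ε ^ a' ∧
    ‖(picAcc h₀ h₁ S' (((x, ε), s), t) - picAcc h₀ h₁ S (((x, ε), s), t)).2‖ ≤ C * ε ^ b' := by
  obtain ⟨R, hR, b1⟩ := hS
  obtain ⟨R', hR', b2⟩ := hS'
  obtain ⟨C, hC, b3⟩ := hD
  obtain ⟨r, hr, K, hK, hL⟩ := exists_lipschitz_accel H (max R R')
  refine ⟨4 * K * C, by positivity, ?_⟩
  filter_upwards [b1, b2, b3, picPos_mem_closedBall ⟨R, hR, b1⟩ hr,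
    picPos_mem_closedBall ⟨R', hR', b2⟩ hr, eventually_small zero_lt_one]
    with ε e1 e2 e3 m1 m2 hε s hs t ht
  replace e1 := e1 s hs t ht
  replace e2 := e2 s hs t ht
  obtain ⟨d1, d2, d3, d4⟩ := e3 s hs t ht
  replace m1 := m1 s hs t ht
  replace m2 := m2 s hs t ht
  rw [pow_zero, mul_one] at e1 e2
  set q : Par X × ℝ := (((x, ε), s), t) with hq
  have n1 : ‖(S q).2‖ ≤ max R R' := ((norm_snd_le _).trans e1).trans (le_max_left _ _)
  have n2 : ‖(S' q).2‖ ≤ max R R' := ((norm_snd_le _).trans e2).trans (le_max_right _ _)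
  have hε' : ε ∈ Icc (0 : ℝ) 1 := ⟨hε.1.le, hε.2⟩
  have hpos : ‖picPos S' q - picPos S q‖ ≤ ε * (C * ε ^ a) + ε * (C * ε ^ b) := by
    have e : picPos S' q - picPos S q = (ε • (S' q - S q).1.1, ε ^ 2 * (S' q - S q).1.2) := by
      simp only [picPos, hq, Prod.mk_sub_mk, Prod.fst_sub, Prod.snd_sub, smul_sub, mul_sub]
      ext <;> simp
    rw [e, Prod.norm_def]
    have : ε ^ 2 ≤ ε := by nlinarith [hε.1, hε.2]
    refine max_le ?_ ?_
    · rw [norm_smul, Real.norm_of_nonneg hε.1.le]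
      have := mul_le_mul_of_nonneg_left d1 hε.1.le
      have : 0 ≤ ε * (C * ε ^ b) := by have := hε.1; positivity
      linarith
    · rw [norm_mul, norm_pow, Real.norm_of_nonneg hε.1.le]
      have h5 := mul_le_mul this d3 (norm_nonneg _) hε.1.le
      have : 0 ≤ ε * (C * ε ^ a) := by have := hε.1; positivity
      linarith
  have hy : ‖(S' q).2 - (S q).2‖ ≤ C * ε ^ a + C * ε ^ b := by
    rw [Prod.norm_def]
    have p1 : 0 ≤ C * ε ^ a := by have := hε.1; positivity
    have p2 : 0 ≤ C * ε ^ b := by have := hε.1; positivity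
    exact max_le (d2.trans (by linarith)) (d4.trans (by linarith))
  have pw : ∀ {i j : ℕ}, i ≤ j → C * ε ^ j ≤ C * ε ^ i := fun h =>
    mul_le_mul_of_nonneg_left (pow_le_pow_of_le_one hε.1.le hε.2 h) hC
  have hEa : ε * (C * ε ^ a) = C * ε ^ (a + 1) := by ring
  have hEb : ε * (C * ε ^ b) = C * ε ^ (b + 1) := by ring
  constructor
  · have l1 := hL _ m2 _ m1 ε hε' s hs _ _ n2 n1
    have e : (picAcc h₀ h₁ S' q - picAcc h₀ h₁ S q).1 = ε • (accel h₀ h₁ (picPos S' q, ε, s, (S' q).2)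
        - accel h₀ h₁ (picPos S q, ε, s, (S q).2)).1 := by
      simp [picAcc, hq, smul_sub]
    rw [e, norm_smul, Real.norm_of_nonneg hε.1.le]
    calc _ ≤ ε * (K * (‖picPos S' q - picPos S q‖ + ‖(S' q).2 - (S q).2‖)) :=
          mul_le_mul_of_nonneg_left ((norm_fst_le _).trans l1) hε.1.le
      _ ≤ ε * (K * ((C * ε ^ a + C * ε ^ b) + (C * ε ^ a + C * ε ^ b))) := by
          have h5 := pw (Nat.le_succ a)
          have h6 := pw (Nat.le_succ b)
          rw [Nat.succ_eq_add_one] at h5 h6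
          rw [hEa, hEb] at hpos
          have hε0 := hε.1.le
          gcongr
          linarith
      _ = K * (2 * (C * ε ^ (a + 1)) + 2 * (C * ε ^ (b + 1))) := by ring
      _ ≤ K * (2 * (C * ε ^ a') + 2 * (C * ε ^ a')) := by
          have h5 := pw h1
          have h6 := pw h2
          gcongr
      _ = _ := by ring
  -- The normal component of `accel` does not involve the normal velocity, which is therefore
  -- replaced by 0 before the Lipschitz bound is used. Otherwise the order `b` would enter without
  -- the factor `ε`.
  · have l1 := hL _ m2 _ m1 ε hε' s hs ((S' q).2.1, 0) ((S q).2.1, 0)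
      (by rw [Prod.norm_mk, norm_zero]; exact max_le ((norm_fst_le _).trans n2) ((norm_nonneg _).trans n2))
      (by rw [Prod.norm_mk, norm_zero]; exact max_le ((norm_fst_le _).trans n1) ((norm_nonneg _).trans n1))
    have e : (picAcc h₀ h₁ S' q - picAcc h₀ h₁ S q).2 =
        (accel h₀ h₁ (picPos S' q, ε, s, ((S' q).2.1, 0))
        - accel h₀ h₁ (picPos S q, ε, s, ((S q).2.1, 0))).2 := by
      simp [picAcc, hq, accel]
    rw [e]
    have d2' : ‖((S' q).2.1, (0 : ℝ)) - ((S q).2.1, 0)‖ ≤ C * ε ^ a := by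
      simpa [Prod.norm_def] using d2
    calc _ ≤ K * (‖picPos S' q - picPos S q‖ + ‖((S' q).2.1, (0 : ℝ)) - ((S q).2.1, 0)‖) :=
          (norm_snd_le _).trans l1
      _ ≤ K * ((C * ε ^ b' + C * ε ^ b') + C * ε ^ b') := by
          have h5 := pw (h3.trans (Nat.le_succ a))
          have h6 := pw h4
          have h7 := pw h3
          rw [Nat.succ_eq_add_one] at h5
          rw [hEa, hEb] at hpos
          gcongr <;> linarith
      _ ≤ _ := by
          have : 0 ≤ K * (C * ε ^ b') := by have := hε.1; positivity
          linarith

theorem unifO_curveOfAcc_sub {A B : Par X × ℝ → X × ℝ} {ξ : X}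
    (hA : ∀ s ∈ Icc (0 : ℝ) 1, ∀ t ∈ Icc (0 : ℝ) 1, ∀ᶠ r in 𝓝 (((x, (0 : ℝ)), s), t), ContinuousAt A r)
    (hB : ∀ s ∈ Icc (0 : ℝ) 1, ∀ t ∈ Icc (0 : ℝ) 1, ∀ᶠ r in 𝓝 (((x, (0 : ℝ)), s), t), ContinuousAt B r)
    {a b : ℕ} (h : ∃ C, 0 ≤ C ∧ ∀ᶠ ε in 𝓝[>] (0 : ℝ), ∀ s ∈ Icc (0 : ℝ) 1, ∀ t ∈ Icc (0 : ℝ) 1,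
      ‖(A (((x, ε), s), t) - B (((x, ε), s), t)).1‖ ≤ C * ε ^ a ∧
      ‖(A (((x, ε), s), t) - B (((x, ε), s), t)).2‖ ≤ C * ε ^ b) :
    UnifO₂ a b x (fun r => curveOfAcc ξ A r - curveOfAcc ξ B r) := by
  have hX : CompleteSpace X := FiniteDimensional.complete ℝ X
  obtain ⟨C, hC, h⟩ := h
  refine ⟨2 * C, by positivity, ?_⟩
  filter_upwards [h, nhdsWithin_le_nhds (eventually_forall_Icc_Icc hA),
    nhdsWithin_le_nhds (eventually_forall_Icc_Icc hB)] with ε hε cA cB s hs t ht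
  have c1 : ContinuousOn (fun t => A (((x, ε), s), t)) (Icc 0 1) := continuousOn_slice (cA s hs)
  have c2 : ContinuousOn (fun t => B (((x, ε), s), t)) (Icc 0 1) := continuousOn_slice (cB s hs)
  have k1 := norm_clm_curveOfAcc_sub_le (ξ := ξ) (L := ContinuousLinearMap.fst ℝ X ℝ) c1 c2 ht
    (fun t ht => (hε s hs t ht).1)
  have k2 := norm_clm_curveOfAcc_sub_le (ξ := ξ) (L := ContinuousLinearMap.snd ℝ X ℝ) c1 c2 ht
    (fun t ht => (hε s hs t ht).2)
  rw [← mul_assoc] at k1 k2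
  exact ⟨k1.1, k1.2, k2.1, k2.2⟩

theorem contDiffAt_pic (H : NormalMetrics h₀ h₁ x c) (ξ : X) (J : ℕ) {s t : ℝ}
    (hs : s ∈ Icc (0 : ℝ) 1) (ht : t ∈ Icc (0 : ℝ) 1) :
    ContDiffAt ℝ 2 (pic h₀ h₁ ξ J) (((x, 0), s), t) :=
  (jetBound_pic (ι := Unit) (l := 2) (x := fun _ => x) ⟨‖x‖, norm_nonneg x, fun _ => le_rfl⟩
    (jetBound_single H.smooth₀) (jetBound_single H.smooth₁) H.pos (fun _ => H.elliptic₀)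
    (fun _ => H.elliptic₁) ξ J).contDiffAt (((), ⟨s, hs⟩), ⟨t, ht⟩)

theorem contDiffAt_picAcc_pic (H : NormalMetrics h₀ h₁ x c) (ξ : X) (J : ℕ) {s t : ℝ}
    (hs : s ∈ Icc (0 : ℝ) 1) (ht : t ∈ Icc (0 : ℝ) 1) :
    ContDiffAt ℝ 2 (picAcc h₀ h₁ (pic h₀ h₁ ξ J)) (((x, 0), s), t) :=
  (jetBound_picAcc (ι := Unit) (l := 2) (x := fun _ => x) (s := fun _ => s) (t := fun _ => t)
    (S := fun _ => pic h₀ h₁ ξ J) ⟨‖x‖, norm_nonneg x, fun _ => le_rfl⟩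
    (jetBound_single H.smooth₀) (jetBound_single H.smooth₁) H.pos (fun _ => H.elliptic₀)
    (fun _ => H.elliptic₁) (fun _ => hs) (fun _ => ht)
    (jetBound_single (contDiffAt_pic H ξ J hs ht))).contDiffAt ()

theorem unifO_zero_pic (H : NormalMetrics h₀ h₁ x c) (ξ : X) (J : ℕ) :
    UnifO 0 x (pic h₀ h₁ ξ J) :=
  unifO_zero_of_continuousAt fun _ hs _ ht => (contDiffAt_pic H ξ J hs ht).continuousAt

theorem eventually_continuousAt_picAcc (H : NormalMetrics h₀ h₁ x c) (ξ : X) (J : ℕ) :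
    ∀ s ∈ Icc (0 : ℝ) 1, ∀ t ∈ Icc (0 : ℝ) 1, ∀ᶠ r in 𝓝 (((x, (0 : ℝ)), s), t),
      ContinuousAt (picAcc h₀ h₁ (pic h₀ h₁ ξ J)) r := fun _ hs _ ht =>
  ((contDiffAt_picAcc_pic H ξ J hs ht).eventually (by simp)).mono fun _ h => h.continuousAt

theorem unifO₂_pic_succ (H : NormalMetrics h₀ h₁ x c) (ξ : X) {J a b a' b' : ℕ}
    (hD : UnifO₂ a b x (fun r => pic h₀ h₁ ξ (J + 1) r - pic h₀ h₁ ξ J r))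
    (h1 : a' ≤ a + 1) (h2 : a' ≤ b + 1) (h3 : b' ≤ a) (h4 : b' ≤ b + 1) :
    UnifO₂ a' b' x (fun r => pic h₀ h₁ ξ (J + 2) r - pic h₀ h₁ ξ (J + 1) r) :=
  unifO_curveOfAcc_sub (eventually_continuousAt_picAcc H ξ (J + 1))
    (eventually_continuousAt_picAcc H ξ J)
    (unifO_picAcc_sub H (unifO_zero_pic H ξ J) (unifO_zero_pic H ξ (J + 1)) hD h1 h2 h3 h4)

/-- The orders evolve as `(M, M)`, `(M + 1, M)`, `(M + 1, M + 1)`: two iterations gain one power of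
`ε` in both components, whence the index `2 * M`. -/
theorem unifO₂_pic (H : NormalMetrics h₀ h₁ x c) (ξ : X) (M : ℕ) :
    UnifO₂ M M x (fun r => pic h₀ h₁ ξ (2 * M + 1) r - pic h₀ h₁ ξ (2 * M) r) := by
  induction M with
  | zero =>
    obtain ⟨C, hC, h⟩ := unifO_zero_of_continuousAt (x := x)
      (u := fun r => pic h₀ h₁ ξ 1 r - pic h₀ h₁ ξ 0 r) fun s hs t ht =>
        (contDiffAt_pic H ξ 1 hs ht).continuousAt.sub (contDiffAt_pic H ξ 0 hs ht).continuousAt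
    refine ⟨C, hC, h.mono fun ε hε s hs t ht => ?_⟩
    have := hε s hs t ht
    exact ⟨(norm_fst_le _).trans ((norm_fst_le _).trans this),
      (norm_fst_le _).trans ((norm_snd_le _).trans this),
      (norm_snd_le _).trans ((norm_fst_le _).trans this),
      (norm_snd_le _).trans ((norm_snd_le _).trans this)⟩
  | succ M ih =>
    have h1 : UnifO₂ (M + 1) M x (fun r => pic h₀ h₁ ξ (2 * M + 2) r - pic h₀ h₁ ξ (2 * M + 1) r) :=
      unifO₂_pic_succ H ξ ih le_rfl le_rfl le_rfl (Nat.le_succ M)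
    exact unifO₂_pic_succ H ξ h1 (Nat.le_succ _) le_rfl le_rfl le_rfl

/-- The discrepancy in the scaled geodesic equation. -/
theorem unifO_picAcc_pic (H : NormalMetrics h₀ h₁ x c) (ξ : X) (M : ℕ) :
    UnifO M x (fun r => picAcc h₀ h₁ (pic h₀ h₁ ξ (2 * M)) r
      - picAcc h₀ h₁ (pic h₀ h₁ ξ (2 * M + 1)) r) := by
  obtain ⟨C, hC, h⟩ := unifO_picAcc_sub H (unifO_zero_pic H ξ (2 * M)) (unifO_zero_pic H ξ (2 * M + 1))
    (unifO₂_pic H ξ M) (Nat.le_succ M) (Nat.le_succ M) le_rfl (Nat.le_succ M)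
  refine ⟨C, hC, h.mono fun ε hε s hs t ht => ?_⟩
  rw [norm_sub_rev, Prod.norm_def]
  exact max_le (hε s hs t ht).1 (hε s hs t ht).2

end Convergence

/-- Both bounds with one constant on one ball, as `energy_ge_of_approx_geodesic` needs them. The
second is the mean value inequality for `f` minus its linearization, the derivative of `f` being
Lipschitz. -/
theorem exists_quadratic_bound {E F : Type} [NormedAddCommGroup E] [NormedSpace ℝ E]
    [NormedAddCommGroup F] [NormedSpace ℝ F] {f : E → F} {p : E} (h : ContDiffAt ℝ 2 f p) :
    ∃ r > 0, ∃ K ≥ 0, ∀ x ∈ Metric.ball p r, ∀ y ∈ Metric.ball p r,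
      ‖f y - f x‖ ≤ K * ‖y - x‖ ∧ ‖f y - f x - fderiv ℝ f x (y - x)‖ ≤ K * ‖y - x‖ ^ 2 := by
  obtain ⟨K₁, t₁, ht₁, h₁⟩ := (h.of_le (by norm_num : (1 : WithTop ℕ∞) ≤ 2)).exists_lipschitzOnWith
  obtain ⟨K₂, t₂, ht₂, h₂⟩ := (h.fderiv_right (m := 1) (by norm_num)).exists_lipschitzOnWith
  have h₃ : ∀ᶠ q in 𝓝 p, DifferentiableAt ℝ f q :=
    (h.eventually (by simp)).mono fun q hq => hq.differentiableAt (by norm_num)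
  obtain ⟨r, hr, hb⟩ := Metric.eventually_nhds_iff_ball.1
    ((eventually_mem_set.2 ht₁).and ((eventually_mem_set.2 ht₂).and h₃))
  refine ⟨r, hr, max K₁ K₂, by positivity, fun x hx y hy => ⟨?_, ?_⟩⟩
  · have := h₁.dist_le_mul y (hb y hy).1 x (hb x hx).1
    rw [dist_eq_norm, dist_eq_norm] at this
    exact this.trans (mul_le_mul_of_nonneg_right (le_max_left _ _) (norm_nonneg _))
  · have hseg : segment ℝ x y ⊆ Metric.ball p r := (convex_ball p r).segment_subset hx hy
    have := (convex_segment x y).norm_image_sub_le_of_norm_hasFDerivWithin_le'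
      (f := f) (f' := fderiv ℝ f) (φ := fderiv ℝ f x) (C := max K₁ K₂ * ‖y - x‖)
      (fun z hz => (hb z (hseg hz)).2.2.hasFDerivAt.hasFDerivWithinAt) (fun z hz => ?_)
      (left_mem_segment ℝ x y) (right_mem_segment ℝ x y)
    · rw [pow_two, ← mul_assoc]; exact this
    · have h5 := h₂.dist_le_mul z (hb z (hseg hz)).2.1 x (hb x hx).2.1
      rw [dist_eq_norm, dist_eq_norm] at h5
      have h6 : ‖z - x‖ ≤ ‖y - x‖ := by
        obtain ⟨a, b, ha, hb, hab, rfl⟩ := hz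
        have : a • x + b • y - x = b • (y - x) := by
          rw [show a = 1 - b by linarith, smul_sub, sub_smul, one_smul]; abel
        rw [this, norm_smul, Real.norm_of_nonneg hb]
        nlinarith [norm_nonneg (y - x)]
      exact h5.trans (mul_le_mul (le_max_right _ _) h6 (norm_nonneg _) (by positivity))

/-- Strict convexity makes the normal acceleration negative. Concavity and zero ends then keep the
approximate geodesics in the half space, so that they are admissible competitors. -/
theorem nonneg_of_concave {z z' z'' : ℝ → ℝ} (h1 : ∀ t ∈ Icc (0 : ℝ) 1, HasDerivAt z (z' t) t)
    (h2 : ∀ t ∈ Icc (0 : ℝ) 1, HasDerivAt z' (z'' t) t) (h3 : ∀ t ∈ Icc (0 : ℝ) 1, z'' t ≤ 0)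
    (h0 : z 0 = 0) (h4 : z 1 = 0) {t : ℝ} (ht : t ∈ Icc (0 : ℝ) 1) : 0 ≤ z t := by
  have hc : ConcaveOn ℝ (Icc (0 : ℝ) 1) z := by
    refine concaveOn_of_hasDerivWithinAt2_nonpos (f' := z') (f'' := z'') (convex_Icc 0 1)
      (fun t ht => (h1 t ht).continuousAt.continuousWithinAt) ?_ ?_ ?_ <;>
    intro t ht <;> rw [interior_Icc] at ht <;> have ht' := Ioo_subset_Icc_self ht
    · exact (h1 t ht').hasDerivWithinAt
    · exact (h2 t ht').hasDerivWithinAt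
    · exact h3 t ht'
  have := hc.2 (left_mem_Icc.2 zero_le_one) (right_mem_Icc.2 zero_le_one)
    (sub_nonneg.2 ht.2) ht.1 (by ring)
  simpa [h0, h4] using this

/-! ### The metric `h + (dxⁿ)²` and the residual of its geodesic equation -/

section ProductMetric

variable {X : Type} [NormedAddCommGroup X] [NormedSpace ℝ X]

/-- The extension of a bilinear form by `0` to the second factor, as a linear map. -/
noncomputable def liftBilin : (X →L[ℝ] X →L[ℝ] ℝ) →L[ℝ] ((X × ℝ) →L[ℝ] (X × ℝ) →L[ℝ] ℝ) :=
  ((ContinuousLinearMap.compL ℝ (X × ℝ) X ((X × ℝ) →L[ℝ] ℝ)).flip (ContinuousLinearMap.fst ℝ X ℝ)).comp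
    (ContinuousLinearMap.compL ℝ X (X →L[ℝ] ℝ) ((X × ℝ) →L[ℝ] ℝ)
      ((ContinuousLinearMap.compL ℝ (X × ℝ) X ℝ).flip (ContinuousLinearMap.fst ℝ X ℝ)))

theorem liftBilin_apply (B : X →L[ℝ] X →L[ℝ] ℝ) (v w : X × ℝ) :
    liftBilin B v w = B v.1 w.1 := rfl

/-- The metric `h + (dxⁿ)²`. -/
noncomputable def prodMetric (h : X × ℝ → X →L[ℝ] X →L[ℝ] ℝ) (q : X × ℝ) :
    (X × ℝ) →L[ℝ] (X × ℝ) →L[ℝ] ℝ :=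
  liftBilin (h q) + (ContinuousLinearMap.snd ℝ X ℝ).smulRight (ContinuousLinearMap.snd ℝ X ℝ)

theorem prodMetric_apply (h : X × ℝ → X →L[ℝ] X →L[ℝ] ℝ) (q v w : X × ℝ) :
    prodMetric h q v w = h q v.1 w.1 + v.2 * w.2 := rfl

theorem contDiffAt_prodMetric {h : X × ℝ → X →L[ℝ] X →L[ℝ] ℝ} {q : X × ℝ} {l : WithTop ℕ∞}
    (hh : ContDiffAt ℝ l h q) : ContDiffAt ℝ l (prodMetric h) q :=
  ContDiffAt.add (f := fun q => (liftBilin (X := X)) (h q))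
    (((liftBilin (X := X)).contDiff (n := l)).contDiffAt.comp q hh) contDiffAt_const

theorem fderiv_prodMetric {h : X × ℝ → X →L[ℝ] X →L[ℝ] ℝ} {q : X × ℝ}
    (hh : DifferentiableAt ℝ h q) (u v w : X × ℝ) :
    fderiv ℝ (prodMetric h) q u v w = fderiv ℝ h q u v.1 w.1 := by
  have h1 : HasFDerivAt (prodMetric h) ((liftBilin (X := X)).comp (fderiv ℝ h q)) q :=
    ((liftBilin (X := X)).hasFDerivAt.comp q hh.hasFDerivAt).add_const _
  rw [h1.fderiv]
  rfl

theorem segMetric_prodMetric (h₀ h₁ : X × ℝ → X →L[ℝ] X →L[ℝ] ℝ) (s : ℝ) :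
    (fun x => (1 - s) • prodMetric h₀ x + s • prodMetric h₁ x) = prodMetric (segMetric h₀ h₁ s) := by
  ext1 q
  ext v w <;> simp [prodMetric_apply, segMetric]

theorem fderiv_segMetric {h₀ h₁ : X × ℝ → X →L[ℝ] X →L[ℝ] ℝ} {q : X × ℝ}
    (d0 : DifferentiableAt ℝ h₀ q) (d1 : DifferentiableAt ℝ h₁ q) (s : ℝ) :
    fderiv ℝ (segMetric h₀ h₁ s) q = segDeriv h₀ h₁ s q :=
  ((d0.hasFDerivAt.const_smul (1 - s)).add (d1.hasFDerivAt.const_smul s)).fderiv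

theorem elliptic_prodMetric {h : X × ℝ → X →L[ℝ] X →L[ℝ] ℝ} {q : X × ℝ} {c : ℝ} (hc : 0 ≤ c)
    (hh : ∀ v, c * ‖v‖ ^ 2 ≤ h q v v) (v : X × ℝ) :
    min c 1 * ‖v‖ ^ 2 ≤ prodMetric h q v v := by
  rw [prodMetric_apply]
  have h1 := hh v.1
  have h2 : 0 ≤ v.2 * v.2 := mul_self_nonneg _
  have h3 : 0 ≤ c * ‖v.1‖ ^ 2 := by positivity
  rcases le_total ‖v.1‖ ‖v.2‖ with h4 | h4
  · rw [Prod.norm_def, max_eq_right h4, Real.norm_eq_abs, sq_abs]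
    nlinarith [min_le_right c 1]
  · rw [Prod.norm_def, max_eq_left h4]
    nlinarith [min_le_left c 1, sq_nonneg ‖v.1‖]

/-- The velocity of the curve `(x + ε z', ε² zⁿ)`. -/
noncomputable def picVel (S : Par X × ℝ → (X × ℝ) × (X × ℝ)) (r : Par X × ℝ) : X × ℝ :=
  (r.1.1.2 • (S r).2.1, r.1.1.2 ^ 2 * (S r).2.2)

/-- The unscaled acceleration. -/
noncomputable def scaleAcc (A : Par X × ℝ → X × ℝ) (r : Par X × ℝ) : X × ℝ :=
  (r.1.1.2 • (A r).1, r.1.1.2 ^ 2 * (A r).2)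

variable [FiniteDimensional ℝ X]

/-- `accel` solves the scaled equation exactly, so the residual measures only the difference between
the actual acceleration `A` and the one prescribed by the state. Undoing the scaling multiplies it
by `ε` tangentially and by `ε²` normally. -/
theorem geodesicResidual_eq {h₀ h₁ : X × ℝ → X →L[ℝ] X →L[ℝ] ℝ}
    {S : Par X × ℝ → (X × ℝ) × (X × ℝ)} {A : Par X × ℝ → X × ℝ} {r : Par X × ℝ}
    (d0 : DifferentiableAt ℝ h₀ (picPos S r)) (d1 : DifferentiableAt ℝ h₁ (picPos S r)) {c : ℝ}
    (hc : 0 < c) (e0 : ∀ v, c * ‖v‖ ^ 2 ≤ h₀ (picPos S r) v v)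
    (e1 : ∀ v, c * ‖v‖ ^ 2 ≤ h₁ (picPos S r) v v) (hs : r.1.2 ∈ Icc (0 : ℝ) 1) (w : X × ℝ) :
    geodesicResidual (prodMetric (segMetric h₀ h₁ r.1.2)) (picPos S r) (picVel S r) (scaleAcc A r) w =
      r.1.1.2 * segMetric h₀ h₁ r.1.2 (picPos S r) (A r - picAcc h₀ h₁ S r).1 w.1
        + r.1.1.2 ^ 2 * (A r - picAcc h₀ h₁ S r).2 * w.2 := by
  have hd : DifferentiableAt ℝ (segMetric h₀ h₁ r.1.2) (picPos S r) :=
    ((d0.const_smul (1 - r.1.2)).add (d1.const_smul r.1.2))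
  have hinv := isInvertible_of_elliptic hc (segMetric_elliptic e0 e1 hs)
  simp only [geodesicResidual, fderiv_prodMetric hd, fderiv_segMetric d0 d1, prodMetric_apply]
  set D := segDeriv h₀ h₁ r.1.2 (picPos S r)
  set H := segMetric h₀ h₁ r.1.2 (picPos S r)
  set ε := r.1.1.2
  set y := (S r).2
  have k1 : H (picAcc h₀ h₁ S r).1 w.1 = ε * ((1 / 2) * D (w.1, 0) y.1 y.1
      - D (y.1, ε * y.2) y.1 w.1) := by
    have e : (picAcc h₀ h₁ S r).1 = ε • H.inverse ((1 / 2 : ℝ) •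
        ((D.comp (ContinuousLinearMap.inl ℝ X ℝ)).flip y.1).flip y.1 - D (y.1, ε * y.2) y.1) := rfl
    rw [e, map_smul, hinv.self_apply_inverse]
    rfl
  have k2 : (picAcc h₀ h₁ S r).2 = (1 / 2) * D (0, 1) y.1 y.1 := rfl
  have k3 : picVel S r = ε • (y.1, ε * y.2) := by
    simp only [picVel, Prod.smul_mk, smul_eq_mul]
    congr 1
    ring
  have k4 : D w y.1 y.1 = D (w.1, 0) y.1 y.1 + w.2 * D (0, 1) y.1 y.1 := by
    have hw : D w = D (w.1, 0) + w.2 • D (0, 1) := by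
      rw [← map_smul, ← map_add]
      congr 1
      ext <;> simp
    rw [hw]
    rfl
  rw [Prod.fst_sub, Prod.snd_sub, map_sub, sub_apply, k1, k2, k3]
  simp only [scaleAcc, map_smul, Prod.smul_fst, smul_apply, smul_eq_mul]
  rw [k4]
  ring

end ProductMetric

/-! ### Families of approximate geodesics and the expansion of the squared distance -/

section Family

variable {X : Type} [NormedAddCommGroup X] [NormedSpace ℝ X]

theorem hasDerivAt_picPos {S : Par X × ℝ → (X × ℝ) × (X × ℝ)} {q : Par X} {t : ℝ}
    (h : HasDerivAt (fun τ => (S (q, τ)).1) (S (q, t)).2 t) :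
    HasDerivAt (fun τ => picPos S (q, τ)) (picVel S (q, t)) t := by
  have h1 := ((ContinuousLinearMap.fst ℝ X ℝ).hasFDerivAt.comp_hasDerivAt t h)
  have h2 := ((ContinuousLinearMap.snd ℝ X ℝ).hasFDerivAt.comp_hasDerivAt t h)
  exact ((h1.const_smul q.1.2).const_add q.1.1).prodMk (h2.const_mul (q.1.2 ^ 2))

theorem hasDerivAt_picVel {S : Par X × ℝ → (X × ℝ) × (X × ℝ)} {A : Par X × ℝ → X × ℝ} {q : Par X}
    {t : ℝ} (h : HasDerivAt (fun τ => (S (q, τ)).2) (A (q, t)) t) :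
    HasDerivAt (fun τ => picVel S (q, τ)) (scaleAcc A (q, t)) t := by
  have h1 := ((ContinuousLinearMap.fst ℝ X ℝ).hasFDerivAt.comp_hasDerivAt t h)
  have h2 := ((ContinuousLinearMap.snd ℝ X ℝ).hasFDerivAt.comp_hasDerivAt t h)
  exact (h1.const_smul q.1.2).prodMk (h2.const_mul (q.1.2 ^ 2))

/-- A family of curves from `x` to `x + ε ξ`, inside `W ∩ {xⁿ ≥ 0}`, whose member with the number
`s` is an approximate geodesic of the metric `(1 - s) h₀ + s h₁ + (dxⁿ)²`. -/
structure ApproxGeodesics (h₀ h₁ : X × ℝ → X →L[ℝ] X →L[ℝ] ℝ) (x ξ : X) (W : Set (X × ℝ)) (C : ℝ)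
    (M : ℕ) (S : Par X × ℝ → (X × ℝ) × (X × ℝ)) (A : Par X × ℝ → X × ℝ) (ε : ℝ) : Prop where
  regular : ∀ s ∈ Icc (0 : ℝ) 1, ∀ t ∈ Icc (0 : ℝ) 1, ∀ᶠ r in 𝓝 (((x, ε), s), t),
    ContDiffAt ℝ 2 S r ∧ ContinuousAt A r ∧
      HasDerivAt (fun τ => (S (r.1, τ)).1) (S r).2 r.2 ∧ HasDerivAt (fun τ => (S (r.1, τ)).2) (A r) r.2
  mem : ∀ s ∈ Icc (0 : ℝ) 1, ∀ t ∈ Icc (0 : ℝ) 1, picPos S (((x, ε), s), t) ∈ W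
  nonneg : ∀ s ∈ Icc (0 : ℝ) 1, ∀ t ∈ Icc (0 : ℝ) 1, 0 ≤ (picPos S (((x, ε), s), t)).2
  vel : ∀ s ∈ Icc (0 : ℝ) 1, ∀ t ∈ Icc (0 : ℝ) 1, ‖picVel S (((x, ε), s), t)‖ ≤ C * ε
  res : ∀ s ∈ Icc (0 : ℝ) 1, ∀ t ∈ Icc (0 : ℝ) 1, ∀ w,
    |geodesicResidual (prodMetric (segMetric h₀ h₁ s)) (picPos S (((x, ε), s), t))
      (picVel S (((x, ε), s), t)) (scaleAcc A (((x, ε), s), t)) w| ≤ C * ε ^ (M + 1) * ‖w‖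
  variation : ∀ s ∈ Icc (0 : ℝ) 1, ∀ t ∈ Icc (0 : ℝ) 1,
    ‖fderiv ℝ (picPos S) (((x, ε), s), t)‖ ≤ C
  left_end : ∀ s, picPos S (((x, ε), s), 0) = (x, 0)
  right_end : ∀ s, picPos S (((x, ε), s), 1) = (x + ε • ξ, 0)

variable [FiniteDimensional ℝ X] {h₀ h₁ : X × ℝ → X →L[ℝ] X →L[ℝ] ℝ} {x : X} {c : ℝ}

/-- A convex combination of two negative numbers, with an end point of `[0, 1]` treated separately
to keep the inequality strict. -/
theorem bend_neg {ξ : X} (hξ₀ : fderiv ℝ h₀ (x, 0) (0, 1) ξ ξ < 0)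
    (hξ₁ : fderiv ℝ h₁ (x, 0) (0, 1) ξ ξ < 0) {s : ℝ} (hs : s ∈ Icc (0 : ℝ) 1) :
    bend h₀ h₁ ξ x s < 0 := by
  have e : bend h₀ h₁ ξ x s = 1 / 2 * ((1 - s) * fderiv ℝ h₀ (x, 0) (0, 1) ξ ξ
    + s * fderiv ℝ h₁ (x, 0) (0, 1) ξ ξ) := by simp [bend, segDeriv]
  rw [e]
  have h1 := mul_le_mul_of_nonneg_left hξ₀.le (sub_nonneg.2 hs.2)
  have h2 := mul_le_mul_of_nonneg_left hξ₁.le hs.1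
  rcases hs.1.eq_or_lt with h | h
  · subst h; nlinarith
  · nlinarith [mul_lt_mul_of_pos_left hξ₁ h]

theorem contDiffAt_picPos_pic (H : NormalMetrics h₀ h₁ x c) (ξ : X) (J : ℕ) {s t : ℝ}
    (hs : s ∈ Icc (0 : ℝ) 1) (ht : t ∈ Icc (0 : ℝ) 1) :
    ContDiffAt ℝ 2 (picPos (pic h₀ h₁ ξ J)) (((x, 0), s), t) :=
  (jetBound_picPos (ι := Unit) (l := 2) (S := fun _ => pic h₀ h₁ ξ J)
    (r := fun _ => (((x, 0), s), t)) ⟨_, norm_nonneg _, fun _ => le_rfl⟩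
    (jetBound_single (contDiffAt_pic H ξ J hs ht))).contDiffAt ()

/-- Regularity, position and the sign of the normal acceleration are open conditions that hold at `ε
= 0` on the compact square of the `(s, t)`, hence for small `ε`. The residual is the discrepancy of
order `ε^M` from `unifO_picAcc_pic`, with a further `ε` from the scaling. The iterate `2M + 1` has
the acceleration prescribed by the iterate `2M`, which explains the two indices. -/
theorem exists_approxGeodesics (H : NormalMetrics h₀ h₁ x c) {ξ : X}
    (hξ₀ : fderiv ℝ h₀ (x, 0) (0, 1) ξ ξ < 0) (hξ₁ : fderiv ℝ h₁ (x, 0) (0, 1) ξ ξ < 0) (M : ℕ)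
    {W : Set (X × ℝ)} (hW : W ∈ 𝓝 (x, (0 : ℝ))) :
    ∃ C, 0 ≤ C ∧ ∀ᶠ ε in 𝓝[>] (0 : ℝ), ApproxGeodesics h₀ h₁ x ξ W C M (pic h₀ h₁ ξ (2 * M + 1))
      (picAcc h₀ h₁ (pic h₀ h₁ ξ (2 * M))) ε := by
  have hX : CompleteSpace X := FiniteDimensional.complete ℝ X
  set S := pic h₀ h₁ ξ (2 * M + 1) with hS
  set A := picAcc h₀ h₁ (pic h₀ h₁ ξ (2 * M)) with hA
  have hSA : S = curveOfAcc ξ A := rfl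
  have zero_of : ∀ {r : Par X × ℝ}, r.2 = 0 → (S r).1 = 0 := fun {r} hr => by
    rw [hSA, show r = (r.1, 0) from Prod.ext rfl hr, curveOfAcc_zero]
  have one_of : ∀ {r : Par X × ℝ}, r.2 = 1 → (S r).1 = (ξ, 0) := fun {r} hr => by
    rw [hSA, show r = (r.1, 1) from Prod.ext rfl hr, curveOfAcc_one]
  -- regularity
  have E1 := eventually_forall_Icc_Icc (x := x) (P := fun r => ∀ᶠ r' in 𝓝 r,
      ContDiffAt ℝ 2 S r' ∧ ContinuousAt A r' ∧ HasDerivAt (fun τ => (S (r'.1, τ)).1) (S r').2 r'.2 ∧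
      HasDerivAt (fun τ => (S (r'.1, τ)).2) (A r') r'.2) (by
    intro s hs t ht
    refine eventually_eventually_nhds.2 ?_
    filter_upwards [(contDiffAt_pic H ξ (2 * M + 1) hs ht).eventually (by simp),
      eventually_continuousAt_picAcc H ξ (2 * M) s hs t ht,
      hasDerivAt_curveOfAcc (ξ := ξ) (eventually_continuousAt_picAcc H ξ (2 * M) s hs) t ht]
      with r h1 h2 h3
    exact ⟨h1, h2, h3.1, h3.2⟩)
  -- position
  have good : ∀ᶠ p in 𝓝 (x, (0 : ℝ)), p ∈ W ∧ DifferentiableAt ℝ h₀ p ∧ DifferentiableAt ℝ h₁ p ∧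
      (∀ v, c / 2 * ‖v‖ ^ 2 ≤ h₀ p v v) ∧ (∀ v, c / 2 * ‖v‖ ^ 2 ≤ h₁ p v v) ∧
      ‖h₀ p‖ ≤ ‖h₀ (x, 0)‖ + 1 ∧ ‖h₁ p‖ ≤ ‖h₁ (x, 0)‖ + 1 := by
    have n0 := H.smooth₀.continuousAt.norm.eventually_lt_const (lt_add_one ‖h₀ (x, 0)‖)
    have n1 := H.smooth₁.continuousAt.norm.eventually_lt_const (lt_add_one ‖h₁ (x, 0)‖)
    filter_upwards [hW, H.smooth₀.eventually (by simp), H.smooth₁.eventually (by simp),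
      eventually_elliptic H.smooth₀.continuousAt H.pos H.elliptic₀,
      eventually_elliptic H.smooth₁.continuousAt H.pos H.elliptic₁, n0, n1] with p a1 a2 a3 a4 a5 a6 a7
    exact ⟨a1, a2.differentiableAt (by simp), a3.differentiableAt (by simp), a4, a5, a6.le, a7.le⟩
  have E2 := eventually_forall_Icc_Icc (x := x) (P := fun r => picPos S r ∈ W ∧
      DifferentiableAt ℝ h₀ (picPos S r) ∧ DifferentiableAt ℝ h₁ (picPos S r) ∧
      (∀ v, c / 2 * ‖v‖ ^ 2 ≤ h₀ (picPos S r) v v) ∧ (∀ v, c / 2 * ‖v‖ ^ 2 ≤ h₁ (picPos S r) v v) ∧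
      ‖h₀ (picPos S r)‖ ≤ ‖h₀ (x, 0)‖ + 1 ∧ ‖h₁ (picPos S r)‖ ≤ ‖h₁ (x, 0)‖ + 1) (by
    intro s hs t ht
    have h1 := (contDiffAt_picPos_pic H ξ (2 * M + 1) hs ht).continuousAt
    rw [ContinuousAt, picPos_zero] at h1
    exact h1.eventually good)
  -- the normal acceleration
  have E3 := eventually_forall_Icc_Icc (x := x) (P := fun r => (A r).2 < 0) (by
    intro s hs t ht
    have h1 := (contDiffAt_picAcc_pic H ξ (2 * M) hs ht).continuousAt.snd
    refine h1.eventually_lt_const ?_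
    change (picAcc h₀ h₁ (pic h₀ h₁ ξ (2 * M)) (((x, 0), s), t)).2 < 0
    rw [picAcc_at_zero h₀ h₁ (pic_snd_fst_at_zero h₀ h₁ ξ x (2 * M) s t)]
    exact bend_neg hξ₀ hξ₁ hs)
  obtain ⟨C₁, hC₁, E4⟩ := unifO_picAcc_pic H ξ M
  obtain ⟨C₂, hC₂, E5⟩ := unifO_zero_of_continuousAt (x := x) (u := fderiv ℝ (picPos S))
    fun s hs t ht => (contDiffAt_picPos_pic H ξ (2 * M + 1) hs ht).continuousAt_fderiv (by simp)
  obtain ⟨C₃, hC₃, E6⟩ := unifO_zero_pic H ξ (2 * M + 1)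
  set N := ‖h₀ (x, 0)‖ + ‖h₁ (x, 0)‖ + 2 with hN
  have hN0 : 0 ≤ N := by positivity
  refine ⟨(N + 1) * C₁ + C₂ + C₃, by positivity, ?_⟩
  filter_upwards [nhdsWithin_le_nhds E1, nhdsWithin_le_nhds E2, nhdsWithin_le_nhds E3, E4, E5, E6,
    eventually_small zero_lt_one] with ε e1 e2 e3 e4 e5 e6 hε
  refine ⟨e1, fun s hs t ht => (e2 s hs t ht).1, fun s hs t ht => ?_, fun s hs t ht => ?_,
    fun s hs t ht w => ?_, fun s hs t ht => ?_, fun s => ?_, fun s => ?_⟩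
  · have h1 : ∀ τ ∈ Icc (0 : ℝ) 1, HasDerivAt (fun τ => (S (((x, ε), s), τ)).1.2)
        (S (((x, ε), s), τ)).2.2 τ := fun τ hτ =>
      (ContinuousLinearMap.snd ℝ X ℝ).hasFDerivAt.comp_hasDerivAt τ (e1 s hs τ hτ).self_of_nhds.2.2.1
    have h2 : ∀ τ ∈ Icc (0 : ℝ) 1, HasDerivAt (fun τ => (S (((x, ε), s), τ)).2.2)
        (A (((x, ε), s), τ)).2 τ := fun τ hτ =>
      (ContinuousLinearMap.snd ℝ X ℝ).hasFDerivAt.comp_hasDerivAt τ (e1 s hs τ hτ).self_of_nhds.2.2.2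
    have h3 := nonneg_of_concave h1 h2 (fun τ hτ => (e3 s hs τ hτ).le)
      (by rw [zero_of rfl]; rfl) (by rw [one_of rfl]) ht
    exact mul_nonneg (sq_nonneg _) h3
  · have h1 := e6 s hs t ht
    rw [pow_zero, mul_one] at h1
    have h2 := (norm_snd_le _).trans h1
    have h3 : ‖picVel S (((x, ε), s), t)‖ ≤ C₃ * ε := by
      rw [picVel, Prod.norm_mk]
      refine max_le ?_ ?_
      · rw [norm_smul, Real.norm_of_nonneg hε.1.le, mul_comm]
        exact mul_le_mul_of_nonneg_right ((norm_fst_le _).trans h2) hε.1.le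
      · rw [norm_mul, norm_pow, Real.norm_of_nonneg hε.1.le]
        have h4 := (norm_snd_le _).trans h2
        have : ε ^ 2 ≤ ε := by nlinarith [hε.1, hε.2]
        calc _ ≤ ε * C₃ := mul_le_mul this h4 (norm_nonneg _) hε.1.le
          _ = _ := mul_comm _ _
    exact h3.trans (mul_le_mul_of_nonneg_right (le_add_of_nonneg_left (by positivity)) hε.1.le)
  · obtain ⟨-, d0, d1, el0, el1, n0, n1⟩ := e2 s hs t ht
    have h1 := geodesicResidual_eq (A := A) d0 d1 (half_pos H.pos) el0 el1 hs w
    have h2 := e4 s hs t ht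
    set r : Par X × ℝ := (((x, ε), s), t) with hr
    have h1' : geodesicResidual (prodMetric (segMetric h₀ h₁ s)) (picPos S r) (picVel S r)
      (scaleAcc A r) w = ε * segMetric h₀ h₁ s (picPos S r) (A r - picAcc h₀ h₁ S r).1 w.1
        + ε ^ 2 * (A r - picAcc h₀ h₁ S r).2 * w.2 := h1
    rw [h1']
    have hseg : ‖segMetric h₀ h₁ s (picPos S r)‖ ≤ N := by
      rw [segMetric]
      refine (norm_add_le _ _).trans ?_
      rw [norm_smul, norm_smul, Real.norm_of_nonneg hs.1, Real.norm_of_nonneg (sub_nonneg.2 hs.2)]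
      have := norm_nonneg (h₀ (picPos S r))
      have := norm_nonneg (h₁ (picPos S r))
      nlinarith [hs.1, hs.2]
    have hT : |segMetric h₀ h₁ s (picPos S r) (A r - picAcc h₀ h₁ S r).1 w.1| ≤
        N * (C₁ * ε ^ M) * ‖w‖ := by
      refine ((segMetric h₀ h₁ s (picPos S r)).le_opNorm₂ _ _).trans ?_
      exact mul_le_mul (mul_le_mul hseg ((norm_fst_le _).trans h2) (norm_nonneg _) hN0)
        (norm_fst_le _) (norm_nonneg _) (by have := hε.1; positivity)
    have hT2 : |(A r - picAcc h₀ h₁ S r).2 * w.2| ≤ (C₁ * ε ^ M) * ‖w‖ := by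
      rw [abs_mul]
      exact mul_le_mul ((norm_snd_le _).trans h2) (by rw [← Real.norm_eq_abs]; exact norm_snd_le w) (abs_nonneg _)
        (by have := hε.1; positivity)
    have hε2 : ε ^ 2 ≤ ε := by nlinarith [hε.1, hε.2]
    calc _ ≤ ε * (N * (C₁ * ε ^ M) * ‖w‖) + ε * ((C₁ * ε ^ M) * ‖w‖) := by
          refine (abs_add_le _ _).trans (add_le_add ?_ ?_)
          · rw [abs_mul, abs_of_pos hε.1]
            exact mul_le_mul_of_nonneg_left hT hε.1.le
          · rw [mul_assoc, abs_mul, abs_of_nonneg (sq_nonneg ε)]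
            exact mul_le_mul hε2 hT2 (abs_nonneg _) hε.1.le
      _ = ((N + 1) * C₁) * ε ^ (M + 1) * ‖w‖ := by ring
      _ ≤ _ := by
          have := hε.1
          gcongr
          linarith
  · have := e5 s hs t ht
    rw [pow_zero, mul_one] at this
    refine this.trans ?_
    nlinarith [mul_nonneg (by linarith : 0 ≤ N + 1) hC₁]
  · simp [picPos, zero_of]
  · simp [picPos, one_of]

/-- `ρ` is, near `x`, the square of the distance with respect to the metric `h + (dxⁿ)²` on the half
space `xⁿ ≥ 0`, as expressed by the energies of curves. -/
structure IsLocalDistSq (h : X × ℝ → X →L[ℝ] X →L[ℝ] ℝ) (ρ : X → X → ℝ) (x : X) : Prop where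
  upper : ∃ W ∈ 𝓝 (x, (0 : ℝ)), ∀ (y : X) (γ : ℝ → X × ℝ), ContDiffOn ℝ 1 γ (Icc 0 1) →
    (∀ t ∈ Icc (0 : ℝ) 1, γ t ∈ W ∧ 0 ≤ (γ t).2) → γ 0 = (x, 0) → γ 1 = (y, 0) →
    ρ x y ≤ energy (prodMetric h) γ
  lower : ∀ W ∈ 𝓝 (x, (0 : ℝ)), ∃ b > 0, ∀ᶠ y in 𝓝 x, ∀ B < b,
    (∀ γ : ℝ → X × ℝ, ContDiffOn ℝ 1 γ (Icc 0 1) → (∀ t ∈ Icc (0 : ℝ) 1, γ t ∈ W ∧ 0 ≤ (γ t).2) →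
      γ 0 = (x, 0) → γ 1 = (y, 0) → B ≤ energy (prodMetric h) γ) → B ≤ ρ x y

theorem ApproxGeodesics.contDiffOn {W : Set (X × ℝ)} {C : ℝ} {M : ℕ} {ξ : X}
    {S : Par X × ℝ → (X × ℝ) × (X × ℝ)} {A : Par X × ℝ → X × ℝ} {ε : ℝ}
    (G : ApproxGeodesics h₀ h₁ x ξ W C M S A ε) {s : ℝ} (hs : s ∈ Icc (0 : ℝ) 1) :
    ContDiffOn ℝ 1 (fun t => picPos S (((x, ε), s), t)) (Icc 0 1) := by
  intro t ht
  have h1 := (G.regular s hs t ht).self_of_nhds.1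
  have h2 : ContDiffAt ℝ 2 (picPos S) (((x, ε), s), t) :=
    (jetBound_picPos (ι := Unit) (l := 2) (S := fun _ => S) (r := fun _ => (((x, ε), s), t))
      ⟨_, norm_nonneg _, fun _ => le_rfl⟩ (jetBound_single h1)).contDiffAt ()
  have h3 : ContDiffAt ℝ 2 (fun t : ℝ => (((x, ε), s), t)) t := contDiffAt_const.prodMk contDiffAt_id
  exact ((h2.comp t h3).of_le (by norm_num)).contDiffWithinAt

theorem ApproxGeodesics.hasDerivAt {W : Set (X × ℝ)} {C : ℝ} {M : ℕ} {ξ : X}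
    {S : Par X × ℝ → (X × ℝ) × (X × ℝ)} {A : Par X × ℝ → X × ℝ} {ε : ℝ}
    (G : ApproxGeodesics h₀ h₁ x ξ W C M S A ε) {s : ℝ} (hs : s ∈ Icc (0 : ℝ) 1) {t : ℝ}
    (ht : t ∈ Icc (0 : ℝ) 1) :
    HasDerivAt (fun τ => picPos S (((x, ε), s), τ)) (picVel S (((x, ε), s), t)) t :=
  hasDerivAt_picPos (G.regular s hs t ht).self_of_nhds.2.2.1

theorem ApproxGeodesics.energy_le {W : Set (X × ℝ)} {C N : ℝ} {M : ℕ} {ξ : X}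
    {S : Par X × ℝ → (X × ℝ) × (X × ℝ)} {A : Par X × ℝ → X × ℝ} {ε : ℝ}
    (G : ApproxGeodesics h₀ h₁ x ξ W C M S A ε) {s : ℝ} (hs : s ∈ Icc (0 : ℝ) 1)
    {H : X × ℝ → (X × ℝ) →L[ℝ] (X × ℝ) →L[ℝ] ℝ} (hN : 0 ≤ N) (hC : 0 ≤ C) (hε : 0 ≤ ε)
    (hH : ∀ p ∈ W, ‖H p‖ ≤ N) :
    energy H (fun t => picPos S (((x, ε), s), t)) ≤ N * (C * ε) ^ 2 := by
  rw [energy_eq_integral fun t ht => G.hasDerivAt hs ht]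
  refine (Real.le_norm_self _).trans ((intervalIntegral.norm_integral_le_of_norm_le_const
    (C := N * (C * ε) ^ 2) fun t ht => ?_).trans
    (by rw [sub_zero, abs_one, mul_one]))
  rw [uIoc_of_le zero_le_one] at ht
  have ht' := Ioc_subset_Icc_self ht
  refine ((H _).le_opNorm₂ _ _).trans ?_
  rw [pow_two, ← mul_assoc]
  have := G.vel s hs t ht'
  have := hH _ (G.mem s hs t ht')
  gcongr

theorem fderiv_slice_norm_le {Y : Type} [NormedAddCommGroup Y] [NormedSpace ℝ Y]
    {f : Par X × ℝ → Y} {x : X} {ε s t C : ℝ}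
    (hf : DifferentiableAt ℝ f (((x, ε), s), t)) (hC : ‖fderiv ℝ f (((x, ε), s), t)‖ ≤ C) :
    ‖fderiv ℝ (fun q : ℝ × ℝ => f (((x, ε), q.1), q.2)) (s, t) (1, 0)‖ ≤ C := by
  have h1 : HasFDerivAt (fun q : ℝ × ℝ => (((x, ε), q.1), q.2))
      (((0 : ℝ × ℝ →L[ℝ] X × ℝ).prod (ContinuousLinearMap.fst ℝ ℝ ℝ)).prod
        (ContinuousLinearMap.snd ℝ ℝ ℝ)) (s, t) :=
    ((hasFDerivAt_const _ _).prodMk hasFDerivAt_fst).prodMk hasFDerivAt_snd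
  have h2 := hf.hasFDerivAt.comp (f := fun q : ℝ × ℝ => (((x, ε), q.1), q.2)) (s, t) h1
  have h3 : fderiv ℝ (fun q : ℝ × ℝ => f (((x, ε), q.1), q.2)) (s, t) = _ := h2.fderiv
  rw [h3, ContinuousLinearMap.comp_apply]
  refine (ContinuousLinearMap.le_opNorm _ _).trans ?_
  have : ‖(((0 : ℝ × ℝ →L[ℝ] X × ℝ).prod (ContinuousLinearMap.fst ℝ ℝ ℝ)).prod
        (ContinuousLinearMap.snd ℝ ℝ ℝ)) ((1 : ℝ), (0 : ℝ))‖ = 1 := by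
    simp [Prod.norm_def]
  rw [this, mul_one]
  exact hC

/-- From above, each squared distance is at most the energy of the approximate geodesic at `s = 0`
or `s = 1`. From below, convexity makes that energy minimal up to `O(ε^(M+1))`. The difference of
the two energies is computed along the segment of metrics with the same accuracy. The normal
velocities drop out of the integrand, because the two metrics share the term `(dxⁿ)²`. -/
theorem distSq_sub_distSq_expansion (H : NormalMetrics h₀ h₁ x c) {ξ : X}
    (hξ₀ : fderiv ℝ h₀ (x, 0) (0, 1) ξ ξ < 0) (hξ₁ : fderiv ℝ h₁ (x, 0) (0, 1) ξ ξ < 0) (M : ℕ)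
    {ρ₀ ρ₁ : X → X → ℝ} (L₀ : IsLocalDistSq h₀ ρ₀ x) (L₁ : IsLocalDistSq h₁ ρ₁ x) :
    ∃ C, 0 ≤ C ∧ ∀ᶠ ε in 𝓝[>] (0 : ℝ), |ρ₁ x (x + ε • ξ) - ρ₀ x (x + ε • ξ) -
      ε ^ 2 * ∫ s in (0 : ℝ)..1, ∫ t in (0 : ℝ)..1,
        (h₁ (picPos (pic h₀ h₁ ξ (2 * M + 1)) (((x, ε), s), t)) -
          h₀ (picPos (pic h₀ h₁ ξ (2 * M + 1)) (((x, ε), s), t)))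
          (pic h₀ h₁ ξ (2 * M + 1) (((x, ε), s), t)).2.1
          (pic h₀ h₁ ξ (2 * M + 1) (((x, ε), s), t)).2.1| ≤ C * ε ^ (M + 1) := by
  obtain ⟨W₀, hW₀, up₀⟩ := L₀.upper
  obtain ⟨W₁, hW₁, up₁⟩ := L₁.upper
  -- the neighbourhood on which the metrics are controlled
  obtain ⟨r₀, hr₀, K₀, hK₀, q₀⟩ := exists_quadratic_bound
    (contDiffAt_prodMetric (H.smooth₀.of_le (by norm_num : (2 : WithTop ℕ∞) ≤ 3)))
  obtain ⟨r₁, hr₁, K₁, hK₁, q₁⟩ := exists_quadratic_bound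
    (contDiffAt_prodMetric (H.smooth₁.of_le (by norm_num : (2 : WithTop ℕ∞) ≤ 3)))
  set N₀ := ‖prodMetric h₀ (x, 0)‖ + 1 with hN₀
  set N₁ := ‖prodMetric h₁ (x, 0)‖ + 1 with hN₁
  have hW : ∀ᶠ p in 𝓝 (x, (0 : ℝ)), p ∈ W₀ ∧ p ∈ W₁ ∧ p ∈ Metric.ball (x, (0 : ℝ)) r₀ ∧
      p ∈ Metric.ball (x, (0 : ℝ)) r₁ ∧ p ∈ Metric.ball (x, (0 : ℝ)) 1 ∧
      ContDiffAt ℝ 3 h₀ p ∧ ContDiffAt ℝ 3 h₁ p ∧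
      (∀ v w, h₀ p v w = h₀ p w v) ∧ (∀ v w, h₁ p v w = h₁ p w v) ∧
      (∀ v, c / 2 * ‖v‖ ^ 2 ≤ h₀ p v v) ∧ (∀ v, c / 2 * ‖v‖ ^ 2 ≤ h₁ p v v) ∧
      ‖prodMetric h₀ p‖ ≤ N₀ ∧ ‖prodMetric h₁ p‖ ≤ N₁ := by
    filter_upwards [hW₀, hW₁, Metric.ball_mem_nhds (x, (0 : ℝ)) hr₀, Metric.ball_mem_nhds (x, (0 : ℝ)) hr₁,
      Metric.ball_mem_nhds (x, (0 : ℝ)) one_pos, H.smooth₀.eventually (by simp),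
      H.smooth₁.eventually (by simp), H.symm₀, H.symm₁,
      eventually_elliptic H.smooth₀.continuousAt H.pos H.elliptic₀,
      eventually_elliptic H.smooth₁.continuousAt H.pos H.elliptic₁,
      (contDiffAt_prodMetric H.smooth₀).continuousAt.norm.eventually_lt_const (lt_add_one _),
      (contDiffAt_prodMetric H.smooth₁).continuousAt.norm.eventually_lt_const (lt_add_one _)]
      with p a1 a2 a3 a4 a5 a6 a7 a8 a9 a10 a11 a12 a13
    exact ⟨a1, a2, a3, a4, a5, a6, a7, a8, a9, a10, a11, a12.le, a13.le⟩
  set W := {p | p ∈ W₀ ∧ p ∈ W₁ ∧ p ∈ Metric.ball (x, (0 : ℝ)) r₀ ∧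
      p ∈ Metric.ball (x, (0 : ℝ)) r₁ ∧ p ∈ Metric.ball (x, (0 : ℝ)) 1 ∧
      ContDiffAt ℝ 3 h₀ p ∧ ContDiffAt ℝ 3 h₁ p ∧
      (∀ v w, h₀ p v w = h₀ p w v) ∧ (∀ v w, h₁ p v w = h₁ p w v) ∧
      (∀ v, c / 2 * ‖v‖ ^ 2 ≤ h₀ p v v) ∧ (∀ v, c / 2 * ‖v‖ ^ 2 ≤ h₁ p v v) ∧
      ‖prodMetric h₀ p‖ ≤ N₀ ∧ ‖prodMetric h₁ p‖ ≤ N₁} with hWdef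
  have hWn : W ∈ 𝓝 (x, (0 : ℝ)) := hW
  obtain ⟨C, hC, hG⟩ := exists_approxGeodesics H hξ₀ hξ₁ M hWn
  obtain ⟨b₀, hb₀, lo₀⟩ := L₀.lower W hWn
  obtain ⟨b₁, hb₁, lo₁⟩ := L₁.lower W hWn
  have hy : Tendsto (fun ε : ℝ => x + ε • ξ) (𝓝[>] 0) (𝓝 x) := by
    have : ContinuousAt (fun ε : ℝ => x + ε • ξ) 0 := by fun_prop
    simpa using this.tendsto.mono_left nhdsWithin_le_nhds
  have hsmall : ∀ {f : ℝ → ℝ} {b : ℝ}, Continuous f → f 0 < b → ∀ᶠ ε in 𝓝[>] (0 : ℝ), f ε < b :=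
    fun hf hb => nhdsWithin_le_nhds (hf.continuousAt.eventually_lt_const hb)
  set a := min (c / 2) 1 with ha
  have ha0 : 0 < a := lt_min (half_pos H.pos) one_pos
  have hc2 : 0 ≤ c / 2 := (half_pos H.pos).le
  set S := pic h₀ h₁ ξ (2 * M + 1) with hS
  -- the energies of the approximate geodesics are almost minimal
  have minim : ∀ {h : X × ℝ → X →L[ℝ] X →L[ℝ] ℝ} {K s ε : ℝ}, 0 ≤ K → 0 < ε →
      s ∈ Icc (0 : ℝ) 1 → segMetric h₀ h₁ s = h →
      ApproxGeodesics h₀ h₁ x ξ W C M S (picAcc h₀ h₁ (pic h₀ h₁ ξ (2 * M))) ε →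
      (∀ p ∈ W, ContDiffAt ℝ 3 h p ∧ (∀ v w, h p v w = h p w v) ∧ (∀ v, c / 2 * ‖v‖ ^ 2 ≤ h p v v)) →
      (∀ p ∈ W, ∀ q ∈ W, ‖prodMetric h q - prodMetric h p‖ ≤ K * ‖q - p‖ ∧
        ‖prodMetric h q - prodMetric h p - fderiv ℝ (prodMetric h) p (q - p)‖ ≤ K * ‖q - p‖ ^ 2) →
      2 * K * (C * ε) + K * (C * ε) ^ 2 < a →
      ∀ γ : ℝ → X × ℝ, ContDiffOn ℝ 1 γ (Icc 0 1) → (∀ t ∈ Icc (0 : ℝ) 1, γ t ∈ W ∧ 0 ≤ (γ t).2) →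
      γ 0 = (x, 0) → γ 1 = (x + ε • ξ, 0) →
      energy (prodMetric h) (fun t => picPos S (((x, ε), s), t)) - 4 * C * ε ^ (M + 1) ≤
        energy (prodMetric h) γ := by
    intro h K s ε hK hε hs hh G hreg hq hsm γ hγ hγW hγ0 hγ1
    -- The displacement bound is `d = 2` because `W` lies in the unit ball about the base point.
    have key := energy_ge_of_approx_geodesic (G := prodMetric h) (c := γ)
      (γ := fun t => picPos S (((x, ε), s), t)) (γ' := fun t => picVel S (((x, ε), s), t))
      (γ'' := fun t => scaleAcc (picAcc h₀ h₁ (pic h₀ h₁ ξ (2 * M))) (((x, ε), s), t))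
      (B := W) (K := K) (a := a) (r := C * ε) (e := C * ε ^ (M + 1)) (d := 2)
      hK (by positivity) (by positivity)
      (fun p hp => (contDiffAt_prodMetric (hreg p hp).1).of_le (by norm_num))
      (fun p hp v w => by rw [prodMetric_apply, prodMetric_apply, (hreg p hp).2.1, mul_comm v.2])
      (fun p hp v => elliptic_prodMetric hc2 (hreg p hp).2.2 v)
      (fun p hp q hq' => (hq p hp q hq').1) (fun p hp q hq' => (hq p hp q hq').2)
      (fun t ht => G.hasDerivAt hs ht)
      (fun t ht => hasDerivAt_picVel (G.regular s hs t ht).self_of_nhds.2.2.2)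
      (fun t ht => by
        have h1 : ContinuousAt (fun τ => picAcc h₀ h₁ (pic h₀ h₁ ξ (2 * M)) (((x, ε), s), τ)) t :=
          (G.regular s hs t ht).self_of_nhds.2.1.comp (f := fun τ : ℝ => (((x, ε), s), τ)) (by fun_prop)
        exact ((h1.fst.const_smul ε).prodMk (h1.snd.const_mul (ε ^ 2))).continuousWithinAt)
      (fun t ht => G.mem s hs t ht) (fun t ht => G.vel s hs t ht) hsm.le
      (fun t ht w => by have := G.res s hs t ht w; rwa [hh] at this) hγ (fun t ht => (hγW t ht).1)
      (fun t ht => by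
        have h1 := (hγW t ht).1.2.2.2.2.1
        have h2 := (G.mem s hs t ht).2.2.2.2.1
        rw [mem_ball_iff_norm] at h1 h2
        calc ‖γ t - picPos S (((x, ε), s), t)‖ = ‖(γ t - (x, 0)) - (picPos S (((x, ε), s), t) - (x, 0))‖ := by
              congr 1; abel
          _ ≤ 2 := (norm_sub_le _ _).trans (by linarith))
      (by rw [hγ0, G.left_end]) (by rw [hγ1, G.right_end])
    linarith
  have seg0 : segMetric h₀ h₁ 0 = h₀ := by ext1 p; simp [segMetric]
  have seg1 : segMetric h₀ h₁ 1 = h₁ := by ext1 p; simp [segMetric]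
  have I0 : (0 : ℝ) ∈ Icc (0 : ℝ) 1 := by simp
  have I1 : (1 : ℝ) ∈ Icc (0 : ℝ) 1 := by simp
  -- `2 C²` is the error along the family, with residual `C ε^(M+1)` and variation at most `C`. Each
  -- `4 C` is the defect of minimality for one of the two metrics.
  refine ⟨2 * (C * C) + 4 * C + 4 * C, by positivity, ?_⟩
  filter_upwards [hG, eventually_small zero_lt_one, hy.eventually lo₀, hy.eventually lo₁,
    hsmall (f := fun ε => N₀ * (C * ε) ^ 2) (by fun_prop) (by simpa using hb₀),
    hsmall (f := fun ε => N₁ * (C * ε) ^ 2) (by fun_prop) (by simpa using hb₁),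
    hsmall (f := fun ε => 2 * K₀ * (C * ε) + K₀ * (C * ε) ^ 2) (by fun_prop) (by simpa using ha0),
    hsmall (f := fun ε => 2 * K₁ * (C * ε) + K₁ * (C * ε) ^ 2) (by fun_prop) (by simpa using ha0)]
    with ε G hε l0 l1 s0 s1 t0 t1
  have hεM : 0 ≤ C * ε ^ (M + 1) := by have := hε.1; positivity
  -- the distance of `h₀`
  have up0 : ρ₀ x (x + ε • ξ) ≤ energy (prodMetric h₀) (fun t => picPos S (((x, ε), 0), t)) :=
    up₀ _ _ (G.contDiffOn I0) (fun t ht => ⟨(G.mem 0 I0 t ht).1, G.nonneg 0 I0 t ht⟩)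
      (G.left_end 0) (G.right_end 0)
  have up1 : ρ₁ x (x + ε • ξ) ≤ energy (prodMetric h₁) (fun t => picPos S (((x, ε), 1), t)) :=
    up₁ _ _ (G.contDiffOn I1) (fun t ht => ⟨(G.mem 1 I1 t ht).2.1, G.nonneg 1 I1 t ht⟩)
      (G.left_end 1) (G.right_end 1)
  have low0 : energy (prodMetric h₀) (fun t => picPos S (((x, ε), 0), t)) - 4 * C * ε ^ (M + 1) ≤
      ρ₀ x (x + ε • ξ) := by
    refine l0 _ ?_ (minim hK₀ hε.1 I0 seg0 G (fun p hp => ⟨hp.2.2.2.2.2.1, hp.2.2.2.2.2.2.2.1,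
      hp.2.2.2.2.2.2.2.2.2.1⟩) (fun p hp q hq => q₀ p hp.2.2.1 q hq.2.2.1) t0)
    have := G.energy_le I0 (H := prodMetric h₀) (N := N₀) (by positivity) hC hε.1.le
      (fun p hp => hp.2.2.2.2.2.2.2.2.2.2.2.1)
    linarith
  have low1 : energy (prodMetric h₁) (fun t => picPos S (((x, ε), 1), t)) - 4 * C * ε ^ (M + 1) ≤
      ρ₁ x (x + ε • ξ) := by
    refine l1 _ ?_ (minim hK₁ hε.1 I1 seg1 G (fun p hp => ⟨hp.2.2.2.2.2.2.1, hp.2.2.2.2.2.2.2.2.1,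
      hp.2.2.2.2.2.2.2.2.2.2.1⟩) (fun p hp q hq => q₁ p hp.2.2.2.1 q hq.2.2.2.1) t1)
    have := G.energy_le I1 (H := prodMetric h₁) (N := N₁) (by positivity) hC hε.1.le
      (fun p hp => hp.2.2.2.2.2.2.2.2.2.2.2.2)
    linarith
  -- the variation of the energy
  have hpos : ∀ s ∈ Icc (0 : ℝ) 1, ∀ t ∈ Icc (0 : ℝ) 1,
      ContDiffAt ℝ 2 (picPos S) (((x, ε), s), t) := fun s hs t ht =>
    (jetBound_picPos (ι := Unit) (l := 2) (S := fun _ => S) (r := fun _ => (((x, ε), s), t))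
      ⟨_, norm_nonneg _, fun _ => le_rfl⟩
      (jetBound_single (G.regular s hs t ht).self_of_nhds.1)).contDiffAt ()
  have hin : ∀ q : ℝ × ℝ, ContDiffAt ℝ 2 (fun q : ℝ × ℝ => (((x, ε), q.1), q.2)) q := fun q =>
    (contDiffAt_const.prodMk contDiffAt_fst).prodMk contDiffAt_snd
  have fam := energy_sub_energy_of_family (G₀ := prodMetric h₀) (G₁ := prodMetric h₁)
    (Γ := fun q => picPos S (((x, ε), q.1), q.2)) (Γ' := fun q => picVel S (((x, ε), q.1), q.2))
    (Γ'' := fun q => scaleAcc (picAcc h₀ h₁ (pic h₀ h₁ ξ (2 * M))) (((x, ε), q.1), q.2))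
    (a := (x, 0)) (b := (x + ε • ξ, 0)) (e := C * ε ^ (M + 1)) (d := C) hεM
    (fun s hs t ht => ContDiffAt.comp (f := fun q : ℝ × ℝ => (((x, ε), q.1), q.2)) (s, t)
      (hpos s hs t ht) (hin (s, t)))
    (fun s hs t ht => by
      have h1 : ContDiffAt ℝ 1 (fun q : ℝ × ℝ => S (((x, ε), q.1), q.2)) (s, t) :=
        (ContDiffAt.comp (f := fun q : ℝ × ℝ => (((x, ε), q.1), q.2)) (s, t)
          (G.regular s hs t ht).self_of_nhds.1 (hin (s, t))).of_le (by norm_num)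
      exact ((contDiffAt_const (c := ε)).smul h1.snd.fst).prodMk
        ((contDiffAt_const (c := ε ^ 2)).mul h1.snd.snd))
    (fun s hs t ht => by
      have h1 : ContinuousAt (fun τ => picAcc h₀ h₁ (pic h₀ h₁ ξ (2 * M)) (((x, ε), s), τ)) t :=
        (G.regular s hs t ht).self_of_nhds.2.1.comp (f := fun τ : ℝ => (((x, ε), s), τ)) (by fun_prop)
      exact ((h1.fst.const_smul ε).prodMk (h1.snd.const_mul (ε ^ 2))).continuousWithinAt)
    (fun s hs t ht => by
      have := (hin (s, t)).continuousAt.eventually (G.regular s hs t ht)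
      filter_upwards [this] with q hq
      exact hasDerivAt_picPos hq.2.2.1)
    (fun s hs t ht => hasDerivAt_picVel (G.regular s hs t ht).self_of_nhds.2.2.2)
    (fun s => G.left_end s) (fun s => G.right_end s)
    (fun s hs t ht => (contDiffAt_prodMetric (G.mem s hs t ht).2.2.2.2.2.1).of_le (by norm_num))
    (fun s hs t ht => (contDiffAt_prodMetric (G.mem s hs t ht).2.2.2.2.2.2.1).of_le (by norm_num))
    (fun s hs t ht v w => by
      have h1 := (G.mem s hs t ht).2.2.2.2.2.2.2.1
      have h2 := (G.mem s hs t ht).2.2.2.2.2.2.2.2.1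
      simp only [prodMetric_apply]
      rw [h1, h2, mul_comm v.2]
      exact ⟨rfl, rfl⟩)
    (fun s hs t ht w => by
      rw [segMetric_prodMetric]
      exact G.res s hs t ht w)
    (fun s hs t ht => fderiv_slice_norm_le ((hpos s hs t ht).differentiableAt (by norm_num))
      (G.variation s hs t ht))
  have hint : (∫ s in (0 : ℝ)..1, ∫ t in (0 : ℝ)..1,
      (prodMetric h₁ (picPos S (((x, ε), s), t)) - prodMetric h₀ (picPos S (((x, ε), s), t)))
        (picVel S (((x, ε), s), t)) (picVel S (((x, ε), s), t))) =
      ε ^ 2 * ∫ s in (0 : ℝ)..1, ∫ t in (0 : ℝ)..1, (h₁ (picPos S (((x, ε), s), t)) -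
        h₀ (picPos S (((x, ε), s), t))) (S (((x, ε), s), t)).2.1 (S (((x, ε), s), t)).2.1 := by
    rw [← intervalIntegral.integral_const_mul]
    congr 1
    ext s
    rw [← intervalIntegral.integral_const_mul]
    congr 1
    ext t
    simp only [sub_apply, prodMetric_apply, picVel, map_smul,
      smul_apply, smul_eq_mul]
    ring
  simp only at fam
  rw [hint] at fam
  rw [abs_le] at fam ⊢
  have e1 : 2 * (C * ε ^ (M + 1) * C) = 2 * (C * C) * ε ^ (M + 1) := by ring
  rw [e1] at fam
  have e2 : (2 * (C * C) + 4 * C + 4 * C) * ε ^ (M + 1) =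
    2 * (C * C) * ε ^ (M + 1) + 4 * C * ε ^ (M + 1) + 4 * C * ε ^ (M + 1) := by ring
  rw [e2]
  constructor <;> linarith [fam.1, fam.2]

end Family

/-! ### Taylor expansions -/

/-- The limit at 0 kills the constant coefficient; then divide by the variable and repeat. -/
theorem coeff_eq_zero_of_isLittleO {P : Polynomial ℝ} {N : ℕ}
    (h : (fun ε => P.eval ε) =o[𝓝[>] (0 : ℝ)] fun ε => ε ^ N) : P.coeff N = 0 := by
  induction N generalizing P with
  | zero =>
    have h1 : Tendsto (fun ε => P.eval ε) (𝓝[>] (0 : ℝ)) (𝓝 0) := by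
      simpa using h
    have h2 : Tendsto (fun ε => P.eval ε) (𝓝[>] (0 : ℝ)) (𝓝 (P.eval 0)) :=
      P.continuous.continuousAt.tendsto.mono_left nhdsWithin_le_nhds
    rw [Polynomial.coeff_zero_eq_eval_zero]
    exact tendsto_nhds_unique h2 h1
  | succ N ih =>
    have h0 : P.coeff 0 = 0 := by
      have h1 : Tendsto (fun ε => P.eval ε) (𝓝[>] (0 : ℝ)) (𝓝 0) := by
        refine h.isBigO.trans_tendsto ?_
        have : ContinuousAt (fun ε : ℝ => ε ^ (N + 1)) 0 := by fun_prop
        simpa using this.tendsto.mono_left nhdsWithin_le_nhds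
      have h2 : Tendsto (fun ε => P.eval ε) (𝓝[>] (0 : ℝ)) (𝓝 (P.eval 0)) :=
        P.continuous.continuousAt.tendsto.mono_left nhdsWithin_le_nhds
      rw [Polynomial.coeff_zero_eq_eval_zero]
      exact tendsto_nhds_unique h2 h1
    have hP : ∀ ε, P.eval ε = ε * P.divX.eval ε := fun ε => by
      conv_lhs => rw [← Polynomial.X_mul_divX_add P, h0]
      simp
    rw [← Polynomial.coeff_divX]
    refine ih (Asymptotics.isLittleO_iff.2 fun δ hδ => ?_)
    filter_upwards [Asymptotics.isLittleO_iff.1 h hδ, self_mem_nhdsWithin] with ε hε hpos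
    have hpos' : 0 < ‖ε‖ := norm_pos_iff.2 (ne_of_gt hpos)
    rw [hP, norm_mul, pow_succ, norm_mul, ← mul_assoc, mul_comm] at hε
    exact le_of_mul_le_mul_right hε hpos'

theorem taylor_isLittleO_zero {f : ℝ → ℝ} {N : ℕ} (hf : ContDiffAt ℝ N f 0) :
    (fun ε => f ε - ∑ j ∈ Finset.range (N + 1), (iteratedDeriv j f 0 / j.factorial) * ε ^ j)
      =o[𝓝[>] (0 : ℝ)] fun ε => ε ^ N := by
  obtain ⟨u, hu, hfu⟩ := hf.contDiffOn le_rfl (by simp)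
  obtain ⟨r, hr, hru⟩ := Metric.mem_nhds_iff.1 hu
  have h1 := taylor_isLittleO (convex_ball (0 : ℝ) r) (Metric.mem_ball_self hr) (hfu.mono hru)
  rw [nhdsWithin_eq_nhds.2 (Metric.ball_mem_nhds _ hr)] at h1
  have h2 := h1.mono (nhdsWithin_le_nhds (s := Ioi 0))
  simp only [sub_zero] at h2
  refine h2.congr_left fun ε => ?_
  rw [taylor_within_apply]
  congr 1
  refine Finset.sum_congr rfl fun j _ => ?_
  rw [iteratedDerivWithin_of_isOpen Metric.isOpen_ball (Metric.mem_ball_self hr), sub_zero,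
    smul_eq_mul]
  ring

section NormalJet

variable {X : Type} [NormedAddCommGroup X] [NormedSpace ℝ X]
  {F : Type} [NormedAddCommGroup F] [NormedSpace ℝ F]

/-- The `i`-th derivative in the direction of the second factor, at `0`. -/
noncomputable def normalJet (f : X × ℝ → F) (i : ℕ) (x : X) : F :=
  iteratedDeriv i (fun t => f (x, t)) 0

theorem normalJet_succ {f : X × ℝ → F} {x : X}
    (h : ∀ᶠ q in 𝓝 (x, (0 : ℝ)), DifferentiableAt ℝ f q) (i : ℕ) :
    ∀ᶠ y in 𝓝 x, normalJet f (i + 1) y = normalJet (fun q => fderiv ℝ f q (0, 1)) i y := by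
  filter_upwards [deriv_slice_eventuallyEq h] with y hy
  rw [normalJet, iteratedDeriv_succ']
  exact hy.iteratedDeriv_eq i

/-- The bound holds for all `p` near `(x, 0)`, with the foot point moving. The remainder vanishes at
`t = 0`, and its normal derivative is the remainder of one order less for the normal derivative of
`f`, so the mean value inequality gives the induction step. -/
theorem normalJet_taylor {f : X × ℝ → F} {x : X} {k : ℕ} (h : ContDiffAt ℝ k f (x, 0)) :
    ∃ C, 0 ≤ C ∧ ∀ᶠ p in 𝓝 (x, (0 : ℝ)),
      ‖f p - ∑ i ∈ Finset.range k, (p.2 ^ i / i.factorial) • normalJet f i p.1‖ ≤ C * |p.2| ^ k := by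
  induction k generalizing f with
  | zero =>
    refine ⟨‖f (x, 0)‖ + 1, by positivity, ?_⟩
    filter_upwards [h.continuousAt.norm.eventually_lt_const (lt_add_one ‖f (x, 0)‖)] with p hp
    simpa using hp.le
  | succ k ih =>
    have hd := eventually_differentiableAt h (by omega)
    have h' : ContDiffAt ℝ k (fun q => fderiv ℝ f q (0, 1)) (x, 0) :=
      (h.fderiv_right (m := k) (by push_cast; exact le_rfl)).clm_apply contDiffAt_const
    obtain ⟨C, hC, hb⟩ := ih h'
    have hj : ∀ᶠ y in 𝓝 x, ∀ i ∈ Finset.range k,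
        normalJet f (i + 1) y = normalJet (fun q => fderiv ℝ f q (0, 1)) i y :=
      (Filter.eventually_all_finset _).2 fun i _ => normalJet_succ hd i
    have hall := hd.and (hb.and (continuousAt_fst.eventually hj))
    obtain ⟨r, hr, hball⟩ := Metric.eventually_nhds_iff_ball.1 hall
    refine ⟨C, hC, Metric.eventually_nhds_iff_ball.2 ⟨r, hr, ?_⟩⟩
    rintro ⟨y, t⟩ hp
    have hmem : ∀ τ, |τ| ≤ |t| → (y, τ) ∈ Metric.ball (x, (0 : ℝ)) r := by
      intro τ hτ
      rw [mem_ball_iff_norm, Prod.mk_sub_mk, Prod.norm_mk, sub_zero, max_lt_iff] at hp ⊢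
      exact ⟨hp.1, lt_of_le_of_lt hτ hp.2⟩
    have hder : ∀ τ ∈ uIcc 0 t, HasDerivWithinAt
        (fun τ => f (y, τ) - ∑ i ∈ Finset.range (k + 1), (τ ^ i / i.factorial) • normalJet f i y)
        (fderiv ℝ f (y, τ) (0, 1) - ∑ i ∈ Finset.range k, (τ ^ i / i.factorial) •
          normalJet (fun q => fderiv ℝ f q (0, 1)) i y) (uIcc 0 t) τ := by
      intro τ hτ
      have hτ' : |τ| ≤ |t| := by simpa using abs_sub_left_of_mem_uIcc hτ
      have hm := hball _ (hmem τ hτ')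
      have d1 : HasDerivAt (fun τ => f (y, τ)) (fderiv ℝ f (y, τ) (0, 1)) τ :=
        hm.1.hasFDerivAt.comp_hasDerivAt (f := fun τ => (y, τ)) τ
          ((hasDerivAt_const τ y).prodMk (hasDerivAt_id τ))
      have d2 : HasDerivAt (fun τ => ∑ i ∈ Finset.range (k + 1),
          (τ ^ i / (i.factorial : ℝ)) • normalJet f i y) (∑ i ∈ Finset.range k, (τ ^ i / i.factorial) •
          normalJet (fun q => fderiv ℝ f q (0, 1)) i y) τ := by
        have d3 : ∀ i ∈ Finset.range (k + 1), HasDerivAt (fun τ => (τ ^ i / (i.factorial : ℝ)) •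
            normalJet f i y) (((i * τ ^ (i - 1)) / (i.factorial : ℝ)) • normalJet f i y) τ :=
          fun i _ => ((hasDerivAt_pow i τ).div_const _).smul_const _
        refine (HasDerivAt.fun_sum d3).congr_deriv ?_
        rw [Finset.sum_range_succ']
        simp only [Nat.cast_zero, zero_mul, zero_div, zero_smul, add_zero]
        refine Finset.sum_congr rfl fun i hi => ?_
        rw [hm.2.2 i hi, Nat.factorial_succ]
        congr 1
        have : ((i + 1 : ℕ) : ℝ) ≠ 0 := by positivity
        have : (i.factorial : ℝ) ≠ 0 := by positivity
        push_cast
        field_simp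
      exact (d1.sub d2).hasDerivWithinAt
    have hle : ∀ τ ∈ uIcc 0 t, ‖fderiv ℝ f (y, τ) (0, 1) - ∑ i ∈ Finset.range k,
        (τ ^ i / (i.factorial : ℝ)) • normalJet (fun q => fderiv ℝ f q (0, 1)) i y‖ ≤ C * |t| ^ k := by
      intro τ hτ
      have hτ' : |τ| ≤ |t| := by simpa using abs_sub_left_of_mem_uIcc hτ
      refine (hball _ (hmem τ hτ')).2.1.trans ?_
      have := abs_nonneg τ
      gcongr
    have := (convex_uIcc 0 t).norm_image_sub_le_of_norm_hasDerivWithin_le hder hle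
      left_mem_uIcc right_mem_uIcc
    have e0 : f (y, 0) - ∑ i ∈ Finset.range (k + 1), ((0 : ℝ) ^ i / (i.factorial : ℝ)) • normalJet f i y
        = 0 := by
      rw [Finset.sum_range_succ']
      simp [normalJet]
    rw [e0, sub_zero, sub_zero, Real.norm_eq_abs, mul_assoc, ← pow_succ] at this
    exact this

theorem jetBound_normalJet {ι : Type*} {l j : ℕ} {u : ι → X × ℝ → F} {p : ι → X} {R : ι → ℝ}
    (hR : ∀ i, 0 ≤ R i) (hp : ∃ C, 0 ≤ C ∧ ∀ i, ‖p i‖ ≤ C)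
    (h : JetBound (l + j) u (fun i => (p i, 0)) R) :
    JetBound l (fun i => normalJet (u i) j) p R := JetBound.iteratedDeriv_slice hR hp h

end NormalJet

/-! ### The terms of the expansion -/

section Psi

variable {X : Type} [NormedAddCommGroup X] [NormedSpace ℝ X]

/-- The contribution of the `i`-th normal derivative of `h₁ - h₀`, as a function of `(x, ε)`. -/
noncomputable def psi (h₀ h₁ : X × ℝ → X →L[ℝ] X →L[ℝ] ℝ) (ξ : X) (J i : ℕ) (q : X × ℝ) : ℝ :=
  ∫ s in (0 : ℝ)..1, ∫ t in (0 : ℝ)..1, (pic h₀ h₁ ξ J ((q, s), t)).1.2 ^ i *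
    normalJet (fun p => h₁ p - h₀ p) i (q.1 + q.2 • (pic h₀ h₁ ξ J ((q, s), t)).1.1)
      (pic h₀ h₁ ξ J ((q, s), t)).2.1 (pic h₀ h₁ ξ J ((q, s), t)).2.1

variable [FiniteDimensional ℝ X] {ι : Type*}

/-- `psi` is linear in the normal derivative of `h₁ - h₀` and inherits its scale `R`; the iterates
enter as bounded factors. At `ε = 0` the normal derivative is taken at `x` itself, so its jets at
`x` suffice. -/
theorem jetBound_psi {l : ℕ} {h₀ h₁ : ι → X × ℝ → X →L[ℝ] X →L[ℝ] ℝ} {x : ι → X} {R : ι → ℝ}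
    (hR : ∀ i, 0 ≤ R i) (hx : ∃ C, 0 ≤ C ∧ ∀ i, ‖x i‖ ≤ C)
    (H₀ : JetBound (l + 1) h₀ (fun i => (x i, 0)) (fun _ => 1))
    (H₁ : JetBound (l + 1) h₁ (fun i => (x i, 0)) (fun _ => 1)) {c : ℝ} (hc : 0 < c)
    (hell₀ : ∀ i v, c * ‖v‖ ^ 2 ≤ h₀ i (x i, 0) v v) (hell₁ : ∀ i v, c * ‖v‖ ^ 2 ≤ h₁ i (x i, 0) v v)
    (ξ : X) (J j : ℕ) (hf : JetBound l (fun i => normalJet (fun p => h₁ i p - h₀ i p) j) x R) :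
    JetBound l (fun i => psi (h₀ i) (h₁ i) ξ J j) (fun i => (x i, 0)) R := by
  let κ := (ι × Icc (0 : ℝ) 1) × Icc (0 : ℝ) 1
  let r : κ → Par X × ℝ := fun k => (((x k.1.1, 0), (k.1.2 : ℝ)), (k.2 : ℝ))
  have one : ∀ k : κ, (0 : ℝ) ≤ 1 := fun _ => zero_le_one
  have hR' : ∀ k : κ, 0 ≤ R k.1.1 := fun k => hR _
  have hS : JetBound l (fun k : κ => pic (h₀ k.1.1) (h₁ k.1.1) ξ J) r (fun _ => 1) :=
    jetBound_pic hx H₀ H₁ hc hell₀ hell₁ ξ J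
  have hr : ∃ C, 0 ≤ C ∧ ∀ k : κ, ‖r k‖ ≤ C :=
    bounded_prodMk (bounded_prodMk (bounded_prodMk (bounded_reindex hx fun k : κ => k.1.1)
      ⟨0, le_rfl, by simp⟩) (bounded_Icc fun k : κ => k.1.2)) (bounded_Icc fun k : κ => k.2)
  have hpos := (jetBound_picPos hr hS).clm_apply (ContinuousLinearMap.fst ℝ X ℝ)
  have hz := (hS.clm_apply (ContinuousLinearMap.fst ℝ (X × ℝ) (X × ℝ))).clm_apply
    (ContinuousLinearMap.snd ℝ X ℝ)
  have hy := (hS.clm_apply (ContinuousLinearMap.snd ℝ (X × ℝ) (X × ℝ))).clm_apply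
    (ContinuousLinearMap.fst ℝ X ℝ)
  have hf' : JetBound l (fun k : κ => normalJet (fun p => h₁ k.1.1 p - h₀ k.1.1 p) j)
      (fun k => (ContinuousLinearMap.fst ℝ X ℝ) (picPos (pic (h₀ k.1.1) (h₁ k.1.1) ξ J) (r k)))
      (fun k => R k.1.1) := by
    have : (fun k : κ => (ContinuousLinearMap.fst ℝ X ℝ)
        (picPos (pic (h₀ k.1.1) (h₁ k.1.1) ξ J) (r k))) = fun k => x k.1.1 := by
      ext1 k; simp [r, picPos_zero]
    rw [this]
    exact hf.reindex fun k : κ => k.1.1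
  have hg := JetBound.mul hR' (hz.pow j) (JetBound.clm_bilin hR' (JetBound.clm_bilin hR'
    (JetBound.comp hR' hf' hpos) hy) hy)
  let u : ι → Par X × ℝ → ℝ := fun i r => (pic (h₀ i) (h₁ i) ξ J r).1.2 ^ j *
    normalJet (fun p => h₁ i p - h₀ i p) j (r.1.1.1 + r.1.1.2 • (pic (h₀ i) (h₁ i) ξ J r).1.1)
      (pic (h₀ i) (h₁ i) ξ J r).2.1 (pic (h₀ i) (h₁ i) ξ J r).2.1
  have hu : JetBound l (fun k : κ => u k.1.1) r (fun k => R k.1.1) := hg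
  have h1 := JetBound.integral (ι := ι × Icc (0 : ℝ) 1) (u := fun k => u k.1)
    (p := fun k => ((x k.1, (0 : ℝ)), (k.2 : ℝ))) (R := fun k => R k.1) (fun k => hR _) hu
  exact JetBound.integral (u := fun i y => ∫ t in (0 : ℝ)..1, u i (y, t))
    (p := fun i => (x i, (0 : ℝ))) hR h1

end Psi

/-! ### Comparison of coefficients in the expansion in `ε` -/

section Expansion

/-- A double integral over the unit square depends linearly and continuously on a continuous
integrand. -/
theorem integral_integral_sub_sum_le {α : Type} (I : Finset α) {g : ℝ → ℝ → ℝ} {u : α → ℝ → ℝ → ℝ}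
    (a : α → ℝ) {δ : ℝ}
    (hg : ContinuousOn (fun q : ℝ × ℝ => g q.1 q.2) (Icc 0 1 ×ˢ Icc 0 1))
    (hu : ∀ i ∈ I, ContinuousOn (fun q : ℝ × ℝ => u i q.1 q.2) (Icc 0 1 ×ˢ Icc 0 1))
    (h : ∀ s ∈ Icc (0 : ℝ) 1, ∀ t ∈ Icc (0 : ℝ) 1, |g s t - ∑ i ∈ I, a i * u i s t| ≤ δ) :
    |(∫ s in (0 : ℝ)..1, ∫ t in (0 : ℝ)..1, g s t) -
      ∑ i ∈ I, a i * ∫ s in (0 : ℝ)..1, ∫ t in (0 : ℝ)..1, u i s t| ≤ δ := by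
  have hδ : 0 ≤ δ := (abs_nonneg _).trans (h 0 (by simp) 0 (by simp))
  -- Composing with the projection to `[0, 1]` makes the integrands continuous on the whole plane
  -- without changing the integrals.
  let π : ℝ → ℝ := fun t => (projIcc (0 : ℝ) 1 zero_le_one t : ℝ)
  have hπ : Continuous π := continuous_subtype_val.comp continuous_projIcc
  have hπm : ∀ t, π t ∈ Icc (0 : ℝ) 1 := fun t => (projIcc (0 : ℝ) 1 zero_le_one t).2
  have hπe : ∀ t ∈ Icc (0 : ℝ) 1, π t = t := fun t ht => by simp [π, projIcc_of_mem _ ht]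
  have ext : ∀ v : ℝ → ℝ → ℝ, (∫ s in (0 : ℝ)..1, ∫ t in (0 : ℝ)..1, v s t) =
      ∫ s in (0 : ℝ)..1, ∫ t in (0 : ℝ)..1, v (π s) (π t) := fun v => by
    refine intervalIntegral.integral_congr fun s hs => intervalIntegral.integral_congr fun t ht => ?_
    rw [uIcc_of_le zero_le_one] at hs ht
    simp only [hπe s hs, hπe t ht]
  have cont : ∀ v : ℝ → ℝ → ℝ, ContinuousOn (fun q : ℝ × ℝ => v q.1 q.2) (Icc 0 1 ×ˢ Icc 0 1) →
      Continuous (fun q : ℝ × ℝ => v (π q.1) (π q.2)) := fun v hv =>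
    hv.comp_continuous (f := fun q : ℝ × ℝ => (π q.1, π q.2)) (by fun_prop)
      fun q => ⟨hπm _, hπm _⟩
  have cint : ∀ v : ℝ → ℝ → ℝ, Continuous (fun q : ℝ × ℝ => v (π q.1) (π q.2)) →
      Continuous fun s => ∫ t in (0 : ℝ)..1, v (π s) (π t) := fun v hv =>
    intervalIntegral.continuous_parametric_intervalIntegral_of_continuous' hv 0 1
  have csl : ∀ (v : ℝ → ℝ → ℝ) (s : ℝ), Continuous (fun q : ℝ × ℝ => v (π q.1) (π q.2)) →
      Continuous fun t => v (π s) (π t) := fun v s hv =>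
    hv.comp (Continuous.prodMk_right s)
  have key : (∫ s in (0 : ℝ)..1, ∫ t in (0 : ℝ)..1, g s t) -
      ∑ i ∈ I, a i * ∫ s in (0 : ℝ)..1, ∫ t in (0 : ℝ)..1, u i s t =
      ∫ s in (0 : ℝ)..1, ∫ t in (0 : ℝ)..1, (g (π s) (π t) - ∑ i ∈ I, a i * u i (π s) (π t)) := by
    have e1 : ∀ s, ∫ t in (0 : ℝ)..1, (g (π s) (π t) - ∑ i ∈ I, a i * u i (π s) (π t)) =
        (∫ t in (0 : ℝ)..1, g (π s) (π t)) - ∑ i ∈ I, a i * ∫ t in (0 : ℝ)..1, u i (π s) (π t) := by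
      intro s
      rw [intervalIntegral.integral_sub ((csl g s (cont g hg)).intervalIntegrable _ _)
        ((continuous_finsetSum I fun i hi => (csl (u i) s (cont _ (hu i hi))).const_mul
          (a i)).intervalIntegrable _ _),
        intervalIntegral.integral_finsetSum fun i hi =>
          ((csl (u i) s (cont _ (hu i hi))).const_mul (a i)).intervalIntegrable _ _]
      simp only [intervalIntegral.integral_const_mul]
    simp only [e1]
    rw [intervalIntegral.integral_sub ((cint g (cont g hg)).intervalIntegrable _ _)
      ((continuous_finsetSum I fun i hi => (cint (u i) (cont _ (hu i hi))).const_mul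
        (a i)).intervalIntegrable _ _),
      intervalIntegral.integral_finsetSum fun i hi =>
        ((cint (u i) (cont _ (hu i hi))).const_mul (a i)).intervalIntegrable _ _, ext g]
    simp only [intervalIntegral.integral_const_mul, ext (u _)]
  rw [key, ← Real.norm_eq_abs]
  have b1 : ∀ s, ‖∫ t in (0 : ℝ)..1, (g (π s) (π t) - ∑ i ∈ I, a i * u i (π s) (π t))‖ ≤ δ := fun s => by
    simpa using intervalIntegral.norm_integral_le_of_norm_le_const (a := (0 : ℝ)) (b := 1)
      (f := fun t => g (π s) (π t) - ∑ i ∈ I, a i * u i (π s) (π t)) (C := δ)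
      fun t _ => h _ (hπm s) _ (hπm t)
  simpa using intervalIntegral.norm_integral_le_of_norm_le_const (a := (0 : ℝ)) (b := 1)
    (f := fun s => ∫ t in (0 : ℝ)..1, (g (π s) (π t) - ∑ i ∈ I, a i * u i (π s) (π t))) (C := δ)
    fun s _ => b1 s

theorem isLittleO_of_bound {f : ℝ → ℝ} {N : ℕ} {C : ℝ}
    (h : ∀ᶠ ε in 𝓝[>] (0 : ℝ), |f ε| ≤ C * ε ^ (N + 1)) :
    f =o[𝓝[>] (0 : ℝ)] fun ε => ε ^ N := by
  have h1 : f =O[𝓝[>] (0 : ℝ)] fun ε => ε ^ (N + 1) := by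
    refine Asymptotics.IsBigO.of_bound C ?_
    filter_upwards [h, self_mem_nhdsWithin] with ε hε hpos
    rw [Real.norm_eq_abs, Real.norm_of_nonneg (pow_nonneg (le_of_lt hpos) _)]
    exact hε
  exact h1.trans_isLittleO ((Asymptotics.isLittleO_pow_pow (Nat.lt_succ_self N)).mono nhdsWithin_le_nhds)

/-- Comparison of the coefficients of `ε ^ (2 k + 2)`. -/
theorem coeff_eq_sum_of_expansion {k : ℕ} {δ Φ : ℝ → ℝ} {Ψ : ℕ → ℝ → ℝ}
    (hδ : ContDiffAt ℝ (2 * k + 2 : ℕ) δ 0)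
    (hΨ : ∀ i ∈ Finset.range (k + 1), ContDiffAt ℝ (2 * k - 2 * i : ℕ) (Ψ i) 0) {C₁ C₂ : ℝ}
    (h1 : ∀ᶠ ε in 𝓝[>] (0 : ℝ), |δ ε - ε ^ 2 * Φ ε| ≤ C₁ * ε ^ (2 * k + 3))
    (h2 : ∀ᶠ ε in 𝓝[>] (0 : ℝ), |Φ ε - ∑ i ∈ Finset.range (k + 1), (ε ^ (2 * i) / i.factorial) * Ψ i ε|
      ≤ C₂ * ε ^ (2 * k + 2)) :
    iteratedDeriv (2 * k + 2) δ 0 / (2 * k + 2).factorial = ∑ i ∈ Finset.range (k + 1),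
      (1 / (i.factorial : ℝ)) *
        (iteratedDeriv (2 * k - 2 * i) (Ψ i) 0 / (2 * k - 2 * i).factorial) := by
  let d : ℕ → ℝ := fun j => iteratedDeriv j δ 0 / j.factorial
  let p : ℕ → ℕ → ℝ := fun i j => iteratedDeriv j (Ψ i) 0 / j.factorial
  -- The Taylor polynomial of `δ` minus those of the terms `ε^(2i+2) Ψ i / i!`, each carried exactly
  -- to the total degree `2k + 2`.
  let P : Polynomial ℝ := ∑ j ∈ Finset.range (2 * k + 2 + 1), Polynomial.C (d j) * Polynomial.X ^ j -
    ∑ i ∈ Finset.range (k + 1), ∑ j ∈ Finset.range (2 * k - 2 * i + 1),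
      Polynomial.C (1 / (i.factorial : ℝ) * p i j) * Polynomial.X ^ (2 * i + 2 + j)
  have hP : (fun ε => P.eval ε) =o[𝓝[>] (0 : ℝ)] fun ε => ε ^ (2 * k + 2) := by
    have a1 := taylor_isLittleO_zero hδ
    have a2 := isLittleO_of_bound h1
    have a3 : (fun ε => ε ^ 2 * (Φ ε - ∑ i ∈ Finset.range (k + 1), (ε ^ (2 * i) / i.factorial) * Ψ i ε))
        =o[𝓝[>] (0 : ℝ)] fun ε => ε ^ (2 * k + 2) := by
      refine isLittleO_of_bound (C := C₂) ?_
      filter_upwards [h2, eventually_small zero_lt_one] with ε hε hpos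
      rw [abs_mul, abs_of_nonneg (sq_nonneg ε)]
      calc _ ≤ ε ^ 2 * (C₂ * ε ^ (2 * k + 2)) := mul_le_mul_of_nonneg_left hε (sq_nonneg _)
        _ = ε * (C₂ * ε ^ (2 * k + 2 + 1)) := by ring
        _ ≤ 1 * (C₂ * ε ^ (2 * k + 2 + 1)) := by
            refine mul_le_mul_of_nonneg_right hpos.2 ?_
            have h3 := (abs_nonneg _).trans hε
            have : C₂ * ε ^ (2 * k + 2 + 1) = ε * (C₂ * ε ^ (2 * k + 2)) := by ring
            rw [this]
            exact mul_nonneg hpos.1.le h3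
        _ = _ := one_mul _
    have a4 : ∀ i ∈ Finset.range (k + 1), (fun ε => (1 / (i.factorial : ℝ)) * (ε ^ (2 * i + 2) *
        (Ψ i ε - ∑ j ∈ Finset.range (2 * k - 2 * i + 1), p i j * ε ^ j)))
        =o[𝓝[>] (0 : ℝ)] fun ε => ε ^ (2 * k + 2) := by
      intro i hi
      have b1 := taylor_isLittleO_zero (hΨ i hi)
      have b2 := (Asymptotics.isBigO_refl (fun ε : ℝ => ε ^ (2 * i + 2)) (𝓝[>] 0)).mul_isLittleO b1
      refine (b2.const_mul_left _).congr_right fun ε => ?_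
      rw [← pow_add]
      congr 1
      have := Finset.mem_range.1 hi
      omega
    have a5 := Asymptotics.IsLittleO.sum a4
    refine (((a2.add a3).add a5).sub a1).congr_left fun ε => ?_
    simp only [P, Polynomial.eval_sub, Polynomial.eval_finsetSum, Polynomial.eval_mul,
      Polynomial.eval_C, Polynomial.eval_pow, Polynomial.eval_X]
    have c1 : ∑ i ∈ Finset.range (k + 1), (1 / (i.factorial : ℝ)) * (ε ^ (2 * i + 2) *
        (Ψ i ε - ∑ j ∈ Finset.range (2 * k - 2 * i + 1), p i j * ε ^ j)) =
        ε ^ 2 * (∑ i ∈ Finset.range (k + 1), (ε ^ (2 * i) / i.factorial) * Ψ i ε) -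
        ∑ i ∈ Finset.range (k + 1), ∑ j ∈ Finset.range (2 * k - 2 * i + 1),
          (1 / (i.factorial : ℝ) * p i j) * ε ^ (2 * i + 2 + j) := by
      rw [Finset.mul_sum, ← Finset.sum_sub_distrib]
      refine Finset.sum_congr rfl fun i _ => ?_
      rw [mul_sub, mul_sub, Finset.mul_sum, Finset.mul_sum]
      congr 1
      · ring
      · exact Finset.sum_congr rfl fun j _ => by ring
    rw [Finset.sum_apply, c1]
    simp only [d]
    ring
  have hc := coeff_eq_zero_of_isLittleO hP
  simp only [P, Polynomial.coeff_sub, Polynomial.finsetSum_coeff, Polynomial.coeff_C_mul,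
    Polynomial.coeff_X_pow] at hc
  rw [sub_eq_zero] at hc
  have e1 : ∑ j ∈ Finset.range (2 * k + 2 + 1), d j * (if 2 * k + 2 = j then (1 : ℝ) else 0) =
      d (2 * k + 2) := by simp
  -- Here `i ≤ k`, so the subtraction of natural numbers is exact, and only `j = 2k - 2i` reaches
  -- the degree `2k + 2`.
  have e2 : ∀ i ∈ Finset.range (k + 1), ∑ j ∈ Finset.range (2 * k - 2 * i + 1),
      1 / (i.factorial : ℝ) * p i j * (if 2 * k + 2 = 2 * i + 2 + j then (1 : ℝ) else 0) =
      1 / (i.factorial : ℝ) * p i (2 * k - 2 * i) := by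
    intro i hi
    have := Finset.mem_range.1 hi
    rw [Finset.sum_eq_single (2 * k - 2 * i)]
    · rw [if_pos (by omega), mul_one]
    · intro j _ hj
      rw [if_neg (by omega), mul_zero]
    · intro hj
      exact absurd (Finset.mem_range.2 (by omega)) hj
  rw [e1, Finset.sum_congr rfl e2] at hc
  exact hc

variable {X : Type} [NormedAddCommGroup X] [NormedSpace ℝ X] [FiniteDimensional ℝ X]
  {h₀ h₁ : X × ℝ → X →L[ℝ] X →L[ℝ] ℝ} {x : X} {c : ℝ}

/-- Taylor expansion of `h₁ - h₀` at `xⁿ = ε² zⁿ`: the term with index `i` carries `ε^(2i)`, and the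
remainder of order `k + 1` is `O(ε^(2k+2))`, for any number of iterations. -/
theorem psi_expansion (H : NormalMetrics h₀ h₁ x c) (ξ : X) (J k : ℕ)
    (s₀ : ContDiffAt ℝ (k + 1 : ℕ) h₀ (x, 0)) (s₁ : ContDiffAt ℝ (k + 1 : ℕ) h₁ (x, 0)) :
    ∃ C, ∀ᶠ ε in 𝓝[>] (0 : ℝ), |(∫ s in (0 : ℝ)..1, ∫ t in (0 : ℝ)..1,
        (h₁ (picPos (pic h₀ h₁ ξ J) (((x, ε), s), t)) -
          h₀ (picPos (pic h₀ h₁ ξ J) (((x, ε), s), t)))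
          (pic h₀ h₁ ξ J (((x, ε), s), t)).2.1 (pic h₀ h₁ ξ J (((x, ε), s), t)).2.1) -
        ∑ i ∈ Finset.range (k + 1), (ε ^ (2 * i) / i.factorial) * psi h₀ h₁ ξ J i (x, ε)|
      ≤ C * ε ^ (2 * k + 2) := by
  set S := pic h₀ h₁ ξ J with hS
  set f : X × ℝ → X →L[ℝ] X →L[ℝ] ℝ := fun p => h₁ p - h₀ p with hf
  have sf : ContDiffAt ℝ (k + 1 : ℕ) f (x, 0) := s₁.sub s₀
  obtain ⟨C₁, hC₁, hT⟩ := normalJet_taylor sf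
  have hj : ∀ᶠ y in 𝓝 x, ∀ i ∈ Finset.range (k + 1), ContinuousAt (normalJet f i) y := by
    refine (Filter.eventually_all_finset _).2 fun i hi => ?_
    have := Finset.mem_range.1 hi
    have h1 := (jetBound_normalJet (l := 0) (j := i) (p := fun _ => x) (fun _ => zero_le_one)
      ⟨_, norm_nonneg _, fun _ => le_rfl⟩
      (jetBound_single (sf.of_le (by exact_mod_cast (by omega : 0 + i ≤ k + 1))))).contDiffAt ()
    exact (h1.eventually (by simp)).mono fun y hy => hy.continuousAt
  have good : ∀ᶠ p in 𝓝 (x, (0 : ℝ)), ContinuousAt f p ∧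
      (∀ i ∈ Finset.range (k + 1), ContinuousAt (normalJet f i) p.1) ∧
      ‖f p - ∑ i ∈ Finset.range (k + 1), (p.2 ^ i / i.factorial) • normalJet f i p.1‖ ≤
        C₁ * |p.2| ^ (k + 1) := by
    filter_upwards [sf.eventually (by simp), continuousAt_fst.eventually hj, hT] with p a1 a2 a3
    exact ⟨a1.continuousAt, a2, a3⟩
  have E2 := eventually_forall_Icc_Icc (x := x) (P := fun r => ContinuousAt S r ∧
      ContinuousAt f (picPos S r) ∧
      (∀ i ∈ Finset.range (k + 1), ContinuousAt (normalJet f i) (picPos S r).1) ∧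
      ‖f (picPos S r) - ∑ i ∈ Finset.range (k + 1), ((picPos S r).2 ^ i / i.factorial) •
        normalJet f i (picPos S r).1‖ ≤ C₁ * |(picPos S r).2| ^ (k + 1)) (by
    intro s hs t ht
    have h1 := (contDiffAt_picPos_pic H ξ J hs ht).continuousAt
    rw [ContinuousAt, picPos_zero] at h1
    exact (((contDiffAt_pic H ξ J hs ht).eventually (by simp)).mono fun r hr => hr.continuousAt).and
      (h1.eventually good))
  obtain ⟨R, hR, E6⟩ := unifO_zero_pic H ξ J
  refine ⟨C₁ * R ^ (k + 1) * R * R, ?_⟩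
  filter_upwards [nhdsWithin_le_nhds E2, E6, eventually_small zero_lt_one] with ε e2 e6 hε
  have hin : ∀ q : ℝ × ℝ, ContinuousAt (fun q : ℝ × ℝ => (((x, ε), q.1), q.2)) q := fun q => by fun_prop
  have cS : ∀ q ∈ Icc (0 : ℝ) 1 ×ˢ Icc (0 : ℝ) 1,
      ContinuousAt (fun q : ℝ × ℝ => S (((x, ε), q.1), q.2)) q := fun q hq =>
    (e2 q.1 hq.1 q.2 hq.2).1.comp (f := fun q : ℝ × ℝ => (((x, ε), q.1), q.2)) (hin q)
  have cP : ∀ q ∈ Icc (0 : ℝ) 1 ×ˢ Icc (0 : ℝ) 1,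
      ContinuousAt (fun q : ℝ × ℝ => picPos S (((x, ε), q.1), q.2)) q := fun q hq =>
    ((continuousAt_const (y := x)).add ((cS q hq).fst.fst.const_smul ε)).prodMk
      ((cS q hq).fst.snd.const_mul (ε ^ 2))
  refine integral_integral_sub_sum_le (Finset.range (k + 1))
    (g := fun s t => f (picPos S (((x, ε), s), t)) (S (((x, ε), s), t)).2.1 (S (((x, ε), s), t)).2.1)
    (u := fun i s t => (S (((x, ε), s), t)).1.2 ^ i * normalJet f i (x + ε • (S (((x, ε), s), t)).1.1)
      (S (((x, ε), s), t)).2.1 (S (((x, ε), s), t)).2.1)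
    (fun i => ε ^ (2 * i) / i.factorial) ?_ ?_ ?_
  · intro q hq
    have := ContinuousAt.comp (f := fun q : ℝ × ℝ => picPos S (((x, ε), q.1), q.2))
      (e2 q.1 hq.1 q.2 hq.2).2.1 (cP q hq)
    exact ((this.clm_apply (cS q hq).snd.fst).clm_apply (cS q hq).snd.fst).continuousWithinAt
  · intro i hi q hq
    have := ContinuousAt.comp (f := fun q : ℝ × ℝ => (picPos S (((x, ε), q.1), q.2)).1)
      ((e2 q.1 hq.1 q.2 hq.2).2.2.1 i hi) (cP q hq).fst
    exact (((cS q hq).fst.snd.pow i).mul ((this.clm_apply (cS q hq).snd.fst).clm_apply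
      (cS q hq).snd.fst)).continuousWithinAt
  · intro s hs t ht
    have b1 := (e2 s hs t ht).2.2.2
    have b2 := e6 s hs t ht
    rw [pow_zero, mul_one] at b2
    set r : Par X × ℝ := (((x, ε), s), t) with hr
    set y := (S r).2.1 with hy
    have n1 : ‖y‖ ≤ R := (norm_fst_le _).trans ((norm_snd_le _).trans b2)
    have n2 : ‖(S r).1.2‖ ≤ R := (norm_snd_le _).trans ((norm_fst_le _).trans b2)
    have e : f (picPos S r) y y - ∑ i ∈ Finset.range (k + 1), ε ^ (2 * i) / i.factorial *
        ((S r).1.2 ^ i * normalJet f i (x + ε • (S r).1.1) y y) =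
        (f (picPos S r) - ∑ i ∈ Finset.range (k + 1), ((picPos S r).2 ^ i / i.factorial) •
        normalJet f i (picPos S r).1) y y := by
      simp only [sub_apply, sum_apply,
        smul_apply, smul_eq_mul]
      congr 1
      refine Finset.sum_congr rfl fun i _ => ?_
      simp only [picPos, hr]
      ring
    change |f (picPos S r) y y - ∑ i ∈ Finset.range (k + 1), ε ^ (2 * i) / i.factorial *
        ((S r).1.2 ^ i * normalJet f i (x + ε • (S r).1.1) y y)| ≤ _
    rw [e, ← Real.norm_eq_abs]
    refine (ContinuousLinearMap.le_opNorm₂ _ _ _).trans ?_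
    have n3 : |(picPos S r).2| ≤ ε ^ 2 * R := by
      have : (picPos S r).2 = ε ^ 2 * (S r).1.2 := rfl
      rw [this, abs_mul, abs_of_nonneg (sq_nonneg ε)]
      exact mul_le_mul_of_nonneg_left n2 (sq_nonneg _)
    calc _ ≤ (C₁ * (ε ^ 2 * R) ^ (k + 1)) * R * R := by
          have := b1.trans (mul_le_mul_of_nonneg_left (pow_le_pow_left₀ (abs_nonneg _) n3 (k + 1)) hC₁)
          have hε0 := hε.1.le
          gcongr
      _ = _ := by rw [mul_pow, ← pow_mul]; ring

end Expansion

/-! ### The coefficient of the highest normal derivative -/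

section Recursion

variable {X : Type} [NormedAddCommGroup X] [NormedSpace ℝ X]

/-- The mean value of the power `k` of the normal component of the scaled geodesics. -/
noncomputable def weight (h₀ h₁ : X × ℝ → X →L[ℝ] X →L[ℝ] ℝ) (ξ : X) (J k : ℕ) (q : X × ℝ) : ℝ :=
  ∫ s in (0 : ℝ)..1, ∫ t in (0 : ℝ)..1, (pic h₀ h₁ ξ J ((q, s), t)).1.2 ^ k

variable [FiniteDimensional ℝ X] {ι : Type*}

/-- At `ε = 0` the tangential velocity is the constant `ξ` and the foot point is `x`, so the normal
derivative factors out of the integral. -/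
theorem psi_at_zero (h₀ h₁ : X × ℝ → X →L[ℝ] X →L[ℝ] ℝ) (ξ x : X) (J k : ℕ) :
    psi h₀ h₁ ξ (J + 1) k (x, 0) = weight h₀ h₁ ξ (J + 1) k (x, 0) *
      normalJet (fun p => h₁ p - h₀ p) k x ξ ξ := by
  have hX : CompleteSpace X := FiniteDimensional.complete ℝ X
  rw [psi, weight, ← intervalIntegral.integral_mul_const]
  congr 1
  ext s
  rw [← intervalIntegral.integral_mul_const]
  congr 1
  ext t
  rw [pic_succ_at_zero]
  simp

theorem jetBound_weight {l : ℕ} {h₀ h₁ : ι → X × ℝ → X →L[ℝ] X →L[ℝ] ℝ} {x : ι → X}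
    (hx : ∃ C, 0 ≤ C ∧ ∀ i, ‖x i‖ ≤ C)
    (H₀ : JetBound (l + 1) h₀ (fun i => (x i, 0)) (fun _ => 1))
    (H₁ : JetBound (l + 1) h₁ (fun i => (x i, 0)) (fun _ => 1)) {c : ℝ} (hc : 0 < c)
    (hell₀ : ∀ i v, c * ‖v‖ ^ 2 ≤ h₀ i (x i, 0) v v) (hell₁ : ∀ i v, c * ‖v‖ ^ 2 ≤ h₁ i (x i, 0) v v)
    (ξ : X) (J k : ℕ) :
    JetBound l (fun i => weight (h₀ i) (h₁ i) ξ J k) (fun i => (x i, 0)) (fun _ => 1) := by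
  let κ := (ι × Icc (0 : ℝ) 1) × Icc (0 : ℝ) 1
  let r : κ → Par X × ℝ := fun k => (((x k.1.1, 0), (k.1.2 : ℝ)), (k.2 : ℝ))
  have hS : JetBound l (fun k : κ => pic (h₀ k.1.1) (h₁ k.1.1) ξ J) r (fun _ => 1) :=
    jetBound_pic hx H₀ H₁ hc hell₀ hell₁ ξ J
  have hz := ((hS.clm_apply (ContinuousLinearMap.fst ℝ (X × ℝ) (X × ℝ))).clm_apply
    (ContinuousLinearMap.snd ℝ X ℝ)).pow k
  let u : ι → Par X × ℝ → ℝ := fun i r => (pic (h₀ i) (h₁ i) ξ J r).1.2 ^ k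
  have hu : JetBound l (fun k : κ => u k.1.1) r (fun _ => 1) := hz
  have h1 := JetBound.integral (ι := ι × Icc (0 : ℝ) 1) (u := fun k => u k.1)
    (p := fun k => ((x k.1, (0 : ℝ)), (k.2 : ℝ))) (R := fun _ => 1) (fun k => zero_le_one) hu
  exact JetBound.integral (u := fun i y => ∫ t in (0 : ℝ)..1, u i (y, t))
    (p := fun i => (x i, (0 : ℝ))) (fun _ => zero_le_one) h1

/-- Strict convexity acts quantitatively here. At `ε = 0` the normal component is at least `(b /
4)(t - t²)`, and the mean of the `k`-th power of this is positive and depends on `b` and `k` only.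
-/
theorem exists_weight_lower_bound {b : ℝ} (hb : 0 < b) (k : ℕ) : ∃ w > 0,
    ∀ (h₀ h₁ : X × ℝ → X →L[ℝ] X →L[ℝ] ℝ) (ξ x : X) (J : ℕ), fderiv ℝ h₀ (x, 0) (0, 1) ξ ξ ≤ -b →
      fderiv ℝ h₁ (x, 0) (0, 1) ξ ξ ≤ -b → w ≤ weight h₀ h₁ ξ (J + 1) k (x, 0) := by
  have hX : CompleteSpace X := FiniteDimensional.complete ℝ X
  have hcont : ∀ a : ℝ, IntervalIntegrable (fun t : ℝ => (a * (t ^ 2 - t) / 2) ^ k) volume 0 1 := fun a =>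
    (by fun_prop : Continuous fun t : ℝ => (a * (t ^ 2 - t) / 2) ^ k).intervalIntegrable 0 1
  have hpos : 0 < ∫ t in (0 : ℝ)..1, (-b / 2 * (t ^ 2 - t) / 2) ^ k := by
    refine intervalIntegral.intervalIntegral_pos_of_pos_on (hcont _) (fun t ht => pow_pos ?_ k)
      zero_lt_one
    have : 0 < b * (t * (1 - t)) := mul_pos hb (mul_pos ht.1 (sub_pos.2 ht.2))
    nlinarith
  refine ⟨_, hpos, fun h₀ h₁ ξ x J hξ₀ hξ₁ => ?_⟩
  have e : ∀ s, bend h₀ h₁ ξ x s = 1 / 2 * ((1 - s) * fderiv ℝ h₀ (x, 0) (0, 1) ξ ξ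
    + s * fderiv ℝ h₁ (x, 0) (0, 1) ξ ξ) := fun s => by simp [bend, segDeriv]
  have hbend : ∀ s ∈ Icc (0 : ℝ) 1, bend h₀ h₁ ξ x s ≤ -b / 2 := fun s hs => by
    rw [e]
    nlinarith [mul_le_mul_of_nonneg_left hξ₀ (sub_nonneg.2 hs.2), mul_le_mul_of_nonneg_left hξ₁ hs.1]
  have hin : ∀ s ∈ Icc (0 : ℝ) 1, (∫ t in (0 : ℝ)..1, (-b / 2 * (t ^ 2 - t) / 2) ^ k) ≤
      ∫ t in (0 : ℝ)..1, (bend h₀ h₁ ξ x s * (t ^ 2 - t) / 2) ^ k := by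
    intro s hs
    refine intervalIntegral.integral_mono_on zero_le_one (hcont _) (hcont _) fun t ht => ?_
    have ht' : t ^ 2 - t ≤ 0 := by nlinarith [ht.1, ht.2]
    refine pow_le_pow_left₀ ?_ ?_ k
    · nlinarith
    · nlinarith [hbend s hs]
  have hw : weight h₀ h₁ ξ (J + 1) k (x, 0) = ∫ s in (0 : ℝ)..1, ∫ t in (0 : ℝ)..1,
      (bend h₀ h₁ ξ x s * (t ^ 2 - t) / 2) ^ k := by
    rw [weight]
    simp only [pic_succ_at_zero]
  have cs : Continuous fun s => ∫ t in (0 : ℝ)..1, (bend h₀ h₁ ξ x s * (t ^ 2 - t) / 2) ^ k := by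
    refine intervalIntegral.continuous_parametric_intervalIntegral_of_continuous' ?_ 0 1
    simp only [e]
    fun_prop
  rw [hw]
  calc (∫ t in (0 : ℝ)..1, (-b / 2 * (t ^ 2 - t) / 2) ^ k)
      = ∫ s in (0 : ℝ)..1, ∫ t in (0 : ℝ)..1, (-b / 2 * (t ^ 2 - t) / 2) ^ k := by simp
    _ ≤ _ := intervalIntegral.integral_mono_on zero_le_one (by simp)
        (cs.intervalIntegrable 0 1) hin

/-- The distance function determines the `k`-th normal derivative of `h₁ - h₀`, up to lower ones. -/
theorem weight_mul_normalJet {h₀ h₁ : X × ℝ → X →L[ℝ] X →L[ℝ] ℝ} {x : X} {c : ℝ}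
    (H : NormalMetrics h₀ h₁ x c) {ξ : X} (hξ₀ : fderiv ℝ h₀ (x, 0) (0, 1) ξ ξ < 0)
    (hξ₁ : fderiv ℝ h₁ (x, 0) (0, 1) ξ ξ < 0) {k : ℕ}
    (s₀ : ContDiffAt ℝ (2 * k + 3 : ℕ) h₀ (x, 0)) (s₁ : ContDiffAt ℝ (2 * k + 3 : ℕ) h₁ (x, 0))
    {ρ₀ ρ₁ : X → X → ℝ} (L₀ : IsLocalDistSq h₀ ρ₀ x) (L₁ : IsLocalDistSq h₁ ρ₁ x)
    (hδ : ContDiffAt ℝ (2 * k + 2 : ℕ) (fun ε : ℝ => ρ₁ x (x + ε • ξ) - ρ₀ x (x + ε • ξ)) 0) :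
    weight h₀ h₁ ξ (2 * (2 * k + 2) + 1) k (x, 0) * normalJet (fun p => h₁ p - h₀ p) k x ξ ξ =
      k.factorial * (iteratedDeriv (2 * k + 2) (fun ε : ℝ => ρ₁ x (x + ε • ξ) - ρ₀ x (x + ε • ξ)) 0
        / (2 * k + 2).factorial - ∑ i ∈ Finset.range k, (1 / (i.factorial : ℝ)) *
        (iteratedDeriv (2 * k - 2 * i) (fun ε => psi h₀ h₁ ξ (2 * (2 * k + 2) + 1) i (x, ε)) 0
          / (2 * k - 2 * i).factorial)) := by
  -- The choice `M = 2k + 2` makes the remainder `O(ε^(2k+3))`, beyond the coefficient to be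
  -- compared.
  obtain ⟨C₁, -, e1⟩ := distSq_sub_distSq_expansion H hξ₀ hξ₁ (2 * k + 2) L₀ L₁
  obtain ⟨C₂, e2⟩ := psi_expansion H ξ (2 * (2 * k + 2) + 1) k
    (s₀.of_le (by exact_mod_cast (by omega : k + 1 ≤ 2 * k + 3)))
    (s₁.of_le (by exact_mod_cast (by omega : k + 1 ≤ 2 * k + 3)))
  have hx : ∃ C, 0 ≤ C ∧ ∀ _ : Unit, ‖x‖ ≤ C := ⟨_, norm_nonneg x, fun _ => le_rfl⟩
  have hΨ : ∀ i ∈ Finset.range (k + 1), ContDiffAt ℝ (2 * k - 2 * i : ℕ)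
      (fun ε => psi h₀ h₁ ξ (2 * (2 * k + 2) + 1) i (x, ε)) 0 := by
    intro i hi
    have := Finset.mem_range.1 hi
    have hj := jetBound_normalJet (l := 2 * k - 2 * i) (j := i) (fun _ : Unit => zero_le_one) hx
      (jetBound_single ((s₁.sub s₀).of_le
        (by exact_mod_cast (by omega : 2 * k - 2 * i + i ≤ 2 * k + 3))))
    have hp := (jetBound_psi (ι := Unit) (fun _ => zero_le_one) hx
      (jetBound_single (s₀.of_le (by exact_mod_cast (by omega : 2 * k - 2 * i + 1 ≤ 2 * k + 3))))
      (jetBound_single (s₁.of_le (by exact_mod_cast (by omega : 2 * k - 2 * i + 1 ≤ 2 * k + 3))))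
      H.pos (fun _ => H.elliptic₀) (fun _ => H.elliptic₁) ξ (2 * (2 * k + 2) + 1) i hj).contDiffAt ()
    exact hp.comp (0 : ℝ) (contDiffAt_const.prodMk contDiffAt_id)
  have key := coeff_eq_sum_of_expansion (k := k)
    (Ψ := fun i ε => psi h₀ h₁ ξ (2 * (2 * k + 2) + 1) i (x, ε)) hδ hΨ e1 e2
  -- The summand `i = k` is not differentiated: it is `psi` at `ε = 0`, the weight times the
  -- unknown. The other summands involve lower normal derivatives only.
  rw [Finset.sum_range_succ] at key
  have e0 : 2 * k - 2 * k = 0 := by omega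
  rw [e0, iteratedDeriv_zero, psi_at_zero] at key
  have hk : (k.factorial : ℝ) ≠ 0 := by positivity
  rw [key]
  simp only [Nat.factorial_zero, Nat.cast_one, div_one]
  field_simp
  ring

/-- A form is a fixed linear combination of its entries in a basis. This reduces the estimate of
tensors to scalar functions. -/
theorem jetBound_of_apply_apply {Y : Type} [NormedAddCommGroup Y] [NormedSpace ℝ Y] {l : ℕ}
    {u : ι → Y → X →L[ℝ] X →L[ℝ] ℝ} {p : ι → Y} {R : ι → ℝ} (hR : ∀ i, 0 ≤ R i)
    (h : ∀ v w, JetBound l (fun i y => u i y v w) p R) : JetBound l u p R := by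
  let b := Module.finBasis ℝ X
  let co : Fin (Module.finrank ℝ X) → X →L[ℝ] ℝ := fun a => LinearMap.toContinuousLinearMap (b.coord a)
  have e : ∀ B : X →L[ℝ] X →L[ℝ] ℝ, B = ∑ a, ∑ a', B (b a) (b a') • (co a).smulRight (co a') := by
    intro B
    ext v w
    have hv : v = ∑ a, b.coord a v • b a := (b.sum_repr v).symm
    have hw : w = ∑ a, b.coord a w • b a := (b.sum_repr w).symm
    have h1 : B v w = ∑ a, b.coord a v * B (b a) w := by
      conv_lhs => rw [hv]
      simp only [map_sum, map_smul, sum_apply, smul_apply,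
        smul_eq_mul]
    have h2 : ∀ a, B (b a) w = ∑ a', b.coord a' w * B (b a) (b a') := fun a => by
      conv_lhs => rw [hw]
      simp only [map_sum, map_smul, smul_eq_mul]
    rw [h1]
    simp only [h2, sum_apply, smul_apply,
      ContinuousLinearMap.smulRight_apply, smul_eq_mul, co, LinearMap.coe_toContinuousLinearMap']
    refine Finset.sum_congr rfl fun a _ => ?_
    rw [Finset.mul_sum]
    exact Finset.sum_congr rfl fun a' _ => by ring
  refine (JetBound.sum Finset.univ (u := fun a i y => ∑ a', u i y (b a) (b a') •
    (co a).smulRight (co a')) hR fun a _ => JetBound.sum Finset.univ hR fun a' _ =>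
    (h (b a) (b a')).clm_apply (ContinuousLinearMap.toSpanSingleton ℝ ((co a).smulRight (co a')))).congr
    fun i => Eventually.of_forall fun y => ?_
  exact e (u i y)

/-- Needed for polarization: the distances in direction `ξ` give access only to the values on `(ξ,
ξ)`. -/
theorem normalJet_symm {f : X × ℝ → X →L[ℝ] X →L[ℝ] ℝ} {x : X} {k : ℕ}
    (hf : ContDiffAt ℝ k f (x, 0)) (h : ∀ᶠ p in 𝓝 (x, (0 : ℝ)), ∀ v w, f p v w = f p w v) (v w : X) :
    normalJet f k x v w = normalJet f k x w v := by
  let L : (X →L[ℝ] X →L[ℝ] ℝ) →L[ℝ] (X →L[ℝ] X →L[ℝ] ℝ) :=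
    (ContinuousLinearMap.flipₗᵢ ℝ X X ℝ).toContinuousLinearEquiv.toContinuousLinearMap
  have hL : ∀ B v w, L B v w = B w v := fun B v w => rfl
  have hg : ContDiffAt ℝ k (fun t : ℝ => f (x, t)) 0 :=
    hf.comp (0 : ℝ) (contDiffAt_const.prodMk contDiffAt_id)
  have he : (fun t : ℝ => L (f (x, t))) =ᶠ[𝓝 0] fun t => f (x, t) := by
    have : ContinuousAt (fun t : ℝ => (x, t)) 0 := by fun_prop
    filter_upwards [this.eventually h] with t ht
    ext v w
    rw [hL, ht]
  have h1 : iteratedDeriv k (fun t : ℝ => L (f (x, t))) 0 = L (normalJet f k x) := by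
    simp only [iteratedDeriv_eq_iteratedFDeriv, normalJet]
    have := L.iteratedFDeriv_comp_left hg (i := k) le_rfl
    have h2 : iteratedFDeriv ℝ k (fun t : ℝ => L (f (x, t))) 0 = _ := this
    rw [h2]
    rfl
  rw [he.iteratedDeriv_eq k] at h1
  change normalJet f k x = _ at h1
  conv_lhs => rw [h1]
  rfl

end Recursion

theorem natCast_ne_infty (n : ℕ) : ((n : ℕ) : WithTop ℕ∞) ≠ (∞ : WithTop ℕ∞) := by simp

/-! ### The recursion over the normal derivatives with uniform bounds -/

section Stability

variable {X : Type} [NormedAddCommGroup X] [NormedSpace ℝ X] [FiniteDimensional ℝ X] {ι : Type*}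

theorem NormalMetrics.eventually {h₀ h₁ : X × ℝ → X →L[ℝ] X →L[ℝ] ℝ} {x : X} {c : ℝ}
    (H : NormalMetrics h₀ h₁ x c) : ∀ᶠ y in 𝓝 x, NormalMetrics h₀ h₁ y (c / 2) := by
  have hc : ContinuousAt (fun y : X => (y, (0 : ℝ))) x := by fun_prop
  filter_upwards [hc.eventually (H.smooth₀.eventually (by simp)),
    hc.eventually (H.smooth₁.eventually (by simp)), hc.eventually H.symm₀.eventually_nhds,
    hc.eventually H.symm₁.eventually_nhds,
    hc.eventually (eventually_elliptic H.smooth₀.continuousAt H.pos H.elliptic₀),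
    hc.eventually (eventually_elliptic H.smooth₁.continuousAt H.pos H.elliptic₁)]
    with y a1 a2 a3 a4 a5 a6
  exact ⟨half_pos H.pos, a1, a2, a3, a4, a5, a6⟩

theorem eventually_fderiv_neg {h : X × ℝ → X →L[ℝ] X →L[ℝ] ℝ} {x : X} (hh : ContDiffAt ℝ 3 h (x, 0))
    {ξ : X} (hξ : fderiv ℝ h (x, 0) (0, 1) ξ ξ < 0) :
    ∀ᶠ y in 𝓝 x, fderiv ℝ h (y, 0) (0, 1) ξ ξ < 0 := by
  have hc : ContinuousAt (fun y : X => (y, (0 : ℝ))) x := by fun_prop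
  have h1 : ContinuousAt (fun y : X => fderiv ℝ h (y, 0)) x :=
    (show ContinuousAt (fderiv ℝ h) (x, 0) from hh.continuousAt_fderiv (by simp)).comp
      (f := fun y : X => (y, (0 : ℝ))) hc
  exact (((h1.clm_apply continuousAt_const).clm_apply continuousAt_const).clm_apply
    continuousAt_const).eventually_lt_const hξ

/-- These are the Taylor coefficients in `ε` along `(y, y + εξ)`, as functions of `y`: composition
with an affine map, then `j` orders are spent on `ε`. -/
theorem jetBound_iteratedDeriv_diagonal {l j : ℕ} {x : ι → X} {R : ι → ℝ} (hR : ∀ i, 0 ≤ R i)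
    (hx : ∃ C, 0 ≤ C ∧ ∀ i, ‖x i‖ ≤ C) {D : ι → X × X → ℝ}
    (hD : JetBound (l + j) D (fun i => (x i, x i)) R) (ξ : X) :
    JetBound l (fun i y => iteratedDeriv j (fun ε : ℝ => D i (y, y + ε • ξ)) 0) x R := by
  have hid := jetBound_id (l := l + j) (p := fun i => (x i, (0 : ℝ)))
    (bounded_prodMk hx ⟨0, le_rfl, by simp⟩)
  have haff : JetBound (l + j) (fun (_ : ι) (q : X × ℝ) => (q.1, q.1 + q.2 • ξ))
      (fun i => (x i, (0 : ℝ))) (fun _ => 1) :=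
    (hid.clm_apply (ContinuousLinearMap.fst ℝ X ℝ)).prodMk
      ((hid.clm_apply (ContinuousLinearMap.fst ℝ X ℝ)).add
        (hid.clm_apply ((ContinuousLinearMap.toSpanSingleton ℝ ξ).comp
          (ContinuousLinearMap.snd ℝ X ℝ))))
  have hD' : JetBound (l + j) D (fun i => (x i, x i + (0 : ℝ) • ξ)) R := by
    simpa using hD
  have hcomp : JetBound (l + j) (fun i (q : X × ℝ) => D i (q.1, q.1 + q.2 • ξ))
      (fun i => (x i, (0 : ℝ))) R :=
    JetBound.comp (u := D) (v := fun _ (q : X × ℝ) => (q.1, q.1 + q.2 • ξ)) hR hD' haff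
  exact JetBound.iteratedDeriv_slice (u := fun i (q : X × ℝ) => D i (q.1, q.1 + q.2 • ξ)) hR hx hcomp

/-- The lower bound of the weight, with the upper bound contained in its jets, confines it to a
compact interval away from 0, on which inversion is smooth. -/
theorem jetBound_weight_inv {l : ℕ} {h₀ h₁ : ι → X × ℝ → X →L[ℝ] X →L[ℝ] ℝ} {x : ι → X}
    (hx : ∃ C, 0 ≤ C ∧ ∀ i, ‖x i‖ ≤ C)
    (H₀ : JetBound (l + 1) h₀ (fun i => (x i, 0)) (fun _ => 1))
    (H₁ : JetBound (l + 1) h₁ (fun i => (x i, 0)) (fun _ => 1)) {c : ℝ} (hc : 0 < c)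
    (hell₀ : ∀ i v, c * ‖v‖ ^ 2 ≤ h₀ i (x i, 0) v v) (hell₁ : ∀ i v, c * ‖v‖ ^ 2 ≤ h₁ i (x i, 0) v v)
    {ξ : X} {b : ℝ} (hb : 0 < b) (hconv₀ : ∀ i, fderiv ℝ (h₀ i) (x i, 0) (0, 1) ξ ξ ≤ -b)
    (hconv₁ : ∀ i, fderiv ℝ (h₁ i) (x i, 0) (0, 1) ξ ξ ≤ -b) (J k : ℕ) :
    (∀ i, ∀ᶠ y in 𝓝 (x i), weight (h₀ i) (h₁ i) ξ (J + 1) k (y, 0) ≠ 0) ∧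
    JetBound l (fun i y => (weight (h₀ i) (h₁ i) ξ (J + 1) k (y, 0))⁻¹) x (fun _ => 1) := by
  obtain ⟨w, hw, hweight⟩ := exists_weight_lower_bound (X := X) hb k
  have h1 := jetBound_weight (l := l) hx H₀ H₁ hc hell₀ hell₁ ξ (J + 1) k
  have hin : JetBound l (fun (_ : ι) (y : X) => (y, (0 : ℝ))) x (fun _ => 1) :=
    (jetBound_id hx).clm_apply (ContinuousLinearMap.inl ℝ X ℝ)
  have h2 := JetBound.comp (v := fun _ y => (y, (0 : ℝ))) (fun _ => zero_le_one) h1 hin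
  obtain ⟨B, hB, hbd⟩ := h2.bound
  have hlow : ∀ i, w ≤ weight (h₀ i) (h₁ i) ξ (J + 1) k (x i, 0) := fun i =>
    hweight (h₀ i) (h₁ i) ξ (x i) _ (hconv₀ i) (hconv₁ i)
  refine ⟨fun i => ((h2.contDiffAt i).continuousAt).eventually_ne (ne_of_gt (hw.trans_le (hlow i))),
    h2.comp_of_compact (K := Icc w B) (G := fun r : ℝ => r⁻¹) isCompact_Icc
    (fun r hr => contDiffAt_inv ℝ (ne_of_gt (hw.trans_le hr.1))) fun i => ⟨hlow i, ?_⟩⟩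
  have := hbd i
  rw [mul_one] at this
  exact (le_abs_self _).trans this

/-- The normal derivatives of `h₁ - h₀` are controlled by the jets of the difference of the squared
distances. -/
theorem jetBound_normalJet_of_distSq {h₀ h₁ : ι → X × ℝ → X →L[ℝ] X →L[ℝ] ℝ} {x : ι → X} {R : ι → ℝ}
    (hR : ∀ i, 0 ≤ R i) (hx : ∃ C, 0 ≤ C ∧ ∀ i, ‖x i‖ ≤ C) {N : ℕ} {b c : ℝ} (hb : 0 < b) (hc : 0 < c)
    (H₀ : JetBound (N + 3) h₀ (fun i => (x i, 0)) (fun _ => 1))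
    (H₁ : JetBound (N + 3) h₁ (fun i => (x i, 0)) (fun _ => 1))
    (hsymm₀ : ∀ i, ∀ᶠ p in 𝓝 (x i, (0 : ℝ)), ∀ v w, h₀ i p v w = h₀ i p w v)
    (hsymm₁ : ∀ i, ∀ᶠ p in 𝓝 (x i, (0 : ℝ)), ∀ v w, h₁ i p v w = h₁ i p w v)
    (hell₀ : ∀ i v, c * ‖v‖ ^ 2 ≤ h₀ i (x i, 0) v v) (hell₁ : ∀ i v, c * ‖v‖ ^ 2 ≤ h₁ i (x i, 0) v v)
    (hconv₀ : ∀ i ξ, fderiv ℝ (h₀ i) (x i, 0) (0, 1) ξ ξ ≤ -(b * ‖ξ‖ ^ 2))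
    (hconv₁ : ∀ i ξ, fderiv ℝ (h₁ i) (x i, 0) (0, 1) ξ ξ ≤ -(b * ‖ξ‖ ^ 2))
    {ρ₀ ρ₁ : ι → X → X → ℝ} (L₀ : ∀ i, ∀ᶠ y in 𝓝 (x i), IsLocalDistSq (h₀ i) (ρ₀ i) y)
    (L₁ : ∀ i, ∀ᶠ y in 𝓝 (x i), IsLocalDistSq (h₁ i) (ρ₁ i) y)
    (hD : JetBound (N + 2) (fun i (z : X × X) => ρ₁ i z.1 z.2 - ρ₀ i z.1 z.2) (fun i => (x i, x i)) R)
    (k : ℕ) (hk : 2 * k ≤ N) :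
    JetBound (N - 2 * k) (fun i => normalJet (fun p => h₁ i p - h₀ i p) k) x R := by
  -- The count of orders: the `k`-th step spends `2k + 2` of the `N + 2` orders of the distances,
  -- and `2k - 2j` of the `N - 2j` orders of the `j`-th normal derivative. In both cases `N - 2k`
  -- remain.
  induction k using Nat.strong_induction_on with
  | _ k ih =>
  set l := N - 2 * k with hl
  have one : ∀ i : ι, (0 : ℝ) ≤ 1 := fun _ => zero_le_one
  have NM : ∀ i, NormalMetrics (h₀ i) (h₁ i) (x i) c := fun i =>
    ⟨hc, (H₀.contDiffAt i).of_le (by exact_mod_cast (by omega : 3 ≤ N + 3)),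
      (H₁.contDiffAt i).of_le (by exact_mod_cast (by omega : 3 ≤ N + 3)), hsymm₀ i, hsymm₁ i,
      hell₀ i, hell₁ i⟩
  -- the values on the diagonal
  have diag : ∀ ξ, JetBound l (fun i y => normalJet (fun p => h₁ i p - h₀ i p) k y ξ ξ) x R := by
    intro ξ
    rcases eq_or_ne ξ 0 with rfl | hξ
    · simpa using jetBound_const_family (l := l) (p := x) (fun _ : ι => (0 : ℝ)) hR ⟨0, le_rfl, by simp⟩
    have hbξ : 0 < b * ‖ξ‖ ^ 2 := mul_pos hb (pow_pos (norm_pos_iff.2 hξ) 2)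
    set J := 2 * (2 * k + 2) + 1 with hJ
    have jδ : JetBound l (fun i y => iteratedDeriv (2 * k + 2)
        (fun ε : ℝ => ρ₁ i y (y + ε • ξ) - ρ₀ i y (y + ε • ξ)) 0) x R :=
      jetBound_iteratedDeriv_diagonal (l := l) (j := 2 * k + 2)
        (D := fun i (z : X × X) => ρ₁ i z.1 z.2 - ρ₀ i z.1 z.2) hR hx (hD.mono (by omega)) ξ
    have jψ : ∀ j ∈ Finset.range k, JetBound l (fun i y => iteratedDeriv (2 * k - 2 * j)
        (fun ε => psi (h₀ i) (h₁ i) ξ J j (y, ε)) 0) x R := by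
      intro j hj
      have hjk := Finset.mem_range.1 hj
      have h1 := jetBound_psi (l := l + (2 * k - 2 * j)) hR hx (H₀.mono (by omega)) (H₁.mono (by omega))
        hc hell₀ hell₁ ξ J j ((ih j hjk (by omega)).mono (by omega))
      exact JetBound.iteratedDeriv_slice (u := fun i => psi (h₀ i) (h₁ i) ξ J j) hR hx h1
    obtain ⟨wpos, jw⟩ := jetBound_weight_inv (l := l) hx (H₀.mono (by omega)) (H₁.mono (by omega)) hc
      hell₀ hell₁ hbξ (fun i => hconv₀ i ξ) (fun i => hconv₁ i ξ) (2 * (2 * k + 2)) k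
    rw [← hJ] at jw wpos
    have jrhs := JetBound.mul hR jw ((jδ.const_smul (1 / ((2 * k + 2).factorial : ℝ))).sub
      (JetBound.sum (Finset.range k) hR fun j hj => (jψ j hj).const_smul
        (1 / (j.factorial : ℝ) * (1 / ((2 * k - 2 * j).factorial : ℝ)))) |>.const_smul (k.factorial : ℝ))
    -- The identity `weight_mul_normalJet` holds at every `y` near `x i`, where strict convexity and
    -- ellipticity persist, so it may be differentiated in `y`.
    refine jrhs.congr fun i => ?_
    have hc0 : ContinuousAt (fun y : X => (y, (0 : ℝ))) (x i) := by fun_prop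
    have hdiag : ContinuousAt (fun y : X => (y, y)) (x i) := by fun_prop
    have hn0 : fderiv ℝ (h₀ i) (x i, 0) (0, 1) ξ ξ < 0 := (hconv₀ i ξ).trans_lt (neg_neg_of_pos hbξ)
    have hn1 : fderiv ℝ (h₁ i) (x i, 0) (0, 1) ξ ξ < 0 := (hconv₁ i ξ).trans_lt (neg_neg_of_pos hbξ)
    filter_upwards [(NM i).eventually, eventually_fderiv_neg (NM i).smooth₀ hn0,
      eventually_fderiv_neg (NM i).smooth₁ hn1,
      hc0.eventually ((H₀.contDiffAt i).eventually (natCast_ne_infty _)),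
      hc0.eventually ((H₁.contDiffAt i).eventually (natCast_ne_infty _)), L₀ i, L₁ i,
      hdiag.eventually ((hD.contDiffAt i).eventually (natCast_ne_infty _)), wpos i] with y a1 a2 a3 a4 a5 a6 a7 a8 a9
    have hδ : ContDiffAt ℝ (2 * k + 2 : ℕ) (fun ε : ℝ => ρ₁ i y (y + ε • ξ) - ρ₀ i y (y + ε • ξ)) 0 := by
      have h1 : ContDiffAt ℝ (N + 2 : ℕ) (fun ε : ℝ => (y, y + ε • ξ)) 0 :=
        contDiffAt_const.prodMk (contDiffAt_const.add (contDiffAt_id.smul contDiffAt_const))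
      have h2 := ContDiffAt.comp (g := fun z : X × X => ρ₁ i z.1 z.2 - ρ₀ i z.1 z.2)
        (f := fun ε : ℝ => (y, y + ε • ξ)) (0 : ℝ) (by simpa using a8) h1
      exact h2.of_le (by exact_mod_cast (by omega : 2 * k + 2 ≤ N + 2))
    have key := weight_mul_normalJet a1 a2 a3 (k := k)
      (a4.of_le (by exact_mod_cast (by omega : 2 * k + 3 ≤ N + 3)))
      (a5.of_le (by exact_mod_cast (by omega : 2 * k + 3 ≤ N + 3))) a6 a7 hδ
    rw [← hJ] at key
    rw [(eq_inv_mul_iff_mul_eq₀ a9).2 key]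
    simp only [smul_eq_mul]
    congr 2
    rw [div_eq_inv_mul, one_div]
    congr 1
    refine Finset.sum_congr rfl fun j _ => ?_
    rw [one_div, one_div, div_eq_inv_mul, mul_assoc]
  -- polarization
  refine jetBound_of_apply_apply hR fun v w => ?_
  refine ((((diag (v + w)).sub (diag v)).sub (diag w)).const_smul (1 / 2)).congr fun i => ?_
  have hc0 : ContinuousAt (fun y : X => (y, (0 : ℝ))) (x i) := by fun_prop
  filter_upwards [hc0.eventually ((H₀.contDiffAt i).eventually (natCast_ne_infty _)),
    hc0.eventually ((H₁.contDiffAt i).eventually (natCast_ne_infty _)),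
    hc0.eventually (hsymm₀ i).eventually_nhds, hc0.eventually (hsymm₁ i).eventually_nhds]
    with y a1 a2 a3 a4
  have hs := normalJet_symm (f := fun p => h₁ i p - h₀ i p) (k := k)
    ((a2.sub a1).of_le (by exact_mod_cast (by omega : k ≤ N + 3)))
    (by filter_upwards [a3, a4] with p b1 b2 v w
        rw [sub_apply, sub_apply, sub_apply,
          sub_apply, b1, b2]) w v
  simp only [map_add, add_apply, smul_eq_mul, hs]
  ring

end Stability

/-! ### Extension across a hyperplane by higher order reflection -/

section Reflection

/-- Lagrange interpolation at the `N + 1` nodes `-a j`, evaluated at 1, reproduces the monomials of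
degree at most `N`; the weights are the values of the basis polynomials at 1. The bound `a j ≤ 1`
keeps reflected points within the given depth. -/
theorem exists_reflection_coeffs (N : ℕ) : ∃ a lam : Fin (N + 1) → ℝ, (∀ j, 0 < a j ∧ a j ≤ 1) ∧
    ∀ i ≤ N, ∑ j, lam j * (-a j) ^ i = 1 := by
  let a : Fin (N + 1) → ℝ := fun j => 1 / ((j : ℝ) + 1)
  have ha : ∀ j, 0 < a j ∧ a j ≤ 1 := fun j => ⟨by positivity, by
    rw [div_le_one (by positivity)]; linarith [(Nat.cast_nonneg (j : ℕ) : (0 : ℝ) ≤ (j : ℕ))]⟩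
  have hinj : InjOn (fun j => -a j) (Finset.univ : Finset (Fin (N + 1))) := by
    intro i _ j _ h
    simp only [a, neg_inj, one_div, inv_inj, add_left_inj, Nat.cast_inj] at h
    exact Fin.ext h
  refine ⟨a, fun j => (Lagrange.basis Finset.univ (fun j => -a j) j).eval 1, ha, fun i hi => ?_⟩
  have h1 := Lagrange.eq_interpolate (f := (Polynomial.X ^ i : Polynomial ℝ)) hinj (by
    rw [Polynomial.degree_X_pow, Finset.card_univ, Fintype.card_fin]
    exact_mod_cast Nat.lt_succ_of_le hi)
  have h2 := congrArg (Polynomial.eval 1) h1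
  rw [Lagrange.interpolate_apply, Polynomial.eval_finsetSum] at h2
  simp only [Polynomial.eval_pow, Polynomial.eval_X, one_pow, Polynomial.eval_mul,
    Polynomial.eval_C] at h2
  exact (Finset.sum_congr rfl fun j _ => mul_comm _ _).trans h2.symm

variable {X F : Type} [NormedAddCommGroup X] [NormedSpace ℝ X] [NormedAddCommGroup F] [NormedSpace ℝ F]
  {M : ℕ}

/-- The reflection of `u` across `{t = 0}`, with the nodes `a` and the weights `lam`. -/
noncomputable def reflect (a lam : Fin M → ℝ) (u : X × ℝ → F) (q : X × ℝ) : F :=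
  open Classical in if 0 ≤ q.2 then u q else ∑ j, lam j • u (q.1, -a j * q.2)

theorem reflect_of_nonneg {a lam : Fin M → ℝ} {u : X × ℝ → F} {q : X × ℝ} (h : 0 ≤ q.2) :
    reflect a lam u q = u q := if_pos h

theorem reflect_of_nonpos {a lam : Fin M → ℝ} {u : X × ℝ → F} {q : X × ℝ} (h : q.2 ≤ 0)
    (hl : ∑ j, lam j = 1) : reflect a lam u q = ∑ j, lam j • u (q.1, -a j * q.2) := by
  rcases h.eq_or_lt with h | h
  · rw [reflect_of_nonneg h.ge, h]
    have : (q.1, (0 : ℝ)) = q := Prod.ext rfl h.symm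
    simp [this, ← Finset.sum_smul, hl]
  · exact if_neg (not_le.2 h)

theorem hasFDerivWithinAt_reflected {a lam : Fin M → ℝ} (ha : ∀ j, 0 < a j ∧ a j ≤ 1)
    {W : Set X} {δ : ℝ} {u : X × ℝ → F} {u' : X × ℝ → X × ℝ →L[ℝ] F}
    (hu : ∀ q ∈ W ×ˢ Ico 0 δ, HasFDerivWithinAt u (u' q) (W ×ˢ Ico 0 δ) q)
    {q : X × ℝ} (hq : q ∈ W ×ˢ Ioc (-δ) 0) :
    HasFDerivWithinAt (fun q : X × ℝ => ∑ j, lam j • u (q.1, -a j * q.2))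
      (∑ j, lam j • (u' (q.1, -a j * q.2)).comp ((ContinuousLinearMap.fst ℝ X ℝ).prod
        (-a j • ContinuousLinearMap.snd ℝ X ℝ))) (W ×ˢ Ioc (-δ) 0) q := by
  refine HasFDerivWithinAt.fun_sum fun j _ => HasFDerivWithinAt.const_smul ?_ (lam j)
  have hm : MapsTo (fun q : X × ℝ => (q.1, -a j * q.2)) (W ×ˢ Ioc (-δ) 0) (W ×ˢ Ico 0 δ) := by
    rintro ⟨x, t⟩ ⟨hx, ht⟩
    refine ⟨hx, ?_, ?_⟩
    · nlinarith [ht.2, (ha j).1]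
    · have : -t < δ := by linarith [ht.1]
      nlinarith [ht.2, (ha j).1, (ha j).2]
  have hd : HasFDerivAt (fun q : X × ℝ => (q.1, -a j * q.2)) ((ContinuousLinearMap.fst ℝ X ℝ).prod
      (-a j • ContinuousLinearMap.snd ℝ X ℝ)) q :=
    hasFDerivAt_fst.prodMk (hasFDerivAt_snd.const_mul (-a j))
  exact (hu _ (hm hq)).comp (f := fun q : X × ℝ => (q.1, -a j * q.2)) q hd.hasFDerivWithinAt hm

/-- The `x`-derivative of a reflection is the reflection of the `x`-derivative with the same
weights. For the `t`-derivative the weights become `lam j * (-a j)`, which satisfy the moment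
conditions up to one order less. Hence the induction over arbitrary weights; the conditions of order
0 and 1 match values and first derivatives at `t = 0`. -/
theorem contDiffOn_reflect {N : ℕ} {a lam : Fin M → ℝ} (ha : ∀ j, 0 < a j ∧ a j ≤ 1)
    (hl : ∀ i ≤ N, ∑ j, lam j * (-a j) ^ i = 1) {W : Set X} (hW : IsOpen W) {δ : ℝ}
    {u : X × ℝ → F} (hu : ContDiffOn ℝ N u (W ×ˢ Ico 0 δ)) :
    ContDiffOn ℝ N (reflect a lam u) (W ×ˢ Ioo (-δ) δ) := by
  induction N generalizing F lam with
  | zero =>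
    have hl0 : ∑ j, lam j = 1 := by simpa using hl 0 le_rfl
    simp only [Nat.cast_zero, contDiffOn_zero] at hu ⊢
    have e : W ×ˢ Ioo (-δ) δ = (W ×ˢ Ioo (-δ) δ ∩ {q | q.2 ≤ 0}) ∪ (W ×ˢ Ioo (-δ) δ ∩ {q | 0 ≤ q.2}) := by
      rw [← inter_union_distrib_left]
      exact (inter_eq_left.2 fun q _ => le_total q.2 0).symm
    have c1 : ContinuousOn (reflect a lam u) (W ×ˢ Ioo (-δ) δ ∩ {q | q.2 ≤ 0}) := by
      have h1 : ContinuousOn (fun q : X × ℝ => ∑ j, lam j • u (q.1, -a j * q.2))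
          (W ×ˢ Ioo (-δ) δ ∩ {q | q.2 ≤ 0}) := by
        refine continuousOn_finsetSum _ fun j _ => ContinuousOn.const_smul (hu.comp
          (f := fun q : X × ℝ => (q.1, -a j * q.2)) (by fun_prop) ?_) _
        rintro ⟨x, t⟩ ⟨⟨hx, ht⟩, ht0⟩
        have ht0' : t ≤ 0 := ht0
        refine ⟨hx, ?_, ?_⟩
        · nlinarith [(ha j).1]
        · have : -t < δ := by linarith [ht.1]
          nlinarith [(ha j).1, (ha j).2]
      exact h1.congr fun q hq => reflect_of_nonpos hq.2 hl0
    have c2 : ContinuousOn (reflect a lam u) (W ×ˢ Ioo (-δ) δ ∩ {q | 0 ≤ q.2}) :=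
      (hu.mono fun q hq => ⟨hq.1.1, hq.2, hq.1.2.2⟩).congr fun q hq => reflect_of_nonneg hq.2
    intro q hq
    rw [e]
    have k1 : ContinuousWithinAt (reflect a lam u) (W ×ˢ Ioo (-δ) δ ∩ {q | q.2 ≤ 0}) q := by
      by_cases h : q.2 ≤ 0
      · exact c1 q ⟨hq, h⟩
      · refine continuousWithinAt_of_notMem_closure fun hc => h ?_
        exact closure_minimal inter_subset_right (isClosed_le continuous_snd continuous_const) hc
    have k2 : ContinuousWithinAt (reflect a lam u) (W ×ˢ Ioo (-δ) δ ∩ {q | 0 ≤ q.2}) q := by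
      by_cases h : 0 ≤ q.2
      · exact c2 q ⟨hq, h⟩
      · refine continuousWithinAt_of_notMem_closure fun hc => h ?_
        exact closure_minimal inter_subset_right (isClosed_le continuous_const continuous_snd) hc
    exact k1.union k2
  | succ N ih =>
    have hl0 : ∑ j, lam j = 1 := by simpa using hl 0 (Nat.zero_le _)
    have hl1 : ∑ j, lam j * (-a j) = 1 := by simpa using hl 1 (by omega)
    rcases le_or_gt δ 0 with hδ | hδ
    · have : W ×ˢ Ioo (-δ) δ = ∅ := by rw [Ioo_eq_empty (by linarith), prod_empty]
      rw [this]
      exact contDiffOn_empty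
    have hS : UniqueDiffOn ℝ (W ×ˢ Ico 0 δ) := hW.uniqueDiffOn.prod (uniqueDiffOn_Ico 0 δ)
    have hO : IsOpen (W ×ˢ Ioo (-δ) δ) := hW.prod isOpen_Ioo
    set u' := fderivWithin ℝ u (W ×ˢ Ico 0 δ) with hu'
    have hd : ∀ q ∈ W ×ˢ Ico 0 δ, HasFDerivWithinAt u (u' q) (W ×ˢ Ico 0 δ) q := fun q hq =>
      (hu.differentiableOn (by simp) q hq).hasFDerivWithinAt
    have hu'C : ContDiffOn ℝ N u' (W ×ˢ Ico 0 δ) := hu.fderivWithin hS (by push_cast; exact le_rfl)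
    let uX : X × ℝ → X →L[ℝ] F := fun q => (u' q).comp (ContinuousLinearMap.inl ℝ X ℝ)
    let uT : X × ℝ → F := fun q => u' q (0, 1)
    have huX : ContDiffOn ℝ N uX (W ×ˢ Ico 0 δ) := hu'C.clm_comp contDiffOn_const
    have huT : ContDiffOn ℝ N uT (W ×ˢ Ico 0 δ) := hu'C.clm_apply contDiffOn_const
    have i1 := ih (fun i hi => hl i (by omega)) huX
    have i2 := ih (lam := fun j => lam j * (-a j)) (fun i hi => by
      rw [← hl (i + 1) (by omega)]
      exact Finset.sum_congr rfl fun j _ => by ring) huT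
    let v' : X × ℝ → X × ℝ →L[ℝ] F := fun q => (reflect a lam uX q).comp (ContinuousLinearMap.fst ℝ X ℝ) +
      (ContinuousLinearMap.snd ℝ X ℝ).smulRight (reflect a (fun j => lam j * (-a j)) uT q)
    have hv'C : ContDiffOn ℝ N v' (W ×ˢ Ioo (-δ) δ) :=
      (i1.clm_comp contDiffOn_const).add ((ContinuousLinearMap.smulRightL ℝ (X × ℝ) F
        (ContinuousLinearMap.snd ℝ X ℝ)).contDiff.comp_contDiffOn i2)
    have split : ∀ L : X × ℝ →L[ℝ] F, (L.comp (ContinuousLinearMap.inl ℝ X ℝ)).comp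
        (ContinuousLinearMap.fst ℝ X ℝ) + (ContinuousLinearMap.snd ℝ X ℝ).smulRight (L (0, 1)) = L := by
      intro L
      ext v
      · simp
      · simp [← Prod.zero_eq_mk]
    -- the derivative from above
    have up : ∀ q ∈ W ×ˢ Ico 0 δ, HasFDerivWithinAt (reflect a lam u) (v' q) (W ×ˢ Ico 0 δ) q := by
      intro q hq
      have e : v' q = u' q := by
        simp only [v', reflect_of_nonneg hq.2.1]
        exact split (u' q)
      rw [e]
      exact (hd q hq).congr (fun y hy => reflect_of_nonneg hy.2.1) (reflect_of_nonneg hq.2.1)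
    -- the derivative from below
    have low : ∀ q ∈ W ×ˢ Ioc (-δ) 0, HasFDerivWithinAt (reflect a lam u) (v' q) (W ×ˢ Ioc (-δ) 0) q := by
      intro q hq
      have e : v' q = ∑ j, lam j • (u' (q.1, -a j * q.2)).comp ((ContinuousLinearMap.fst ℝ X ℝ).prod
          (-a j • ContinuousLinearMap.snd ℝ X ℝ)) := by
        simp only [v']
        rw [reflect_of_nonpos hq.2.2 hl0, reflect_of_nonpos hq.2.2 hl1]
        ext v
        · simp [uX, sum_apply]
        · have h3 : ∀ (L : X × ℝ →L[ℝ] F) (r : ℝ), L (0, -r) = -(r • L (0, 1)) := fun L r => by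
            rw [← map_smul, ← map_neg]; simp
          simp [uT, sum_apply, h3]
          exact Finset.sum_congr rfl fun j _ => SemigroupAction.mul_smul _ _ _
      rw [e]
      exact (hasFDerivWithinAt_reflected ha hd hq).congr (fun y hy => reflect_of_nonpos hy.2.2 hl0)
        (reflect_of_nonpos hq.2.2 hl0)
    have full : ∀ q ∈ W ×ˢ Ioo (-δ) δ, HasFDerivAt (reflect a lam u) (v' q) q := by
      rintro ⟨x, t⟩ hq
      have hWn : W ∈ 𝓝 x := hW.mem_nhds hq.1
      rcases lt_trichotomy t 0 with h | h | h
      · exact (low (x, t) ⟨hq.1, hq.2.1, h.le⟩).hasFDerivAt (prod_mem_nhds hWn (Ioc_mem_nhds hq.2.1 h))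
      · subst h
        have h1 := (up (x, 0) ⟨hq.1, le_rfl, hδ⟩).union (low (x, 0) ⟨hq.1, by linarith, le_rfl⟩)
        refine h1.hasFDerivAt ?_
        rw [← prod_union, union_comm, Ioc_union_Ico_eq_Ioo (by linarith) hδ]
        exact prod_mem_nhds hWn (Ioo_mem_nhds (by linarith) hδ)
      · exact (up (x, t) ⟨hq.1, h.le, hq.2.2⟩).hasFDerivAt (prod_mem_nhds hWn (Ico_mem_nhds h hq.2.2))
    push_cast
    rw [contDiffOn_succ_iff_fderiv_of_isOpen hO]
    refine ⟨fun q hq => (full q hq).differentiableAt.differentiableWithinAt, by simp, ?_⟩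
    exact hv'C.congr fun q hq => (full q hq).fderiv

/-- A `C^N` function on a half space extends to a `C^N` function. -/
theorem exists_contDiffOn_extension (N : ℕ) {W : Set X} (hW : IsOpen W) {δ : ℝ}
    {u : X × ℝ → F} (hu : ContDiffOn ℝ N u (W ×ˢ Ico 0 δ)) :
    ∃ v : X × ℝ → F, ContDiffOn ℝ N v (W ×ˢ Ioo (-δ) δ) ∧ (∀ q, 0 ≤ q.2 → v q = u q) := by
  obtain ⟨a, lam, ha, hl⟩ := exists_reflection_coeffs N
  exact ⟨reflect a lam u, contDiffOn_reflect ha hl hW hu, fun q hq => reflect_of_nonneg hq⟩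

end Reflection

/-! ### Smooth dependence of the solutions of ordinary differential equations -/

section Nemytskii

variable {T : Type} [TopologicalSpace T] [CompactSpace T]
  {E F : Type} [NormedAddCommGroup E] [NormedSpace ℝ E] [NormedAddCommGroup F] [NormedSpace ℝ F]

/-- Pointwise application, as a map on spaces of continuous functions. -/
noncomputable def applyL : C(T, E →L[ℝ] F) →L[ℝ] C(T, E) →L[ℝ] C(T, F) :=
  LinearMap.mkContinuous₂ (LinearMap.mk₂ ℝ
    (fun (A : C(T, E →L[ℝ] F)) (v : C(T, E)) => (⟨fun t => A t (v t), by fun_prop⟩ : C(T, F)))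
    (fun A B v => by ext; simp) (fun a A v => by ext; simp) (fun A v w => by ext; simp)
    (fun a A v => by ext; simp)) 1 (fun A v => by
      refine (ContinuousMap.norm_le _ (by positivity)).2 fun t => ?_
      refine ((A t).le_opNorm (v t)).trans ?_
      rw [one_mul]
      exact mul_le_mul (A.norm_coe_le_norm t) (v.norm_coe_le_norm t) (norm_nonneg _) (norm_nonneg _))

/-- The range of the path is compact, so `Z'` is uniformly continuous around it, and the pointwise
mean value inequality holds uniformly in `t`. -/
theorem hasFDerivAt_postcomp {Z : E → F} {Z' : E → E →L[ℝ] F} (hZ : Continuous Z)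
    (hZ' : Continuous Z') (h : ∀ x, HasFDerivAt Z (Z' x) x) (u : C(T, E)) :
    HasFDerivAt (fun u : C(T, E) => (⟨Z, hZ⟩ : C(E, F)).comp u)
      (applyL ((⟨Z', hZ'⟩ : C(E, E →L[ℝ] F)).comp u)) u := by
  rw [hasFDerivAt_iff_isLittleO_nhds_zero, Asymptotics.isLittleO_iff]
  intro c hc
  have huc := (isCompact_range u.continuous).uniformContinuousAt_of_continuousAt Z'
    (fun a _ => hZ'.continuousAt) (Metric.dist_mem_uniformity hc)
  obtain ⟨δ, hδ, hd⟩ := Metric.mem_uniformity_dist.1 huc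
  filter_upwards [Metric.ball_mem_nhds (0 : C(T, E)) hδ] with v hv
  rw [mem_ball_zero_iff] at hv
  refine (ContinuousMap.norm_le _ (by positivity)).2 fun t => ?_
  have hvt : ‖v t‖ ≤ ‖v‖ := v.norm_coe_le_norm t
  have h1 := (convex_ball (u t) δ).norm_image_sub_le_of_norm_hasFDerivWithin_le' (f := Z) (f' := Z')
    (φ := Z' (u t)) (C := c) (x := u t) (y := u t + v t) (fun x _ => (h x).hasFDerivWithinAt)
    (fun x hx => by
      have h2 := hd (a := u t) (b := x) (by rw [dist_comm]; exact hx) (mem_range_self t)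
      rw [← dist_eq_norm, dist_comm]
      exact le_of_lt h2) (Metric.mem_ball_self hδ) (by
      rw [Metric.mem_ball, dist_eq_norm, add_sub_cancel_left]; exact hvt.trans_lt hv)
  rw [add_sub_cancel_left] at h1
  exact h1.trans (mul_le_mul_of_nonneg_left hvt hc.le)

/-- The derivative is the same kind of map, composition with `Z'`, followed by the continuous linear
map `applyL`. -/
theorem contDiff_postcomp (N : ℕ) {Z : E → F} (hZ : ContDiff ℝ N Z) :
    ContDiff ℝ N (fun u : C(T, E) => (⟨Z, hZ.continuous⟩ : C(E, F)).comp u) := by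
  induction N generalizing F with
  | zero =>
    simp only [Nat.cast_zero, contDiff_zero]
    exact ContinuousMap.continuous_postcomp _
  | succ N ih =>
    push_cast at hZ ⊢
    obtain ⟨Z', hZ', hd⟩ := contDiff_succ_iff_hasFDerivAt.1 hZ
    have h1 := (applyL (T := T) (E := E) (F := F)).contDiff.comp (ih hZ') (n := N)
    exact contDiff_succ_iff_hasFDerivAt.2 ⟨fun u => applyL ((⟨Z', hZ'.continuous⟩ : C(E, E →L[ℝ] F)).comp u),
      h1, fun u => hasFDerivAt_postcomp hZ.continuous hZ'.continuous hd u⟩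

end Nemytskii

section Flow

variable {E : Type} [NormedAddCommGroup E] [NormedSpace ℝ E] [FiniteDimensional ℝ E]

/-- The primitive of a path on `[-1, 1]` that vanishes at `0`. -/
noncomputable def pathPrimitive (E : Type) [NormedAddCommGroup E] [NormedSpace ℝ E] :
    C(Icc (-1 : ℝ) 1, E) →L[ℝ] C(Icc (-1 : ℝ) 1, E) :=
  LinearMap.mkContinuous
    { toFun := fun u => ⟨fun t => ∫ s in (0 : ℝ)..t, IccExtend (by norm_num) u s,
        (intervalIntegral.continuous_primitive (fun a b =>
          (u.continuous.Icc_extend' (h := by norm_num)).intervalIntegrable a b) 0).comp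
          continuous_subtype_val⟩
      map_add' := fun u v => by
        ext t
        exact intervalIntegral.integral_add
          ((u.continuous.Icc_extend' (h := by norm_num)).intervalIntegrable _ _)
          ((v.continuous.Icc_extend' (h := by norm_num)).intervalIntegrable _ _)
      map_smul' := fun a u => by
        ext t
        exact intervalIntegral.integral_smul a (IccExtend (by norm_num) u) } 1 (fun u => by
    refine (ContinuousMap.norm_le _ (by positivity)).2 fun t => ?_
    have h := intervalIntegral.norm_integral_le_of_norm_le_const (a := (0 : ℝ)) (b := t) (C := ‖u‖)
      (f := IccExtend (by norm_num) u) (fun s _ => u.norm_coe_le_norm _)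
    refine h.trans ?_
    rw [one_mul, sub_zero]
    exact mul_le_of_le_one_right (norm_nonneg _) (abs_le.2 t.2))

/-- The path `s ↦ u (r s)`. -/
noncomputable def rescalePath (r : Icc (-1 : ℝ) 1) (u : C(Icc (-1 : ℝ) 1, E)) : C(Icc (-1 : ℝ) 1, E) :=
  u.comp ⟨fun s => ⟨r * s, by
    have := abs_le.1 ((abs_mul (r : ℝ) s).le.trans
      (mul_le_one₀ (abs_le.2 r.2) (abs_nonneg _) (abs_le.2 s.2)))
    exact this⟩, by fun_prop⟩

/-- The path `u(s) = Y(y, t s)` on `[-1, 1]` solves `u(s) = y + t ∫₀ˢ Z(u)`. At `t = 0` the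
linearization in `u` is the identity, so the implicit function theorem gives `u` as a `C^N` function
of `(y, t)`; the flow is its value at `s = 1`. -/
theorem exists_contDiff_flow_of_contDiff {N : ℕ} (hN : N ≠ 0) {Z : E → E} (hZ : ContDiff ℝ N Z)
    (z : E) : ∃ Y : E × ℝ → E, ContDiffAt ℝ N Y (z, 0) ∧ (∀ᶠ y in 𝓝 z, Y (y, 0) = y) ∧
      ∀ᶠ q in 𝓝 (z, (0 : ℝ)), HasDerivAt (fun t => Y (q.1, t)) (Z (Y q)) q.2 := by
  have : CompleteSpace E := FiniteDimensional.complete ℝ E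
  let P := C(Icc (-1 : ℝ) 1, E)
  let NZ : P → P := fun u => (⟨Z, hZ.continuous⟩ : C(E, E)).comp u
  have hNZ : ContDiff ℝ N NZ := contDiff_postcomp N hZ
  let cst : E →L[ℝ] P := ContinuousLinearMap.const ℝ _
  let G : (E × ℝ) × P → P := fun w => w.2 - cst w.1.1 - w.1.2 • pathPrimitive E (NZ w.2)
  have hG : ContDiff ℝ N G := by
    have : ContDiff ℝ N (fun w : (E × ℝ) × P => NZ w.2) := hNZ.comp contDiff_snd
    fun_prop
  have hN' : (N : WithTop ℕ∞) ≠ 0 := by exact_mod_cast hN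
  let w0 : (E × ℝ) × P := ((z, 0), cst z)
  have hinv : (fderiv ℝ G w0 ∘L ContinuousLinearMap.inr ℝ (E × ℝ) P).IsInvertible := by
    have h1 : HasFDerivAt (fun u : P => G ((z, 0), u))
        (fderiv ℝ G w0 ∘L ContinuousLinearMap.inr ℝ (E × ℝ) P) (cst z) :=
      HasFDerivAt.comp (cst z) (g := G) (f := fun u : P => ((z, (0 : ℝ)), u))
        ((hG.differentiable hN').differentiableAt.hasFDerivAt)
        (hasFDerivAt_prodMk_right (z, (0 : ℝ)) (cst z))
    have h2 : HasFDerivAt (fun u : P => G ((z, 0), u)) (ContinuousLinearMap.id ℝ P) (cst z) := by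
      have : (fun u : P => G ((z, 0), u)) = fun u => u - cst z := by
        funext u; simp [G]
      rw [this]
      exact (hasFDerivAt_id _).sub_const _
    rw [h1.unique h2]
    exact ⟨ContinuousLinearEquiv.refl ℝ P, rfl⟩
  have hGat : ContDiffAt ℝ N G w0 := hG.contDiffAt
  let S : E × ℝ → P := hGat.implicitFunction hN' hinv
  have hS0 : S (z, 0) = cst z := hGat.implicitFunction_apply_self hN' hinv
  have hSC : ContDiffAt ℝ N S (z, 0) := hGat.contDiffAt_implicitFunction hN' hinv
  have hw0 : G w0 = 0 := by simp [G, w0]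
  have hsol : ∀ᶠ x in 𝓝 (z, (0 : ℝ)), G (x, S x) = 0 := by
    have := hGat.eventually_apply_implicitFunction hN' hinv
    rw [hw0] at this
    exact this
  have huniq : ∀ᶠ v in 𝓝 w0, G v = 0 → S v.1 = v.2 := by
    filter_upwards [hGat.eventually_apply_eq_iff_implicitFunction hN' hinv] with v hv
    rw [hw0] at hv
    exact hv.1
  let one : Icc (-1 : ℝ) 1 := ⟨1, by norm_num⟩
  let Y : E × ℝ → E := fun q => S q one
  have hYC : ContDiffAt ℝ N Y (z, 0) :=
    (ContinuousMap.evalCLM ℝ one : P →L[ℝ] E).contDiff.contDiffAt.comp (z, 0) hSC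
  -- the integral equation
  have heq : ∀ q, G (q, S q) = 0 → ∀ s : Icc (-1 : ℝ) 1,
      S q s = q.1 + q.2 • ∫ σ in (0 : ℝ)..s, Z (IccExtend (by norm_num) (S q) σ) := by
    intro q hq s
    have h := congrArg (fun u : P => u s) hq
    change S q s - q.1 - q.2 • ∫ σ in (0 : ℝ)..s, Z (IccExtend (by norm_num) (S q) σ) = 0 at h
    rw [sub_eq_zero, sub_eq_iff_eq_add] at h
    rw [h, add_comm]
  obtain ⟨ρ, hρ, hball⟩ := Metric.eventually_nhds_iff.1 huniq
  have hev : ∀ᶠ q in 𝓝 (z, (0 : ℝ)), G (q, S q) = 0 ∧ dist (S q) (cst z) < ρ ∧ dist q (z, 0) < ρ :=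
    hsol.and (((hSC.continuousAt.tendsto.eventually (by
      rw [hS0]; exact Metric.ball_mem_nhds _ hρ))).and (Metric.ball_mem_nhds _ hρ))
  obtain ⟨η, hη, hηb⟩ := Metric.eventually_nhds_iff.1 hev
  -- rescaling
  have hresc : ∀ y t, dist (y, t) (z, (0 : ℝ)) < η → ∀ r : Icc (-1 : ℝ) 1,
      S (y, t * r) = rescalePath r (S (y, t)) := by
    intro y t hyt r
    obtain ⟨e1, e2, e3⟩ := hηb hyt
    have hr : |(r : ℝ)| ≤ 1 := abs_le.2 r.2
    refine hball (y := ((y, t * r), rescalePath r (S (y, t)))) ?_ ?_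
    · rw [Prod.dist_eq, max_lt_iff]
      constructor
      · refine lt_of_le_of_lt ?_ e3
        rw [Prod.dist_eq, Prod.dist_eq]
        refine max_le_max le_rfl ?_
        change dist (t * (r : ℝ)) 0 ≤ dist t 0
        simp only [dist_zero_right, Real.norm_eq_abs, abs_mul]
        exact mul_le_of_le_one_right (abs_nonneg _) hr
      · refine lt_of_le_of_lt ?_ e2
        refine (ContinuousMap.dist_le dist_nonneg).2 fun s => ?_
        exact ContinuousMap.dist_apply_le_dist (f := S (y, t)) (g := cst z) _
    · ext s
      change rescalePath r (S (y, t)) s - y - (t * r) • ∫ σ in (0 : ℝ)..s,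
        Z (IccExtend (by norm_num) (rescalePath r (S (y, t))) σ) = 0
      rw [sub_eq_zero, sub_eq_iff_eq_add]
      change S (y, t) _ = _
      rw [heq _ e1, add_comm]
      congr 1
      change t • ∫ σ in (0 : ℝ)..(r * s : ℝ), Z (IccExtend (by norm_num) (S (y, t)) σ) = _
      rw [mul_smul]
      congr 1
      have h5 := intervalIntegral.smul_integral_comp_mul_left (a := (0 : ℝ)) (b := s)
        (fun σ => Z (IccExtend (by norm_num) (S (y, t)) σ)) (r : ℝ)
      rw [mul_zero] at h5
      rw [← h5]
      congr 1
      refine intervalIntegral.integral_congr fun σ hσ => ?_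
      have hσ' : σ ∈ Icc (-1 : ℝ) 1 :=
        uIcc_subset_Icc (by norm_num : (0 : ℝ) ∈ Icc (-1 : ℝ) 1) s.2 hσ
      have hrσ : (r : ℝ) * σ ∈ Icc (-1 : ℝ) 1 := abs_le.1 ((abs_mul (r : ℝ) σ).le.trans
        (mul_le_one₀ hr (abs_nonneg _) (abs_le.2 hσ')))
      change Z _ = Z _
      rw [IccExtend_of_mem _ _ hσ', IccExtend_of_mem _ _ hrσ]
      rfl
  refine ⟨Y, hYC, ?_, ?_⟩
  · have : Tendsto (fun y : E => (y, (0 : ℝ))) (𝓝 z) (𝓝 (z, 0)) :=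
      (Continuous.prodMk_left (0 : ℝ)).tendsto z
    filter_upwards [this.eventually hsol] with y hy
    change S (y, 0) one = y
    rw [heq _ hy]; simp
  -- By the rescaling property one path for the time `t₁` contains the solution for all shorter
  -- times, and its integral equation can be differentiated in `t`.
  · let t₁ : ℝ := η / 2
    have ht₁ : 0 < t₁ := by positivity
    have hmem : Metric.ball z η ×ˢ Ioo (-t₁) t₁ ∈ 𝓝 (z, (0 : ℝ)) :=
      prod_mem_nhds (Metric.ball_mem_nhds _ hη) (Ioo_mem_nhds (by linarith) ht₁)
    filter_upwards [hmem] with ⟨y, t⟩ ⟨hy, ht⟩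
    have hyt : dist (y, t₁) (z, (0 : ℝ)) < η := by
      rw [Prod.dist_eq, max_lt_iff]
      refine ⟨hy, ?_⟩
      rw [dist_zero_right, Real.norm_of_nonneg ht₁.le]
      exact half_lt_self hη
    let w : ℝ → E := fun σ => Z (IccExtend (by norm_num) (S (y, t₁)) σ)
    have hw : Continuous w := hZ.continuous.comp ((S (y, t₁)).continuous.Icc_extend' (h := by norm_num))
    have hr : ∀ t ∈ Ioo (-t₁) t₁, t / t₁ ∈ Icc (-1 : ℝ) 1 := fun t ht =>
      ⟨by rw [le_div_iff₀ ht₁]; linarith [ht.1], by rw [div_le_iff₀ ht₁]; linarith [ht.2]⟩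
    have hY : ∀ t (ht : t ∈ Ioo (-t₁) t₁), Y (y, t) = S (y, t₁) ⟨t / t₁, hr t ht⟩ := by
      intro t ht
      have h6 := hresc y t₁ hyt ⟨t / t₁, hr t ht⟩
      simp only [mul_div_cancel₀ t ht₁.ne'] at h6
      change S (y, t) one = _
      rw [h6]
      change S (y, t₁) _ = _
      congr 1
      ext
      exact mul_one _
    have hd : HasDerivAt (fun t => y + t₁ • ∫ σ in (0 : ℝ)..(t / t₁), w σ) (w (t / t₁)) t := by
      have h7 : HasDerivAt (fun b => ∫ σ in (0 : ℝ)..b, w σ) (w (t / t₁)) (t / t₁) :=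
        intervalIntegral.integral_hasDerivAt_right (hw.intervalIntegrable _ _)
          (hw.stronglyMeasurableAtFilter _ _) hw.continuousAt
      have h8 := ((h7.scomp t ((hasDerivAt_id t).div_const t₁)).const_smul t₁).const_add y
      refine h8.congr_deriv ?_
      rw [smul_smul, one_div, mul_inv_cancel₀ ht₁.ne', one_smul]
    have hw' : w (t / t₁) = Z (Y (y, t)) := by
      simp only [w]
      rw [IccExtend_of_mem _ _ (hr t ht), hY t ht]
    rw [← hw']
    refine hd.congr_of_eventuallyEq ?_
    filter_upwards [isOpen_Ioo.mem_nhds ht] with s hs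
    rw [hY s hs, heq _ (hηb hyt).1]

/-- The local flow of a `C^N` vector field is `C^N`. -/
theorem exists_contDiffAt_flow {N : ℕ} (hN : N ≠ 0) {Z : E → E} {z : E} (hZ : ContDiffAt ℝ N Z z) :
    ∃ Y : E × ℝ → E, ContDiffAt ℝ N Y (z, 0) ∧ (∀ᶠ y in 𝓝 z, Y (y, 0) = y) ∧
      ∀ᶠ q in 𝓝 (z, (0 : ℝ)), HasDerivAt (fun t => Y (q.1, t)) (Z (Y q)) q.2 := by
  obtain ⟨V, hV, hZV⟩ := hZ.contDiffOn le_rfl (by simp)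
  obtain ⟨ε, hε, hεV⟩ := Metric.mem_nhds_iff.1 hV
  -- The cut-off makes the field globally `C^N`. It equals 1 near `z`, where the solution stays for
  -- initial values near `z` and small times.
  let χ : ContDiffBump z := ⟨ε / 4, ε / 2, by positivity, by linarith⟩
  have hχ : ContDiff ℝ N (fun y => χ y • Z y) := by
    rw [contDiff_iff_contDiffAt]
    intro y
    by_cases hy : y ∈ Metric.ball z ε
    · exact χ.contDiffAt.smul ((hZV.mono hεV).contDiffAt (Metric.isOpen_ball.mem_nhds hy))
    · have h0 : (fun y => χ y • Z y) =ᶠ[𝓝 y] fun _ => 0 := by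
        have hy' : y ∈ (tsupport χ)ᶜ := by
          rw [χ.tsupport_eq]
          intro h
          have h' : dist y z ≤ ε / 2 := h
          exact hy (by rw [Metric.mem_ball]; linarith)
        filter_upwards [(isClosed_tsupport χ).isOpen_compl.mem_nhds hy'] with x hx
        rw [image_eq_zero_of_notMem_tsupport hx, zero_smul]
      exact contDiffAt_const.congr_of_eventuallyEq h0
  obtain ⟨Y, hY, hY0, hYd⟩ := exists_contDiff_flow_of_contDiff hN hχ z
  refine ⟨Y, hY, hY0, ?_⟩
  have h1 : Tendsto Y (𝓝 (z, 0)) (𝓝 z) := by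
    have := hY.continuousAt.tendsto
    rwa [hY0.self_of_nhds] at this
  filter_upwards [hYd, h1.eventually χ.eventuallyEq_one] with q hq hq1
  rw [hq1] at hq
  simpa using hq

end Flow

/-! ### Local geometry of a smooth domain -/

section Domain

variable {n : ℕ} {Ω : Set (Eu n)} {p : Eu n} {r : Eu n → ℝ}

theorem eventually_lt_of_fderiv_neg {E : Type} [NormedAddCommGroup E] [NormedSpace ℝ E] {r : E → ℝ}
    {q v : E} (h : DifferentiableAt ℝ r q) (h0 : r q = 0) (hv : fderiv ℝ r q v < 0) :
    ∀ᶠ s in 𝓝[>] (0 : ℝ), r (q + s • v) < 0 := by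
  have h1 : HasDerivAt (fun s : ℝ => r (q + s • v)) (fderiv ℝ r q v) 0 := by
    have h2 : HasDerivAt (fun s : ℝ => q + s • v) v 0 := by
      simpa using ((hasDerivAt_id (0 : ℝ)).smul_const v).const_add q
    have h3 : HasFDerivAt r (fderiv ℝ r q) (q + (0 : ℝ) • v) := by simpa using h.hasFDerivAt
    exact h3.comp_hasDerivAt (0 : ℝ) h2
  have h4 := (hasDerivAt_iff_tendsto_slope.1 h1).mono_left (nhdsGT_le_nhdsNE 0)
  filter_upwards [h4.eventually (gt_mem_nhds hv), self_mem_nhdsWithin] with s hs hs0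
  have hs0' : (0 : ℝ) < s := hs0
  rw [slope_def_field] at hs
  simp only [zero_smul, add_zero, h0, sub_zero] at hs
  exact neg_of_div_neg_left hs hs0'.le

theorem IsLocalDefiningFunction.eventually (h : IsLocalDefiningFunction Ω p r) :
    ∀ᶠ q in 𝓝 p, IsLocalDefiningFunction Ω q r := by
  obtain ⟨O, hO, hpO, hr, hd, hΩ⟩ := h
  have h1 : ContinuousAt (fderiv ℝ r) p :=
    (hr.contDiffAt (hO.mem_nhds hpO)).continuousAt_fderiv (by simp)
  filter_upwards [hO.mem_nhds hpO, h1.eventually_ne hd] with q hq hq'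
  exact ⟨O, hO, hq, hr, hq', hΩ⟩

theorem IsLocalDefiningFunction.contDiffAt (h : IsLocalDefiningFunction Ω p r) :
    ContDiffAt ℝ ∞ r p := by
  obtain ⟨O, hO, hpO, hr, hd, hΩ⟩ := h
  exact hr.contDiffAt (hO.mem_nhds hpO)

theorem IsLocalDefiningFunction.mem_iff (h : IsLocalDefiningFunction Ω p r) : p ∈ Ω ↔ r p < 0 := by
  obtain ⟨O, hO, hpO, hr, hd, hΩ⟩ := h
  exact hΩ p hpO

theorem IsLocalDefiningFunction.mem_closure_iff (h : IsLocalDefiningFunction Ω p r) :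
    p ∈ closure Ω ↔ r p ≤ 0 := by
  have hc : ContinuousAt r p := h.contDiffAt.continuousAt
  obtain ⟨O, hO, hpO, hr, hd, hΩ⟩ := id h
  constructor
  · intro hp
    by_contra hn
    rw [mem_closure_iff_frequently] at hp
    refine hp ?_
    filter_upwards [hO.mem_nhds hpO, hc.eventually (lt_mem_nhds (not_le.1 hn))] with q hq hq0 hqΩ
    exact absurd ((hΩ q hq).1 hqΩ) (not_lt.2 hq0.le)
  · intro hp
    rcases hp.lt_or_eq with h0 | h0
    · exact subset_closure (h.mem_iff.2 h0)
    · obtain ⟨v, hv⟩ : ∃ v, fderiv ℝ r p v < 0 := by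
        obtain ⟨w, hw⟩ := DFunLike.ne_iff.1 hd
        rcases lt_or_gt_of_ne hw with h1 | h1
        · exact ⟨w, h1⟩
        · exact ⟨-w, by rw [map_neg]; simpa using h1⟩
      have h1 := eventually_lt_of_fderiv_neg (h.contDiffAt.differentiableAt (by simp)) h0 hv
      have h2 : Tendsto (fun s : ℝ => p + s • v) (𝓝[>] 0) (𝓝 p) := by
        have : Continuous fun s : ℝ => p + s • v := by fun_prop
        simpa using (this.tendsto 0).mono_left nhdsWithin_le_nhds
      refine mem_closure_of_tendsto h2 ?_
      filter_upwards [h1, h2.eventually (hO.mem_nhds hpO)] with s hs hsO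
      exact (hΩ _ hsO).2 hs

theorem IsLocalDefiningFunction.eq_zero (h : IsLocalDefiningFunction Ω p r)
    (hΩ : IsOpen Ω) (hp : p ∈ frontier Ω) : r p = 0 := by
  refine le_antisymm (h.mem_closure_iff.1 hp.1) (not_lt.1 fun hn => ?_)
  rw [hΩ.frontier_eq] at hp
  exact hp.2 (h.mem_iff.2 hn)

/-- At a boundary point the tangent cone contains, up to scaling, every vector along which `r`
decreases, and these vectors span the space. -/
theorem IsSmoothDomain.uniqueDiffOn (hΩ : IsSmoothDomain Ω) : UniqueDiffOn ℝ (closure Ω) := by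
  intro p hp
  by_cases hpΩ : p ∈ Ω
  · exact (hΩ.isOpen.uniqueDiffWithinAt hpΩ).mono subset_closure
  have hpf : p ∈ frontier Ω := by rw [hΩ.isOpen.frontier_eq]; exact ⟨hp, hpΩ⟩
  obtain ⟨r, h⟩ := hΩ.smooth_boundary p hpf
  have h0 := h.eq_zero hΩ.isOpen hpf
  rw [uniqueDiffWithinAt_iff]
  refine ⟨?_, subset_closure hp⟩
  have hneg : ∀ v, fderiv ℝ r p v < 0 → v ∈ Submodule.span ℝ (tangentConeAt ℝ (closure Ω) p) := by
    intro v hv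
    have h1 := eventually_lt_of_fderiv_neg (h.contDiffAt.differentiableAt (by simp)) h0 hv
    have h2 : Tendsto (fun s : ℝ => p + s • v) (𝓝[>] 0) (𝓝 p) := by
      have : Continuous fun s : ℝ => p + s • v := by fun_prop
      simpa using (this.tendsto 0).mono_left nhdsWithin_le_nhds
    obtain ⟨ε, hε, hs⟩ := mem_nhdsGT_iff_exists_Ioo_subset.1 (h1.and (h2.eventually h.eventually))
    have hε' : (0 : ℝ) < ε := hε
    have hseg : openSegment ℝ p (p + ε • v) ⊆ closure Ω := by
      rw [openSegment_eq_image']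
      rintro _ ⟨θ, hθ, rfl⟩
      have hm := hs (a := θ * ε) ⟨by nlinarith [hθ.1], by nlinarith [hθ.2]⟩
      simp only [add_sub_cancel_left, smul_smul]
      exact hm.2.mem_closure_iff.2 hm.1.le
    have h3 := mem_tangentConeAt_of_openSegment_subset hseg
    rw [add_sub_cancel_left] at h3
    have h4 := Submodule.smul_mem _ ε⁻¹ (Submodule.subset_span (R := ℝ) h3)
    rwa [smul_smul, inv_mul_cancel₀ hε'.ne', one_smul] at h4
  obtain ⟨O, hO, hpO, hr, hd, -⟩ := id h
  obtain ⟨v, hv⟩ : ∃ v, fderiv ℝ r p v < 0 := by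
    obtain ⟨w, hw⟩ := DFunLike.ne_iff.1 hd
    rcases lt_or_gt_of_ne hw with h1 | h1
    · exact ⟨w, h1⟩
    · exact ⟨-w, by rw [map_neg]; simpa using h1⟩
  have htop : Submodule.span ℝ (tangentConeAt ℝ (closure Ω) p) = ⊤ := by
    rw [eq_top_iff]
    intro w _
    obtain ⟨l, hl⟩ : ∃ l : ℝ, fderiv ℝ r p w + l * fderiv ℝ r p v < 0 := by
      refine ⟨(fderiv ℝ r p w + 1) / (-fderiv ℝ r p v), ?_⟩
      have : (fderiv ℝ r p w + 1) / (-fderiv ℝ r p v) * fderiv ℝ r p v = -(fderiv ℝ r p w + 1) := by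
        field_simp [hv.ne]
      rw [this]; linarith
    have h5 := Submodule.sub_mem _ (hneg (w + l • v) (by simpa using hl))
      (Submodule.smul_mem _ l (hneg v hv))
    simpa using h5
  rw [htop]
  exact dense_univ

/-- A function that vanishes on `{t = 0}` and decreases in `t` has the sign of `-t`. -/
theorem eventually_sign_of_deriv_neg {X : Type} [NormedAddCommGroup X] [NormedSpace ℝ X]
    {u : X × ℝ → ℝ} {x : X} (hu : ContDiffAt ℝ 1 u (x, 0)) (h0 : ∀ᶠ y in 𝓝 x, u (y, 0) = 0)
    (hd : fderiv ℝ u (x, 0) (0, 1) < 0) :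
    ∀ᶠ q in 𝓝 (x, (0 : ℝ)), (u q < 0 ↔ 0 < q.2) ∧ (u q ≤ 0 ↔ 0 ≤ q.2) := by
  have hc : ContinuousAt (fun q => fderiv ℝ u q (0, 1)) (x, 0) :=
    (hu.continuousAt_fderiv (by simp)).clm_apply continuousAt_const
  have hev : ∀ᶠ q in 𝓝 (x, (0 : ℝ)), fderiv ℝ u q (0, 1) < 0 ∧ DifferentiableAt ℝ u q ∧ u (q.1, 0) = 0 := by
    have h0' : ∀ᶠ q : X × ℝ in 𝓝 (x, (0 : ℝ)), u (q.1, 0) = 0 :=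
      (continuous_fst.tendsto (x, (0 : ℝ))).eventually h0
    exact (hc.eventually (gt_mem_nhds hd)).and ((eventually_differentiableAt hu one_ne_zero).and h0')
  obtain ⟨ε, hε, hb⟩ := Metric.eventually_nhds_iff.1 hev
  filter_upwards [prod_mem_nhds (Metric.ball_mem_nhds x hε) (Metric.ball_mem_nhds (0 : ℝ) hε)]
    with ⟨y, t⟩ ⟨hy, ht⟩
  have hin : ∀ s ∈ Metric.ball (0 : ℝ) ε, dist (y, s) (x, (0 : ℝ)) < ε := fun s hs => by
    rw [Prod.dist_eq]; exact max_lt hy hs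
  have hder : ∀ s ∈ Metric.ball (0 : ℝ) ε, HasDerivAt (fun s => u (y, s)) (fderiv ℝ u (y, s) (0, 1)) s := by
    intro s hs
    have h2 : HasDerivAt (fun s : ℝ => (y, s)) ((0 : X), (1 : ℝ)) s :=
      (hasDerivAt_const s y).prodMk (hasDerivAt_id s)
    exact (hb (hin s hs)).2.1.hasFDerivAt.comp_hasDerivAt s h2
  have hanti : StrictAntiOn (fun s => u (y, s)) (Metric.ball (0 : ℝ) ε) := by
    refine strictAntiOn_of_deriv_neg (convex_ball 0 ε)
      (fun s hs => (hder s hs).continuousAt.continuousWithinAt) fun s hs => ?_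
    rw [Metric.isOpen_ball.interior_eq] at hs
    rw [(hder s hs).deriv]
    exact (hb (hin s hs)).1
  have h00 : u (y, 0) = 0 := (hb (hin 0 (Metric.mem_ball_self hε))).2.2
  have k1 := hanti.lt_iff_gt (Metric.mem_ball_self hε) ht
  have k2 := hanti.le_iff_ge (Metric.mem_ball_self hε) ht
  have k3 := hanti.lt_iff_gt ht (Metric.mem_ball_self hε)
  have k4 := hanti.le_iff_ge ht (Metric.mem_ball_self hε)
  simp only [h00] at k1 k2 k3 k4
  exact ⟨k3, k4⟩

end Domain

/-! ### Uniqueness of solutions of ordinary differential equations -/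

section Uniqueness

variable {E : Type} [NormedAddCommGroup E] [NormedSpace ℝ E]

/-- Uniqueness for ordinary differential equations whose right side is `C¹` along one solution. -/
theorem eqOn_of_ode {Z : E → E} {D : Set E} (hZ : ∀ y ∈ D, ContDiffAt ℝ 1 Z y) {y₁ y₂ : ℝ → E} {a b : ℝ}
    (h₁ : ContinuousOn y₁ (Icc a b)) (h₂ : ContinuousOn y₂ (Icc a b))
    (d₁ : ∀ t ∈ Ico a b, y₁ t ∈ D → HasDerivWithinAt y₁ (Z (y₁ t)) (Ici t) t)
    (d₂ : ∀ t ∈ Ico a b, y₂ t ∈ D → HasDerivWithinAt y₂ (Z (y₂ t)) (Ici t) t)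
    (hD : IsOpen D) (h₂D : ∀ t ∈ Icc a b, y₂ t ∈ D) (h0 : y₁ a = y₂ a) : EqOn y₁ y₂ (Icc a b) := by
  have hcl : IsClosed ({t | y₁ t = y₂ t} ∩ Icc a b) := by
    have h : ContinuousOn (fun t => y₁ t - y₂ t) (Icc a b) := h₁.sub h₂
    have := h.preimage_isClosed_of_isClosed isClosed_Icc (isClosed_singleton (x := (0 : E)))
    rw [inter_comm]
    convert this using 2
    ext t
    simp [sub_eq_zero]
  -- Continuation along the closed set of coincidence. Only `y₂` is assumed to stay in `D`; where
  -- the solutions agree, `y₁` is in `D` too, and remains there for a while.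
  refine IsClosed.Icc_subset_of_forall_exists_gt hcl h0 ?_
  rintro t ⟨ht, htab⟩ y hy
  have ht' : y₁ t = y₂ t := ht
  have hty : t < y := hy
  obtain ⟨K, S, hS, hL⟩ := (hZ _ (h₂D t (Ico_subset_Icc_self htab))).exists_lipschitzOnWith
  have hS' : S ∩ D ∈ 𝓝 (y₂ t) := inter_mem hS (hD.mem_nhds (h₂D t (Ico_subset_Icc_self htab)))
  have hIcc : Icc a b ∈ 𝓝[≥] t := Icc_mem_nhdsGE_of_mem htab
  have c₁ : ContinuousWithinAt y₁ (Ici t) t :=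
    (h₁ t (Ico_subset_Icc_self htab)).mono_of_mem_nhdsWithin hIcc
  have c₂ : ContinuousWithinAt y₂ (Ici t) t :=
    (h₂ t (Ico_subset_Icc_self htab)).mono_of_mem_nhdsWithin hIcc
  have hev := inter_mem (inter_mem hIcc (Ico_mem_nhdsGE hty))
    (inter_mem (c₁ (by rw [ht']; exact hS')) (c₂ hS'))
  obtain ⟨c, hc, hsub⟩ := (mem_nhdsGE_iff_exists_Icc_subset (α := ℝ)).1 hev
  have hc' : t < c := hc
  have huni := ODE_solution_unique_of_mem_Icc_right (v := fun _ => Z) (s := fun _ => S ∩ D) (K := K)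
    (f := y₁) (g := y₂) (a := t) (b := c) (fun _ _ => hL.mono inter_subset_left)
    (h₁.mono fun s hs => (hsub hs).1.1)
    (fun s hs => d₁ s ⟨(hsub (Ico_subset_Icc_self hs)).1.1.1,
      hs.2.trans_le (hsub (right_mem_Icc.2 hc'.le)).1.1.2⟩ (hsub (Ico_subset_Icc_self hs)).2.1.2)
    (fun s hs => (hsub (Ico_subset_Icc_self hs)).2.1)
    (h₂.mono fun s hs => (hsub hs).1.1)
    (fun s hs => d₂ s ⟨(hsub (Ico_subset_Icc_self hs)).1.1.1,
      hs.2.trans_le (hsub (right_mem_Icc.2 hc'.le)).1.1.2⟩ (hsub (Ico_subset_Icc_self hs)).2.2.2)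
    (fun s hs => (hsub (Ico_subset_Icc_self hs)).2.2) ht'
  exact ⟨c, huni (right_mem_Icc.2 hc'.le), hc', (hsub (right_mem_Icc.2 hc'.le)).1.2.2.le⟩

end Uniqueness

/-! ### Boundary charts and the extension of functions across the boundary -/

theorem exists_local_inverse {E F : Type} [NormedAddCommGroup E] [NormedSpace ℝ E] [CompleteSpace E]
    [NormedAddCommGroup F] [NormedSpace ℝ F] {f : E → F} {e : E ≃L[ℝ] F} {a : E} {N : WithTop ℕ∞}
    (hf : ContDiffAt ℝ N f a) (he : HasFDerivAt f (e : E →L[ℝ] F) a) (hN : N ≠ 0) :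
    ∃ s : F → E, ContDiffAt ℝ N s (f a) ∧ s (f a) = a ∧ (∀ᶠ y in 𝓝 (f a), f (s y) = y) ∧
      ∀ᶠ x in 𝓝 a, s (f x) = x :=
  have hs : HasStrictFDerivAt f (e : E →L[ℝ] F) a := hf.hasStrictFDerivAt' he hN
  ⟨hf.localInverse he hN, hf.to_localInverse he hN, hs.localInverse_apply_image,
    hs.eventually_right_inverse, hs.eventually_left_inverse⟩

section Chart

variable {n : ℕ} {Ω : Set (Eu n)} {U : Set (Eu (n - 1))} {φ : Eu (n - 1) → Eu n} {x : Eu (n - 1)}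
  {r : Eu n → ℝ}

theorem exists_equiv_of_transversal (hn : 2 ≤ n) {L : Eu (n - 1) →L[ℝ] Eu n}
    (hL : Function.Injective L) {l : Eu n →L[ℝ] ℝ} (hl : ∀ v, l (L v) = 0) {w : Eu n} (hw : l w ≠ 0) :
    ∃ e : (Eu (n - 1) × ℝ) ≃L[ℝ] Eu n, ∀ q, e q = L q.1 + q.2 • w := by
  let T : (Eu (n - 1) × ℝ) →L[ℝ] Eu n :=
    L.comp (ContinuousLinearMap.fst ℝ _ _) + (ContinuousLinearMap.snd ℝ _ _).smulRight w
  have hT : ∀ q, T q = L q.1 + q.2 • w := fun q => rfl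
  have hinj : Function.Injective (T : (Eu (n - 1) × ℝ) →ₗ[ℝ] Eu n) := by
    rw [← LinearMap.ker_eq_bot, LinearMap.ker_eq_bot']
    intro q hq
    have hq' : L q.1 + q.2 • w = 0 := hq
    have h2 : q.2 = 0 := by
      have := congrArg l hq'
      rw [map_add, hl, zero_add, map_smul, map_zero, smul_eq_mul] at this
      exact (mul_eq_zero.1 this).resolve_right hw
    rw [h2, zero_smul, add_zero] at hq'
    exact Prod.ext (hL (hq'.trans (map_zero L).symm)) h2
  have hfin : Module.finrank ℝ (Eu (n - 1) × ℝ) = Module.finrank ℝ (Eu n) := by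
    rw [Module.finrank_prod, finrank_euclideanSpace_fin, finrank_euclideanSpace_fin,
      Module.finrank_self]
    omega
  have hsurj := (LinearMap.injective_iff_surjective_of_finrank_eq_finrank hfin).1 hinj
  exact ⟨(LinearEquiv.ofBijective (T : (Eu (n - 1) × ℝ) →ₗ[ℝ] Eu n)
    ⟨hinj, hsurj⟩).toContinuousLinearEquiv, fun q => rfl⟩

theorem IsBoundaryChart.contDiffAt (hφ : IsBoundaryChart Ω U φ) (hx : x ∈ U) : ContDiffAt ℝ ∞ φ x :=
  hφ.smooth.contDiffAt (hφ.isOpen.mem_nhds hx)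

theorem IsBoundaryChart.fderiv_eq_zero (hφ : IsBoundaryChart Ω U φ) (hΩ : IsSmoothDomain Ω)
    (hx : x ∈ U) (hr : IsLocalDefiningFunction Ω (φ x) r) (v : Eu (n - 1)) :
    fderiv ℝ r (φ x) (fderiv ℝ φ x v) = 0 := by
  have h1 := (hr.contDiffAt.differentiableAt (by simp)).hasFDerivAt.comp x
    ((hφ.contDiffAt hx).differentiableAt (by simp)).hasFDerivAt
  have h2 : (r ∘ φ) =ᶠ[𝓝 x] fun _ => 0 := by
    filter_upwards [hφ.isOpen.mem_nhds hx,
      (hφ.contDiffAt hx).continuousAt.eventually hr.eventually] with y hy hy'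
    exact hy'.eq_zero hΩ.isOpen (hφ.mapsTo hy)
  have h3 := h1.unique ((hasFDerivAt_const (0 : ℝ) x).congr_of_eventuallyEq h2)
  exact DFunLike.congr_fun h3 v

/-- The image of `dφ` and one vector on which `dr` does not vanish span the space, so the kernel of
`dr` is the image of `dφ`. -/
theorem IsBoundaryChart.exists_of_fderiv_eq_zero (hn : 2 ≤ n) (hφ : IsBoundaryChart Ω U φ)
    (hΩ : IsSmoothDomain Ω) (hx : x ∈ U) (hr : IsLocalDefiningFunction Ω (φ x) r) {w : Eu n}
    (hw : fderiv ℝ r (φ x) w = 0) : ∃ v, fderiv ℝ φ x v = w := by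
  have h0 : fderiv ℝ r (φ x) ≠ 0 := by obtain ⟨O, -, -, -, hd, -⟩ := hr; exact hd
  obtain ⟨w₀, hw₀⟩ := DFunLike.ne_iff.1 h0
  obtain ⟨e, he⟩ := exists_equiv_of_transversal hn (hφ.immersion x hx)
    (hφ.fderiv_eq_zero hΩ hx hr) hw₀
  obtain ⟨q, hq⟩ := e.surjective w
  rw [he] at hq
  have h1 := congrArg (fderiv ℝ r (φ x)) hq
  rw [map_add, hφ.fderiv_eq_zero hΩ hx hr, zero_add, map_smul, hw, smul_eq_mul] at h1
  have h2 : q.2 = 0 := (mul_eq_zero.1 h1).resolve_right hw₀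
  rw [h2, zero_smul, add_zero] at hq
  exact ⟨_, hq⟩

/-- A map that starts at the boundary and moves inwards parametrizes `Ω` near the boundary by a half
space. -/
theorem IsBoundaryChart.eventually_mem_iff (hφ : IsBoundaryChart Ω U φ) (hΩ : IsSmoothDomain Ω)
    (hx : x ∈ U) (hr : IsLocalDefiningFunction Ω (φ x) r) {Θ : Co n → Eu n}
    (hΘ : ContDiffAt ℝ 1 Θ (x, 0)) (h0 : ∀ᶠ y in 𝓝 x, Θ (y, 0) = φ y)
    (hd : fderiv ℝ r (φ x) (fderiv ℝ Θ (x, 0) (0, 1)) < 0) :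
    ∀ᶠ q in 𝓝 (x, (0 : ℝ)), (Θ q ∈ Ω ↔ 0 < q.2) ∧ (Θ q ∈ closure Ω ↔ 0 ≤ q.2) := by
  have hΘx : Θ (x, 0) = φ x := h0.self_of_nhds
  have hr' : ContDiffAt ℝ 1 r (Θ (x, 0)) := by rw [hΘx]; exact hr.contDiffAt.of_le (by norm_num)
  have hu : ContDiffAt ℝ 1 (fun q => r (Θ q)) (x, 0) := hr'.comp (x, 0) hΘ
  have hc : Tendsto Θ (𝓝 (x, 0)) (𝓝 (φ x)) := by
    have := hΘ.continuousAt.tendsto; rwa [hΘx] at this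
  have h1 : ∀ᶠ y in 𝓝 x, r (Θ (y, 0)) = 0 := by
    filter_upwards [h0, hφ.isOpen.mem_nhds hx,
      (hφ.contDiffAt hx).continuousAt.eventually hr.eventually] with y hy hyU hy'
    rw [hy]
    exact hy'.eq_zero hΩ.isOpen (hφ.mapsTo hyU)
  have h2 : fderiv ℝ (fun q => r (Θ q)) (x, 0) (0, 1) < 0 := by
    have := ((hr'.differentiableAt one_ne_zero).hasFDerivAt.comp (x, (0 : ℝ))
      (hΘ.differentiableAt one_ne_zero).hasFDerivAt).fderiv
    have e : fderiv ℝ (fun q => r (Θ q)) (x, 0) = (fderiv ℝ r (Θ (x, 0))).comp (fderiv ℝ Θ (x, 0)) := this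
    rw [e, hΘx]
    exact hd
  filter_upwards [eventually_sign_of_deriv_neg hu h1 h2, hc.eventually hr.eventually] with q hq hq'
  exact ⟨hq'.mem_iff.trans hq.1, hq'.mem_closure_iff.trans hq.2⟩

/-- A `C^N` function on the closure of a smooth domain extends across the boundary. -/
theorem IsBoundaryChart.exists_extension (hn : 2 ≤ n) (hφ : IsBoundaryChart Ω U φ)
    (hΩ : IsSmoothDomain Ω) (hx : x ∈ U) {G : Type} [NormedAddCommGroup G] [NormedSpace ℝ G] {N : ℕ}
    {f : Eu n → G} (hf : ContDiffOn ℝ N f (closure Ω)) :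
    ∃ f' : Eu n → G, ContDiffAt ℝ N f' (φ x) ∧ ∀ᶠ q in 𝓝 (φ x), q ∈ closure Ω → f' q = f q := by
  obtain ⟨r, hr⟩ := hΩ.smooth_boundary _ (hφ.mapsTo hx)
  have hr0 : fderiv ℝ r (φ x) ≠ 0 := by obtain ⟨O, -, -, -, hd, -⟩ := hr; exact hd
  obtain ⟨w, hw⟩ : ∃ v, fderiv ℝ r (φ x) v < 0 := by
    obtain ⟨w, hw⟩ := DFunLike.ne_iff.1 hr0
    rcases lt_or_gt_of_ne hw with h1 | h1
    · exact ⟨w, h1⟩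
    · exact ⟨-w, by rw [map_neg]; simpa using h1⟩
  obtain ⟨e, he⟩ := exists_equiv_of_transversal hn (hφ.immersion x hx)
    (hφ.fderiv_eq_zero hΩ hx hr) hw.ne
  -- The boundary is flattened along the constant inward direction `w`, the function is reflected in
  -- the flat coordinates and carried back. `Θ` is smooth, so no derivative of `f` is lost.
  let Θ : Co n → Eu n := fun q => φ q.1 + q.2 • w
  have hΘC : ContDiffAt ℝ ∞ Θ (x, 0) := by
    have : ContDiffAt ℝ ∞ (fun q : Co n => φ q.1) (x, 0) :=
      (hφ.contDiffAt hx).comp (x, (0 : ℝ)) contDiffAt_fst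
    exact this.add (by fun_prop)
  have hΘd : HasFDerivAt Θ (e : Co n →L[ℝ] Eu n) (x, 0) := by
    have h1 : HasFDerivAt (fun q : Co n => φ q.1) ((fderiv ℝ φ x).comp (ContinuousLinearMap.fst ℝ _ _))
        (x, (0 : ℝ)) := HasFDerivAt.comp (x, (0 : ℝ)) (g := φ) (f := Prod.fst)
      ((hφ.contDiffAt hx).differentiableAt (by simp)).hasFDerivAt hasFDerivAt_fst
    have h2 : HasFDerivAt (fun q : Co n => q.2 • w) ((ContinuousLinearMap.snd ℝ _ _).smulRight w)
        (x, (0 : ℝ)) := ((ContinuousLinearMap.snd ℝ (Eu (n - 1)) ℝ).smulRight w).hasFDerivAt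
    refine (h1.add h2).congr_fderiv ?_
    exact ContinuousLinearMap.ext fun q => (he q).symm
  have hΘ0 : Θ (x, 0) = φ x := by simp [Θ]
  have hmem := hφ.eventually_mem_iff hΩ hx hr (hΘC.of_le (by norm_num))
    (Eventually.of_forall fun y => by simp [Θ]) (by
      rw [hΘd.fderiv]
      change fderiv ℝ r (φ x) (e (0, 1)) < 0
      rw [he]; simpa using hw)
  obtain ⟨s, hsC, hs0, hs1, -⟩ := exists_local_inverse hΘC hΘd (by simp)
  rw [hΘ0] at hsC hs0 hs1
  have hC : ∀ᶠ q in 𝓝 (x, (0 : ℝ)), ContDiffAt ℝ N Θ q :=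
    (hΘC.of_le (by exact_mod_cast le_top)).eventually (by simp)
  obtain ⟨δ, hδ, hb⟩ := Metric.eventually_nhds_iff.1 (hC.and hmem)
  have hin : ∀ q ∈ Metric.ball x δ ×ˢ Ioo (-δ) δ, dist q (x, (0 : ℝ)) < δ := fun q hq => by
    rw [Prod.dist_eq]; exact max_lt hq.1 (by rw [dist_zero_right]; exact abs_lt.2 hq.2)
  have hsub : Metric.ball x δ ×ˢ Ico 0 δ ⊆ Metric.ball x δ ×ˢ Ioo (-δ) δ :=
    prod_mono le_rfl fun t ht => ⟨by linarith [ht.1], ht.2⟩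
  have hu : ContDiffOn ℝ N (f ∘ Θ) (Metric.ball x δ ×ˢ Ico 0 δ) :=
    hf.comp (fun q hq => (hb (hin q (hsub hq))).1.contDiffWithinAt)
      fun q hq => (hb (hin q (hsub hq))).2.2.2 hq.2.1
  obtain ⟨v, hv, hvu⟩ := exists_contDiffOn_extension N Metric.isOpen_ball hu
  have hsC' : ContDiffAt ℝ N s (φ x) := hsC.of_le (by exact_mod_cast le_top)
  have hO : Metric.ball x δ ×ˢ Ioo (-δ) δ ∈ 𝓝 (x, (0 : ℝ)) :=
    prod_mem_nhds (Metric.ball_mem_nhds x hδ) (Ioo_mem_nhds (by linarith) hδ)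
  refine ⟨v ∘ s, ContDiffAt.comp (φ x) (by rw [hs0]; exact hv.contDiffAt hO) hsC', ?_⟩
  have hst : Tendsto s (𝓝 (φ x)) (𝓝 (x, 0)) := by
    have := hsC'.continuousAt.tendsto; rwa [hs0] at this
  filter_upwards [hs1, hst.eventually hO] with q hq hq1 hqΩ
  have h3 := (hb (hin _ hq1)).2.2.1 (by rw [hq]; exact hqΩ)
  change v (s q) = f q
  rw [hvu _ h3]
  change f (Θ (s q)) = f q
  rw [hq]

/-- `G` is a `C^N` extension of the metric `g` to a neighbourhood of the boundary point `p`. -/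
structure IsMetricExtension (Ω : Set (Eu n)) (g : TensorField n) (N : ℕ) (p : Eu n)
    (G : TensorField n) : Prop where
  contDiffAt : ContDiffAt ℝ N G p
  symm : ∀ q v w, G q v w = G q w v
  eq : ∀ᶠ q in 𝓝 p, q ∈ closure Ω → G q = g q

/-- The extension given by `exists_extension` comes without symmetry outside the closure, so it is
averaged with its transpose. -/
theorem IsBoundaryChart.exists_metricExtension (hn : 2 ≤ n) (hφ : IsBoundaryChart Ω U φ)
    (hΩ : IsSmoothDomain Ω) (hx : x ∈ U) {N : ℕ} {g : TensorField n}
    (hg : ContDiffOn ℝ N g (closure Ω)) (hs : ∀ q ∈ closure Ω, ∀ v w, g q v w = g q w v) :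
    ∃ G, IsMetricExtension Ω g N (φ x) G := by
  obtain ⟨f, hf, hfg⟩ := hφ.exists_extension hn hΩ hx hg
  let L := (ContinuousLinearMap.flipₗᵢ ℝ (Eu n) (Eu n) ℝ).toContinuousLinearEquiv.toContinuousLinearMap
  refine ⟨fun q => (1 / 2 : ℝ) • (f q + L (f q)), ?_, fun q v w => ?_, ?_⟩
  · exact (hf.add (L.contDiff.contDiffAt.comp (φ x) hf)).const_smul _
  · change (1 / 2 : ℝ) * (f q v w + f q w v) = (1 / 2 : ℝ) * (f q w v + f q v w)
    ring
  · filter_upwards [hfg] with q hq hqΩ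
    ext v w
    change (1 / 2 : ℝ) * (f q v w + f q w v) = g q v w
    rw [hq hqΩ, hs q hqΩ w v]
    ring

theorem IsMetricExtension.eventually {g G : TensorField n} {N : ℕ} {p : Eu n}
    (h : IsMetricExtension Ω g N p G) : ∀ᶠ q in 𝓝 p, IsMetricExtension Ω g N q G := by
  filter_upwards [h.contDiffAt.eventually (by simp), h.eq.eventually_nhds] with q h1 h2
  exact ⟨h1, h.symm, h2⟩

theorem IsMetricExtension.eventuallyEq {g G : TensorField n} {N : ℕ} {p : Eu n}
    (h : IsMetricExtension Ω g N p G) : g =ᶠ[𝓝[closure Ω] p] G := by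
  filter_upwards [mem_nhdsWithin_of_mem_nhds h.eq, self_mem_nhdsWithin] with q hq hq'
  exact (hq hq').symm

theorem IsMetricExtension.eq_self {g G : TensorField n} {N : ℕ} {p : Eu n}
    (h : IsMetricExtension Ω g N p G) (hp : p ∈ closure Ω) : G p = g p := h.eq.self_of_nhds hp

theorem IsMetricExtension.dMetric_eq {g G : TensorField n} {N : ℕ} {p : Eu n}
    (h : IsMetricExtension Ω g N p G) (hΩ : IsSmoothDomain Ω) (hN : N ≠ 0) (hp : p ∈ closure Ω) :
    dMetric Ω g p = fderiv ℝ G p := by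
  rw [dMetric, h.eventuallyEq.fderivWithin_eq (h.eq_self hp).symm]
  exact (h.contDiffAt.differentiableAt (by exact_mod_cast hN)).fderivWithin (hΩ.uniqueDiffOn p hp)

/-- On the closure derivatives are unique, so the derivatives of any extension at boundary points
are the one-sided ones of `g`. Bounds for `g` thus pass to `G` without any estimate of the extension
procedure. -/
theorem IsMetricExtension.iteratedFDeriv_eq {g G : TensorField n} {N j : ℕ} {p : Eu n}
    (h : IsMetricExtension Ω g N p G) (hΩ : IsSmoothDomain Ω) (hj : j ≤ N) (hp : p ∈ closure Ω) :
    iteratedFDeriv ℝ j G p = iteratedFDerivWithin ℝ j g (closure Ω) p := by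
  rw [h.eventuallyEq.iteratedFDerivWithin_eq (h.eq_self hp).symm]
  exact (iteratedFDerivWithin_eq_iteratedFDeriv hΩ.uniqueDiffOn
    (h.contDiffAt.of_le (by exact_mod_cast hj)) hp).symm

end Chart

/-! ### The geodesic vector field and the unit normal field -/

section Spray

variable {ι : Type} {E : Type} [NormedAddCommGroup E] [NormedSpace ℝ E] [FiniteDimensional ℝ E]

/-- The covector `w ↦ ½ D(w)(v, v) - D(v)(v, w)`. -/
noncomputable def christoffelForm (D : E →L[ℝ] E →L[ℝ] E →L[ℝ] ℝ) (v : E) : E →L[ℝ] ℝ :=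
  (1 / 2 : ℝ) • (D.flip v).flip v - D v v

theorem christoffelForm_apply (D : E →L[ℝ] E →L[ℝ] E →L[ℝ] ℝ) (v w : E) :
    christoffelForm D v w = (1 / 2) * D w v v - D v v w := rfl

/-- The geodesic vector field of the metric `G`, on pairs of a position and a velocity. -/
noncomputable def spray (G : E → E →L[ℝ] E →L[ℝ] ℝ) (z : E × E) : E × E :=
  (z.2, (G z.1).inverse (christoffelForm (fderiv ℝ G z.1) z.2))

theorem metric_spray_apply {G : E → E →L[ℝ] E →L[ℝ] ℝ} {z : E × E} (h : (G z.1).IsInvertible) (w : E) :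
    G z.1 (spray G z).2 w = (1 / 2) * fderiv ℝ G z.1 w z.2 z.2 - fderiv ℝ G z.1 z.2 z.2 w := by
  have h1 : G z.1 (spray G z).2 = christoffelForm (fderiv ℝ G z.1) z.2 := h.self_apply_inverse _
  rw [h1, christoffelForm_apply]

theorem jetBound_spray {l : ℕ} {G : ι → E → E →L[ℝ] E →L[ℝ] ℝ} {z : ι → E × E} {c : ℝ} (hc : 0 < c)
    (hz : ∃ C, 0 ≤ C ∧ ∀ i, ‖z i‖ ≤ C) (hG : JetBound (l + 1) G (fun i => (z i).1) (fun _ => 1))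
    (hell : ∀ i v, c * ‖v‖ ^ 2 ≤ G i (z i).1 v v) :
    JetBound l (fun i => spray (G i)) z (fun _ => 1) := by
  have h1 : ∀ _ : ι, (0 : ℝ) ≤ 1 := fun _ => zero_le_one
  have hid : JetBound l (fun (_ : ι) (y : E × E) => y) z (fun _ => 1) := jetBound_id hz
  have hp := hid.clm_apply (ContinuousLinearMap.fst ℝ E E)
  have hv := hid.clm_apply (ContinuousLinearMap.snd ℝ E E)
  have hinv : JetBound l (fun i (y : E × E) => (G i y.1).inverse) z (fun _ => 1) :=
    JetBound.comp (u := fun i q => (G i q).inverse) h1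
      (JetBound.inverse hc (hG.mono (Nat.le_succ l)) hell) hp
  have hD : JetBound l (fun i (y : E × E) => fderiv ℝ (G i) y.1) z (fun _ => 1) :=
    JetBound.comp (u := fun i => fderiv ℝ (G i)) h1 hG.fderiv hp
  have hA : JetBound l (fun i (y : E × E) => (fderiv ℝ (G i) y.1).flip y.2) z (fun _ => 1) :=
    JetBound.clm_bilin h1 (hD.clm_apply
      (ContinuousLinearMap.flipₗᵢ ℝ E E (E →L[ℝ] ℝ)).toContinuousLinearEquiv.toContinuousLinearMap) hv
  have hB : JetBound l (fun i (y : E × E) => ((fderiv ℝ (G i) y.1).flip y.2).flip y.2) z (fun _ => 1) :=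
    JetBound.clm_bilin h1 (hA.clm_apply
      (ContinuousLinearMap.flipₗᵢ ℝ E E ℝ).toContinuousLinearEquiv.toContinuousLinearMap) hv
  have hC : JetBound l (fun i (y : E × E) => fderiv ℝ (G i) y.1 y.2 y.2) z (fun _ => 1) :=
    JetBound.clm_bilin h1 (JetBound.clm_bilin h1 hD hv) hv
  exact hv.prodMk (JetBound.clm_bilin h1 hinv ((hB.const_smul (1 / 2)).sub hC))

/-- The gradient of `r` with respect to the metric `G`. -/
noncomputable def metricGradient (G : E → E →L[ℝ] E →L[ℝ] ℝ) (r : E → ℝ) (q : E) : E :=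
  (G q).inverse (fderiv ℝ r q)

/-- The unit vector field normal to the level sets of `r`, in the direction in which `r` decreases. -/
noncomputable def normalField (G : E → E →L[ℝ] E →L[ℝ] ℝ) (r : E → ℝ) (q : E) : E :=
  -((√(fderiv ℝ r q (metricGradient G r q)))⁻¹ • metricGradient G r q)

/-- Keeps the radicand in `normalField` away from 0 in terms of bounds for `G` and `dr` alone. -/
theorem fderiv_metricGradient_ge {G : E → E →L[ℝ] E →L[ℝ] ℝ} {r : E → ℝ} {q : E} {c C : ℝ} (hc : 0 < c)
    (hC : 0 < C) (hell : ∀ v, c * ‖v‖ ^ 2 ≤ G q v v) (hG : ‖G q‖ ≤ C) :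
    c * (‖fderiv ℝ r q‖ / C) ^ 2 ≤ fderiv ℝ r q (metricGradient G r q) := by
  have h1 : G q (metricGradient G r q) = fderiv ℝ r q :=
    (isInvertible_of_elliptic hc hell).self_apply_inverse _
  have h2 : ‖fderiv ℝ r q‖ ≤ C * ‖metricGradient G r q‖ := by
    rw [← h1]
    exact ((G q).le_opNorm _).trans (mul_le_mul_of_nonneg_right hG (norm_nonneg _))
  have h3 : ‖fderiv ℝ r q‖ / C ≤ ‖metricGradient G r q‖ := by
    rw [div_le_iff₀ hC, mul_comm]; exact h2
  calc _ ≤ c * ‖metricGradient G r q‖ ^ 2 := by gcongr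
    _ ≤ G q (metricGradient G r q) (metricGradient G r q) := hell _
    _ = _ := by rw [h1]

theorem jetBound_normalField {l : ℕ} {G : ι → E → E →L[ℝ] E →L[ℝ] ℝ} {r : E → ℝ} {p : ι → E} {b c : ℝ}
    (hb : 0 < b) (hc : 0 < c) (hG : JetBound l G p (fun _ => 1))
    (hell : ∀ i v, c * ‖v‖ ^ 2 ≤ G i (p i) v v)
    (hr : JetBound l (fun _ => fderiv ℝ r) p (fun _ => 1)) (hrb : ∀ i, b ≤ ‖fderiv ℝ r (p i)‖) :
    JetBound l (fun i => normalField (G i) r) p (fun _ => 1) := by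
  have h1 : ∀ _ : ι, (0 : ℝ) ≤ 1 := fun _ => zero_le_one
  have hgrad : JetBound l (fun i => metricGradient (G i) r) p (fun _ => 1) :=
    JetBound.clm_bilin h1 (JetBound.inverse hc hG hell) hr
  have hq : JetBound l (fun i q => fderiv ℝ r q (metricGradient (G i) r q)) p (fun _ => 1) :=
    JetBound.clm_bilin h1 hr hgrad
  obtain ⟨C, hC, hCb⟩ := hG.bound
  obtain ⟨M, hM, hMb⟩ := hq.bound
  have hC' : (0 : ℝ) < C + 1 := by linarith
  have hlow : ∀ i, c * (b / (C + 1)) ^ 2 ≤ fderiv ℝ r (p i) (metricGradient (G i) r (p i)) := fun i => by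
    refine le_trans ?_ (fderiv_metricGradient_ge hc hC' (hell i) ((hCb i).trans (by linarith)))
    have := hrb i
    gcongr
  have hpos : 0 < c * (b / (C + 1)) ^ 2 := by positivity
  have hs : JetBound l (fun i q => (√(fderiv ℝ r q (metricGradient (G i) r q)))⁻¹) p (fun _ => 1) := by
    refine JetBound.comp_of_compact (G := fun s : ℝ => (√s)⁻¹) (K := Icc (c * (b / (C + 1)) ^ 2) M)
      isCompact_Icc (fun s hs => ?_) hq fun i => ⟨hlow i, ?_⟩
    · have hs0 : 0 < s := hpos.trans_le hs.1
      exact (Real.contDiffAt_sqrt hs0.ne').inv (Real.sqrt_pos.2 hs0).ne'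
    · exact (Real.le_norm_self _).trans (by simpa using hMb i)
  exact (JetBound.smul h1 hs hgrad).neg

theorem normalField_spec {G : E → E →L[ℝ] E →L[ℝ] ℝ} {r : E → ℝ} {q : E} {c : ℝ} (hc : 0 < c)
    (hell : ∀ v, c * ‖v‖ ^ 2 ≤ G q v v) (hr : fderiv ℝ r q ≠ 0) :
    fderiv ℝ r q (normalField G r q) < 0 ∧ G q (normalField G r q) (normalField G r q) = 1 ∧
      ∀ w, G q (normalField G r q) w = fderiv ℝ r q w / fderiv ℝ r q (normalField G r q) := by
  have h1 : G q (metricGradient G r q) = fderiv ℝ r q :=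
    (isInvertible_of_elliptic hc hell).self_apply_inverse _
  set W := metricGradient G r q with hW
  have hW0 : W ≠ 0 := fun h => hr (by rw [← h1, h, map_zero])
  have hpos : 0 < fderiv ℝ r q W := by
    rw [← h1]
    have : 0 < ‖W‖ := norm_pos_iff.2 hW0
    exact lt_of_lt_of_le (by positivity) (hell W)
  set s := √(fderiv ℝ r q W) with hs
  have hs0 : 0 < s := Real.sqrt_pos.2 hpos
  have hss : fderiv ℝ r q W = s * s := (Real.mul_self_sqrt hpos.le).symm
  have hν : normalField G r q = -(s⁻¹ • W) := rfl
  have e1 : fderiv ℝ r q (normalField G r q) = -s := by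
    rw [hν, map_neg, map_smul, smul_eq_mul, hss]; field_simp
  have e2 : ∀ w, G q (normalField G r q) w = -(s⁻¹ * fderiv ℝ r q w) := fun w => by
    rw [hν, map_neg, map_smul, h1]; rfl
  refine ⟨by rw [e1]; linarith, ?_, fun w => ?_⟩
  · rw [e2, e1]; field_simp
  · rw [e2, e1]; field_simp

end Spray

/-! ### Uniqueness of the inward unit normal -/

section Normal

variable {n : ℕ} {Ω : Set (Eu n)} {U : Set (Eu (n - 1))} {φ : Eu (n - 1) → Eu n} {x : Eu (n - 1)}
  {r : Eu n → ℝ} {g : TensorField n}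

/-- The inward unit normal does not depend on the defining function. -/
theorem IsBoundaryChart.fderiv_inward_neg (hn : 2 ≤ n) (hφ : IsBoundaryChart Ω U φ)
    (hΩ : IsSmoothDomain Ω) (hx : x ∈ U) (hr : IsLocalDefiningFunction Ω (φ x) r) {ν : Eu n}
    (hν : IsInwardUnitNormal Ω g (φ x) ν) :
    fderiv ℝ r (φ x) ν < 0 ∧ g (φ x) ν ν = 1 ∧ ∀ w, fderiv ℝ r (φ x) w = 0 → g (φ x) ν w = 0 := by
  obtain ⟨hp, r', hr', h1, h2, h3⟩ := hν
  refine ⟨?_, h1, fun w hw => ?_⟩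
  · rcases lt_trichotomy (fderiv ℝ r (φ x) ν) 0 with h | h | h
    · exact h
    · obtain ⟨v, hv⟩ := hφ.exists_of_fderiv_eq_zero hn hΩ hx hr h
      rw [← hv, hφ.fderiv_eq_zero hΩ hx hr'] at h3
      exact absurd h3 (lt_irrefl _)
    · exfalso
      have k1 := eventually_lt_of_fderiv_neg (hr'.contDiffAt.differentiableAt (by simp))
        (hr'.eq_zero hΩ.isOpen hp) h3
      have k2 := eventually_lt_of_fderiv_neg (r := fun q => -r q) (q := φ x) (v := ν)
        (hr.contDiffAt.differentiableAt (by simp)).neg (by rw [hr.eq_zero hΩ.isOpen hp, neg_zero]) (by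
          rw [fderiv_fun_neg]; simpa using h)
      have k3 : Tendsto (fun s : ℝ => φ x + s • ν) (𝓝[>] 0) (𝓝 (φ x)) := by
        have : Continuous fun s : ℝ => φ x + s • ν := by fun_prop
        simpa using (this.tendsto 0).mono_left nhdsWithin_le_nhds
      obtain ⟨s, ⟨s1, s2⟩, s3, s4⟩ := ((k1.and k2).and
        ((k3.eventually hr.eventually).and (k3.eventually hr'.eventually))).exists
      have s5 := s3.mem_iff.1 (s4.mem_iff.2 s1)
      linarith
  · obtain ⟨v, hv⟩ := hφ.exists_of_fderiv_eq_zero hn hΩ hx hr hw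
    exact h2 w (by rw [← hv]; exact hφ.fderiv_eq_zero hΩ hx hr' v)

/-- Two vectors orthogonal to the kernel of `l` are proportional; unit length and the sign of `l`
leave only the factor 1. -/
theorem inward_unique {B : Eu n →L[ℝ] Eu n →L[ℝ] ℝ}
    (hpos : ∀ v, v ≠ 0 → 0 < B v v) {l : Eu n →L[ℝ] ℝ} {ν ν' : Eu n}
    (h : l ν < 0 ∧ B ν ν = 1 ∧ ∀ w, l w = 0 → B ν w = 0)
    (h' : l ν' < 0 ∧ B ν' ν' = 1 ∧ ∀ w, l w = 0 → B ν' w = 0) : ν = ν' := by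
  obtain ⟨h1, h2, h3⟩ := h
  obtain ⟨k1, k2, k3⟩ := h'
  set a := l ν' / l ν with ha
  have ha0 : 0 < a := div_pos_of_neg_of_neg k1 h1
  have hk : l (ν' - a • ν) = 0 := by
    rw [map_sub, map_smul, smul_eq_mul, ha, div_mul_cancel₀ _ h1.ne, sub_self]
  have hz : ν' - a • ν = 0 := by
    by_contra hne
    have h4 := hpos _ hne
    have h5 : B (ν' - a • ν) (ν' - a • ν) = B ν' (ν' - a • ν) - a * B ν (ν' - a • ν) := by
      rw [map_sub B, map_smul B]; rfl
    rw [h5, h3 _ hk, k3 _ hk] at h4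
    simp at h4
  have hν' : ν' = a • ν := sub_eq_zero.1 hz
  have h6 : a * a = 1 := by
    have h8 : B (a • ν) (a • ν) = a * (a * B ν ν) := by rw [map_smul, map_smul]; rfl
    rw [hν', h8, h2] at k2
    linarith
  have h7 : a = 1 := by nlinarith
  rw [hν', h7, one_smul]

end Normal

/-! ### The flow of normal geodesics and the Gauss lemma -/

section NormalFlow

variable {n : ℕ} {Ω : Set (Eu n)} {U : Set (Eu (n - 1))} {φ : Eu (n - 1) → Eu n} {x : Eu (n - 1)}
  {r : Eu n → ℝ} {g G : TensorField n} {N : ℕ} {c : ℝ} {S : Co n → Eu n × Eu n}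

/-- `S (y, t)` is the position and the velocity at the time `t` of the geodesic of `G` (an extension of
`g` across the boundary) that starts at `φ y` normally to the boundary, for `(y, t)` near `(x, 0)`. -/
structure IsNormalFlow (Ω : Set (Eu n)) (g : TensorField n) (φ : Eu (n - 1) → Eu n) (r : Eu n → ℝ)
    (N : ℕ) (c : ℝ) (G : TensorField n) (S : Co n → Eu n × Eu n) (x : Eu (n - 1)) : Prop where
  ext : IsMetricExtension Ω g (N + 1) (φ x) G
  elliptic : ∀ v, c * ‖v‖ ^ 2 ≤ G (φ x) v v
  defining : IsLocalDefiningFunction Ω (φ x) r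
  smooth : ContDiffAt ℝ N S (x, 0)
  ode : ∀ᶠ q in 𝓝 (x, (0 : ℝ)), HasDerivAt (fun t => S (q.1, t)) (spray G (S q)) q.2
  init : ∀ᶠ y in 𝓝 x, S (y, 0) = (φ y, normalField G r (φ y))

theorem IsLocalDefiningFunction.fderiv_ne_zero {p : Eu n} (h : IsLocalDefiningFunction Ω p r) :
    fderiv ℝ r p ≠ 0 := by obtain ⟨O, -, -, -, hd, -⟩ := h; exact hd

theorem contDiffAt_normalField {p : Eu n} (hc : 0 < c) (hG : ContDiffAt ℝ N G p)
    (hell : ∀ v, c * ‖v‖ ^ 2 ≤ G p v v) (hr : IsLocalDefiningFunction Ω p r) :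
    ContDiffAt ℝ N (normalField G r) p :=
  (jetBound_normalField (ι := Unit) (G := fun _ => G) (p := fun _ => p)
    (norm_pos_iff.2 hr.fderiv_ne_zero) hc (jetBound_single hG) (fun _ => hell)
    (jetBound_single ((hr.contDiffAt.of_le (m := ((N + 1 : ℕ) : WithTop ℕ∞))
      (by exact_mod_cast le_top)).fderiv_right (by norm_cast))) fun _ => le_rfl).contDiffAt ()

theorem contDiffAt_spray {z : Eu n × Eu n} (hc : 0 < c) (hG : ContDiffAt ℝ (N + 1 : ℕ) G z.1)
    (hell : ∀ v, c * ‖v‖ ^ 2 ≤ G z.1 v v) : ContDiffAt ℝ N (spray G) z :=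
  (jetBound_spray (ι := Unit) (G := fun _ => G) (z := fun _ => z) hc
    ⟨‖z‖, norm_nonneg _, fun _ => le_rfl⟩ (jetBound_single hG) fun _ => hell).contDiffAt ()

/-- The local flow of `spray`, composed with the initial data. The field contains one derivative of
`G`, whence the order `N + 1` for the extension and `N` for the flow. -/
theorem IsBoundaryChart.exists_normalFlow (hφ : IsBoundaryChart Ω U φ) (hx : x ∈ U) (hN : N ≠ 0)
    (hc : 0 < c) (hG : IsMetricExtension Ω g (N + 1) (φ x) G) (hell : ∀ v, c * ‖v‖ ^ 2 ≤ G (φ x) v v)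
    (hr : IsLocalDefiningFunction Ω (φ x) r) : ∃ S, IsNormalFlow Ω g φ r N c G S x := by
  obtain ⟨Y, hY, hY0, hYd⟩ := exists_contDiffAt_flow hN
    (contDiffAt_spray (z := (φ x, normalField G r (φ x))) hc hG.contDiffAt hell)
  let s : Eu (n - 1) → Eu n × Eu n := fun y => (φ y, normalField G r (φ y))
  have hφN : ContDiffAt ℝ N φ x := (hφ.contDiffAt hx).of_le (by exact_mod_cast le_top)
  have hs : ContDiffAt ℝ N s x := hφN.prodMk ((contDiffAt_normalField hc (hG.contDiffAt.of_le
    (by exact_mod_cast Nat.le_succ N)) hell hr).comp x hφN)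
  have hs' : ContDiffAt ℝ N (fun q : Co n => (s q.1, q.2)) (x, 0) :=
    ContDiffAt.prodMk (hs.comp (x, (0 : ℝ)) contDiffAt_fst) contDiffAt_snd
  refine ⟨fun q => Y (s q.1, q.2), hG, hell, hr, ?_, ?_, ?_⟩
  · exact ContDiffAt.comp (g := Y) (f := fun q : Co n => (s q.1, q.2)) (x, (0 : ℝ)) hY hs'
  · exact hs'.continuousAt.tendsto.eventually hYd
  · exact hs.continuousAt.tendsto.eventually hY0

theorem IsNormalFlow.eventually (hφ : IsBoundaryChart Ω U φ) (hx : x ∈ U) (hc : 0 < c)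
    (h : IsNormalFlow Ω g φ r N c G S x) :
    ∀ᶠ y in 𝓝 x, y ∈ U ∧ IsNormalFlow Ω g φ r N (c / 2) G S y := by
  have hφc := (hφ.contDiffAt hx).continuousAt
  have e1 : Tendsto (fun y : Eu (n - 1) => (y, (0 : ℝ))) (𝓝 x) (𝓝 (x, 0)) :=
    (Continuous.prodMk_left (0 : ℝ)).tendsto x
  filter_upwards [hφ.isOpen.mem_nhds hx, hφc.eventually h.ext.eventually,
    hφc.eventually (eventually_elliptic h.ext.contDiffAt.continuousAt hc h.elliptic),
    hφc.eventually h.defining.eventually, e1.eventually (h.smooth.eventually (by simp)),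
    e1.eventually h.ode.eventually_nhds, h.init.eventually_nhds] with y y0 y1 y2 y3 y4 y5 y6
  exact ⟨y0, y1, y2, y3, y4, y5, y6⟩

theorem eventually_eq_of_deriv_zero {α X : Type} [NormedAddCommGroup X] {u : α → X × ℝ → ℝ} {x : X}
    (h : ∀ᶠ q in 𝓝 (x, (0 : ℝ)), ∀ a, HasDerivAt (fun t => u a (q.1, t)) 0 q.2) :
    ∀ᶠ q in 𝓝 (x, (0 : ℝ)), ∀ a, u a q = u a (q.1, 0) := by
  obtain ⟨ε, hε, hb⟩ := Metric.eventually_nhds_iff.1 h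
  filter_upwards [prod_mem_nhds (Metric.ball_mem_nhds x hε) (Metric.ball_mem_nhds (0 : ℝ) hε)]
    with ⟨y, t⟩ ⟨hy, ht⟩ a
  have hin : ∀ s ∈ Metric.ball (0 : ℝ) ε, dist (y, s) (x, (0 : ℝ)) < ε := fun s hs => by
    rw [Prod.dist_eq]; exact max_lt hy hs
  exact (convex_ball (0 : ℝ) ε).is_const_of_fderivWithin_eq_zero (𝕜 := ℝ) (f := fun t => u a (y, t))
    (fun s hs => (hb (hin s hs) a).differentiableAt.differentiableWithinAt) (fun s hs => by
      rw [fderivWithin_of_isOpen Metric.isOpen_ball hs]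
      have := (hb (hin s hs) a).hasFDerivAt.fderiv
      simp only at this
      rw [this]; ext; simp) ht (Metric.mem_ball_self hε)

theorem IsNormalFlow.apply_zero (h : IsNormalFlow Ω g φ r N c G S x) :
    S (x, 0) = (φ x, normalField G r (φ x)) := h.init.self_of_nhds

theorem IsNormalFlow.tendsto_fst (h : IsNormalFlow Ω g φ r N c G S x) :
    Tendsto (fun q => (S q).1) (𝓝 (x, 0)) (𝓝 (φ x)) := by
  have h1 := (continuous_fst.tendsto _).comp h.smooth.continuousAt.tendsto
  rw [h.apply_zero] at h1
  exact h1

/-- Facts that hold at all points near `(x, 0)`. -/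
theorem IsNormalFlow.eventually_regular (h : IsNormalFlow Ω g φ r N c G S x) (hc : 0 < c) :
    ∀ᶠ q in 𝓝 (x, (0 : ℝ)), ContDiffAt ℝ N S q ∧ ContDiffAt ℝ (N + 1 : ℕ) G (S q).1 ∧
      (∀ v, c / 2 * ‖v‖ ^ 2 ≤ G (S q).1 v v) ∧
      HasDerivAt (fun t => S (q.1, t)) (spray G (S q)) q.2 := by
  filter_upwards [h.smooth.eventually (by simp), h.ode,
    h.tendsto_fst.eventually (h.ext.contDiffAt.eventually (by simp)),
    h.tendsto_fst.eventually (eventually_elliptic h.ext.contDiffAt.continuousAt hc h.elliptic)]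
    with q h1 h2 h3 h4
  exact ⟨h1, h3, h4, h2⟩

theorem hasDerivAt_slice {X Y : Type} [NormedAddCommGroup X] [NormedSpace ℝ X] [NormedAddCommGroup Y]
    [NormedSpace ℝ Y] {u : X × ℝ → Y} {q : X × ℝ} (h : DifferentiableAt ℝ u q) :
    HasDerivAt (fun t => u (q.1, t)) (fderiv ℝ u q (0, 1)) q.2 := by
  have h2 : HasDerivAt (fun s : ℝ => (q.1, s)) ((0 : X), (1 : ℝ)) q.2 :=
    (hasDerivAt_const q.2 q.1).prodMk (hasDerivAt_id q.2)
  exact h.hasFDerivAt.comp_hasDerivAt (f := fun s : ℝ => (q.1, s)) q.2 h2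

theorem hasDerivAt_bilin {E : Type} [NormedAddCommGroup E] [NormedSpace ℝ E]
    {B : ℝ → E →L[ℝ] E →L[ℝ] ℝ} {v w : ℝ → E} {B' : E →L[ℝ] E →L[ℝ] ℝ} {v' w' : E} {t : ℝ}
    (hB : HasDerivAt B B' t) (hv : HasDerivAt v v' t) (hw : HasDerivAt w w' t) :
    HasDerivAt (fun t => B t (v t) (w t)) (B' (v t) (w t) + B t v' (w t) + B t (v t) w') t := by
  have := (hB.clm_apply hv).clm_apply hw
  simpa only [add_apply] using this

/-- The derivative in time of the `y`-derivative of the position is the `y`-derivative of the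
velocity. -/
theorem IsNormalFlow.mixed (h : IsNormalFlow Ω g φ r N c G S x) (hN : 2 ≤ N) :
    ∀ᶠ q in 𝓝 (x, (0 : ℝ)), fderiv ℝ S q (0, 1) = spray G (S q) ∧ ∀ ξ : Eu (n - 1),
      HasDerivAt (fun t => (fderiv ℝ S (q.1, t) (ξ, 0)).1) (fderiv ℝ S q (ξ, 0)).2 q.2 := by
  have hS : ∀ᶠ q in 𝓝 (x, (0 : ℝ)), ContDiffAt ℝ 2 S q :=
    (h.smooth.of_le (by exact_mod_cast hN)).eventually (by simp)
  have h1 : ∀ᶠ q in 𝓝 (x, (0 : ℝ)), fderiv ℝ S q (0, 1) = spray G (S q) := by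
    filter_upwards [h.ode, hS] with q hq hq2
    exact (hasDerivAt_slice (hq2.differentiableAt (by simp))).unique hq
  filter_upwards [h1.eventually_nhds, hS] with q hq hq2
  refine ⟨hq.self_of_nhds, fun ξ => ?_⟩
  have hd : DifferentiableAt ℝ (fderiv ℝ S) q :=
    (hq2.fderiv_right (m := 1) (by norm_num)).differentiableAt one_ne_zero
  have h2 : HasDerivAt (fun t => fderiv ℝ S (q.1, t) (ξ, 0)) (fderiv ℝ (fderiv ℝ S) q (0, 1) (ξ, 0)) q.2 := by
    simpa using (hasDerivAt_slice hd).clm_apply (hasDerivAt_const q.2 ((ξ, 0) : Co n))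
  have hsym := (hq2.isSymmSndFDerivAt (by simp)).eq (0, 1) (ξ, 0)
  have h3 : fderiv ℝ (fderiv ℝ S) q (ξ, 0) (0, 1) = fderiv ℝ (fun q => spray G (S q)) q (ξ, 0) := by
    have e : (fun q => fderiv ℝ S q (0, 1)) =ᶠ[𝓝 q] fun q => spray G (S q) := hq
    rw [← e.fderiv_eq, fderiv_clm_apply hd (differentiableAt_const _)]
    simp
  have h4 : (fderiv ℝ (fun q => spray G (S q)) q (ξ, 0)).1 = (fderiv ℝ S q (ξ, 0)).2 := by
    have hdd : DifferentiableAt ℝ (fun q => spray G (S q)) q := by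
      have e : (fun q => fderiv ℝ S q (0, 1)) =ᶠ[𝓝 q] fun q => spray G (S q) := hq
      exact (hd.clm_apply (differentiableAt_const _)).congr_of_eventuallyEq e.symm
    have k1 := hdd.hasFDerivAt.fst
    have k2 := (hq2.differentiableAt (by simp)).hasFDerivAt.snd
    have k3 : (fun q => (spray G (S q)).1) = fun q => (S q).2 := rfl
    rw [k3] at k1
    exact DFunLike.congr_fun (k1.unique k2) (ξ, 0)
  rw [hsym, h3] at h2
  have h5 := h2.hasFDerivAt.fst.hasDerivAt
  refine h5.congr_deriv ?_
  rw [← h4]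
  simp

theorem IsNormalFlow.eventually_init (hφ : IsBoundaryChart Ω U φ) (hΩ : IsSmoothDomain Ω) (hx : x ∈ U)
    (h : IsNormalFlow Ω g φ r N c G S x) (hc : 0 < c) (hN : N ≠ 0) :
    ∀ᶠ y in 𝓝 x, G (S (y, 0)).1 (S (y, 0)).2 (S (y, 0)).2 = 1 ∧ ∀ ξ,
      (fderiv ℝ S (y, 0) (ξ, 0)).1 = fderiv ℝ φ y ξ ∧
      G (S (y, 0)).1 (S (y, 0)).2 (fderiv ℝ S (y, 0) (ξ, 0)).1 = 0 := by
  filter_upwards [h.eventually hφ hx hc] with y ⟨hyU, hy⟩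
  have h1 := normalField_spec (half_pos hc) hy.elliptic hy.defining.fderiv_ne_zero
  have h2 : ∀ ξ, (fderiv ℝ S (y, 0) (ξ, 0)).1 = fderiv ℝ φ y ξ := by
    intro ξ
    have k1 : HasFDerivAt (fun y' => (S (y', 0)).1)
        ((ContinuousLinearMap.fst ℝ _ _).comp ((fderiv ℝ S (y, 0)).comp (ContinuousLinearMap.inl ℝ _ ℝ))) y :=
      (HasFDerivAt.comp y (g := S) (f := fun y' : Eu (n - 1) => (y', (0 : ℝ)))
        (hy.smooth.differentiableAt (by exact_mod_cast hN)).hasFDerivAt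
        (hasFDerivAt_prodMk_left y (0 : ℝ))).fst
    have k2 : (fun y' => (S (y', 0)).1) =ᶠ[𝓝 y] φ := by
      filter_upwards [hy.init] with z hz
      rw [hz]
    have k3 := k1.unique ((((hφ.contDiffAt hyU).differentiableAt (by simp)).hasFDerivAt).congr_of_eventuallyEq k2)
    exact DFunLike.congr_fun k3 ξ
  refine ⟨?_, fun ξ => ⟨h2 ξ, ?_⟩⟩
  · rw [hy.apply_zero]; exact h1.2.1
  · rw [h2, hy.apply_zero]
    simp only
    rw [h1.2.2, hφ.fderiv_eq_zero hΩ hyU hy.defining, zero_div]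

/-- Along the flow the derivative of the metric and the two acceleration terms in the derivative of
`G(v, v)` cancel, so the initial value 1 persists. -/
theorem IsNormalFlow.speed (hφ : IsBoundaryChart Ω U φ) (hΩ : IsSmoothDomain Ω) (hx : x ∈ U)
    (h : IsNormalFlow Ω g φ r N c G S x) (hc : 0 < c) (hN : N ≠ 0) :
    ∀ᶠ q in 𝓝 (x, (0 : ℝ)), G (S q).1 (S q).2 (S q).2 = 1 := by
  have h1 := eventually_eq_of_deriv_zero (x := x) (u := fun (_ : Unit) q => G (S q).1 (S q).2 (S q).2) (by
    filter_upwards [h.eventually_regular hc] with q ⟨_, hq2, hq3, hq4⟩ _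
    have hq5 := (hq2.differentiableAt (by simp)).hasFDerivAt.comp_hasDerivAt (f := fun t => (S (q.1, t)).1)
      q.2 hq4.hasFDerivAt.fst.hasDerivAt
    have hv := hq4.hasFDerivAt.snd.hasDerivAt
    refine (hasDerivAt_bilin hq5 hv hv).congr_deriv ?_
    have ha := metric_spray_apply (z := S q) (isInvertible_of_elliptic (half_pos hc) hq3) (S q).2
    have hs := h.ext.symm (S q).1 (S q).2 (spray G (S q)).2
    simp only [ContinuousLinearMap.comp_apply, ContinuousLinearMap.toSpanSingleton_apply, one_smul,
      ContinuousLinearMap.coe_fst', ContinuousLinearMap.coe_snd']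
    change fderiv ℝ G (S q).1 (S q).2 (S q).2 (S q).2 + G (S q).1 (spray G (S q)).2 (S q).2
      + G (S q).1 (S q).2 (spray G (S q)).2 = 0
    rw [hs, ha]; ring)
  filter_upwards [h1, (continuous_fst.tendsto (x, (0 : ℝ))).eventually (h.eventually_init hφ hΩ hx hc hN)]
    with q hq hq'
  rw [hq ()]
  exact hq'.1

/-- The Gauss lemma. -/
theorem IsNormalFlow.perp (hφ : IsBoundaryChart Ω U φ) (hΩ : IsSmoothDomain Ω) (hx : x ∈ U)
    (h : IsNormalFlow Ω g φ r N c G S x) (hc : 0 < c) (hN : 2 ≤ N) :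
    ∀ᶠ q in 𝓝 (x, (0 : ℝ)), ∀ ξ, G (S q).1 (S q).2 (fderiv ℝ S q (ξ, 0)).1 = 0 := by
  have h1 := eventually_eq_of_deriv_zero (x := x)
    (u := fun (ξ : Eu (n - 1)) q => G (S q).1 (S q).2 (fderiv ℝ S q (ξ, 0)).1) (by
    filter_upwards [h.eventually_regular hc, (h.speed hφ hΩ hx hc (by omega)).eventually_nhds,
      h.mixed hN] with q ⟨hq1, hq2, hq3, hq4⟩ hsp hmix ξ
    have hq5 := (hq2.differentiableAt (by simp)).hasFDerivAt.comp_hasDerivAt (f := fun t => (S (q.1, t)).1)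
      q.2 hq4.hasFDerivAt.fst.hasDerivAt
    have hv := hq4.hasFDerivAt.snd.hasDerivAt
    refine (hasDerivAt_bilin hq5 hv (hmix.2 ξ)).congr_deriv ?_
    have ha := metric_spray_apply (z := S q) (isInvertible_of_elliptic (half_pos hc) hq3)
      (fderiv ℝ S q (ξ, 0)).1
    simp only [ContinuousLinearMap.comp_apply, ContinuousLinearMap.toSpanSingleton_apply, one_smul,
      ContinuousLinearMap.coe_fst', ContinuousLinearMap.coe_snd']
    change fderiv ℝ G (S q).1 (S q).2 (S q).2 (fderiv ℝ S q (ξ, 0)).1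
      + G (S q).1 (spray G (S q)).2 (fderiv ℝ S q (ξ, 0)).1
      + G (S q).1 (S q).2 (fderiv ℝ S q (ξ, 0)).2 = 0
    have hSd := (hq1.differentiableAt (by simp; omega)).hasFDerivAt
    have hGd : HasFDerivAt (fun q => G (S q).1) _ q :=
      HasFDerivAt.comp q (g := G) (f := fun q => (S q).1)
        (hq2.differentiableAt (by simp)).hasFDerivAt hSd.fst
    have k1 := ((hGd.clm_apply hSd.snd).clm_apply hSd.snd)
    -- The constancy of the speed, differentiated in the direction `ξ`, is the identity that cancels
    -- the remaining terms.
    have k2 := k1.unique ((hasFDerivAt_const (1 : ℝ) q).congr_of_eventuallyEq hsp)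
    have k3 := DFunLike.congr_fun k2 (ξ, 0)
    have k4 : fderiv ℝ G (S q).1 (fderiv ℝ S q (ξ, 0)).1 (S q).2 (S q).2
      + G (S q).1 (fderiv ℝ S q (ξ, 0)).2 (S q).2 + G (S q).1 (S q).2 (fderiv ℝ S q (ξ, 0)).2 = 0 := by
      have k5 : G (S q).1 (S q).2 (fderiv ℝ S q (ξ, 0)).2 + (G (S q).1 (fderiv ℝ S q (ξ, 0)).2 (S q).2
        + fderiv ℝ G (S q).1 (fderiv ℝ S q (ξ, 0)).1 (S q).2 (S q).2) = 0 := k3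
      linarith
    have hs := h.ext.symm (S q).1 (S q).2 (fderiv ℝ S q (ξ, 0)).2
    rw [ha]
    linarith)
  filter_upwards [h1, (continuous_fst.tendsto (x, (0 : ℝ))).eventually
    (h.eventually_init hφ hΩ hx hc (by omega))] with q hq hq' ξ
  rw [hq ξ]
  exact (hq'.2 ξ).2

/-- The metric induced on the level sets of `xⁿ`. -/
noncomputable def tangentialMetric (G : TensorField n) (S : Co n → Eu n × Eu n) (q : Co n) :
    Eu (n - 1) →L[ℝ] Eu (n - 1) →L[ℝ] ℝ :=
  (G (S q).1).bilinearComp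
    ((ContinuousLinearMap.fst ℝ (Eu n) (Eu n)).comp ((fderiv ℝ S q).comp (ContinuousLinearMap.inl ℝ _ ℝ)))
    ((ContinuousLinearMap.fst ℝ (Eu n) (Eu n)).comp ((fderiv ℝ S q).comp (ContinuousLinearMap.inl ℝ _ ℝ)))

theorem tangentialMetric_apply (q : Co n) (v w : Eu (n - 1)) :
    tangentialMetric G S q v w = G (S q).1 (fderiv ℝ S q (v, 0)).1 (fderiv ℝ S q (w, 0)).1 := rfl

/-- The Gauss lemma removes the mixed terms and unit speed makes the normal coefficient 1. This
product form is what the scaled geodesic equation presupposes. -/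
theorem IsNormalFlow.pullback (hφ : IsBoundaryChart Ω U φ) (hΩ : IsSmoothDomain Ω) (hx : x ∈ U)
    (h : IsNormalFlow Ω g φ r N c G S x) (hc : 0 < c) (hN : 2 ≤ N) :
    ∀ᶠ q in 𝓝 (x, (0 : ℝ)), ∀ v w,
      G (S q).1 (fderiv ℝ S q v).1 (fderiv ℝ S q w).1 = prodMetric (tangentialMetric G S) q v w := by
  filter_upwards [h.perp hφ hΩ hx hc hN, h.speed hφ hΩ hx hc (by omega), h.mixed hN] with q h1 h2 h3
  have hd : ∀ v : Co n, (fderiv ℝ S q v).1 = (fderiv ℝ S q (v.1, 0)).1 + v.2 • (S q).2 := by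
    intro v
    have e : v = (v.1, (0 : ℝ)) + v.2 • ((0 : Eu (n - 1)), (1 : ℝ)) := by ext <;> simp
    conv_lhs => rw [e, map_add, map_smul, h3.1]
    rfl
  intro v w
  rw [prodMetric_apply, tangentialMetric_apply, hd v, hd w]
  have hs := h.ext.symm (S q).1 (fderiv ℝ S q (v.1, 0)).1 (S q).2
  simp only [map_add, map_smul, add_apply, smul_apply, smul_eq_mul, hs, h1, h2]
  ring

theorem jetBound_tangentialMetric {ι : Type} {l : ℕ} {G : ι → TensorField n} {S : ι → Co n → Eu n × Eu n}
    {q : ι → Co n} (hS : JetBound (l + 1) S q (fun _ => 1))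
    (hG : JetBound l G (fun i => (S i (q i)).1) (fun _ => 1)) :
    JetBound l (fun i => tangentialMetric (G i) (S i)) q (fun _ => 1) := by
  have h1 : ∀ _ : ι, (0 : ℝ) ≤ 1 := fun _ => zero_le_one
  have hGF : JetBound l (fun i q => G i (S i q).1) q (fun _ => 1) :=
    JetBound.comp (u := G) h1 hG ((hS.mono (Nat.le_succ l)).clm_apply (ContinuousLinearMap.fst ℝ (Eu n) (Eu n)))
  have hA : JetBound l (fun i q => (ContinuousLinearMap.fst ℝ (Eu n) (Eu n)).comp
      ((fderiv ℝ (S i) q).comp (ContinuousLinearMap.inl ℝ (Eu (n - 1)) ℝ))) q (fun _ => 1) :=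
    (hS.fderiv.clm_apply ((ContinuousLinearMap.compL ℝ (Eu (n - 1)) (Co n) (Eu n × Eu n)).flip
      (ContinuousLinearMap.inl ℝ (Eu (n - 1)) ℝ))).clm_apply
      (ContinuousLinearMap.compL ℝ (Eu (n - 1)) (Eu n × Eu n) (Eu n)
        (ContinuousLinearMap.fst ℝ (Eu n) (Eu n)))
  have hB := (JetBound.bilin h1 (ContinuousLinearMap.compL ℝ (Eu (n - 1)) (Eu n) (Eu n →L[ℝ] ℝ)) hGF hA).clm_apply
    (ContinuousLinearMap.flipₗᵢ ℝ (Eu (n - 1)) (Eu n) ℝ).toContinuousLinearEquiv.toContinuousLinearMap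
  have hC := (JetBound.bilin h1 (ContinuousLinearMap.compL ℝ (Eu (n - 1)) (Eu n) (Eu (n - 1) →L[ℝ] ℝ)) hB hA).clm_apply
    (ContinuousLinearMap.flipₗᵢ ℝ (Eu (n - 1)) (Eu (n - 1)) ℝ).toContinuousLinearEquiv.toContinuousLinearMap
  exact hC

end NormalFlow

/-! ### The second fundamental form and the normal geodesics -/

section NormalGeodesics

variable {n : ℕ} {Ω : Set (Eu n)} {U : Set (Eu (n - 1))} {φ : Eu (n - 1) → Eu n} {x : Eu (n - 1)}
  {r : Eu n → ℝ} {g G : TensorField n} {N : ℕ} {c : ℝ} {S : Co n → Eu n × Eu n}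

theorem fderiv_symm {E : Type} [NormedAddCommGroup E] [NormedSpace ℝ E] {G : E → E →L[ℝ] E →L[ℝ] ℝ}
    {p : E} (hG : DifferentiableAt ℝ G p) (hs : ∀ q v w, G q v w = G q w v) (a v w : E) :
    fderiv ℝ G p a v w = fderiv ℝ G p a w v := by
  have h : ∀ v w, HasFDerivAt (fun q => G q v w) (((fderiv ℝ G p).flip v).flip w) p := fun v w => by
    have h1 := (hG.hasFDerivAt.clm_apply (hasFDerivAt_const v p)).clm_apply (hasFDerivAt_const w p)
    refine h1.congr_fderiv ?_
    ext a
    simp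
  have h2 := h w v
  simp_rw [hs _ w v] at h2
  exact DFunLike.congr_fun ((h v w).unique h2) a

section Line

variable {X Y : Type} [NormedAddCommGroup X] [NormedSpace ℝ X] [NormedAddCommGroup Y] [NormedSpace ℝ Y]

theorem hasDerivAt_line (x ξ : X) : HasDerivAt (fun s : ℝ => x + s • ξ) ξ 0 := by
  simpa using ((hasDerivAt_id (0 : ℝ)).smul_const ξ).const_add x

theorem tendsto_line (x ξ : X) : Tendsto (fun s : ℝ => x + s • ξ) (𝓝 0) (𝓝 x) := by
  simpa using (hasDerivAt_line x ξ).continuousAt.tendsto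

theorem hasDerivAt_comp_line {f : X → Y} {x : X} (hf : DifferentiableAt ℝ f x) (ξ : X) :
    HasDerivAt (fun s : ℝ => f (x + s • ξ)) (fderiv ℝ f x ξ) 0 := by
  have h1 : HasFDerivAt f (fderiv ℝ f x) (x + (0 : ℝ) • ξ) := by simpa using hf.hasFDerivAt
  exact h1.comp_hasDerivAt (0 : ℝ) (hasDerivAt_line x ξ)

end Line

theorem IsNormalFlow.differentiableAt_metric (h : IsNormalFlow Ω g φ r N c G S x) :
    DifferentiableAt ℝ G (φ x) := h.ext.contDiffAt.differentiableAt (by simp)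

theorem hasDerivAt_comp_curve {E Y : Type} [NormedAddCommGroup E] [NormedSpace ℝ E]
    [NormedAddCommGroup Y] [NormedSpace ℝ Y] {f : E → Y} {γ : ℝ → E} {u p : E} {t : ℝ}
    (hγ : HasDerivAt γ u t) (hp : γ t = p) (hf : DifferentiableAt ℝ f p) :
    HasDerivAt (fun s => f (γ s)) (fderiv ℝ f p u) t := by
  subst hp
  exact hf.hasFDerivAt.comp_hasDerivAt t hγ

theorem IsBoundaryChart.hasDerivAt_fderiv_line (hφ : IsBoundaryChart Ω U φ) (hx : x ∈ U)
    (ξ : Eu (n - 1)) :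
    HasDerivAt (fun s : ℝ => fderiv ℝ φ (x + s • ξ) ξ) (fderiv ℝ (fderiv ℝ φ) x ξ ξ) 0 := by
  have h2 := (hasDerivAt_comp_line ((((hφ.contDiffAt hx).fderiv_right (m := 1)
    (by norm_cast)).differentiableAt one_ne_zero)) ξ).clm_apply (hasDerivAt_const (0 : ℝ) ξ)
  simpa using h2

/-- The velocity field is perpendicular to the boundary; this equation differentiated along it. -/
theorem IsNormalFlow.metric_fderiv_velocity (hφ : IsBoundaryChart Ω U φ) (hΩ : IsSmoothDomain Ω)
    (hx : x ∈ U) (h : IsNormalFlow Ω g φ r N c G S x) (hc : 0 < c) (hN : N ≠ 0) (ξ : Eu (n - 1)) :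
    G (φ x) (fderiv ℝ S (x, 0) (ξ, 0)).2 (fderiv ℝ φ x ξ) =
      -fderiv ℝ G (φ x) (fderiv ℝ φ x ξ) (normalField G r (φ x)) (fderiv ℝ φ x ξ)
        - G (φ x) (normalField G r (φ x)) (fderiv ℝ (fderiv ℝ φ) x ξ ξ) := by
  have hcd := hasDerivAt_comp_line ((hφ.contDiffAt hx).differentiableAt (by simp)) ξ
  have hnd : HasDerivAt (fun s : ℝ => (S (x + s • ξ, 0)).2) (fderiv ℝ S (x, 0) (ξ, 0)).2 0 := by
    have h2 : HasDerivAt (fun s : ℝ => (x + s • ξ, (0 : ℝ))) (ξ, 0) 0 :=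
      (hasDerivAt_line x ξ).prodMk (hasDerivAt_const _ _)
    have h3 := hasDerivAt_comp_curve h2 (p := (x, 0)) (by simp) (h.smooth.differentiableAt (by exact_mod_cast hN))
    exact ((ContinuousLinearMap.snd ℝ (Eu n) (Eu n)).hasFDerivAt).comp_hasDerivAt (0 : ℝ) h3
  have hGc := hasDerivAt_comp_curve hcd (p := φ x) (by simp) h.differentiableAt_metric
  have k1 := hasDerivAt_bilin hGc hnd (hφ.hasDerivAt_fderiv_line hx ξ)
  have k2 : (fun s : ℝ => G (φ (x + s • ξ)) (S (x + s • ξ, 0)).2 (fderiv ℝ φ (x + s • ξ) ξ))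
      =ᶠ[𝓝 0] fun _ => 0 := by
    filter_upwards [(tendsto_line x ξ).eventually (h.eventually_init hφ hΩ hx hc hN),
      (tendsto_line x ξ).eventually h.init] with s hs hs'
    have := (hs.2 ξ).2
    rw [(hs.2 ξ).1] at this
    rw [hs'] at this ⊢
    exact this
  have k3 := k1.unique ((hasDerivAt_const (0 : ℝ) (0 : ℝ)).congr_of_eventuallyEq k2)
  simp only [zero_smul, add_zero, h.apply_zero] at k3
  linarith

/-- Differentiate `dr(dφ ξ) = 0` along a line in the direction `ξ`. This trades the second
derivative of `φ` for the Hessian of `r`, as in the definition of the second fundamental form. -/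
theorem IsNormalFlow.fderiv_defining (hφ : IsBoundaryChart Ω U φ) (hΩ : IsSmoothDomain Ω)
    (hx : x ∈ U) (h : IsNormalFlow Ω g φ r N c G S x) (hc : 0 < c) (ξ : Eu (n - 1)) :
    fderiv ℝ r (φ x) (fderiv ℝ (fderiv ℝ φ) x ξ ξ) =
      -fderiv ℝ (fderiv ℝ r) (φ x) (fderiv ℝ φ x ξ) (fderiv ℝ φ x ξ) := by
  have hcd := hasDerivAt_comp_line ((hφ.contDiffAt hx).differentiableAt (by simp)) ξ
  have hrc := hasDerivAt_comp_curve hcd (p := φ x) (by simp)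
    ((h.defining.contDiffAt.fderiv_right (m := 1) (by norm_cast)).differentiableAt one_ne_zero)
  have k1 := hrc.clm_apply (hφ.hasDerivAt_fderiv_line hx ξ)
  have k2 : (fun s : ℝ => fderiv ℝ r (φ (x + s • ξ)) (fderiv ℝ φ (x + s • ξ) ξ)) =ᶠ[𝓝 0] fun _ => 0 := by
    filter_upwards [(tendsto_line x ξ).eventually (h.eventually hφ hx hc)] with s hs
    exact hφ.fderiv_eq_zero hΩ hs.1 hs.2.defining ξ
  have k3 := k1.unique ((hasDerivAt_const (0 : ℝ) (0 : ℝ)).congr_of_eventuallyEq k2)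
  simp only [zero_smul, add_zero] at k3
  linarith

theorem IsNormalFlow.differentiableAt_tangentialMetric (h : IsNormalFlow Ω g φ r N c G S x)
    (hN : 2 ≤ N) : DifferentiableAt ℝ (tangentialMetric G S) (x, 0) :=
  ((jetBound_tangentialMetric (ι := Unit) (l := 1) (G := fun _ => G) (S := fun _ => S)
    (q := fun _ => (x, 0)) (jetBound_single (h.smooth.of_le (by exact_mod_cast hN)))
    (jetBound_single (by
      rw [h.apply_zero]
      exact h.ext.contDiffAt.of_le (by norm_cast; omega)))).contDiffAt ()).differentiableAt (by norm_num)

theorem IsNormalFlow.hasDerivAt_tangentialMetric (hφ : IsBoundaryChart Ω U φ) (hΩ : IsSmoothDomain Ω)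
    (hx : x ∈ U) (h : IsNormalFlow Ω g φ r N c G S x) (hc : 0 < c) (hN : 2 ≤ N) (ξ : Eu (n - 1)) :
    HasDerivAt (fun t => tangentialMetric G S (x, t) ξ ξ)
      (fderiv ℝ G (φ x) (normalField G r (φ x)) (fderiv ℝ φ x ξ) (fderiv ℝ φ x ξ)
        + G (φ x) (fderiv ℝ S (x, 0) (ξ, 0)).2 (fderiv ℝ φ x ξ)
        + G (φ x) (fderiv ℝ φ x ξ) (fderiv ℝ S (x, 0) (ξ, 0)).2) 0 := by
  have hode := h.ode.self_of_nhds
  have hF : HasDerivAt (fun t => (S (x, t)).1) (normalField G r (φ x)) 0 := by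
    have := ((ContinuousLinearMap.fst ℝ (Eu n) (Eu n)).hasFDerivAt).comp_hasDerivAt (0 : ℝ) hode
    refine this.congr_deriv ?_
    change (S (x, 0)).2 = _
    rw [h.apply_zero]
  have hGt := hasDerivAt_comp_curve hF (p := φ x) (by rw [h.apply_zero]) h.differentiableAt_metric
  have hm := (h.mixed hN).self_of_nhds.2 ξ
  have k1 := hasDerivAt_bilin hGt hm hm
  have hu' := ((h.eventually_init hφ hΩ hx hc (by omega)).self_of_nhds.2 ξ).1
  simp only [hu', h.apply_zero] at k1
  exact k1

/-- The link between the geometry and the expansion: convexity of the boundary is negativity of the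
normal derivative of `h`. The time derivative of the tangential metric contains the tangential
derivative of the normal field, which is eliminated by differentiating its orthogonality to the
boundary. -/
theorem IsNormalFlow.fderiv_tangentialMetric (hφ : IsBoundaryChart Ω U φ) (hΩ : IsSmoothDomain Ω)
    (hx : x ∈ U) (h : IsNormalFlow Ω g φ r N c G S x) (hc : 0 < c) (hN : 2 ≤ N) (ξ : Eu (n - 1)) :
    fderiv ℝ (tangentialMetric G S) (x, 0) (0, 1) ξ ξ =
      -2 * secondFundamentalForm Ω g r (φ x) (normalField G r (φ x)) (fderiv ℝ φ x ξ) := by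
  have spec := normalField_spec hc h.elliptic h.defining.fderiv_ne_zero
  have d1 : HasDerivAt (fun t => tangentialMetric G S (x, t) ξ ξ)
      (fderiv ℝ (tangentialMetric G S) (x, 0) (0, 1) ξ ξ) 0 := by
    have k1 := ((hasDerivAt_slice (h.differentiableAt_tangentialMetric hN)).clm_apply
      (hasDerivAt_const (0 : ℝ) ξ)).clm_apply (hasDerivAt_const (0 : ℝ) ξ)
    simpa using k1
  rw [d1.unique (h.hasDerivAt_tangentialMetric hφ hΩ hx hc hN ξ),
    h.ext.symm (φ x) (fderiv ℝ φ x ξ) (fderiv ℝ S (x, 0) (ξ, 0)).2,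
    h.metric_fderiv_velocity hφ hΩ hx hc (by omega), secondFundamentalForm,
    h.ext.dMetric_eq hΩ (by omega) (hφ.mapsTo hx).1,
    fderiv_symm h.differentiableAt_metric h.ext.symm _ (normalField G r (φ x)) (fderiv ℝ φ x ξ),
    spec.2.2 (fderiv ℝ (fderiv ℝ φ) x ξ ξ), h.fderiv_defining hφ hΩ hx hc]
  have hrν : fderiv ℝ r (φ x) (normalField G r (φ x)) ≠ 0 := spec.1.ne
  field_simp
  ring

theorem IsNormalFlow.eventually_mem_iff (hφ : IsBoundaryChart Ω U φ) (hΩ : IsSmoothDomain Ω) (hx : x ∈ U)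
    (h : IsNormalFlow Ω g φ r N c G S x) (hc : 0 < c) (hN : 2 ≤ N) :
    ∀ᶠ q in 𝓝 (x, (0 : ℝ)), ((S q).1 ∈ Ω ↔ 0 < q.2) ∧ ((S q).1 ∈ closure Ω ↔ 0 ≤ q.2) := by
  have hS1 : ContDiffAt ℝ 1 S (x, 0) := h.smooth.of_le (by norm_cast; omega)
  refine hφ.eventually_mem_iff hΩ hx h.defining (Θ := fun q => (S q).1) hS1.fst ?_ ?_
  · filter_upwards [h.init] with y hy
    rw [hy]
  · have e : fderiv ℝ (fun q => (S q).1) (x, 0) (0, 1) = (fderiv ℝ S (x, 0) (0, 1)).1 := by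
      rw [(hS1.differentiableAt one_ne_zero).hasFDerivAt.fst.fderiv]; rfl
    rw [e, (h.mixed hN).self_of_nhds.1]
    change fderiv ℝ r (φ x) (S (x, 0)).2 < 0
    rw [h.apply_zero]
    exact (normalField_spec hc h.elliptic h.defining.fderiv_ne_zero).1

theorem IsNormalFlow.isInwardUnitNormal (hφ : IsBoundaryChart Ω U φ) (hx : x ∈ U)
    (h : IsNormalFlow Ω g φ r N c G S x) (hc : 0 < c) :
    IsInwardUnitNormal Ω g (φ x) (normalField G r (φ x)) := by
  have spec := normalField_spec hc h.elliptic h.defining.fderiv_ne_zero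
  have hp := hφ.mapsTo hx
  refine ⟨hp, r, h.defining, ?_, fun w hw => ?_, spec.1⟩
  · rw [← h.ext.eq_self hp.1]; exact spec.2.1
  · rw [← h.ext.eq_self hp.1, spec.2.2, hw, zero_div]

theorem IsNormalFlow.eq_normalField (hn : 2 ≤ n) (hφ : IsBoundaryChart Ω U φ) (hΩ : IsSmoothDomain Ω)
    (hx : x ∈ U) (h : IsNormalFlow Ω g φ r N c G S x) (hc : 0 < c) {ν : Eu n}
    (hν : IsInwardUnitNormal Ω g (φ x) ν) : ν = normalField G r (φ x) := by
  have hp := hφ.mapsTo hx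
  refine inward_unique (B := g (φ x)) (l := fderiv ℝ r (φ x)) (fun v hv => ?_)
    (hφ.fderiv_inward_neg hn hΩ hx h.defining hν)
    (hφ.fderiv_inward_neg hn hΩ hx h.defining (h.isInwardUnitNormal hφ hx hc))
  rw [← h.ext.eq_self hp.1]
  have : 0 < ‖v‖ := norm_pos_iff.2 hv
  exact lt_of_lt_of_le (by positivity) (h.elliptic v)

theorem IsNormalFlow.exists_box (hφ : IsBoundaryChart Ω U φ) (hΩ : IsSmoothDomain Ω) (hx : x ∈ U)
    (h : IsNormalFlow Ω g φ r N c G S x) (hc : 0 < c) (hN : 2 ≤ N) :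
    ∃ δ > 0, ∀ y ∈ Metric.ball x δ, (y ∈ U ∧ IsNormalFlow Ω g φ r N (c / 2) G S y) ∧
      ∀ t ∈ Ioo (-δ) δ, ContDiffAt ℝ 2 S (y, t) ∧ IsMetricExtension Ω g (N + 1) (S (y, t)).1 G ∧
        (∀ v, c / 2 * ‖v‖ ^ 2 ≤ G (S (y, t)).1 v v) ∧
        HasDerivAt (fun t => S (y, t)) (spray G (S (y, t))) t ∧
        ((S (y, t)).1 ∈ closure Ω ↔ 0 ≤ t) := by
  have h1 := ((h.eventually_regular hc).and ((h.tendsto_fst.eventually h.ext.eventually).and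
    (h.eventually_mem_iff hφ hΩ hx hc hN))).and ((continuous_fst.tendsto (x, (0 : ℝ))).eventually
      (h.eventually hφ hx hc))
  obtain ⟨δ, hδ, hb⟩ := Metric.eventually_nhds_iff.1 h1
  have hin : ∀ y ∈ Metric.ball x δ, ∀ t ∈ Ioo (-δ) δ, dist (y, t) (x, (0 : ℝ)) < δ := fun y hy t ht => by
    rw [Prod.dist_eq]; exact max_lt hy (by rw [dist_zero_right]; exact abs_lt.2 ht)
  refine ⟨δ, hδ, fun y hy => ⟨(hb (hin y hy 0 ⟨by linarith, hδ⟩)).2, fun t ht => ?_⟩⟩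
  obtain ⟨⟨⟨q1, q2, q3, q4⟩, q5, q6⟩, -⟩ := hb (hin y hy t ht)
  exact ⟨q1.of_le (by exact_mod_cast hN), q5, q3, q4, q6.2⟩

/-- The geodesics of the flow are the normal geodesics of the metric. -/
theorem IsNormalFlow.exists_isNormalGeodesic (hφ : IsBoundaryChart Ω U φ) (hΩ : IsSmoothDomain Ω)
    (hx : x ∈ U) (h : IsNormalFlow Ω g φ r N c G S x) (hc : 0 < c) (hN : 2 ≤ N) :
    ∃ δ > 0, ∀ y ∈ Metric.ball x δ, ∀ s, 0 < s → s ≤ δ →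
      IsNormalGeodesic Ω g (φ y) s (fun t => (S (y, t)).1) := by
  obtain ⟨δ, hδ, hb⟩ := h.exists_box hφ hΩ hx hc hN
  refine ⟨δ, hδ, fun y hy s hs hsδ => ?_⟩
  obtain ⟨⟨hyU, hflow⟩, hbt⟩ := hb y hy
  have hin : ∀ t ∈ Ico 0 s, t ∈ Ioo (-δ) δ := fun t ht => ⟨by linarith [ht.1], by linarith [ht.2]⟩
  have hu : UniqueDiffOn ℝ (Ico 0 s) := uniqueDiffOn_Ico 0 s
  have d1 : ∀ t ∈ Ico 0 s, derivWithin (fun t => (S (y, t)).1) (Ico 0 s) t = (S (y, t)).2 := fun t ht => by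
    have k := ((ContinuousLinearMap.fst ℝ (Eu n) (Eu n)).hasFDerivAt).comp_hasDerivAt t
      (hbt t (hin t ht)).2.2.2.1
    exact k.hasDerivWithinAt.derivWithin (hu t ht)
  have d2 : ∀ t ∈ Ico 0 s, iteratedDerivWithin 2 (fun t => (S (y, t)).1) (Ico 0 s) t =
      (spray G (S (y, t))).2 := fun t ht => by
    have k := ((ContinuousLinearMap.snd ℝ (Eu n) (Eu n)).hasFDerivAt).comp_hasDerivAt t
      (hbt t (hin t ht)).2.2.2.1
    rw [iteratedDerivWithin_succ, derivWithin_congr (f := fun t => (S (y, t)).2)]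
    · exact k.hasDerivWithinAt.derivWithin (hu t ht)
    · intro t' ht'
      rw [iteratedDerivWithin_one]
      exact d1 t' ht'
    · rw [iteratedDerivWithin_one]
      exact d1 t ht
  refine ⟨⟨fun t ht => ?_, fun t ht => (hbt t (hin t ht)).2.2.2.2.2 ht.1, fun t ht w => ?_⟩, ?_, ?_⟩
  · have k : ContDiffAt ℝ 2 (fun t => S (y, t)) t :=
      (hbt t (hin t ht)).1.comp t (contDiffAt_const.prodMk contDiffAt_id)
    exact k.fst.contDiffWithinAt
  · obtain ⟨q1, q2, q3, q4, q5⟩ := hbt t (hin t ht)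
    have hcl : (S (y, t)).1 ∈ closure Ω := q5.2 ht.1
    have k := metric_spray_apply (z := S (y, t)) (isInvertible_of_elliptic (half_pos hc) q3) w
    rw [d1 t ht, d2 t ht, q2.dMetric_eq hΩ (by omega) hcl, ← q2.eq_self hcl, k]
    ring
  · rw [hflow.apply_zero]
  · rw [d1 0 ⟨le_rfl, hs⟩, hflow.apply_zero]
    exact hflow.isInwardUnitNormal hφ hyU (half_pos hc)

/-- Position and velocity of a normal geodesic solve the equation of the spray as long as the
position is near `φ x`, and the initial data agree. Nothing is known beforehand about where `γ`
goes; this is why `eqOn_of_ode` confines only the second solution. -/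
theorem IsNormalFlow.eq_of_isNormalGeodesic (hn : 2 ≤ n) (hφ : IsBoundaryChart Ω U φ)
    (hΩ : IsSmoothDomain Ω) (hx : x ∈ U) (h : IsNormalFlow Ω g φ r N c G S x) (hc : 0 < c) (hN : 2 ≤ N) :
    ∃ δ > 0, ∀ y ∈ Metric.ball x δ, ∀ s, ∀ γ, IsNormalGeodesic Ω g (φ y) s γ →
      ∀ t ∈ Ico 0 s, t < δ → γ t = (S (y, t)).1 := by
  obtain ⟨δ₁, hδ₁, hb⟩ := h.exists_box hφ hΩ hx hc hN
  obtain ⟨O, hOn, hO⟩ : ∃ O ∈ 𝓝 (φ x), ∀ p ∈ O, IsMetricExtension Ω g (N + 1) p G ∧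
      ∀ v, c / 2 * ‖v‖ ^ 2 ≤ G p v v :=
    ⟨_, h.ext.eventually.and (eventually_elliptic h.ext.contDiffAt.continuousAt hc h.elliptic),
      fun p hp => hp⟩
  obtain ⟨O', hO'O, hO'o, hO'x⟩ := mem_nhds_iff.1 hOn
  obtain ⟨δ₂, hδ₂, hb₂⟩ := Metric.eventually_nhds_iff.1 (h.tendsto_fst.eventually (hO'o.mem_nhds hO'x))
  refine ⟨min δ₁ δ₂, lt_min hδ₁ hδ₂, fun y hy s γ hγ t ht htδ => ?_⟩
  have hy₁ : y ∈ Metric.ball x δ₁ := Metric.ball_subset_ball (min_le_left _ _) hy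
  have hy₂ : y ∈ Metric.ball x δ₂ := Metric.ball_subset_ball (min_le_right _ _) hy
  obtain ⟨⟨hyU, hflow⟩, hbt⟩ := hb y hy₁
  have hs : 0 < s := ht.1.trans_lt ht.2
  have hin : ∀ τ ∈ Icc 0 t, τ ∈ Ioo (-δ₁) δ₁ := fun τ hτ =>
    ⟨by linarith [hτ.1], hτ.2.trans_lt (htδ.trans_le (min_le_left _ _))⟩
  have hIs : ∀ τ ∈ Icc 0 t, τ ∈ Ico 0 s := fun τ hτ => ⟨hτ.1, hτ.2.trans_lt ht.2⟩
  have hu : UniqueDiffOn ℝ (Ico 0 s) := uniqueDiffOn_Ico 0 s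
  have hγ1 : ContDiffOn ℝ 1 (derivWithin γ (Ico 0 s)) (Ico 0 s) :=
    hγ.geodesic.contDiffOn.derivWithin hu (by norm_num)
  have hZ : ∀ z ∈ O' ×ˢ (univ : Set (Eu n)), ContDiffAt ℝ 1 (spray G) z := fun z hz => by
    have k := hO _ (hO'O hz.1)
    have := contDiffAt_spray (z := z) (half_pos hc) k.1.contDiffAt k.2
    exact this.of_le (by norm_cast; omega)
  have key := eqOn_of_ode (Z := spray G) (D := O' ×ˢ (univ : Set (Eu n))) hZ
    (y₁ := fun τ => (γ τ, derivWithin γ (Ico 0 s) τ)) (y₂ := fun τ => S (y, τ)) (a := 0) (b := t)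
    ?_ ?_ ?_ ?_ (hO'o.prod isOpen_univ) ?_ ?_
  · exact congrArg Prod.fst (key (right_mem_Icc.2 ht.1))
  · exact (hγ.geodesic.contDiffOn.continuousOn.prodMk hγ1.continuousOn).mono hIs
  · exact fun τ hτ => (hbt τ (hin τ hτ)).2.2.2.1.continuousAt.continuousWithinAt
  · intro τ hτ hD
    have hτs := hIs τ (Ico_subset_Icc_self hτ)
    have hmem : Ico 0 s ∈ 𝓝[≥] τ := mem_of_superset (Ico_mem_nhdsGE hτs.2)
      fun a ha => ⟨hτs.1.trans ha.1, ha.2⟩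
    have k1 : HasDerivWithinAt γ (derivWithin γ (Ico 0 s) τ) (Ici τ) τ :=
      ((hγ.geodesic.contDiffOn.differentiableOn (by norm_num) τ hτs).hasDerivWithinAt).mono_of_mem_nhdsWithin
        hmem
    have k2 : HasDerivWithinAt (derivWithin γ (Ico 0 s)) (iteratedDerivWithin 2 γ (Ico 0 s) τ) (Ici τ) τ := by
      have k3 := ((hγ1.differentiableOn one_ne_zero τ hτs).hasDerivWithinAt).mono_of_mem_nhdsWithin hmem
      rw [iteratedDerivWithin_succ, iteratedDerivWithin_one]
      exact k3
    obtain ⟨q1, q2⟩ := hO _ (hO'O hD.1)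
    have hcl := hγ.geodesic.mapsTo hτs
    have k4 : iteratedDerivWithin 2 γ (Ico 0 s) τ = (spray G (γ τ, derivWithin γ (Ico 0 s) τ)).2 := by
      have hinv := isInvertible_of_elliptic (half_pos hc) q2
      have k5 : G (γ τ) (iteratedDerivWithin 2 γ (Ico 0 s) τ) =
          christoffelForm (fderiv ℝ G (γ τ)) (derivWithin γ (Ico 0 s) τ) := by
        ext w
        have k6 := hγ.geodesic.equation τ hτs w
        rw [q1.dMetric_eq hΩ (by omega) hcl, ← q1.eq_self hcl] at k6
        rw [christoffelForm_apply]
        linarith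
      change _ = (G (γ τ)).inverse _
      rw [← k5, hinv.inverse_apply_self]
    rw [k4] at k2
    exact k1.prodMk k2
  · exact fun τ hτ _ => (hbt τ (hin τ (Ico_subset_Icc_self hτ))).2.2.2.1.hasDerivWithinAt
  · intro τ hτ
    refine ⟨hb₂ ?_, mem_univ _⟩
    rw [Prod.dist_eq]
    refine max_lt hy₂ ?_
    rw [dist_zero_right, Real.norm_of_nonneg hτ.1]
    exact hτ.2.trans_lt (htδ.trans_le (min_le_right _ _))
  · rw [hflow.apply_zero, hγ.start, hflow.eq_normalField hn hφ hΩ hyU (half_pos hc) hγ.normal]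

end NormalGeodesics

/-! ### Length, energy and the boundary distance function -/

section Reparametrization

/-- `θ` is the inverse of `s(t) = ∫₀ᵗ (σ + η) / (l + η)`, where `l` is the integral of `σ`. The
added `η` makes `s` strictly increasing even where the speed vanishes, and `θ' σ(θ) = (l + η) σ / (σ
+ η) ≤ l + η`. -/
theorem exists_reparametrization {σ : ℝ → ℝ} (hσ : ContinuousOn σ (Icc 0 1))
    (hσ0 : ∀ t ∈ Icc (0 : ℝ) 1, 0 ≤ σ t) {η : ℝ} (hη : 0 < η) :
    ∃ θ : ℝ → ℝ, ContDiff ℝ 1 θ ∧ MapsTo θ (Icc 0 1) (Icc 0 1) ∧ θ 0 = 0 ∧ θ 1 = 1 ∧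
      ∀ t ∈ Icc (0 : ℝ) 1, 0 ≤ deriv θ t ∧ deriv θ t * σ (θ t) ≤ (∫ t in (0 : ℝ)..1, σ t) + η := by
  let τ : ℝ → ℝ := IccExtend zero_le_one (domRestrict (Icc 0 1) σ)
  have hτ : Continuous τ := (continuousOn_iff_continuous_domRestrict.1 hσ).Icc_extend'
  have hτσ : ∀ t ∈ Icc (0 : ℝ) 1, τ t = σ t := fun t ht => IccExtend_of_mem _ _ ht
  have hτ0 : ∀ t, 0 ≤ τ t := fun t => hσ0 _ (projIcc (0 : ℝ) 1 zero_le_one t).2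
  set l := ∫ t in (0 : ℝ)..1, σ t with hl
  have hl' : ∫ t in (0 : ℝ)..1, τ t = l := intervalIntegral.integral_congr fun t ht => by
    rw [uIcc_of_le zero_le_one] at ht; exact hτσ t ht
  have hl0 : 0 ≤ l := intervalIntegral.integral_nonneg zero_le_one hσ0
  have hlη : 0 < l + η := by linarith
  let d : ℝ → ℝ := fun t => (τ t + η) / (l + η)
  have hd : Continuous d := (hτ.add continuous_const).div_const _
  set κ := η / (l + η) with hκ
  have hκ0 : 0 < κ := by positivity
  have hdκ : ∀ t, κ ≤ d t := fun t => by
    have := hτ0 t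
    simp only [d, hκ]
    gcongr
    linarith
  let s : ℝ → ℝ := fun t => ∫ u in (0 : ℝ)..t, d u
  have hs : ∀ t, HasDerivAt s (d t) t := fun t => intervalIntegral.integral_hasDerivAt_right
    (hd.intervalIntegrable _ _) (hd.stronglyMeasurableAtFilter _ _) hd.continuousAt
  have hs0 : s 0 = 0 := intervalIntegral.integral_same
  have hs1 : s 1 = 1 := by
    simp only [s, d]
    rw [intervalIntegral.integral_div, intervalIntegral.integral_add (hτ.intervalIntegrable _ _)
      intervalIntegrable_const, hl']
    simp [hlη.ne']
  have hmono : StrictMono s := strictMono_of_deriv_pos fun t => by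
    rw [(hs t).deriv]; exact hκ0.trans_le (hdκ t)
  have hmono' : Monotone fun t => s t - κ * t := by
    have h : ∀ t, HasDerivAt (fun t => s t - κ * t) (d t - κ) t := fun t => by
      have := (hs t).sub ((hasDerivAt_id t).const_mul κ)
      rw [mul_one] at this
      exact this
    refine monotone_of_deriv_nonneg (fun t => (h t).differentiableAt) fun t => ?_
    rw [(h t).deriv]
    linarith [hdκ t]
  have hsc : Continuous s := continuous_iff_continuousAt.2 fun t => (hs t).continuousAt
  have hsurj : Function.Surjective s := by
    refine hsc.surjective ?_ ?_
    · refine tendsto_atTop_mono' atTop ?_ (tendsto_id.const_mul_atTop hκ0)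
      filter_upwards [eventually_ge_atTop 0] with t ht
      have := hmono' ht
      simp only [hs0] at this
      simp only [id]
      linarith
    · refine tendsto_atBot_mono' atBot ?_ (tendsto_id.const_mul_atBot hκ0)
      filter_upwards [eventually_le_atBot 0] with t ht
      have := hmono' ht
      simp only [hs0] at this
      simp only [id]
      linarith
  let e := hmono.orderIsoOfSurjective s hsurj
  let θ : ℝ → ℝ := e.symm
  have hsθ : ∀ t, s (θ t) = t := fun t => e.apply_symm_apply t
  have hθs : ∀ t, θ (s t) = t := fun t => e.symm_apply_apply t
  have hθc : Continuous θ := e.symm.continuous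
  have hθd : ∀ t, HasDerivAt θ (d (θ t))⁻¹ t := fun t =>
    HasDerivAt.of_local_left_inverse hθc.continuousAt (hs (θ t)) (hκ0.trans_le (hdκ _)).ne'
      (Eventually.of_forall hsθ)
  have hθ0 : θ 0 = 0 := by conv_lhs => rw [← hs0]
                           exact hθs 0
  have hθ1 : θ 1 = 1 := by conv_lhs => rw [← hs1]
                           exact hθs 1
  have hmaps : MapsTo θ (Icc 0 1) (Icc 0 1) := fun t ht =>
    ⟨by rw [← hθ0]; exact e.symm.monotone ht.1, by rw [← hθ1]; exact e.symm.monotone ht.2⟩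
  refine ⟨θ, ?_, hmaps, hθ0, hθ1, fun t ht => ?_⟩
  · rw [contDiff_one_iff_deriv]
    refine ⟨fun t => (hθd t).differentiableAt, ?_⟩
    rw [show deriv θ = fun t => (d (θ t))⁻¹ from funext fun t => (hθd t).deriv]
    exact (hd.comp hθc).inv₀ fun t => (hκ0.trans_le (hdκ _)).ne'
  · rw [(hθd t).deriv, ← hτσ _ (hmaps ht)]
    have h1 := hτ0 (θ t)
    have h2 : 0 < τ (θ t) + η := by linarith
    refine ⟨inv_nonneg.2 (hκ0.trans_le (hdκ _)).le, ?_⟩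
    simp only [d]
    rw [inv_div, div_mul_eq_mul_div, div_le_iff₀ h2]
    exact mul_le_mul_of_nonneg_left (by linarith) hlη.le

variable {E : Type} [NormedAddCommGroup E] [NormedSpace ℝ E]

/-- A curve can be reparametrized such that its energy is almost the square of its length. -/
theorem exists_energy_le {G : E → E →L[ℝ] E →L[ℝ] ℝ} {γ : ℝ → E} (hγ : ContDiffOn ℝ 1 γ (Icc 0 1))
    (hG : ContinuousOn (fun t => G (γ t) (derivWithin γ (Icc 0 1) t) (derivWithin γ (Icc 0 1) t)) (Icc 0 1))
    (hpos : ∀ t ∈ Icc (0 : ℝ) 1, 0 ≤ G (γ t) (derivWithin γ (Icc 0 1) t) (derivWithin γ (Icc 0 1) t))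
    {η : ℝ} (hη : 0 < η) :
    ∃ γ' : ℝ → E, ContDiffOn ℝ 1 γ' (Icc 0 1) ∧ (∀ t ∈ Icc (0 : ℝ) 1, ∃ t' ∈ Icc (0 : ℝ) 1, γ' t = γ t') ∧
      γ' 0 = γ 0 ∧ γ' 1 = γ 1 ∧ energy G γ' ≤
        ((∫ t in (0 : ℝ)..1, √(G (γ t) (derivWithin γ (Icc 0 1) t) (derivWithin γ (Icc 0 1) t))) + η) ^ 2 := by
  set σ : ℝ → ℝ := fun t => √(G (γ t) (derivWithin γ (Icc 0 1) t) (derivWithin γ (Icc 0 1) t)) with hσ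
  obtain ⟨θ, hθ, hmaps, hθ0, hθ1, hd⟩ := exists_reparametrization (σ := σ) hG.sqrt
    (fun t _ => Real.sqrt_nonneg _) hη
  refine ⟨γ ∘ θ, hγ.comp hθ.contDiffOn hmaps, fun t ht => ⟨θ t, hmaps ht, rfl⟩, by simp [hθ0],
    by simp [hθ1], ?_⟩
  have hder : ∀ t ∈ Icc (0 : ℝ) 1, derivWithin (γ ∘ θ) (Icc 0 1) t =
      deriv θ t • derivWithin γ (Icc 0 1) (θ t) := fun t ht => by
    have h1 := (hγ.differentiableOn one_ne_zero (θ t) (hmaps ht)).hasDerivWithinAt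
    have h2 : HasDerivWithinAt θ (deriv θ t) (Icc 0 1) t :=
      ((hθ.differentiable one_ne_zero) t).hasDerivAt.hasDerivWithinAt
    exact (h1.scomp t h2 hmaps).derivWithin (uniqueDiffOn_Icc zero_lt_one t ht)
  have h3 := intervalIntegral.norm_integral_le_of_norm_le_const (a := (0 : ℝ)) (b := 1)
    (C := ((∫ t in (0 : ℝ)..1, σ t) + η) ^ 2)
    (f := fun t => G ((γ ∘ θ) t) (derivWithin (γ ∘ θ) (Icc 0 1) t) (derivWithin (γ ∘ θ) (Icc 0 1) t))
    (fun t ht => by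
      rw [uIoc_of_le zero_le_one] at ht
      have ht' := Ioc_subset_Icc_self ht
      rw [hder t ht']
      have h4 := hpos _ (hmaps ht')
      have h5 : G ((γ ∘ θ) t) (deriv θ t • derivWithin γ (Icc 0 1) (θ t))
          (deriv θ t • derivWithin γ (Icc 0 1) (θ t)) = (deriv θ t * σ (θ t)) ^ 2 := by
        rw [mul_pow, hσ, Real.sq_sqrt h4, map_smul, map_smul]
        simp only [smul_apply, smul_eq_mul, Function.comp]
        ring
      rw [h5, Real.norm_of_nonneg (sq_nonneg _)]
      have h6 := hd t ht'
      exact pow_le_pow_left₀ (mul_nonneg h6.1 (Real.sqrt_nonneg _)) h6.2 2)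
  rw [sub_zero, abs_one, mul_one] at h3
  exact (Real.le_norm_self _).trans h3

/-- A curve that moves away by the Euclidean distance `ρ` has length at least `√a ρ`; this disposes
of the curves that leave a coordinate patch. -/
theorem sqrt_mul_norm_sub_le [CompleteSpace E] {G : E → E →L[ℝ] E →L[ℝ] ℝ} {γ : ℝ → E}
    (hγ : ContDiffOn ℝ 1 γ (Icc 0 1))
    (hG : ContinuousOn (fun t => G (γ t) (derivWithin γ (Icc 0 1) t) (derivWithin γ (Icc 0 1) t)) (Icc 0 1))
    {a : ℝ} (ha : 0 ≤ a) (hell : ∀ t ∈ Icc (0 : ℝ) 1, ∀ v, a * ‖v‖ ^ 2 ≤ G (γ t) v v) {t : ℝ}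
    (ht : t ∈ Icc (0 : ℝ) 1) : √a * ‖γ t - γ 0‖ ≤
      ∫ t in (0 : ℝ)..1, √(G (γ t) (derivWithin γ (Icc 0 1) t) (derivWithin γ (Icc 0 1) t)) := by
  have hγ' : ContinuousOn (derivWithin γ (Icc 0 1)) (Icc 0 1) :=
    hγ.continuousOn_derivWithin (uniqueDiffOn_Icc zero_lt_one) le_rfl
  have h1 := integral_deriv_eq_sub ht.1 ht.2
    (fun t ht => (hγ.differentiableOn one_ne_zero t ht).hasDerivWithinAt) hγ'
  have hn : IntervalIntegrable (fun t => ‖derivWithin γ (Icc 0 1) t‖) volume 0 1 :=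
    intervalIntegrable_of_continuousOn hγ'.norm
  have h2 : ‖γ t - γ 0‖ ≤ ∫ t in (0 : ℝ)..1, ‖derivWithin γ (Icc 0 1) t‖ := by
    rw [← h1]
    refine (intervalIntegral.norm_integral_le_integral_norm ht.1).trans ?_
    exact intervalIntegral.integral_mono_interval le_rfl ht.1 ht.2
      (Eventually.of_forall fun _ => norm_nonneg _) hn
  refine (mul_le_mul_of_nonneg_left h2 (Real.sqrt_nonneg a)).trans ?_
  rw [← intervalIntegral.integral_const_mul]
  refine intervalIntegral.integral_mono_on zero_le_one (hn.const_mul _)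
    (intervalIntegrable_of_continuousOn hG.sqrt) fun s hs => ?_
  refine Real.le_sqrt_of_sq_le ?_
  rw [mul_pow, Real.sq_sqrt ha]
  exact hell s hs _

end Reparametrization

/-! ### Lengths and distances in the closure of `Ω` -/

section Distance

variable {n : ℕ} {Ω : Set (Eu n)} {g : TensorField n}

theorem curveLength_nonneg (γ : ℝ → Eu n) : 0 ≤ curveLength g γ :=
  intervalIntegral.integral_nonneg zero_le_one fun _ _ => Real.sqrt_nonneg _

theorem continuousOn_speed {γ : ℝ → Eu n} (hg : ContinuousOn g (closure Ω))
    (hγ : ContDiffOn ℝ 1 γ (Icc 0 1)) (hm : MapsTo γ (Icc 0 1) (closure Ω)) :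
    ContinuousOn (fun t => g (γ t) (derivWithin γ (Icc 0 1) t) (derivWithin γ (Icc 0 1) t)) (Icc 0 1) := by
  have hγ' : ContinuousOn (derivWithin γ (Icc 0 1)) (Icc 0 1) :=
    hγ.continuousOn_derivWithin (uniqueDiffOn_Icc zero_lt_one) le_rfl
  exact ((hg.comp hγ.continuousOn hm).clm_apply hγ').clm_apply hγ'

theorem riemDist_le {γ : ℝ → Eu n} (hγ : ContDiffOn ℝ 1 γ (Icc 0 1))
    (hm : MapsTo γ (Icc 0 1) (closure Ω)) : riemDist Ω g (γ 0) (γ 1) ≤ curveLength g γ :=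
  csInf_le ⟨0, by rintro _ ⟨c, -, -, -, -, rfl⟩; exact curveLength_nonneg c⟩ ⟨γ, hγ, hm, rfl, rfl, rfl⟩

theorem riemDist_nonneg (x y : Eu n) : 0 ≤ riemDist Ω g x y :=
  Real.sInf_nonneg (by rintro _ ⟨c, -, -, -, -, rfl⟩; exact curveLength_nonneg c)

/-- Minimum over the compact product with the unit sphere, then homogeneity. -/
theorem exists_elliptic_of_compact {E : Type} [NormedAddCommGroup E] [NormedSpace ℝ E]
    [FiniteDimensional ℝ E] {T : Type} [TopologicalSpace T] {K : Set T} (hK : IsCompact K)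
    {B : T → E →L[ℝ] E →L[ℝ] ℝ} (hB : ContinuousOn B K) (hpos : ∀ q ∈ K, ∀ v, v ≠ 0 → 0 < B q v v) :
    ∃ a > 0, ∀ q ∈ K, ∀ v, a * ‖v‖ ^ 2 ≤ B q v v := by
  have hP : ProperSpace E := FiniteDimensional.proper ℝ E
  have hc : IsCompact (K ×ˢ Metric.sphere (0 : E) 1) := hK.prod (isCompact_sphere 0 1)
  have hf : ContinuousOn (fun z : T × E => B z.1 z.2 z.2) (K ×ˢ Metric.sphere (0 : E) 1) :=
    ((hB.comp continuousOn_fst fun z hz => hz.1).clm_apply continuousOn_snd).clm_apply continuousOn_snd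
  have hsph : ∀ z ∈ K ×ˢ Metric.sphere (0 : E) 1, 0 < B z.1 z.2 z.2 := fun z hz =>
    hpos z.1 hz.1 z.2 (Metric.ne_of_mem_sphere hz.2 one_ne_zero)
  obtain ⟨a, ha, hb⟩ : ∃ a > 0, ∀ z ∈ K ×ˢ Metric.sphere (0 : E) 1, a ≤ B z.1 z.2 z.2 := by
    rcases (K ×ˢ Metric.sphere (0 : E) 1).eq_empty_or_nonempty with he | hne
    · exact ⟨1, one_pos, fun z hz => by rw [he] at hz; exact hz.elim⟩
    · obtain ⟨z, hz, hmin⟩ := hc.exists_isMinOn hne hf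
      exact ⟨_, hsph z hz, fun w hw => hmin hw⟩
  refine ⟨a, ha, fun q hq v => ?_⟩
  rcases eq_or_ne v 0 with rfl | hv
  · simp
  · have hv' : ‖v‖ ≠ 0 := norm_ne_zero_iff.2 hv
    have h1 := hb (q, ‖v‖⁻¹ • v) ⟨hq, by simp [norm_smul, hv']⟩
    simp only [map_smul, smul_apply, smul_eq_mul] at h1
    have h2 : 0 < ‖v‖ ^ 2 := by positivity
    calc a * ‖v‖ ^ 2 ≤ (‖v‖⁻¹ * (‖v‖⁻¹ * B q v v)) * ‖v‖ ^ 2 := mul_le_mul_of_nonneg_right h1 h2.le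
      _ = B q v v := by field_simp

end Distance

/-! ### The boundary distance function in boundary normal coordinates -/

section LocalDistance

variable {n : ℕ} {Ω : Set (Eu n)} {U : Set (Eu (n - 1))} {φ : Eu (n - 1) → Eu n} {x : Eu (n - 1)}
  {r : Eu n → ℝ} {g G : TensorField n} {N : ℕ} {c : ℝ} {S : Co n → Eu n × Eu n}

/-- The differential at `(x, 0)` is `dφ` together with the normal vector, which is transversal to
the boundary; the inverse function theorem applies. -/
theorem IsNormalFlow.exists_inverse (hn : 2 ≤ n) (hφ : IsBoundaryChart Ω U φ) (hΩ : IsSmoothDomain Ω)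
    (hx : x ∈ U) (h : IsNormalFlow Ω g φ r N c G S x) (hc : 0 < c) (hN : 2 ≤ N) :
    ∃ s : Eu n → Co n, ContDiffAt ℝ 1 s (φ x) ∧ s (φ x) = (x, 0) ∧ (∀ᶠ p in 𝓝 (φ x), (S (s p)).1 = p) ∧
      ∀ᶠ q in 𝓝 (x, (0 : ℝ)), s (S q).1 = q := by
  have spec := normalField_spec hc h.elliptic h.defining.fderiv_ne_zero
  obtain ⟨e, he⟩ := exists_equiv_of_transversal hn (hφ.immersion x hx)
    (hφ.fderiv_eq_zero hΩ hx h.defining) spec.1.ne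
  have hS1 : ContDiffAt ℝ 1 S (x, 0) := h.smooth.of_le (by norm_cast; omega)
  have hd : HasFDerivAt (fun q => (S q).1) (e : Co n →L[ℝ] Eu n) (x, 0) := by
    refine (hS1.differentiableAt one_ne_zero).hasFDerivAt.fst.congr_fderiv ?_
    refine ContinuousLinearMap.ext fun v => ?_
    change (fderiv ℝ S (x, 0) v).1 = e v
    have ev : v = (v.1, (0 : ℝ)) + v.2 • ((0 : Eu (n - 1)), (1 : ℝ)) := by ext <;> simp
    rw [he]
    conv_lhs => rw [ev, map_add, map_smul, (h.mixed hN).self_of_nhds.1]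
    change (fderiv ℝ S (x, 0) (v.1, 0)).1 + v.2 • (S (x, 0)).2 = _
    rw [((h.eventually_init hφ hΩ hx hc (by omega)).self_of_nhds.2 v.1).1, h.apply_zero]
  obtain ⟨s, h1, h2, h3, h4⟩ := exists_local_inverse (f := fun q => (S q).1) hS1.fst hd one_ne_zero
  simp only [h.apply_zero] at h1 h2 h3
  exact ⟨s, h1, h2, h3, h4⟩

/-- The speed of a curve, read in boundary normal coordinates. -/
theorem speed_comp {γ : ℝ → Co n} {t : ℝ} (ht : t ∈ Icc (0 : ℝ) 1)
    (hγ : DifferentiableWithinAt ℝ γ (Icc 0 1) t) (hS : DifferentiableAt ℝ S (γ t))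
    (hp : ∀ v w, G (S (γ t)).1 (fderiv ℝ S (γ t) v).1 (fderiv ℝ S (γ t) w).1 =
      prodMetric (tangentialMetric G S) (γ t) v w) (hg : G (S (γ t)).1 = g (S (γ t)).1) :
    g (S (γ t)).1 (derivWithin (fun t => (S (γ t)).1) (Icc 0 1) t)
        (derivWithin (fun t => (S (γ t)).1) (Icc 0 1) t) =
      prodMetric (tangentialMetric G S) (γ t) (derivWithin γ (Icc 0 1) t) (derivWithin γ (Icc 0 1) t) := by
  have h1 : derivWithin (fun t => (S (γ t)).1) (Icc 0 1) t = (fderiv ℝ S (γ t) (derivWithin γ (Icc 0 1) t)).1 :=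
    ((hS.hasFDerivAt.fst).comp_hasDerivWithinAt t hγ.hasDerivWithinAt).derivWithin
      (uniqueDiffOn_Icc zero_lt_one t ht)
  rw [h1, ← hg, hp]

/-- Points at which the coordinates `S` are regular. -/
structure IsRegularPoint (Ω : Set (Eu n)) (g G : TensorField n) (φ : Eu (n - 1) → Eu n)
    (S : Co n → Eu n × Eu n) (q : Co n) : Prop where
  smooth : ContDiffAt ℝ 1 (fun q => (S q).1) q
  differentiableAt : DifferentiableAt ℝ S q
  pullback : ∀ v w, G (S q).1 (fderiv ℝ S q v).1 (fderiv ℝ S q w).1 =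
    prodMetric (tangentialMetric G S) q v w
  mem_iff : (S q).1 ∈ closure Ω ↔ 0 ≤ q.2
  eq : (S q).1 ∈ closure Ω → G (S q).1 = g (S q).1
  init : (S (q.1, 0)).1 = φ q.1

theorem IsNormalFlow.eventually_isRegularPoint (hφ : IsBoundaryChart Ω U φ) (hΩ : IsSmoothDomain Ω)
    (hx : x ∈ U) (h : IsNormalFlow Ω g φ r N c G S x) (hc : 0 < c) (hN : 2 ≤ N) :
    ∀ᶠ q in 𝓝 (x, (0 : ℝ)), IsRegularPoint Ω g G φ S q := by
  have hS1 : ContDiffAt ℝ 1 S (x, 0) := h.smooth.of_le (by norm_cast; omega)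
  filter_upwards [hS1.eventually (by simp), h.pullback hφ hΩ hx hc hN,
    h.eventually_mem_iff hφ hΩ hx hc hN, h.tendsto_fst.eventually h.ext.eq,
    (continuous_fst.tendsto (x, (0 : ℝ))).eventually h.init] with q h1 h2 h3 h4 h5
  exact ⟨h1.fst, h1.differentiableAt one_ne_zero, h2, h3.2, h4, by rw [h5]⟩

/-- A curve in coordinates is mapped to a curve in the closure with the same speed, and the square
of a length is at most the energy. -/
theorem IsNormalFlow.exists_upper (hφ : IsBoundaryChart Ω U φ) (hΩ : IsSmoothDomain Ω)
    (hx : x ∈ U) (h : IsNormalFlow Ω g φ r N c G S x) (hc : 0 < c) (hN : 2 ≤ N)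
    (hg : ContinuousOn g (closure Ω)) (hpos : ∀ p ∈ closure Ω, ∀ v, 0 ≤ g p v v) :
    ∃ W ∈ 𝓝 (x, (0 : ℝ)), ∀ (y : Eu (n - 1)) (γ : ℝ → Co n), ContDiffOn ℝ 1 γ (Icc 0 1) →
      (∀ t ∈ Icc (0 : ℝ) 1, γ t ∈ W ∧ 0 ≤ (γ t).2) → γ 0 = (x, 0) → γ 1 = (y, 0) →
      riemDist Ω g (φ x) (φ y) ^ 2 ≤ energy (prodMetric (tangentialMetric G S)) γ := by
  refine ⟨_, h.eventually_isRegularPoint hφ hΩ hx hc hN, fun y γ hγ hW h0 h1 => ?_⟩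
  have hreg : ∀ t ∈ Icc (0 : ℝ) 1, IsRegularPoint Ω g G φ S (γ t) := fun t ht => (hW t ht).1
  let γ' : ℝ → Eu n := fun t => (S (γ t)).1
  have hm : MapsTo γ' (Icc 0 1) (closure Ω) := fun t ht => (hreg t ht).mem_iff.2 (hW t ht).2
  have hγ' : ContDiffOn ℝ 1 γ' (Icc 0 1) := fun t ht =>
    (hreg t ht).smooth.comp_contDiffWithinAt t (hγ t ht)
  have e0 : γ' 0 = φ x := by
    have := (hreg 0 (by simp)).init
    simp only [γ']
    rw [h0] at this ⊢
    exact this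
  have e1 : γ' 1 = φ y := by
    have := (hreg 1 (by simp)).init
    simp only [γ']
    rw [h1] at this ⊢
    exact this
  have k1 := riemDist_le (g := g) hγ' hm
  rw [e0, e1] at k1
  have k2 := sq_integral_le (continuousOn_speed hg hγ' hm).sqrt
  refine (pow_le_pow_left₀ (riemDist_nonneg _ _) k1 2).trans (k2.trans (le_of_eq ?_))
  refine intervalIntegral.integral_congr fun t ht => ?_
  rw [uIcc_of_le zero_le_one] at ht
  have hr := hreg t ht
  rw [Real.sq_sqrt (hpos _ (hm ht) _)]
  exact speed_comp ht (hγ.differentiableOn one_ne_zero t ht) hr.differentiableAt hr.pullback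
    (hr.eq (hm ht))

/-- A curve that stays in a small ball can be read in coordinates and reparametrized to have energy
at most `(length + η)²`. Any other curve has length at least `√a ρ`, and the threshold `(√a ρ)²` for
`B` makes such curves irrelevant. -/
theorem IsNormalFlow.exists_lower (hn : 2 ≤ n) (hφ : IsBoundaryChart Ω U φ) (hΩ : IsSmoothDomain Ω)
    (hx : x ∈ U) (h : IsNormalFlow Ω g φ r N c G S x) (hc : 0 < c) (hN : 2 ≤ N)
    (hg : ContinuousOn g (closure Ω)) (hpos : ∀ p ∈ closure Ω, ∀ v, v ≠ 0 → 0 < g p v v)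
    {W : Set (Co n)} (hW : W ∈ 𝓝 (x, (0 : ℝ))) :
    ∃ b > 0, ∀ᶠ y in 𝓝 x, ∀ B < b, (∀ γ : ℝ → Co n, ContDiffOn ℝ 1 γ (Icc 0 1) →
      (∀ t ∈ Icc (0 : ℝ) 1, γ t ∈ W ∧ 0 ≤ (γ t).2) → γ 0 = (x, 0) → γ 1 = (y, 0) →
      B ≤ energy (prodMetric (tangentialMetric G S)) γ) → B ≤ riemDist Ω g (φ x) (φ y) ^ 2 := by
  obtain ⟨a, ha, hell⟩ := exists_elliptic_of_compact hΩ.isBounded.isCompact_closure hg hpos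
  obtain ⟨s, hs1, hs0, hsr, hsl⟩ := h.exists_inverse hn hφ hΩ hx hc hN
  have hst : Tendsto s (𝓝 (φ x)) (𝓝 (x, 0)) := by
    have := hs1.continuousAt.tendsto; rwa [hs0] at this
  have hreg := h.eventually_isRegularPoint hφ hΩ hx hc hN
  have hall := (hs1.eventually (by simp)).and (hsr.and (hst.eventually (hreg.and hW)))
  obtain ⟨ρ, hρ, hb⟩ := Metric.eventually_nhds_iff.1 hall
  obtain ⟨δ, hδ, hbδ⟩ := Metric.eventually_nhds_iff.1 (hreg.and hsl)
  have hsa : 0 < √a := Real.sqrt_pos.2 ha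
  refine ⟨(√a * ρ) ^ 2, by positivity, ?_⟩
  filter_upwards [Metric.ball_mem_nhds x hδ] with y hy B hB hγB
  have hline : ∀ t ∈ Icc (0 : ℝ) 1, dist (x + t • (y - x), (0 : ℝ)) (x, (0 : ℝ)) < δ := fun t ht => by
    rw [Prod.dist_eq]
    refine max_lt ?_ (by simpa using hδ)
    rw [dist_eq_norm, add_sub_cancel_left, norm_smul, Real.norm_of_nonneg ht.1]
    rw [Metric.mem_ball, dist_eq_norm] at hy
    exact lt_of_le_of_lt (mul_le_of_le_one_left (norm_nonneg _) ht.2) hy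
  have hφy : s (φ y) = (y, 0) := by
    have k := hbδ (hline 1 (by simp))
    have k2 := k.1.init
    simp only [one_smul, add_sub_cancel] at k k2
    have k3 := k.2
    rwa [k2] at k3
  have hφx : (S (x, 0)).1 = φ x := by rw [h.apply_zero]
  -- An infimum over the empty set would be 0, so an admissible curve must be exhibited: the image
  -- of the coordinate segment, which lies in the boundary.
  have hne : {l | ∃ γ : ℝ → Eu n, ContDiffOn ℝ 1 γ (Icc 0 1) ∧ MapsTo γ (Icc 0 1) (closure Ω) ∧
      γ 0 = φ x ∧ γ 1 = φ y ∧ l = curveLength g γ}.Nonempty := by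
    refine ⟨_, fun t => (S (x + t • (y - x), 0)).1, fun t ht => ?_, fun t ht =>
      (hbδ (hline t ht)).1.mem_iff.2 le_rfl, ?_, ?_, rfl⟩
    · exact ((hbδ (hline t ht)).1.smooth.comp t (f := fun t : ℝ => (x + t • (y - x), (0 : ℝ)))
        (by fun_prop)).contDiffWithinAt
    · simpa using hφx
    · have k := (hbδ (hline 1 (by simp))).1.init
      simpa using k
  by_cases hB0 : B ≤ 0
  · exact hB0.trans (sq_nonneg _)
  rw [not_le] at hB0
  have hmain : √B ≤ riemDist Ω g (φ x) (φ y) := by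
    refine le_csInf hne ?_
    rintro _ ⟨γ, hγ, hm, h0, h1, rfl⟩
    have hsp := continuousOn_speed hg hγ hm
    by_cases hball : ∀ t ∈ Icc (0 : ℝ) 1, dist (γ t) (φ x) < ρ
    · refine le_of_forall_pos_le_add fun η hη => ?_
      have hin : ∀ t ∈ Icc (0 : ℝ) 1, IsRegularPoint Ω g G φ S (s (γ t)) ∧ s (γ t) ∈ W ∧
          (S (s (γ t))).1 = γ t ∧ ContDiffAt ℝ 1 s (γ t) := fun t ht => by
        obtain ⟨k1, k2, k3, k4⟩ := hb (hball t ht)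
        exact ⟨k3, k4, k2, k1⟩
      let κ : ℝ → Co n := fun t => s (γ t)
      have hκ : ContDiffOn ℝ 1 κ (Icc 0 1) := fun t ht =>
        (hin t ht).2.2.2.comp_contDiffWithinAt t (hγ t ht)
      have hspeed : ∀ t ∈ Icc (0 : ℝ) 1, g (γ t) (derivWithin γ (Icc 0 1) t) (derivWithin γ (Icc 0 1) t) =
          prodMetric (tangentialMetric G S) (κ t) (derivWithin κ (Icc 0 1) t) (derivWithin κ (Icc 0 1) t) := by
        intro t ht
        obtain ⟨k1, k2, k3, k4⟩ := hin t ht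
        have hk : (S (κ t)).1 = γ t := k3
        have k5 := speed_comp (g := g) ht (hκ.differentiableOn one_ne_zero t ht) k1.differentiableAt k1.pullback
          (k1.eq (by rw [k3]; exact hm ht))
        have k6 : derivWithin (fun t => (S (κ t)).1) (Icc 0 1) t = derivWithin γ (Icc 0 1) t :=
          derivWithin_congr (fun t' ht' => (hin t' ht').2.2.1) k3
        rw [k6, hk] at k5
        exact k5
      have hsp' : ContinuousOn (fun t => prodMetric (tangentialMetric G S) (κ t)
          (derivWithin κ (Icc 0 1) t) (derivWithin κ (Icc 0 1) t)) (Icc 0 1) :=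
        hsp.congr fun t ht => (hspeed t ht).symm
      obtain ⟨κ', c1, c2, c3, c4, c5⟩ := exists_energy_le hκ hsp' (fun t ht => by
        rw [← hspeed t ht]
        exact le_trans (by positivity) (hell _ (hm ht) _)) hη
      have hlen : (∫ t in (0 : ℝ)..1, √(prodMetric (tangentialMetric G S) (κ t)
          (derivWithin κ (Icc 0 1) t) (derivWithin κ (Icc 0 1) t))) = curveLength g γ :=
        intervalIntegral.integral_congr fun t ht => by
          rw [uIcc_of_le zero_le_one] at ht
          rw [hspeed t ht]
      rw [hlen] at c5
      refine Real.sqrt_le_iff.2 ⟨add_nonneg (curveLength_nonneg γ) hη.le, le_trans ?_ c5⟩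
      refine hγB κ' c1 (fun t ht => ?_) (by rw [c3]; simp only [κ]; rw [h0, hs0])
        (by rw [c4]; simp only [κ]; rw [h1, hφy])
      obtain ⟨t', ht', e⟩ := c2 t ht
      obtain ⟨k1, k2, k3, k4⟩ := hin t' ht'
      rw [e]
      exact ⟨k2, k1.mem_iff.1 (by rw [k3]; exact hm ht')⟩
    · push Not at hball
      obtain ⟨t, ht, hρt⟩ := hball
      have k := sqrt_mul_norm_sub_le hγ hsp ha.le (fun t ht v => hell _ (hm ht) v) ht
      rw [h0, ← dist_eq_norm] at k
      have k2 : √B ≤ √a * ρ := (Real.sqrt_le_left (by positivity)).2 hB.le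
      exact k2.trans ((mul_le_mul_of_nonneg_left hρt hsa.le).trans k)
  calc B = √B ^ 2 := (Real.sq_sqrt hB0.le).symm
    _ ≤ _ := pow_le_pow_left₀ (Real.sqrt_nonneg _) hmain 2

/-- In boundary normal coordinates, the squared boundary distance is locally an infimum of energies. -/
theorem IsNormalFlow.isLocalDistSq (hn : 2 ≤ n) (hφ : IsBoundaryChart Ω U φ) (hΩ : IsSmoothDomain Ω)
    (hx : x ∈ U) (h : IsNormalFlow Ω g φ r N c G S x) (hc : 0 < c) (hN : 2 ≤ N)
    (hg : ContinuousOn g (closure Ω)) (hpos : ∀ p ∈ closure Ω, ∀ v, v ≠ 0 → 0 < g p v v) :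
    IsLocalDistSq (tangentialMetric G S) (fun y y' => riemDist Ω g (φ y) (φ y') ^ 2) x := by
  refine ⟨h.exists_upper hφ hΩ hx hc hN hg fun p hp v => ?_,
    fun W hW => h.exists_lower hn hφ hΩ hx hc hN hg hpos hW⟩
  rcases eq_or_ne v 0 with rfl | hv
  · simp
  · exact (hpos p hp v hv).le

end LocalDistance

/-! ### The transported metric in boundary normal coordinates -/

section Transport

variable {n : ℕ} {Ω : Set (Eu n)} {U : Set (Eu (n - 1))} {φ : Eu (n - 1) → Eu n} {x : Eu (n - 1)}
  {r : Eu n → ℝ} {g₀ g₁ G₀ G₁ : TensorField n} {N : ℕ} {c : ℝ} {S₀ S₁ : Co n → Eu n × Eu n}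
  {ψ : Eu n → Eu n} {ε : ℝ} {F : Co n → Eu n}

/-- Uniqueness of normal geodesics identifies `F` with the flow of `g₀`, and the matching condition,
applied to the geodesics of both flows, gives `ψ ∘ S₀ = S₁`. So `ψ` is the identity in the two
systems of coordinates. -/
theorem exists_box_matching (hn : 2 ≤ n) (hφ : IsBoundaryChart Ω U φ) (hΩ : IsSmoothDomain Ω)
    (hx : x ∈ U) (h₀ : IsNormalFlow Ω g₀ φ r N c G₀ S₀ x) (h₁ : IsNormalFlow Ω g₁ φ r N c G₁ S₁ x)
    (hc : 0 < c) (hN : 2 ≤ N) (hψ : IsBoundaryNormalMatching Ω g₀ g₁ ψ)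
    (hF : IsBoundaryNormalCoordinates Ω g₀ U φ ε F) :
    ∃ δ > 0, ∀ q ∈ Metric.ball x δ ×ˢ Ioo (-δ) δ, q.1 ∈ U ∧ IsRegularPoint Ω g₀ G₀ φ S₀ q ∧
      IsRegularPoint Ω g₁ G₁ φ S₁ q ∧ (∃ M, IsOpen M ∧ (S₀ q).1 ∈ M ∧ ContDiffOn ℝ 1 ψ (M ∩ closure Ω)) ∧
      (q.2 ∈ Ico 0 ε → F q = (S₀ q).1) ∧ (0 ≤ q.2 → ψ (S₀ q).1 = (S₁ q).1) := by
  obtain ⟨M, M', χ, hM, -, hM₀, -, hψC, -⟩ := hψ.diffeo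
  obtain ⟨δψ, hδψ, hgeo⟩ := hψ.geodesics
  obtain ⟨δ₁, hδ₁, hb₁⟩ := h₀.exists_isNormalGeodesic hφ hΩ hx hc hN
  obtain ⟨δ₂, hδ₂, hb₂⟩ := h₁.exists_isNormalGeodesic hφ hΩ hx hc hN
  obtain ⟨δ₃, hδ₃, hb₃⟩ := h₀.eq_of_isNormalGeodesic hn hφ hΩ hx hc hN
  have hev := ((continuous_fst.tendsto (x, (0 : ℝ))).eventually (hφ.isOpen.mem_nhds hx)).and
    ((h₀.eventually_isRegularPoint hφ hΩ hx hc hN).and ((h₁.eventually_isRegularPoint hφ hΩ hx hc hN).and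
      (h₀.tendsto_fst.eventually (hM.mem_nhds (hM₀ (hφ.mapsTo hx))))))
  obtain ⟨δ₄, hδ₄, hb₄⟩ := Metric.eventually_nhds_iff.1 hev
  let δ := min (min δψ δ₁) (min δ₂ (min δ₃ δ₄))
  have hδ : 0 < δ := lt_min (lt_min hδψ hδ₁) (lt_min hδ₂ (lt_min hδ₃ hδ₄))
  have l1 : δ ≤ δψ := (min_le_left _ _).trans (min_le_left _ _)
  have l2 : δ ≤ δ₁ := (min_le_left _ _).trans (min_le_right _ _)
  have l3 : δ ≤ δ₂ := (min_le_right _ _).trans (min_le_left _ _)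
  have l4 : δ ≤ δ₃ := (min_le_right _ _).trans ((min_le_right _ _).trans (min_le_left _ _))
  have l5 : δ ≤ δ₄ := (min_le_right _ _).trans ((min_le_right _ _).trans (min_le_right _ _))
  refine ⟨δ, hδ, ?_⟩
  rintro ⟨y, t⟩ ⟨hy, ht⟩
  have hd : dist (y, t) (x, (0 : ℝ)) < δ₄ := by
    rw [Prod.dist_eq]
    exact max_lt (lt_of_lt_of_le hy l5) (by rw [dist_zero_right]; exact (abs_lt.2 ht).trans_le l5)
  obtain ⟨hyU, r0, r1, hyM⟩ := hb₄ hd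
  refine ⟨hyU, r0, r1, ⟨M, hM, hyM, hψC⟩, fun htε => ?_, fun ht0 => ?_⟩
  · exact hb₃ y (Metric.ball_subset_ball l4 hy) ε _ (hF.normalGeodesic y hyU) t htε (ht.2.trans_le l4)
  · exact hgeo (φ y) (hφ.mapsTo hyU) δ hδ l1 _ _ (hb₁ y (Metric.ball_subset_ball l2 hy) δ hδ l2)
      (hb₂ y (Metric.ball_subset_ball l3 hy) δ hδ l3) t ⟨ht0, ht.2⟩

/-- As `ψ ∘ S₀ = S₁`, the transported metric in the coordinates of `g₀` is `g₁` in its own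
coordinates. The terms `(dxⁿ)²` cancel and only the tangential parts remain. All derivatives of `F`
and `ψ` are one-sided, and are compared on sets where derivatives are unique. -/
theorem exists_pullback_eq (hn : 2 ≤ n) (hφ : IsBoundaryChart Ω U φ) (hΩ : IsSmoothDomain Ω)
    (hx : x ∈ U) (h₀ : IsNormalFlow Ω g₀ φ r N c G₀ S₀ x) (h₁ : IsNormalFlow Ω g₁ φ r N c G₁ S₁ x)
    (hc : 0 < c) (hN : 2 ≤ N) (hψ : IsBoundaryNormalMatching Ω g₀ g₁ ψ)
    (hF : IsBoundaryNormalCoordinates Ω g₀ U φ ε F) :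
    ∃ δ > 0, ∀ y ∈ Metric.ball x δ, ∀ t ∈ Ico 0 ε, t < δ →
      pullbackOn (U ×ˢ Ico 0 ε) F (metricDifference Ω g₀ g₁ ψ) (y, t) =
        liftBilin (tangentialMetric G₁ S₁ (y, t) - tangentialMetric G₀ S₀ (y, t)) := by
  obtain ⟨δ, hδ, hb⟩ := exists_box_matching hn hφ hΩ hx h₀ h₁ hc hN hψ hF
  refine ⟨δ, hδ, fun y hy t ht htδ => ?_⟩
  set Q : Set (Co n) := Metric.ball x δ ×ˢ Ioo (-δ) δ with hQ
  have hQo : IsOpen Q := Metric.isOpen_ball.prod isOpen_Ioo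
  set D : Set (Co n) := U ×ˢ Ico 0 ε with hD
  have hqQ : (y, t) ∈ Q := ⟨hy, by linarith [ht.1], htδ⟩
  obtain ⟨hyU, r0, r1, ⟨M, hM, hqM, hψC⟩, e0, e1⟩ := hb (y, t) hqQ
  have hqD : (y, t) ∈ D := ⟨hyU, ht⟩
  have huD : UniqueDiffWithinAt ℝ D (y, t) :=
    (hφ.isOpen.uniqueDiffOn.prod (uniqueDiffOn_Ico 0 ε)) _ hqD
  have huDQ : UniqueDiffWithinAt ℝ (D ∩ Q) (y, t) := huD.inter (hQo.mem_nhds hqQ)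
  have hcl : (S₀ (y, t)).1 ∈ closure Ω := r0.mem_iff.2 ht.1
  have hcl' : (S₁ (y, t)).1 ∈ closure Ω := r1.mem_iff.2 ht.1
  have d0 := r0.differentiableAt.hasFDerivAt.fst
  have d1 := r1.differentiableAt.hasFDerivAt.fst
  -- the derivative of the coordinates
  have hFd : fderivWithin ℝ F D (y, t) =
      (ContinuousLinearMap.fst ℝ (Eu n) (Eu n)).comp (fderiv ℝ S₀ (y, t)) := by
    have hev : F =ᶠ[𝓝[D] (y, t)] fun q => (S₀ q).1 := by
      filter_upwards [mem_nhdsWithin_of_mem_nhds (hQo.mem_nhds hqQ), self_mem_nhdsWithin] with q hq hq'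
      exact (hb q hq).2.2.2.2.1 hq'.2
    exact (d0.hasFDerivWithinAt.congr_of_eventuallyEq hev (e0 ht)).fderivWithin huD
  -- the derivative of the diffeomorphism
  have hψd : DifferentiableWithinAt ℝ ψ (closure Ω) (S₀ (y, t)).1 :=
    (hψC.differentiableOn one_ne_zero _ ⟨hqM, hcl⟩).mono_of_mem_nhdsWithin
      (inter_mem (mem_nhdsWithin_of_mem_nhds (hM.mem_nhds hqM)) self_mem_nhdsWithin)
  have hm : MapsTo (fun q => (S₀ q).1) (D ∩ Q) (closure Ω) := fun q hq =>
    (hb q hq.2).2.1.mem_iff.2 hq.1.2.1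
  have hcomp := HasFDerivWithinAt.comp (f := fun q => (S₀ q).1) (y, t) hψd.hasFDerivWithinAt
    d0.hasFDerivWithinAt hm
  have hd1 : HasFDerivWithinAt (ψ ∘ fun q => (S₀ q).1)
      ((ContinuousLinearMap.fst ℝ (Eu n) (Eu n)).comp (fderiv ℝ S₁ (y, t))) (D ∩ Q) (y, t) :=
    d1.hasFDerivWithinAt.congr (fun q hq => (hb q hq.2).2.2.2.2.2 hq.1.2.1) (e1 ht.1)
  have hchain := huDQ.eq hcomp hd1
  have hchain' : ∀ v, fderivWithin ℝ ψ (closure Ω) (S₀ (y, t)).1 (fderiv ℝ S₀ (y, t) v).1 =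
      (fderiv ℝ S₁ (y, t) v).1 := fun v => DFunLike.congr_fun hchain v
  refine ContinuousLinearMap.ext fun v => ContinuousLinearMap.ext fun w => ?_
  change metricDifference Ω g₀ g₁ ψ (F (y, t)) (fderivWithin ℝ F D (y, t) v) (fderivWithin ℝ F D (y, t) w) = _
  rw [hFd, e0 ht]
  change g₁ (ψ (S₀ (y, t)).1) (fderivWithin ℝ ψ (closure Ω) (S₀ (y, t)).1 (fderiv ℝ S₀ (y, t) v).1)
      (fderivWithin ℝ ψ (closure Ω) (S₀ (y, t)).1 (fderiv ℝ S₀ (y, t) w).1) -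
    g₀ (S₀ (y, t)).1 (fderiv ℝ S₀ (y, t) v).1 (fderiv ℝ S₀ (y, t) w).1 = _
  rw [hchain', hchain', e1 ht.1, ← r1.eq hcl', ← r0.eq hcl, r1.pullback, r0.pullback, liftBilin_apply,
    prodMetric_apply, prodMetric_apply]
  change _ = tangentialMetric G₁ S₁ (y, t) v.1 w.1 - tangentialMetric G₀ S₀ (y, t) v.1 w.1
  ring

theorem IsNormalFlow.contDiffAt_tangentialMetric {g G : TensorField n} {S : Co n → Eu n × Eu n} {l : ℕ}
    (h : IsNormalFlow Ω g φ r N c G S x) (hl : l + 1 ≤ N) :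
    ContDiffAt ℝ l (tangentialMetric G S) (x, 0) :=
  (jetBound_tangentialMetric (ι := Unit) (l := l) (G := fun _ => G) (S := fun _ => S)
    (q := fun _ => (x, 0)) (jetBound_single (h.smooth.of_le (by exact_mod_cast hl)))
    (jetBound_single (by
      rw [h.apply_zero]
      exact h.ext.contDiffAt.of_le (by norm_cast; omega)))).contDiffAt ()

/-- The one-sided normal derivatives at `xⁿ = 0` agree with the two-sided ones of the extended
tangential metrics, to which the recursion applies. -/
theorem normalDeriv_eventuallyEq (hn : 2 ≤ n) (hφ : IsBoundaryChart Ω U φ) (hΩ : IsSmoothDomain Ω)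
    (hx : x ∈ U) (h₀ : IsNormalFlow Ω g₀ φ r N c G₀ S₀ x) (h₁ : IsNormalFlow Ω g₁ φ r N c G₁ S₁ x)
    (hc : 0 < c) (hN : 2 ≤ N) (hψ : IsBoundaryNormalMatching Ω g₀ g₁ ψ)
    (hF : IsBoundaryNormalCoordinates Ω g₀ U φ ε F) {k : ℕ} (hk : k + 1 ≤ N) :
    normalDeriv U ε F k (metricDifference Ω g₀ g₁ ψ) =ᶠ[𝓝 x] fun y =>
      liftBilin (normalJet (fun p => tangentialMetric G₁ S₁ p - tangentialMetric G₀ S₀ p) k y) := by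
  obtain ⟨δ, hδ, hb⟩ := exists_pullback_eq hn hφ hΩ hx h₀ h₁ hc hN hψ hF
  have hε := hF.pos
  filter_upwards [Metric.ball_mem_nhds x hδ, h₀.eventually hφ hx hc, h₁.eventually hφ hx hc]
    with y hy h₀y h₁y
  have hC : ContDiffAt ℝ k (fun t : ℝ => tangentialMetric G₁ S₁ (y, t) - tangentialMetric G₀ S₀ (y, t)) 0 := by
    have k1 := (h₁y.2.contDiffAt_tangentialMetric hk).sub (h₀y.2.contDiffAt_tangentialMetric hk)
    exact ContDiffAt.comp (f := fun t : ℝ => (y, t)) (0 : ℝ) k1 (contDiffAt_const.prodMk contDiffAt_id)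
  have hu : UniqueDiffOn ℝ (Ico 0 ε) := uniqueDiffOn_Ico 0 ε
  have h0 : (0 : ℝ) ∈ Ico 0 ε := ⟨le_rfl, hε⟩
  have e : (fun t : ℝ => pullbackOn (U ×ˢ Ico 0 ε) F (metricDifference Ω g₀ g₁ ψ) (y, t)) =ᶠ[𝓝[Ico 0 ε] 0]
      (liftBilin : _ →L[ℝ] _) ∘ fun t : ℝ => tangentialMetric G₁ S₁ (y, t) - tangentialMetric G₀ S₀ (y, t) := by
    filter_upwards [self_mem_nhdsWithin, mem_nhdsWithin_of_mem_nhds (Iio_mem_nhds hδ)] with t ht htδ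
    exact hb y hy t ht htδ
  rw [normalDeriv, e.iteratedDerivWithin_eq (e.self_of_nhdsWithin h0),
    iteratedDerivWithin_eq_iteratedDeriv hu ((liftBilin.contDiff.contDiffAt).comp (0 : ℝ) hC) h0,
    iteratedDeriv_eq_iteratedFDeriv, liftBilin.iteratedFDeriv_comp_left hC le_rfl]
  rfl

end Transport

/-! ### Uniform estimates -/

section Norms

variable {X Y : Type} [NormedAddCommGroup X] [NormedSpace ℝ X] [NormedAddCommGroup Y] [NormedSpace ℝ Y]
  {N : ℕ} {f : X → Y} {S : Set X}

theorem contDiffOn_of_cNormOn_ne_top (h : cNormOn N f S ≠ (⊤ : ℝ≥0∞)) : ContDiffOn ℝ N f S := by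
  by_contra hn
  exact h (if_neg hn)

theorem enorm_le_cNormOn {j : ℕ} (hj : j ≤ N) {x : X} (hx : x ∈ S) :
    ‖iteratedFDerivWithin ℝ j f S x‖ₑ ≤ cNormOn N f S := by
  rw [cNormOn]
  split_ifs
  · exact le_iSup₂_of_le j hj (le_iSup₂_of_le x hx le_rfl)
  · exact le_top

theorem contDiffAt_of_cNormNear_ne_top (h : cNormNear N f S ≠ (⊤ : ℝ≥0∞)) {x : X} (hx : x ∈ S) :
    ContDiffAt ℝ N f x := by
  by_contra hn
  exact h (if_neg fun h' => hn (h' x hx))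

theorem enorm_le_cNormNear {j : ℕ} (hj : j ≤ N) {x : X} (hx : x ∈ S) :
    ‖iteratedFDeriv ℝ j f x‖ₑ ≤ cNormNear N f S := by
  rw [cNormNear]
  split_ifs
  · exact le_iSup₂_of_le j hj (le_iSup₂_of_le x hx le_rfl)
  · exact le_top

theorem norm_le_toReal_of_enorm_le {y : Y} {a : ℝ≥0∞} (ha : a ≠ (⊤ : ℝ≥0∞)) (h : ‖y‖ₑ ≤ a) : ‖y‖ ≤ a.toReal := by
  rw [← toReal_enorm]
  exact ENNReal.toReal_mono ha h

theorem cNormNear_le {C : ℝ≥0∞} (h : ∀ x ∈ S, ContDiffAt ℝ N f x ∧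
    ∀ j ≤ N, ‖iteratedFDeriv ℝ j f x‖ₑ ≤ C) : cNormNear N f S ≤ C := by
  rw [cNormNear, if_pos fun x hx => (h x hx).1]
  exact iSup₂_le fun j hj => iSup₂_le fun x hx => (h x hx).2 j hj

end Norms

variable {n : ℕ} {Ω : Set (Eu n)} {U : Set (Eu (n - 1))} {φ : Eu (n - 1) → Eu n}

/-- A metric on the closure of `Ω` with bounded derivatives, positive definite, such that the metric and
the second fundamental form of the boundary are bounded below. -/
structure IsBoundedMetric (Ω : Set (Eu n)) (l : ℕ) (A c : ℝ) (g : TensorField n) : Prop where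
  contDiffOn : ContDiffOn ℝ l g (closure Ω)
  bound : ∀ j ≤ l, ∀ p ∈ closure Ω, ‖iteratedFDerivWithin ℝ j g (closure Ω) p‖ ≤ A
  symm : ∀ p ∈ closure Ω, ∀ v w, g p v w = g p w v
  pos : ∀ p ∈ closure Ω, ∀ v, v ≠ 0 → 0 < g p v v
  lower : HasBoundaryLowerBound Ω g c

/-- A compact set of parameters of the boundary near which `r` is a defining function. -/
structure IsChartPiece (Ω : Set (Eu n)) (U : Set (Eu (n - 1))) (φ : Eu (n - 1) → Eu n) (r : Eu n → ℝ)
    (B : Set (Eu (n - 1))) : Prop where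
  isCompact : IsCompact B
  subset : B ⊆ U
  defining : ∀ y ∈ B, IsLocalDefiningFunction Ω (φ y) r

theorem IsBoundaryChart.exists_chartPiece (hφ : IsBoundaryChart Ω U φ) (hΩ : IsSmoothDomain Ω)
    {x : Eu (n - 1)} (hx : x ∈ U) : ∃ r, ∃ B ∈ 𝓝 x, IsChartPiece Ω U φ r B := by
  obtain ⟨r, hr⟩ := hΩ.smooth_boundary _ (hφ.mapsTo hx)
  have hU : ∀ᶠ y in 𝓝 x, y ∈ U := hφ.isOpen.mem_nhds hx
  obtain ⟨δ, hδ, hb⟩ := Metric.nhds_basis_closedBall.eventually_iff.1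
    (hU.and ((hφ.contDiffAt hx).continuousAt.eventually hr.eventually))
  exact ⟨r, Metric.closedBall x δ, Metric.closedBall_mem_nhds x hδ, isCompact_closedBall x δ,
    fun y hy => (hb hy).1, fun y hy => (hb hy).2⟩

/-! ### Constants uniform over the class of metrics -/

section Uniform

variable {r : Eu n → ℝ} {B : Set (Eu (n - 1))} {c : ℝ}

theorem IsChartPiece.exists_norm_fderiv_ge (hB : IsChartPiece Ω U φ r B) (hφ : IsBoundaryChart Ω U φ) :
    ∃ b > 0, ∀ y ∈ B, b ≤ ‖fderiv ℝ r (φ y)‖ := by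
  rcases B.eq_empty_or_nonempty with he | hne
  · exact ⟨1, one_pos, fun y hy => by rw [he] at hy; exact hy.elim⟩
  · have hc : ContinuousOn (fun y => ‖fderiv ℝ r (φ y)‖) B := fun y hy =>
      (ContinuousAt.comp (g := fderiv ℝ r) ((hB.defining y hy).contDiffAt.continuousAt_fderiv (by simp))
        (hφ.contDiffAt (hB.subset hy)).continuousAt).norm.continuousWithinAt
    obtain ⟨y, hy, hmin⟩ := hB.isCompact.exists_isMinOn hne hc
    exact ⟨_, norm_pos_iff.2 (hB.defining y hy).fderiv_ne_zero, fun z hz => hmin hz⟩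

theorem IsChartPiece.exists_norm_sq_fderiv_ge (hB : IsChartPiece Ω U φ r B) (hφ : IsBoundaryChart Ω U φ) :
    ∃ a > 0, ∀ y ∈ B, ∀ ξ, a * ‖ξ‖ ^ 2 ≤ ‖fderiv ℝ φ y ξ‖ ^ 2 := by
  have hA : ContinuousOn (fderiv ℝ φ) B := fun y hy =>
    ((hφ.contDiffAt (hB.subset hy)).continuousAt_fderiv (by simp)).continuousWithinAt
  have h1 : ContinuousOn (fun y => ((innerSL ℝ).comp (fderiv ℝ φ y)).flip) B :=
    (ContinuousLinearMap.flipₗᵢ ℝ (Eu (n - 1)) (Eu n) ℝ).continuous.comp_continuousOn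
      (continuousOn_const.clm_comp hA)
  have h2 : ContinuousOn (fun y => (((innerSL ℝ).comp (fderiv ℝ φ y)).flip.comp (fderiv ℝ φ y))) B :=
    h1.clm_comp hA
  obtain ⟨a, ha, h⟩ := exists_elliptic_of_compact hB.isCompact h2 fun y hy v hv => by
    change 0 < inner ℝ (fderiv ℝ φ y v) (fderiv ℝ φ y v)
    rw [real_inner_self_eq_norm_sq]
    have : fderiv ℝ φ y v ≠ 0 := fun h0 => hv (hφ.immersion y (hB.subset hy) (h0.trans (map_zero _).symm))
    have := norm_pos_iff.2 this
    positivity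
  refine ⟨a, ha, fun y hy ξ => (h y hy ξ).trans (le_of_eq ?_)⟩
  exact real_inner_self_eq_norm_sq (fderiv ℝ φ y ξ)

theorem IsBoundedMetric.exists_flow (hn : 2 ≤ n) (hφ : IsBoundaryChart Ω U φ) (hΩ : IsSmoothDomain Ω)
    (hB : IsChartPiece Ω U φ r B) {g : TensorField n} {l : ℕ} {A : ℝ} (hl : l ≠ 0) (hc : 0 < c)
    (hg : IsBoundedMetric Ω (l + 1) A c g) {x : Eu (n - 1)} (hx : x ∈ B) :
    ∃ G S, IsNormalFlow Ω g φ r l c G S x := by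
  obtain ⟨G, hG⟩ := hφ.exists_metricExtension hn hΩ (hB.subset hx) hg.contDiffOn hg.symm
  have hp := hφ.mapsTo (hB.subset hx)
  obtain ⟨S, hS⟩ := hφ.exists_normalFlow (hB.subset hx) hl hc hG
    (fun v => by rw [hG.eq_self hp.1]; exact hg.lower.metric_le _ hp v) (hB.defining x hx)
  exact ⟨G, S, hS⟩

variable {ι : Type} {x : ι → Eu (n - 1)} {g G : ι → TensorField n} {S : ι → Co n → Eu n × Eu n} {l : ℕ} {A : ℝ}

theorem jetBound_extension (hφ : IsBoundaryChart Ω U φ) (hΩ : IsSmoothDomain Ω)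
    (hB : IsChartPiece Ω U φ r B) (hx : ∀ i, x i ∈ B) (hA : 0 ≤ A)
    (hg : ∀ i, IsBoundedMetric Ω (l + 1) A c (g i))
    (hS : ∀ i, IsNormalFlow Ω (g i) φ r l c (G i) (S i) (x i)) :
    JetBound (l + 1) G (fun i => φ (x i)) (fun _ => 1) := by
  refine ⟨A, hA, fun i => ⟨(hS i).ext.contDiffAt, fun j hj => ?_⟩⟩
  have hp := (hφ.mapsTo (hB.subset (hx i))).1
  rw [(hS i).ext.iteratedFDeriv_eq hΩ hj hp, mul_one]
  exact (hg i).bound j hj _ hp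

/-- Only the jets at `t = 0` are bounded, by `JetBound.of_ode`. No control over times of existence
or over neighbourhoods is required. -/
theorem jetBound_flow (hφ : IsBoundaryChart Ω U φ) (hΩ : IsSmoothDomain Ω)
    (hB : IsChartPiece Ω U φ r B) (hx : ∀ i, x i ∈ B) (hA : 0 ≤ A) (hc : 0 < c)
    (hg : ∀ i, IsBoundedMetric Ω (l + 1) A c (g i))
    (hS : ∀ i, IsNormalFlow Ω (g i) φ r l c (G i) (S i) (x i)) :
    JetBound l S (fun i => (x i, 0)) (fun _ => 1) := by
  have h1 : ∀ _ : ι, (0 : ℝ) ≤ 1 := fun _ => zero_le_one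
  have hG := jetBound_extension hφ hΩ hB hx hA hg hS
  obtain ⟨b, hb, hbB⟩ := hB.exists_norm_fderiv_ge hφ
  have hφc : ContinuousOn φ B := fun y hy =>
    (hφ.contDiffAt (hB.subset hy)).continuousAt.continuousWithinAt
  have hφJ : JetBound l (fun _ => φ) x (fun _ => 1) := jetBound_of_compact hB.isCompact
    (fun y hy => (hφ.contDiffAt (hB.subset hy)).of_le (by exact_mod_cast le_top)) hx
  have hrJ : JetBound l (fun _ : ι => fderiv ℝ r) (fun i => φ (x i)) (fun _ => 1) :=
    jetBound_of_compact (hB.isCompact.image_of_continuousOn hφc) (by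
      rintro _ ⟨y, hy, rfl⟩
      exact ((hB.defining y hy).contDiffAt.of_le (m := ((l + 1 : ℕ) : WithTop ℕ∞))
        (by exact_mod_cast le_top)).fderiv_right (by norm_cast)) fun i => ⟨x i, hx i, rfl⟩
  have hν := jetBound_normalField hb hc (hG.mono (Nat.le_succ l)) (fun i => (hS i).elliptic) hrJ
    fun i => hbB _ (hx i)
  have hinit : JetBound l (fun i y => S i (y, 0)) x (fun _ => 1) :=
    (hφJ.prodMk (JetBound.comp (u := fun i => normalField (G i) r) (v := fun _ => φ) h1 hν hφJ)).congr
      fun i => (hS i).init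
  refine JetBound.of_ode (V := fun i => spray (G i)) (fun i => (hS i).smooth) (fun i => (hS i).ode) hinit ?_
  refine jetBound_spray hc ?_ ?_ fun i v => ?_
  · obtain ⟨C, hC, h⟩ := hinit.bound
    exact ⟨C, hC, fun i => by simpa using h i⟩
  · simp only [(hS _).apply_zero]
    exact hG
  · rw [(hS i).apply_zero]
    exact (hS i).elliptic v

theorem jetBound_metric (hφ : IsBoundaryChart Ω U φ) (hΩ : IsSmoothDomain Ω)
    (hB : IsChartPiece Ω U φ r B) (hx : ∀ i, x i ∈ B) (hA : 0 ≤ A) (hc : 0 < c)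
    (hg : ∀ i, IsBoundedMetric Ω (l + 1 + 1) A c (g i))
    (hS : ∀ i, IsNormalFlow Ω (g i) φ r (l + 1) c (G i) (S i) (x i)) :
    JetBound l (fun i => tangentialMetric (G i) (S i)) (fun i => (x i, 0)) (fun _ => 1) := by
  refine jetBound_tangentialMetric (jetBound_flow hφ hΩ hB hx hA hc hg hS) ?_
  simp only [(hS _).apply_zero]
  exact (jetBound_extension hφ hΩ hB hx hA hg hS).mono (by omega)

theorem IsNormalFlow.elliptic_tangentialMetric (hφ : IsBoundaryChart Ω U φ) (hΩ : IsSmoothDomain Ω)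
    {g G : TensorField n} {S : Co n → Eu n × Eu n} {x : Eu (n - 1)} (hx : x ∈ U)
    (h : IsNormalFlow Ω g φ r l c G S x) (hc : 0 < c) (hl : 2 ≤ l) {a : ℝ}
    (ha : ∀ ξ, a * ‖ξ‖ ^ 2 ≤ ‖fderiv ℝ φ x ξ‖ ^ 2) (ξ : Eu (n - 1)) :
    c * a * ‖ξ‖ ^ 2 ≤ tangentialMetric G S (x, 0) ξ ξ := by
  rw [tangentialMetric_apply, ((h.eventually_init hφ hΩ hx hc (by omega)).self_of_nhds.2 ξ).1, h.apply_zero]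
  refine le_trans ?_ (h.elliptic _)
  rw [mul_assoc]
  exact mul_le_mul_of_nonneg_left (ha ξ) hc.le

/-- The bound for the second fundamental form, with `dφ` bounded below, becomes the convexity
constant of the weights. The factor 2 is given away. -/
theorem IsNormalFlow.fderiv_tangentialMetric_le (hφ : IsBoundaryChart Ω U φ) (hΩ : IsSmoothDomain Ω)
    {g G : TensorField n} {S : Co n → Eu n × Eu n} {x : Eu (n - 1)} (hx : x ∈ U)
    (h : IsNormalFlow Ω g φ r l c G S x) (hc : 0 < c) (hl : 2 ≤ l) (hg : HasBoundaryLowerBound Ω g c) {a : ℝ}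
    (ha : ∀ ξ, a * ‖ξ‖ ^ 2 ≤ ‖fderiv ℝ φ x ξ‖ ^ 2) (ξ : Eu (n - 1)) :
    fderiv ℝ (tangentialMetric G S) (x, 0) (0, 1) ξ ξ ≤ -(c * a * ‖ξ‖ ^ 2) := by
  rw [h.fderiv_tangentialMetric hφ hΩ hx hc hl]
  have h1 := hg.secondFundamentalForm_le _ (hφ.mapsTo hx) r _ (fderiv ℝ φ x ξ) h.defining
    (h.isInwardUnitNormal hφ hx hc) (hφ.fderiv_eq_zero hΩ hx h.defining ξ)
  have h2 := mul_le_mul_of_nonneg_left (ha ξ) hc.le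
  have h3 : 0 ≤ c * ‖fderiv ℝ φ x ξ‖ ^ 2 := by positivity
  rw [mul_assoc]
  linarith

/-- The data of the stability estimate, at the boundary point with parameter `x`. -/
structure BoundaryData (n : ℕ) where
  g₀ : TensorField n
  g₁ : TensorField n
  ψ : Eu n → Eu n
  ε : ℝ
  F : Co n → Eu n
  x : Eu (n - 1)
  R : ℝ

/-- The hypotheses of the stability estimate, at one point. -/
structure BoundaryData.IsAdmissible (Ω : Set (Eu n)) (U : Set (Eu (n - 1))) (φ : Eu (n - 1) → Eu n)
    (N : ℕ) (A c : ℝ) (d : BoundaryData n) : Prop where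
  metric₀ : IsBoundedMetric Ω (N + 5) A c d.g₀
  metric₁ : IsBoundedMetric Ω (N + 5) A c d.g₁
  matching : IsBoundaryNormalMatching Ω d.g₀ d.g₁ d.ψ
  coordinates : IsBoundaryNormalCoordinates Ω d.g₀ U φ d.ε d.F
  nonneg : 0 ≤ d.R
  contDiffAt : ContDiffAt ℝ (N + 2 : ℕ) (distSqDifference Ω d.g₀ d.g₁ φ) (d.x, d.x)
  bound : ∀ j ≤ N + 2, ‖iteratedFDeriv ℝ j (distSqDifference Ω d.g₀ d.g₁ φ) (d.x, d.x)‖ ≤ d.R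

/-- The index `i` may run over all admissible data at once, metrics, maps and points alike. A bound
for the family is then a constant that depends on the class only. -/
theorem IsChartPiece.jetBound_normalDeriv (hn : 2 ≤ n) (hφ : IsBoundaryChart Ω U φ) (hΩ : IsSmoothDomain Ω)
    (hB : IsChartPiece Ω U φ r B) (m k : ℕ) (hA : 0 ≤ A) (hc : 0 < c) (d : ι → BoundaryData n)
    (hd : ∀ i, (d i).IsAdmissible Ω U φ (m + 2 * k) A c) (hx : ∀ i, (d i).x ∈ B) :
    JetBound m (fun i => normalDeriv U (d i).ε (d i).F k (metricDifference Ω (d i).g₀ (d i).g₁ (d i).ψ))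
      (fun i => (d i).x) (fun i => (d i).R) := by
  obtain ⟨a, ha, haB⟩ := hB.exists_norm_sq_fderiv_ge hφ
  -- The metrics are `C^(l+2)`. The flows are `C^(l+1)`, as `spray` differentiates the metric, and
  -- the tangential metrics are `C^l`, as they contain the derivative of the flow. The recursion
  -- with `N = m + 2k` asks for `N + 3 = l`.
  set l := m + 2 * k + 3 with hl
  have f₀ := fun i => (hd i).metric₀.exists_flow hn hφ hΩ hB (l := l + 1) (by omega) hc (hx i)
  have f₁ := fun i => (hd i).metric₁.exists_flow hn hφ hΩ hB (l := l + 1) (by omega) hc (hx i)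
  choose G₀ S₀ hS₀ using f₀
  choose G₁ S₁ hS₁ using f₁
  have hU : ∀ i, (d i).x ∈ U := fun i => hB.subset (hx i)
  have hl2 : 2 ≤ l + 1 := by omega
  have hxb : ∃ C, 0 ≤ C ∧ ∀ i, ‖(d i).x‖ ≤ C := by
    obtain ⟨C, hC⟩ := hB.isCompact.isBounded.exists_norm_le
    exact ⟨max C 0, le_max_right _ _, fun i => (hC _ (hx i)).trans (le_max_left _ _)⟩
  have hD : JetBound (m + 2 * k + 2) (fun i (z : Eu (n - 1) × Eu (n - 1)) =>
      riemDist Ω (d i).g₁ (φ z.1) (φ z.2) ^ 2 - riemDist Ω (d i).g₀ (φ z.1) (φ z.2) ^ 2)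
      (fun i => ((d i).x, (d i).x)) (fun i => (d i).R) :=
    ⟨1, zero_le_one, fun i => ⟨(hd i).contDiffAt, fun j hj => by rw [one_mul]; exact (hd i).bound j hj⟩⟩
  have key := jetBound_normalJet_of_distSq (x := fun i => (d i).x) (R := fun i => (d i).R)
    (h₀ := fun i => tangentialMetric (G₀ i) (S₀ i)) (h₁ := fun i => tangentialMetric (G₁ i) (S₁ i))
    (ρ₀ := fun i y y' => riemDist Ω (d i).g₀ (φ y) (φ y') ^ 2)
    (ρ₁ := fun i y y' => riemDist Ω (d i).g₁ (φ y) (φ y') ^ 2)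
    (b := c * a) (c := c * a)
    (fun i => (hd i).nonneg) hxb (mul_pos hc ha) (mul_pos hc ha)
    (jetBound_metric (l := l) hφ hΩ hB hx hA hc (fun i => (hd i).metric₀) hS₀)
    (jetBound_metric (l := l) hφ hΩ hB hx hA hc (fun i => (hd i).metric₁) hS₁)
    (fun i => Eventually.of_forall fun p v w => (hS₀ i).ext.symm _ _ _)
    (fun i => Eventually.of_forall fun p v w => (hS₁ i).ext.symm _ _ _)
    (fun i v => (hS₀ i).elliptic_tangentialMetric hφ hΩ (hU i) hc hl2 (haB _ (hx i)) v)
    (fun i v => (hS₁ i).elliptic_tangentialMetric hφ hΩ (hU i) hc hl2 (haB _ (hx i)) v)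
    (fun i v => (hS₀ i).fderiv_tangentialMetric_le hφ hΩ (hU i) hc hl2 (hd i).metric₀.lower (haB _ (hx i)) v)
    (fun i v => (hS₁ i).fderiv_tangentialMetric_le hφ hΩ (hU i) hc hl2 (hd i).metric₁.lower (haB _ (hx i)) v)
    (fun i => by
      filter_upwards [(hS₀ i).eventually hφ (hU i) hc] with y hy
      exact hy.2.isLocalDistSq hn hφ hΩ hy.1 (half_pos hc) hl2 (hd i).metric₀.contDiffOn.continuousOn
        (hd i).metric₀.pos)
    (fun i => by
      filter_upwards [(hS₁ i).eventually hφ (hU i) hc] with y hy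
      exact hy.2.isLocalDistSq hn hφ hΩ hy.1 (half_pos hc) hl2 (hd i).metric₁.contDiffOn.continuousOn
        (hd i).metric₁.pos)
    hD k (by omega)
  rw [show m + 2 * k - 2 * k = m by omega] at key
  exact (key.clm_apply liftBilin).congr fun i => normalDeriv_eventuallyEq hn hφ hΩ (hU i) (hS₀ i) (hS₁ i) hc
    hl2 (hd i).matching (hd i).coordinates (by omega)

/-- Compactness of `K`: one constant near each point, where a defining function is available, and
the maximum over a finite cover. -/
theorem IsBoundaryChart.exists_normalDeriv_bound (hn : 2 ≤ n) (hφ : IsBoundaryChart Ω U φ)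
    (hΩ : IsSmoothDomain Ω) {K : Set (Eu (n - 1))} (hK : IsCompact K) (hKU : K ⊆ U) (m k : ℕ)
    (hA : 0 ≤ A) (hc : 0 < c) :
    ∃ C, 0 ≤ C ∧ ∀ d : BoundaryData n, d.IsAdmissible Ω U φ (m + 2 * k) A c → d.x ∈ K →
      ContDiffAt ℝ m (normalDeriv U d.ε d.F k (metricDifference Ω d.g₀ d.g₁ d.ψ)) d.x ∧
      ∀ j ≤ m, ‖iteratedFDeriv ℝ j (normalDeriv U d.ε d.F k (metricDifference Ω d.g₀ d.g₁ d.ψ)) d.x‖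
        ≤ C * d.R := by
  refine hK.induction_on (p := fun K => ∃ C, 0 ≤ C ∧ ∀ d : BoundaryData n,
      d.IsAdmissible Ω U φ (m + 2 * k) A c → d.x ∈ K →
      ContDiffAt ℝ m (normalDeriv U d.ε d.F k (metricDifference Ω d.g₀ d.g₁ d.ψ)) d.x ∧
      ∀ j ≤ m, ‖iteratedFDeriv ℝ j (normalDeriv U d.ε d.F k (metricDifference Ω d.g₀ d.g₁ d.ψ)) d.x‖
        ≤ C * d.R) ⟨0, le_rfl, fun d _ h => h.elim⟩ ?_ ?_ fun y hy => ?_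
  · rintro s t hst ⟨C, hC, h⟩
    exact ⟨C, hC, fun d hd hx => h d hd (hst hx)⟩
  · rintro s t ⟨C, hC, h⟩ ⟨C', hC', h'⟩
    refine ⟨max C C', le_max_of_le_left hC, fun d hd hx => ?_⟩
    rcases hx with hx | hx
    · exact ⟨(h d hd hx).1, fun j hj => ((h d hd hx).2 j hj).trans
        (mul_le_mul_of_nonneg_right (le_max_left _ _) hd.nonneg)⟩
    · exact ⟨(h' d hd hx).1, fun j hj => ((h' d hd hx).2 j hj).trans
        (mul_le_mul_of_nonneg_right (le_max_right _ _) hd.nonneg)⟩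
  · obtain ⟨r, B, hBn, hB⟩ := hφ.exists_chartPiece hΩ (hKU hy)
    -- The family is indexed by the type of all admissible data with base point in the piece `B`.
    obtain ⟨C, hC, h⟩ := hB.jetBound_normalDeriv hn hφ hΩ m k hA hc
      (fun i : {d : BoundaryData n // d.IsAdmissible Ω U φ (m + 2 * k) A c ∧ d.x ∈ B} => i.1)
      (fun i => i.2.1) fun i => i.2.2
    exact ⟨B, mem_nhdsWithin_of_mem_nhds hBn, C, hC, fun d hd hx => h ⟨d, hd, hx⟩⟩

theorem IsSimpleMetric.isBoundedMetric {g : TensorField n} (hg : IsSimpleMetric Ω g) {l : ℕ} {A : ℝ≥0}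
    (hA : cNormOn l g (closure Ω) ≤ A) (hc : HasBoundaryLowerBound Ω g c) :
    IsBoundedMetric Ω l A c g := by
  have ht : cNormOn l g (closure Ω) ≠ (⊤ : ℝ≥0∞) := (hA.trans_lt ENNReal.coe_lt_top).ne
  refine ⟨contDiffOn_of_cNormOn_ne_top ht, fun j hj p hp => ?_, hg.symm, hg.pos, hc⟩
  simpa using norm_le_toReal_of_enorm_le ENNReal.coe_ne_top ((enorm_le_cNormOn hj hp).trans hA)

end Uniform

end BoundaryStability

end

/-! ### The stability estimate -/

theorem theorem6 (n : ℕ) (hn : 2 ≤ n)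
    (Ω : Set (BoundaryStability.Eu n)) (hΩ : BoundaryStability.IsSmoothDomain Ω)
    (U : Set (BoundaryStability.Eu (n - 1)))
    (φ : BoundaryStability.Eu (n - 1) → BoundaryStability.Eu n)
    (hφ : BoundaryStability.IsBoundaryChart Ω U φ)
    (K : Set (BoundaryStability.Eu (n - 1))) (hK : IsCompact K) (hKU : K ⊆ U)
    (k m : ℕ) (A : ℝ≥0) (c : ℝ) (hc : 0 < c) :
    ∃ C : ℝ≥0, ∀ g₀ g₁ : BoundaryStability.TensorField n,
      BoundaryStability.IsSimpleMetric Ω g₀ → BoundaryStability.IsSimpleMetric Ω g₁ →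
      BoundaryStability.cNormOn (m + 2 * k + 5) g₀ (closure Ω) ≤ (A : ℝ≥0∞) →
      BoundaryStability.cNormOn (m + 2 * k + 5) g₁ (closure Ω) ≤ (A : ℝ≥0∞) →
      BoundaryStability.HasBoundaryLowerBound Ω g₀ c →
      BoundaryStability.HasBoundaryLowerBound Ω g₁ c →
      ∀ V V' : Set (BoundaryStability.Eu (n - 1)), IsOpen V → IsOpen V' →
      closure V ⊆ V' → V' ⊆ K →
      ∀ ψ : BoundaryStability.Eu n → BoundaryStability.Eu n,
      BoundaryStability.IsBoundaryNormalMatching Ω g₀ g₁ ψ →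
      ∀ (ε : ℝ) (F : BoundaryStability.Co n → BoundaryStability.Eu n),
      BoundaryStability.IsBoundaryNormalCoordinates Ω g₀ U φ ε F →
      BoundaryStability.cNormNear m
          (BoundaryStability.normalDeriv U ε F k (BoundaryStability.metricDifference Ω g₀ g₁ ψ))
          (closure V)
        ≤ (C : ℝ≥0∞) * BoundaryStability.cNormNear (m + 2 * k + 2)
            (BoundaryStability.distSqDifference Ω g₀ g₁ φ) (closure (V' ×ˢ V')) := by
  obtain ⟨C, hC, h⟩ := hφ.exists_normalDeriv_bound hn hΩ hK hKU m k A.2 hc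
  lift C to ℝ≥0 using hC
  -- `C + 1` is not 0, so the right side is `∞` whenever the norm of the distance difference is;
  -- with `C = 0` the product would be 0.
  refine ⟨C + 1, fun g₀ g₁ hg₀ hg₁ hA₀ hA₁ hc₀ hc₁ V V' _ _ hVV' hV'K ψ hψ ε F hF => ?_⟩
  set R := BoundaryStability.cNormNear (m + 2 * k + 2)
    (BoundaryStability.distSqDifference Ω g₀ g₁ φ) (closure (V' ×ˢ V')) with hR
  rcases eq_or_ne R ⊤ with ht | ht
  · rw [ht, ENNReal.mul_top (by simp)]
    exact le_top
  refine BoundaryStability.cNormNear_le fun x hx => ?_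
  have hxV := hVV' hx
  -- Only the jets at diagonal points are used; they lie in `V' × V'` because the closure of `V` is
  -- contained in `V'`.
  have hxx : (x, x) ∈ closure (V' ×ˢ V') := subset_closure ⟨hxV, hxV⟩
  obtain ⟨h1, h2⟩ := h ⟨g₀, g₁, ψ, ε, F, x, R.toReal⟩
    ⟨hg₀.isBoundedMetric hA₀ hc₀, hg₁.isBoundedMetric hA₁ hc₁, hψ, hF, ENNReal.toReal_nonneg,
      BoundaryStability.contDiffAt_of_cNormNear_ne_top ht hxx, fun j hj =>
        BoundaryStability.norm_le_toReal_of_enorm_le ht (BoundaryStability.enorm_le_cNormNear hj hxx)⟩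
    (hV'K hxV)
  refine ⟨h1, fun j hj => ?_⟩
  rw [← ofReal_norm]
  calc _ ≤ ENNReal.ofReal ((C : ℝ) * R.toReal) := ENNReal.ofReal_le_ofReal (h2 j hj)
    _ = C * R := by rw [ENNReal.ofReal_mul C.coe_nonneg, ENNReal.ofReal_coe_nnreal, ENNReal.ofReal_toReal ht]
    _ ≤ _ := by gcongr; simp
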